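/- Let $F$ be a number field with adele ring $\mathbb A$. Let $\mathrm{GSp}(4)$ be the group of $g\in \mathrm{GL}_4$ with ${}^t g J g=\nu(g)J$ for a unit $\nu(g)$, where $J=\begin{pmatrix}0&I_2\\-I_2&0\end{pmatrix}$. Let $dx$ be the Haar measure on $\mathbb A$ for which $F\backslash\mathbb A$ has volume $1$, let $d^\times y$ be a Haar measure on $\mathbb A^\times$, and give $F\backslash \mathbb A$ and $F^\times\backslash\mathbb A^\times$ the quotient measures. Let $\psi$ be a non-trivial continuous unitary character of $F\backslash\mathbb A$, and let $\mu:\mathbb A^\times/F^\times\to\mathbb C^\times$ be a continuous character. Let $\phi$ be a cusp form on $\mathrm{GSp}(4,\mathbb A)$: a left $\mathrm{GSp}(4,F)$-invariant function with a central character that is right invariant under an open subgroup of $\mathrm{GSp}(4,\mathbb A_f)$ ($\mathbb A_f$ the finite adeles), smooth in the archimedean variable, and of uniform moderate growth (all its derivatives by the universal enveloping algebra of the archimedean Lie algebra are bounded by multiples of one and the same power of the adelic height), and whose constant terms along the unipotent radicals of the Siegel and Klingen parabolic subgroups vanish. For a continuous character $\chi:\mathbb A^\times/F^\times\to\mathbb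 C^\times$ put $$\phi^U(g)=\int_{(F\backslash\mathbb A)^3}\phi\left(\begin{pmatrix}1&&u&t\\&1&t&v\\&&1\\&&&1\end{pmatrix}g\right)\psi^{-1}(t)\,du\,dv\,dt,$$ $$B^{\rm split}_\chi(g;\phi)=\int_{F^\times\backslash\mathbb A^\times}\phi^U\left(\begin{pmatrix}y\\&1\\&&1\\&&&y\end{pmatrix}g\right)\chi(y)\,d^\times y,$$ $$W_\phi(g)=\int_{(F\backslash\mathbb A)^4}\phi\left(\begin{pmatrix}1&x_2\\&1\\&&1\\&&-x_2&1\end{pmatrix}\begin{pmatrix}1&&x_4&x_3\\&1&x_3&x_1\\&&1\\&&&1\end{pmatrix}g\right)\psi^{-1}(x_1+x_2)\,dx_1\,dx_2\,dx_3\,dx_4 .$$ Then the integral defining $B^{\rm split}_{\mu|\cdot|^{s-1/2}}(I_4;\phi)$ converges absolutely for every $s\in\mathbb C$ and is an entire function of $s$. There is a real number $\sigma_0$ (depending on $\phi$ and $\mu$) such that for $\Re s>\sigma_0$ the double integral below converges absolutely and $$B^{\rm split}_{\mu|\cdot|^{s-\frac12}}(I_4;\phi)=\int_{\mathbb A^\times}\int_{\mathbb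 A}W_\phi\left(\begin{pmatrix}y\\&y\\&&1\\&x&&1\end{pmatrix}w^{-1}\right)\mu(y)|y|^{s-\frac32}\,dx\,d^\times y,\qquad w=\begin{pmatrix}1\\&&&-1\\&&1\\&1\end{pmatrix}.$$ -/

import Mathlib

open MeasureTheory NumberField Topology
open scoped ENNReal Matrix

noncomputable section

/-! ### The group `GSp(4)` -/

/-- The symplectic form `J`. -/
def sympJ (R : Type*) [CommRing R] : Matrix (Fin 4) (Fin 4) R :=
  !![0, 0, 1, 0; 0, 0, 0, 1; -1, 0, 0, 0; 0, -1, 0, 0]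

theorem sympJ_mul_self (R : Type*) [CommRing R] : sympJ R * sympJ R = -1 := by
  ext i j
  fin_cases i <;> fin_cases j <;> simp [sympJ, Matrix.mul_apply, Fin.sum_univ_four]

/-- `GSp(4, R)`: the matrices `g ∈ GL₄(R)` with `ᵗg J g = ν(g) J` for a scalar `ν(g) ∈ Rˣ`. -/
def GSp4 (R : Type*) [CommRing R] : Subgroup (GL (Fin 4) R) where
  carrier := {g | ∃ ν : Rˣ, (g : Matrix (Fin 4) (Fin 4) R)ᵀ * sympJ R *
    (g : Matrix (Fin 4) (Fin 4) R) = (ν : R) • sympJ R}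
  one_mem' := ⟨1, by simp⟩
  mul_mem' := by
    rintro a b ⟨ν, hν⟩ ⟨ξ, hξ⟩
    refine ⟨ν * ξ, ?_⟩
    have h : ((a * b : GL (Fin 4) R) : Matrix (Fin 4) (Fin 4) R)ᵀ * sympJ R *
        ((a * b : GL (Fin 4) R) : Matrix (Fin 4) (Fin 4) R) =
        (b : Matrix (Fin 4) (Fin 4) R)ᵀ * ((a : Matrix (Fin 4) (Fin 4) R)ᵀ * sympJ R *
        (a : Matrix (Fin 4) (Fin 4) R)) * (b : Matrix (Fin 4) (Fin 4) R) := by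
      simp only [Units.val_mul, Matrix.transpose_mul, Matrix.mul_assoc]
    rw [h, hν, Matrix.mul_smul, Matrix.smul_mul, hξ, smul_smul, Units.val_mul]
  inv_mem' := by
    rintro a ⟨ν, hν⟩
    refine ⟨ν⁻¹, ?_⟩
    have h1 : (a : Matrix (Fin 4) (Fin 4) R) * ((a⁻¹ : GL (Fin 4) R) : Matrix _ _ R) = 1 := by
      rw [← Units.val_mul, mul_inv_cancel, Units.val_one]
    have h2 : ((a⁻¹ : GL (Fin 4) R) : Matrix _ _ R)ᵀ * (a : Matrix (Fin 4) (Fin 4) R)ᵀ = 1 := by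
      rw [← Matrix.transpose_mul, h1, Matrix.transpose_one]
    have h3 : sympJ R = (ν : R) • (((a⁻¹ : GL (Fin 4) R) : Matrix _ _ R)ᵀ * sympJ R *
        ((a⁻¹ : GL (Fin 4) R) : Matrix _ _ R)) := by
      calc sympJ R = (((a⁻¹ : GL (Fin 4) R) : Matrix _ _ R)ᵀ * (a : Matrix (Fin 4) (Fin 4) R)ᵀ) *
            sympJ R * ((a : Matrix (Fin 4) (Fin 4) R) *
            ((a⁻¹ : GL (Fin 4) R) : Matrix _ _ R)) := by rw [h1, h2]; simp
        _ = ((a⁻¹ : GL (Fin 4) R) : Matrix _ _ R)ᵀ * ((a : Matrix (Fin 4) (Fin 4) R)ᵀ *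
            sympJ R * (a : Matrix (Fin 4) (Fin 4) R)) *
            ((a⁻¹ : GL (Fin 4) R) : Matrix _ _ R) := by simp only [Matrix.mul_assoc]
        _ = _ := by rw [hν, Matrix.mul_smul, Matrix.smul_mul]
    conv_rhs => rw [h3]
    rw [smul_smul, Units.inv_mul, one_smul]

/-- A matrix `M` with `ᵗM J M = ν J`, `ν` a unit, as an element of `GSp(4, R)`. -/
def GSp4.ofMatrix {R : Type*} [CommRing R] (M : Matrix (Fin 4) (Fin 4) R) (ν : Rˣ)
    (h : Mᵀ * sympJ R * M = (ν : R) • sympJ R) : GSp4 R :=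
  have hl : (((ν⁻¹ : Rˣ) : R) • -(sympJ R * Mᵀ * sympJ R)) * M = 1 := by
    have h0 : (sympJ R * Mᵀ * sympJ R) * M = (ν : R) • (-1) := by
      rw [Matrix.mul_assoc, Matrix.mul_assoc, ← Matrix.mul_assoc Mᵀ, h, Matrix.mul_smul,
        sympJ_mul_self]
    rw [Matrix.smul_mul, Matrix.neg_mul, h0, ← smul_neg, neg_neg, smul_smul, Units.inv_mul, one_smul]
  ⟨⟨M, ((ν⁻¹ : Rˣ) : R) • -(sympJ R * Mᵀ * sympJ R), mul_eq_one_comm.mp hl, hl⟩, ⟨ν, h⟩⟩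

/-- Functoriality: `GSp(4, R) → GSp(4, S)`, entry by entry. -/
def GSp4.map {R S : Type*} [CommRing R] [CommRing S] (f : R →+* S) (g : GSp4 R) : GSp4 S :=
  ⟨Matrix.GeneralLinearGroup.map f g, by
    obtain ⟨ν, hν⟩ := g.2
    refine ⟨Units.map f.toMonoidHom ν, ?_⟩
    have hJ : (sympJ R).map f = sympJ S := by
      ext i j
      fin_cases i <;> fin_cases j <;> simp [sympJ]
    have h := congrArg (fun A : Matrix (Fin 4) (Fin 4) R => A.map f) hν
    simp only [Matrix.map_mul, hJ] at h
    have h' : ((ν : R) • sympJ R).map f = f ν • sympJ S := by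
      rw [← hJ]; ext i j; simp
    rw [h'] at h
    exact h⟩

section elements

variable {R : Type*} [CommRing R]

/-- The scalar matrix `z`. -/
def GSp4.scalar (z : Rˣ) : GSp4 R :=
  GSp4.ofMatrix !![(z : R), 0, 0, 0; 0, (z : R), 0, 0; 0, 0, (z : R), 0; 0, 0, 0, (z : R)]
    (z * z) (by
      ext i j
      fin_cases i <;> fin_cases j <;>
        simp [sympJ, Matrix.mul_apply, Fin.sum_univ_four])

/-- The element `[1 x; 1; 1; -x 1]` of the Levi subgroup of the Siegel parabolic. -/
def GSp4.n (x : R) : GSp4 R :=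
  GSp4.ofMatrix !![1, x, 0, 0; 0, 1, 0, 0; 0, 0, 1, 0; 0, 0, -x, 1] 1 (by
      ext i j
      fin_cases i <;> fin_cases j <;>
        simp [sympJ, Matrix.mul_apply, Fin.sum_univ_four])

/-- The element `[I X; 0 I]` with `X = [a b; b c]` of the Siegel unipotent radical `U`. -/
def GSp4.u (a b c : R) : GSp4 R :=
  GSp4.ofMatrix !![1, 0, a, b; 0, 1, b, c; 0, 0, 1, 0; 0, 0, 0, 1] 1 (by
      ext i j
      fin_cases i <;> fin_cases j <;>
        simp [sympJ, Matrix.mul_apply, Fin.sum_univ_four])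

/-- The diagonal matrix `diag(y, 1, 1, y)`. -/
def GSp4.besselTorus (y : Rˣ) : GSp4 R :=
  GSp4.ofMatrix !![(y : R), 0, 0, 0; 0, 1, 0, 0; 0, 0, 1, 0; 0, 0, 0, (y : R)] y (by
      ext i j
      fin_cases i <;> fin_cases j <;>
        simp [sympJ, Matrix.mul_apply, Fin.sum_univ_four])

/-- The matrix `[y; y; 1; x 1]` whose entry in the fourth row and second column is `x`. -/
def GSp4.novo (y : Rˣ) (x : R) : GSp4 R :=
  GSp4.ofMatrix !![(y : R), 0, 0, 0; 0, (y : R), 0, 0; 0, 0, 1, 0; 0, x, 0, 1] y (by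
      ext i j
      fin_cases i <;> fin_cases j <;>
        simp [sympJ, Matrix.mul_apply, Fin.sum_univ_four, mul_comm])

/-- The Weyl element `w = [1; , , , -1; , , 1; , 1]`. -/
def GSp4.weyl : GSp4 R :=
  GSp4.ofMatrix !![1, 0, 0, 0; 0, 0, 0, -1; 0, 0, 1, 0; 0, 1, 0, 0] 1 (by
      ext i j
      fin_cases i <;> fin_cases j <;>
        simp [sympJ, Matrix.mul_apply, Fin.sum_univ_four])

end elements

/-! ### Adeles, ideles and measures -/

section adeles

variable (F : Type*) [Field F] [NumberField F]

/-- The adele ring `𝔸` of the number field `F`. -/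
abbrev Adele : Type _ := AdeleRing (𝓞 F) F

instance : MeasurableSpace (Adele F) := borel _
instance : BorelSpace (Adele F) := ⟨rfl⟩

/-- The ideles carry the Borel `σ`-algebra of their own (unit group) topology. -/
instance : MeasurableSpace (Adele F)ˣ := borel _
instance : BorelSpace (Adele F)ˣ := ⟨rfl⟩

/-- `F` as a subgroup of `𝔸`. -/
abbrev principalAdeles : AddSubgroup (Adele F) := AdeleRing.principalSubgroup (𝓞 F) F

/-- `Fˣ` as a subgroup of `𝔸ˣ`. -/
abbrev principalIdeles : Subgroup (Adele F)ˣ :=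
  (Units.map (algebraMap F (Adele F)).toMonoidHom).range

variable {F}

/-- The idele norm `|y| = ∏_v |y_v|_v`. -/
def ideleNorm (y : (Adele F)ˣ) : ℝ :=
  ‖(y : Adele F).1‖ * ∏ᶠ v : IsDedekindDomain.HeightOneSpectrum (𝓞 F), ‖(y : Adele F).2 v‖

end adeles

/-- `ν` is the quotient of the measure `m` on `G` by the counting measure on the (discrete) subgroup
`Γ`: `∫_G f dm = ∫_{G/Γ} ∑_{γ ∈ Γ} f(gγ) dν(gΓ)` for all measurable `f ≥ 0`. -/
def IsQuotientMeasure {G : Type*} [Group G] [MeasurableSpace G] (Γ : Subgroup G)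
    (m : Measure G) (ν : Measure (G ⧸ Γ)) : Prop :=
  ∀ f : G → ℝ≥0∞, Measurable f →
    ∫⁻ g, f g ∂m = ∫⁻ q, ∑' γ : Γ, f (Quotient.out q * (γ : G)) ∂ν

/-- The additive version of `IsQuotientMeasure`. -/
def IsAddQuotientMeasure {G : Type*} [AddGroup G] [MeasurableSpace G] (Γ : AddSubgroup G)
    (m : Measure G) (ν : Measure (G ⧸ Γ)) : Prop :=
  ∀ f : G → ℝ≥0∞, Measurable f →
    ∫⁻ g, f g ∂m = ∫⁻ q, ∑' γ : Γ, f (Quotient.out q + (γ : G)) ∂ν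

/-- The integral over `F \ 𝔸` of an `F`-periodic function `f` on `𝔸`. (For periodic `f` the value at
the representative `Quotient.out q` does not depend on the representative.) -/
def intMod {F : Type*} [Field F] [NumberField F] (ν : Measure (Adele F ⧸ principalAdeles F))
    (f : Adele F → ℂ) : ℂ :=
  ∫ q, f (Quotient.out q) ∂ν

/-! ### Cusp forms on `GSp(4, 𝔸)` -/

section cuspForms

variable {F : Type*} [Field F] [NumberField F]

/-- The adelic height `‖g‖ = ∏_v max_{i,j} (|g_{ij}|_v, |(g⁻¹)_{ij}|_v)`. -/
def adelicHeight (g : GSp4 (Adele F)) : ℝ :=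
  (∏ v : InfinitePlace F, (⨆ p : Fin 4 × Fin 4,
    max ‖((g : GL (Fin 4) (Adele F)) p.1 p.2).1 v‖
      ‖(((g⁻¹ : GSp4 (Adele F)) : GL (Fin 4) (Adele F)) p.1 p.2).1 v‖) ^ v.mult) *
  ∏ᶠ v : IsDedekindDomain.HeightOneSpectrum (𝓞 F), ⨆ p : Fin 4 × Fin 4,
    max ‖((g : GL (Fin 4) (Adele F)) p.1 p.2).2 v‖
      ‖(((g⁻¹ : GSp4 (Adele F)) : GL (Fin 4) (Adele F)) p.1 p.2).2 v‖

variable (F) in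
/-- The continuous one-parameter subgroups of `GSp(4, 𝔸)`. Since `ℝ` is connected and
`GSp(4, 𝔸_f)` is totally disconnected, these are the maps `t ↦ exp(tX)` with `X` in the Lie algebra
of `GSp(4, F ⊗ ℝ)`. -/
abbrev OneParam : Type _ := Multiplicative ℝ →ₜ* GSp4 (Adele F)

/-- The Lie derivative `(Xφ)(g) = d/dt φ(g exp(tX))` at `t = 0`. -/
def lieDeriv (γ : OneParam F) (φ : GSp4 (Adele F) → ℂ) (g : GSp4 (Adele F)) : ℂ :=
  deriv (fun t : ℝ => φ (g * γ (Multiplicative.ofAdd t))) 0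

/-- The iterated Lie derivative `X₁ X₂ ⋯ X_k φ`. -/
def iterLieDeriv (L : List (OneParam F)) (φ : GSp4 (Adele F) → ℂ) : GSp4 (Adele F) → ℂ :=
  L.foldr lieDeriv φ

/-- Cusp forms on `GSp(4, 𝔸)`: smooth functions of uniform moderate growth that are left invariant
under `GSp(4, F)`, have a central character, and have vanishing constant terms along the Siegel and
the Klingen parabolic subgroups. Neither `K`-finiteness nor finiteness under the centre of the
enveloping algebra is required. -/
structure IsCuspForm (ν : Measure (Adele F ⧸ principalAdeles F))
    (φ : GSp4 (Adele F) → ℂ) : Prop where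
  left_invariant : ∀ (γ : GSp4 F) (g : GSp4 (Adele F)),
    φ (GSp4.map (algebraMap F (Adele F)) γ * g) = φ g
  central_character : ∃ ω : (Adele F)ˣ → ℂ, ∀ (z : (Adele F)ˣ) (g : GSp4 (Adele F)),
    φ (GSp4.scalar z * g) = ω z * φ g
  /-- right invariance under an open subgroup of `GSp(4, 𝔸_f)` -/
  finite_invariant : ∃ O ∈ 𝓝 (1 : GSp4 (Adele F)), ∀ k ∈ O,
    (∀ i j, ((k : GL (Fin 4) (Adele F)) i j).1 = ((1 : GL (Fin 4) (Adele F)) i j).1) →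
    ∀ g, φ (g * k) = φ g
  /-- smoothness in the archimedean variable -/
  differentiable : ∀ (L : List (OneParam F)) (γ : OneParam F) (g : GSp4 (Adele F)),
    DifferentiableAt ℝ (fun t : ℝ => iterLieDeriv L φ (g * γ (Multiplicative.ofAdd t))) 0
  continuous : ∀ L : List (OneParam F), Continuous (iterLieDeriv L φ)
  /-- uniform moderate growth: the exponent is the same for all derivatives -/
  uniform_moderate_growth : ∃ N : ℕ, ∀ L : List (OneParam F), ∃ C : ℝ, ∀ g : GSp4 (Adele F),
    ‖iterLieDeriv L φ g‖ ≤ C * adelicHeight g ^ N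
  siegel : ∀ g : GSp4 (Adele F),
    intMod ν (fun a => intMod ν fun b => intMod ν fun c => φ (GSp4.u a b c * g)) = 0
  klingen : ∀ g : GSp4 (Adele F),
    intMod ν (fun x => intMod ν fun b => intMod ν fun a =>
      φ (GSp4.n x * GSp4.u a b 0 * g)) = 0

/-! ### Bessel functional and Whittaker function -/

/-- `φ^U(g) = ∫_{(F \ 𝔸)³} φ([1, , u, w; , 1, w, v; , , 1; , , , 1] g) ψ⁻¹(w) du dv dw`. -/
def besselCoeff (ν : Measure (Adele F ⧸ principalAdeles F)) (ψ : AddChar (Adele F) Circle)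
    (φ : GSp4 (Adele F) → ℂ) (g : GSp4 (Adele F)) : ℂ :=
  intMod ν fun u => intMod ν fun v => intMod ν fun w =>
    φ (GSp4.u u w v * g) * ((ψ (-w) : Circle) : ℂ)

/-- The integrand `φ^U(diag(y, 1, 1, y) g) χ(y)` of the split Bessel functional. -/
def besselIntegrand (ν : Measure (Adele F ⧸ principalAdeles F)) (ψ : AddChar (Adele F) Circle)
    (χ : (Adele F)ˣ → ℂ) (g : GSp4 (Adele F)) (φ : GSp4 (Adele F) → ℂ) (y : (Adele F)ˣ) : ℂ :=
  besselCoeff ν ψ φ (GSp4.besselTorus y * g) * χ y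

/-- The split Bessel functional
`B_χ(g; φ) = ∫_{Fˣ \ 𝔸ˣ} φ^U(diag(y, 1, 1, y) g) χ(y) dˣy`. -/
def splitBessel (ν : Measure (Adele F ⧸ principalAdeles F))
    (ξ : Measure ((Adele F)ˣ ⧸ principalIdeles F)) (ψ : AddChar (Adele F) Circle)
    (χ : (Adele F)ˣ → ℂ) (g : GSp4 (Adele F)) (φ : GSp4 (Adele F) → ℂ) : ℂ :=
  ∫ q, besselIntegrand ν ψ χ g φ (Quotient.out q) ∂ξ

/-- The Whittaker function
`W_φ(g) = ∫_{(F \ 𝔸)⁴} φ(n(x₂) u(x₄, x₃, x₁) g) ψ⁻¹(x₁ + x₂) dx₁ dx₂ dx₃ dx₄`. The order of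
integration is such that each integrand is an `F`-periodic function of its variable. -/
def whittaker (ν : Measure (Adele F ⧸ principalAdeles F)) (ψ : AddChar (Adele F) Circle)
    (φ : GSp4 (Adele F) → ℂ) (g : GSp4 (Adele F)) : ℂ :=
  intMod ν fun x₂ => intMod ν fun x₁ => intMod ν fun x₃ => intMod ν fun x₄ =>
    φ (GSp4.n x₂ * GSp4.u x₄ x₃ x₁ * g) * ((ψ (-(x₁ + x₂)) : Circle) : ℂ)

/-- The quasi-character `μ |·|^z`. -/
def twist (μ : (Adele F)ˣ →* ℂˣ) (z : ℂ) (y : (Adele F)ˣ) : ℂ :=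
  ((μ y : ℂˣ) : ℂ) * (ideleNorm y : ℂ) ^ z

end cuspForms

end

/-! Conjugation by the Weyl element carries the Siegel unipotent radical to the elements `u a 0 0 *
n b * lower (-c)` and `diag(y, 1, 1, y)` to `diag(y, y, 1, 1)`. Hence, with `φ` replaced by its
right translate under `weyl⁻¹`, the Bessel coefficient at `y` is the integral over `c ∈ F\𝔸` of
`centerCoeff` at `lower (-c) * siegelTorus y` (`besselCoeff_eq`). Here `centerCoeff` is the
`ψ`-coefficient along the `n b` of the average of the function over the `u a 0 0`.

Two Fourier expansions then unfold everything. Along `u 0 b 0` the coefficients of `centerCoeff` are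
values of `klingenCoeff` at left translates by `lower (-ξ)`, `ξ ∈ F`, so the sum over `ξ` and the
integral over `F\𝔸` merge into an integral over `𝔸` (`setIntegral_centerCoeff`). Along `u 0 0 c` the
coefficients of `klingenCoeff` are the functions `W_η` (`whittakerCoeff`). The vanishing of the
Siegel constant term gives `W_0 = 0`, and `W_η(g) = W_1(diag(η, η, 1, 1) g)` for `η ≠ 0`, where
`W_1` is the Whittaker function; so the sum over `η` and the integral over `Fˣ\𝔸ˣ` merge into an
integral over `𝔸ˣ`. Moving `lower x` past `diag(y, y, 1, 1)` contributes `|y|⁻¹`, which turns `s -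
1/2` into `s - 3/2`.

Convergence rests on one estimate, `exists_whittakerCoeff_le`. At the points `siegelTorus y * lower
x`, left equivariance of `W_η` makes the Lie derivatives along `u 0 b 0` act as multiplication by
the archimedean part of `x` (`lieDeriv_rootB`), and makes multiplication by the archimedean part of
`ηy` a combination of Lie derivatives with coefficients of degree at most two in `x` (`lin_mul_eq`).
The growth exponent is the same for all derivatives, so iteration gives decay of any order in `x`,
in `η`, and for `|y| → ∞`, while for `|y| → 0` the bound is a power of `|y|⁻¹`. Right invariance
under an open subgroup confines the finite part of `x` to a compact set and `η` to a fractional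
ideal. This gives the double integral for `Re s` large.

The Bessel integral also needs decay for `|y| → 0`. The permutation matrix `swap` relates the Bessel
coefficient at `y` to that of a translate of `φ` at `y⁻¹`, up to the central character, which has
moderate growth. So the coefficient decreases rapidly in both directions; as `Fˣ\𝔸ˣ` is covered by
the positive reals times a compact set, the integral converges for all `s` and is entire.

The harmonic analysis on `𝔸/F` behind this consists of an explicit fundamental domain, the identity
of Haar modulus and idele norm, the compactness of the norm-one idele classes, the self-duality of
`𝔸/F`, and Fourier inversion by Stone–Weierstrass. -/

set_option linter.unusedSectionVars false

noncomputable section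

/-! ### Compactness of the local rings of integers. -/

section localIntegers

open IsDedekindDomain IsDedekindDomain.HeightOneSpectrum WithZero

variable {F : Type*} [Field F] [NumberField F] (v : HeightOneSpectrum (𝓞 F))

/-- Density of `F` in its completion gives an approximation `k`. By the ultrametric inequality `k`
is integral at `v`, and such elements of `F` can be approximated by algebraic integers. -/
theorem exists_valued_sub_lt (x : v.adicCompletion F) (hx : Valued.v x ≤ 1) (n : ℕ) :
    ∃ a : 𝓞 F, Valued.v (x - ((a : F) : v.adicCompletion F)) < exp (-(n : ℤ)) := by
  have hopen : IsOpen {y : v.adicCompletion F | Valued.v (x - y) < exp (-(n : ℤ))} := by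
    obtain ⟨c, hc⟩ := v.valuedAdicCompletion_surjective F (exp (-(n : ℤ)))
    have h : {y : v.adicCompletion F | Valued.v (x - y) < exp (-(n : ℤ))} =
        {y | ‖x - y‖ < ‖c‖} := by
      ext y
      rw [Set.mem_ofPred_eq, Set.mem_ofPred_eq, ← hc]
      exact (Valued.toNormedField.norm_lt_iff (L := v.adicCompletion F) (Γ₀ := ℤᵐ⁰)).symm
    rw [h]
    exact isOpen_lt (by fun_prop) continuous_const
  obtain ⟨k, hk⟩ := (v.denseRange_algebraMap F).exists_mem_open hopen
    ⟨x, by simp⟩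
  have hk1 : v.valuation F k ≤ 1 := by
    rw [← valuedAdicCompletion_eq_valuation' v k]
    have h1 : (exp (-(n : ℤ)) : ℤᵐ⁰) ≤ 1 := by
      rw [← exp_zero, exp_le_exp]; simp
    have h2 : ((k : F) : v.adicCompletion F) = x - (x - (k : v.adicCompletion F)) := by ring
    rw [h2]
    exact (Valuation.map_sub _ _ _).trans (max_le hx (hk.le.trans h1))
  obtain ⟨a, ha⟩ := v.exists_valuation_sub_lt_of_integer hk1
    (Units.mk0 (exp (-(n : ℤ)) : ℤᵐ⁰) exp_ne_zero)
  refine ⟨a, ?_⟩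
  have h3 : x - ((a : F) : v.adicCompletion F) = (x - (k : v.adicCompletion F)) -
      (((a : F) : v.adicCompletion F) - (k : v.adicCompletion F)) := by ring
  rw [h3]
  refine (Valuation.map_sub _ _ _).trans_lt (max_lt hk ?_)
  have h4 : ((a : F) : v.adicCompletion F) - (k : v.adicCompletion F) =
      ((algebraMap (𝓞 F) F a - k : F) : v.adicCompletion F) :=
    (map_sub (algebraMap F (v.adicCompletion F)) (algebraMap (𝓞 F) F a) k).symm
  rw [h4, valuedAdicCompletion_eq_valuation']
  exact ha

/-- The finite ring `𝓞 F / v` maps onto the residue field, because every local integer is congruent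
to a global one. -/
instance finite_residueField_adicCompletion :
    Finite (Valued.ResidueField (v.adicCompletion F)) := by
  have : Finite (𝓞 F ⧸ v.asIdeal) := v.asIdeal.finiteQuotientOfFreeOfNeBot v.ne_bot
  have hle : ∀ a : 𝓞 F, ((a : F) : v.adicCompletion F) ∈ Valued.integer (v.adicCompletion F) :=
    fun a => v.coe_algebraMap_mem (𝓞 F) F a
  let f : 𝓞 F → Valued.ResidueField (v.adicCompletion F) :=
    fun a => IsLocalRing.residue _ ⟨_, hle a⟩
  have hker : ∀ a b : 𝓞 F, a - b ∈ v.asIdeal → f a = f b := by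
    intro a b h
    rw [← sub_eq_zero, ← map_sub, IsLocalRing.residue_eq_zero_iff,
      IsLocalRing.mem_maximalIdeal, mem_nonunits_iff,
      Valuation.Integer.not_isUnit_iff_valuation_lt_one]
    have h4 : ((a : F) : v.adicCompletion F) - ((b : F) : v.adicCompletion F) =
        ((algebraMap (𝓞 F) F (a - b) : F) : v.adicCompletion F) := by
      rw [map_sub]
      exact (map_sub (algebraMap F (v.adicCompletion F)) _ _).symm
    change Valued.v (((a : F) : v.adicCompletion F) - ((b : F) : v.adicCompletion F)) < 1
    rw [h4, valuedAdicCompletion_eq_valuation', valuation_lt_one_iff_mem]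
    exact h
  let g : 𝓞 F ⧸ v.asIdeal → Valued.ResidueField (v.adicCompletion F) :=
    Quotient.lift f fun a b h => hker a b ((Submodule.quotientRel_def _).1 h)
  refine Finite.of_surjective g ?_
  intro y
  obtain ⟨x, rfl⟩ := IsLocalRing.residue_surjective y
  -- Precision `n = 0` means valuation strictly below `1`, which is congruence modulo the maximal
  -- ideal.
  obtain ⟨a, ha⟩ := exists_valued_sub_lt v x.1 x.2 0
  refine ⟨Ideal.Quotient.mk _ a, ?_⟩
  change f a = _
  rw [eq_comm, ← sub_eq_zero, ← map_sub, IsLocalRing.residue_eq_zero_iff,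
      IsLocalRing.mem_maximalIdeal, mem_nonunits_iff,
      Valuation.Integer.not_isUnit_iff_valuation_lt_one]
  simpa using ha

instance compactSpace_adicCompletionIntegers : CompactSpace (v.adicCompletionIntegers F) := by
  have h1 : IsClosed (Valued.integer (v.adicCompletion F) : Set (v.adicCompletion F)) :=
    Valued.isClosed_integer _
  have : CompleteSpace (Valued.integer (v.adicCompletion F)) := h1.completeSpace_coe
  have : IsDiscreteValuationRing (Valued.integer (v.adicCompletion F)) :=
    inferInstanceAs (IsDiscreteValuationRing (v.adicCompletionIntegers F))
  have := (Valued.integer.compactSpace_iff_completeSpace_and_isDiscreteValuationRing_and_finite_residueField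
    (K := v.adicCompletion F) (Γ₀ := ℤᵐ⁰)).2 ⟨inferInstance, inferInstance, inferInstance⟩
  exact this

theorem norm_le_one_iff_mem_adicCompletionIntegers (x : v.adicCompletion F) :
    ‖x‖ ≤ 1 ↔ x ∈ v.adicCompletionIntegers F := by
  have := Valued.toNormedField.norm_le_one_iff (L := v.adicCompletion F) (Γ₀ := ℤᵐ⁰) (x := x)
  exact this

instance isOpen_adicCompletionIntegers_fact :
    Fact (∀ v : HeightOneSpectrum (𝓞 F),
      IsOpen (v.adicCompletionIntegers F : Set (v.adicCompletion F))) :=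
  ⟨fun _ => Valued.isOpen_valuationSubring _⟩

instance isUltrametricDist_adicCompletion : IsUltrametricDist (v.adicCompletion F) :=
  inferInstanceAs (@IsUltrametricDist (v.adicCompletion F)
    (Valued.toNormedField (v.adicCompletion F) ℤᵐ⁰).toMetricSpace.toDist)

end localIntegers

/-! ### Finite adeles: the compact open subring of integral adeles and strong approximation. -/

section finiteAdeles

open IsDedekindDomain IsDedekindDomain.HeightOneSpectrum WithZero

variable (F : Type*) [Field F] [NumberField F]

/-- The finite adeles that are integral at every place. -/
def integralAdeles : Subring (FiniteAdeleRing (𝓞 F) F) where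
  carrier := {x | ∀ v, x v ∈ v.adicCompletionIntegers F}
  mul_mem' hx hy v := mul_mem (hx v) (hy v)
  one_mem' _ := one_mem _
  add_mem' hx hy v := add_mem (hx v) (hy v)
  zero_mem' _ := zero_mem _
  neg_mem' hx v := neg_mem (hx v)

variable {F}

theorem mem_integralAdeles {x : FiniteAdeleRing (𝓞 F) F} :
    x ∈ integralAdeles F ↔ ∀ v, x v ∈ v.adicCompletionIntegers F := Iff.rfl

/-- The inclusion of the product of the local rings of integers in the finite adeles. -/
def integralAdelesMap (x : ∀ v : HeightOneSpectrum (𝓞 F), v.adicCompletionIntegers F) :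
    FiniteAdeleRing (𝓞 F) F :=
  RestrictedProduct.structureMap (fun v : HeightOneSpectrum (𝓞 F) => v.adicCompletion F)
    (fun v => (v.adicCompletionIntegers F : Set (v.adicCompletion F))) Filter.cofinite x

theorem isOpenEmbedding_integralAdelesMap : IsOpenEmbedding (integralAdelesMap (F := F)) :=
  RestrictedProduct.isOpenEmbedding_structureMap isOpen_adicCompletionIntegers_fact.out

theorem range_integralAdelesMap :
    Set.range (integralAdelesMap (F := F)) = (integralAdeles F : Set (FiniteAdeleRing (𝓞 F) F)) := by
  ext x
  constructor
  · rintro ⟨y, rfl⟩ v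
    exact (y v).2
  · intro hx
    exact ⟨fun v => ⟨x v, hx v⟩, by ext v; rfl⟩

theorem isOpen_integralAdeles :
    IsOpen (integralAdeles F : Set (FiniteAdeleRing (𝓞 F) F)) := by
  rw [← range_integralAdelesMap]
  exact isOpenEmbedding_integralAdelesMap.isOpen_range

theorem isCompact_integralAdeles :
    IsCompact (integralAdeles F : Set (FiniteAdeleRing (𝓞 F) F)) := by
  rw [← range_integralAdelesMap]
  exact isCompact_range isOpenEmbedding_integralAdelesMap.continuous

instance : T2Space (FiniteAdeleRing (𝓞 F) F) :=
  inferInstanceAs (T2Space (RestrictedProduct _ _ _))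

instance : LocallyCompactSpace (FiniteAdeleRing (𝓞 F) F) :=
  isCompact_integralAdeles.locallyCompactSpace_of_mem_nhds_of_addGroup
    (x := 0) (isOpen_integralAdeles.mem_nhds (zero_mem _))

theorem finiteAdele_mul_apply (x y : FiniteAdeleRing (𝓞 F) F) (v : HeightOneSpectrum (𝓞 F)) :
    (x * y) v = x v * y v := rfl

theorem finiteAdele_sub_apply (x y : FiniteAdeleRing (𝓞 F) F) (v : HeightOneSpectrum (𝓞 F)) :
    (x - y) v = x v - y v := rfl

theorem finiteAdele_eventually_integral (x : FiniteAdeleRing (𝓞 F) F) :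
    ∀ᶠ v in Filter.cofinite, x v ∈ v.adicCompletionIntegers F := x.2

theorem algebraMap_mem_integralAdeles_iff (a : F) :
    algebraMap F (FiniteAdeleRing (𝓞 F) F) a ∈ integralAdeles F ↔
      ∃ b : 𝓞 F, (b : F) = a := by
  constructor
  · intro h
    refine HeightOneSpectrum.mem_integers_of_valuation_le_one F a fun v => ?_
    have := h v
    rw [mem_adicCompletionIntegers, FiniteAdeleRing.algebraMap_apply,
      valuedAdicCompletion_eq_valuation'] at this
    exact this
  · rintro ⟨b, rfl⟩ v
    exact v.coe_algebraMap_mem (𝓞 F) F b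

/-- An element of `F` that lies in prescribed powers of finitely many primes. -/
theorem exists_ne_zero_mem_pow (S : Finset (HeightOneSpectrum (𝓞 F)))
    (n : HeightOneSpectrum (𝓞 F) → ℕ) :
    ∃ d : 𝓞 F, d ≠ 0 ∧ ∀ v ∈ S, v.intValuation d ≤ exp (-(n v : ℤ)) := by
  have hI : (∏ v ∈ S, v.asIdeal ^ n v) ≠ ⊥ := by
    rw [← Ideal.zero_eq_bot, Finset.prod_ne_zero_iff]
    intro v _
    exact pow_ne_zero _ v.ne_bot
  obtain ⟨d, hd, hd0⟩ := Submodule.exists_mem_ne_zero_of_ne_bot hI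
  refine ⟨d, hd0, fun v hv => ?_⟩
  rw [intValuation_le_pow_iff_mem]
  exact Ideal.le_of_dvd (Finset.dvd_prod_of_mem _ hv) hd

theorem valued_coe_integer (v : HeightOneSpectrum (𝓞 F)) (a : 𝓞 F) :
    Valued.v ((a : F) : v.adicCompletion F) = v.intValuation a := by
  rw [valuedAdicCompletion_eq_valuation', ← valuation_of_algebraMap (K := F)]

theorem exists_mul_mem_integralAdeles (x : FiniteAdeleRing (𝓞 F) F) :
    ∃ d : 𝓞 F, d ≠ 0 ∧ algebraMap F (FiniteAdeleRing (𝓞 F) F) d * x ∈ integralAdeles F := by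
  have hfin : {v | x v ∉ v.adicCompletionIntegers F}.Finite := finiteAdele_eventually_integral x
  obtain ⟨d, hd0, hd⟩ := exists_ne_zero_mem_pow hfin.toFinset
    fun v => (log (Valued.v (x v))).natAbs
  refine ⟨d, hd0, fun v => ?_⟩
  rw [finiteAdele_mul_apply, FiniteAdeleRing.algebraMap_apply]
  by_cases hv : x v ∈ v.adicCompletionIntegers F
  · exact mul_mem (v.coe_algebraMap_mem (𝓞 F) F d) hv
  · have h1 := hd v (by simpa using hv)
    rw [mem_adicCompletionIntegers, map_mul, valued_coe_integer]
    have h2 : Valued.v (x v) ≤ exp (((log (Valued.v (x v))).natAbs : ℤ)) :=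
      le_exp_log.trans (exp_le_exp.2 (Int.le_natAbs))
    calc _ ≤ exp (-(((log (Valued.v (x v))).natAbs : ℤ))) *
          exp (((log (Valued.v (x v))).natAbs : ℤ)) := mul_le_mul' h1 h2
      _ = 1 := by rw [← exp_add]; simp

theorem mem_smul_integralAdeles {d : 𝓞 F} (hd : d ≠ 0) {x : FiniteAdeleRing (𝓞 F) F}
    (h : ∀ v, Valued.v (x v) ≤ v.intValuation d) :
    ∃ s ∈ integralAdeles F, x = algebraMap F (FiniteAdeleRing (𝓞 F) F) d * s := by
  have hdF : (d : F) ≠ 0 := by simpa using hd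
  refine ⟨algebraMap F (FiniteAdeleRing (𝓞 F) F) (d : F)⁻¹ * x, fun v => ?_, ?_⟩
  · rw [finiteAdele_mul_apply, FiniteAdeleRing.algebraMap_apply, mem_adicCompletionIntegers,
      map_mul, valuedAdicCompletion_eq_valuation', map_inv₀]
    have h0 : v.valuation F (d : F) ≠ 0 := by simpa using hdF
    rw [inv_mul_le_one₀ (zero_lt_iff.2 h0)]
    refine (h v).trans_eq ?_
    rw [← valuation_of_algebraMap (K := F)]
  · rw [← mul_assoc, ← map_mul, mul_inv_cancel₀ hdF, map_one, one_mul]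

/-- `𝓞 F` is dense in the integral adeles. -/
theorem exists_integer_sub_mem (x : FiniteAdeleRing (𝓞 F) F) (hx : x ∈ integralAdeles F)
    {d : 𝓞 F} (hd : d ≠ 0) :
    ∃ a : 𝓞 F, ∃ s ∈ integralAdeles F, x = algebraMap F (FiniteAdeleRing (𝓞 F) F) a +
      algebraMap F (FiniteAdeleRing (𝓞 F) F) d * s := by
  have hfin : {v : HeightOneSpectrum (𝓞 F) | v.asIdeal ∣ Ideal.span {d}}.Finite :=
    Ideal.finite_factors (by simpa using hd)
  have hloc : ∀ v : HeightOneSpectrum (𝓞 F), ∃ n : ℕ, exp (-(n : ℤ)) ≤ v.intValuation d := by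
    intro v
    refine ⟨_, (v.intValuation_if_neg hd).ge⟩
  choose n hn using hloc
  have happ := fun v => exists_valued_sub_lt v (x v) (hx v) (n v)
  choose b hb using happ
  -- The Chinese remainder theorem fits the local approximations together at the primes dividing
  -- `d`. At all other primes `d` is a unit and nothing has to be arranged.
  obtain ⟨a, ha⟩ := IsDedekindDomain.exists_forall_sub_mem_ideal (s := hfin.toFinset)
    (fun v : HeightOneSpectrum (𝓞 F) => v.asIdeal) n (fun v _ => v.prime)
    (fun v _ w _ hvw h => hvw (HeightOneSpectrum.ext h)) (fun v => b v)
  have key : ∀ v, Valued.v ((x - algebraMap F (FiniteAdeleRing (𝓞 F) F) a) v) ≤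
      v.intValuation d := by
    intro v
    rw [finiteAdele_sub_apply, FiniteAdeleRing.algebraMap_apply]
    by_cases hv : v.asIdeal ∣ Ideal.span {d}
    · have h1 := ha v (by simpa using hv)
      rw [← intValuation_le_pow_iff_mem] at h1
      have h2 : x v - ((a : F) : v.adicCompletion F) = (x v - ((b v : F) : v.adicCompletion F)) -
          (((a - b v : 𝓞 F) : F) : v.adicCompletion F) := by
        have : (((a - b v : 𝓞 F) : F) : v.adicCompletion F) =
            ((a : F) : v.adicCompletion F) - ((b v : F) : v.adicCompletion F) := by
          exact map_sub (algebraMap F (v.adicCompletion F)) (a : F) (b v : F)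
        rw [this]; ring
      rw [h2]
      refine (Valuation.map_sub _ _ _).trans (max_le ((hb v).le.trans (hn v)) ?_)
      rw [valued_coe_integer]
      exact h1.trans (hn v)
    · have : v.intValuation d = 1 := by
        refine le_antisymm (v.intValuation_le_one d) (not_lt.1 fun h => hv ?_)
        exact (v.intValuation_lt_one_iff_dvd d).1 h
      rw [this]
      exact sub_mem (hx v) (v.coe_algebraMap_mem (𝓞 F) F a)
  obtain ⟨s, hs, h⟩ := mem_smul_integralAdeles hd key
  exact ⟨a, s, hs, by rw [← h]; ring⟩

/-- `𝔸_f = F + d • Ô`. -/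
theorem exists_sub_mem_smul_integralAdeles (x : FiniteAdeleRing (𝓞 F) F) {d : 𝓞 F} (hd : d ≠ 0) :
    ∃ a : F, ∃ s ∈ integralAdeles F, x = algebraMap F (FiniteAdeleRing (𝓞 F) F) a +
      algebraMap F (FiniteAdeleRing (𝓞 F) F) d * s := by
  obtain ⟨c, hc0, hc⟩ := exists_mul_mem_integralAdeles x
  have hcF : (c : F) ≠ 0 := by simpa using hc0
  obtain ⟨a, s, hs, h⟩ := exists_integer_sub_mem _ hc (mul_ne_zero hc0 hd)
  refine ⟨(a : F) / c, s, hs, ?_⟩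
  have : x = algebraMap F (FiniteAdeleRing (𝓞 F) F) (c : F)⁻¹ *
      (algebraMap F (FiniteAdeleRing (𝓞 F) F) c * x) := by
    rw [← mul_assoc, ← map_mul, inv_mul_cancel₀ hcF, map_one, one_mul]
  rw [this, h, mul_add, ← map_mul, ← mul_assoc, ← map_mul]
  congr 2
  · rw [div_eq_inv_mul]
  · congr 1
    push_cast
    field_simp

/-- The sets `d • Ô` form a basis of neighbourhoods of `0`. -/
theorem exists_smul_integralAdeles_subset {U : Set (FiniteAdeleRing (𝓞 F) F)} (hU : U ∈ 𝓝 0) :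
    ∃ d : 𝓞 F, d ≠ 0 ∧ ∀ s ∈ integralAdeles F,
      algebraMap F (FiniteAdeleRing (𝓞 F) F) d * s ∈ U := by
  have h0 : integralAdelesMap (F := F) 0 = 0 := rfl
  have hU' : integralAdelesMap ⁻¹' U ∈ 𝓝 (0 : ∀ v : HeightOneSpectrum (𝓞 F), v.adicCompletionIntegers F) := by
    apply (isOpenEmbedding_integralAdelesMap (F := F)).continuous.continuousAt
    rw [h0]; exact hU
  -- On the integral adeles the topology is the product topology, so `U` restricts only finitely
  -- many components, and there a high power of the prime suffices.
  rw [nhds_pi, Filter.mem_pi] at hU'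
  obtain ⟨S, hS, t, ht, hsub⟩ := hU'
  have hloc : ∀ v : HeightOneSpectrum (𝓞 F), ∃ n : ℕ, ∀ x : v.adicCompletionIntegers F,
      Valued.v (x : v.adicCompletion F) ≤ exp (-(n : ℤ)) → x ∈ t v := by
    intro v
    obtain ⟨ε, hε, hball⟩ := Metric.mem_nhds_iff.1 (ht v)
    have hN := NumberField.HeightOneSpectrum.one_lt_absNorm_nnreal v
    obtain ⟨n, hn⟩ := exists_pow_lt_of_lt_one hε
      (show ((Ideal.absNorm v.asIdeal : ℝ))⁻¹ < 1 from inv_lt_one_of_one_lt₀ (by exact_mod_cast hN))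
    refine ⟨n, fun x hx => hball ?_⟩
    rw [Metric.mem_ball, Subtype.dist_eq, dist_eq_norm]
    refine lt_of_le_of_lt ?_ hn
    change ‖(x : v.adicCompletion F) - 0‖ ≤ _
    rw [sub_zero, NumberField.FinitePlace.norm_def]
    have h1 := (WithZeroMulInt.toNNReal_strictMono hN).monotone hx
    refine (NNReal.coe_le_coe.2 h1).trans_eq ?_
    rw [WithZeroMulInt.toNNReal_neg_apply _ exp_ne_zero]
    have h3 : Multiplicative.toAdd (WithZero.unzero (exp_ne_zero (a := -(n : ℤ)))) = -(n : ℤ) := rfl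
    rw [h3]
    simp
  choose n hn using hloc
  obtain ⟨d, hd0, hd⟩ := exists_ne_zero_mem_pow hS.toFinset n
  refine ⟨d, hd0, fun s hs => ?_⟩
  have hmem : ∀ v, (algebraMap F (FiniteAdeleRing (𝓞 F) F) d * s) v ∈
      v.adicCompletionIntegers F := fun v => mul_mem (v.coe_algebraMap_mem (𝓞 F) F d) (hs v)
  have : (fun v => ⟨_, hmem v⟩ : ∀ v : HeightOneSpectrum (𝓞 F), v.adicCompletionIntegers F) ∈ integralAdelesMap ⁻¹' U := by
    apply hsub
    intro v hv
    apply hn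
    change Valued.v (((d : F) : v.adicCompletion F) * s v) ≤ _
    rw [map_mul, valued_coe_integer]
    calc _ ≤ exp (-(n v : ℤ)) * 1 := mul_le_mul' (hd v (by simpa using hv)) (hs v)
      _ = _ := mul_one _
  exact this

theorem countable_numberField : Countable F :=
  (Module.finBasis ℚ F).equivFun.toEquiv.injective.countable

instance countable_heightOneSpectrum : Countable (HeightOneSpectrum (𝓞 F)) := by
  have hF : Countable F := countable_numberField
  have : Countable (𝓞 F) := Subtype.coe_injective.countable (f := ((↑) : 𝓞 F → F))
  have hI : Countable (Ideal (𝓞 F)) := by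
    refine Function.Surjective.countable (f := fun s : Finset (𝓞 F) => Ideal.span (s : Set (𝓞 F))) ?_
    intro I
    obtain ⟨s, hs⟩ := (isNoetherian_def.1 inferInstance I : I.FG)
    exact ⟨s, hs⟩
  exact Function.Injective.countable (f := fun v : HeightOneSpectrum (𝓞 F) => v.asIdeal)
    fun v w h => HeightOneSpectrum.ext h

/-- The finite adeles are covered by the translates of the integral adeles by the countably many
elements of `F`. -/
instance : SecondCountableTopology (FiniteAdeleRing (𝓞 F) F) := by
  have : Countable F := countable_numberField
  have hsc : SecondCountableTopology (integralAdeles F : Set (FiniteAdeleRing (𝓞 F) F)) := by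
    have h2 := isOpenEmbedding_integralAdelesMap (F := F)
    have h3 : SecondCountableTopology (Set.range (integralAdelesMap (F := F))) :=
      h2.isEmbedding.toHomeomorph.symm.isEmbedding.secondCountableTopology
    rw [range_integralAdelesMap] at h3
    exact h3
  have hU : ∀ a : F, SecondCountableTopology
      ((Homeomorph.subRight (algebraMap F (FiniteAdeleRing (𝓞 F) F) a)) ⁻¹'
        (integralAdeles F : Set (FiniteAdeleRing (𝓞 F) F))) := fun a =>
    ((Homeomorph.subRight (algebraMap F (FiniteAdeleRing (𝓞 F) F) a)).sets
      (t := (integralAdeles F : Set (FiniteAdeleRing (𝓞 F) F)))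
      rfl).isEmbedding.secondCountableTopology
  refine TopologicalSpace.secondCountableTopology_of_countable_cover
    (U := fun a : F => (Homeomorph.subRight (algebraMap F (FiniteAdeleRing (𝓞 F) F) a)) ⁻¹'
      (integralAdeles F : Set (FiniteAdeleRing (𝓞 F) F)))
    (fun a => isOpen_integralAdeles.preimage (Homeomorph.continuous _)) ?_
  rw [Set.eq_univ_iff_forall]
  intro x
  obtain ⟨a, s, hs, h⟩ := exists_sub_mem_smul_integralAdeles x (one_ne_zero (α := 𝓞 F))
  refine Set.mem_iUnion.2 ⟨a, ?_⟩
  simpa [h] using hs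

end finiteAdeles

/-! ### The adele ring as the product of `ℝ^r₁ × ℂ^r₂` and the finite adeles. -/

section adeleTopology

open IsDedekindDomain IsDedekindDomain.HeightOneSpectrum NumberField.mixedEmbedding
  NumberField.InfinitePlace NumberField.InfinitePlace.Completion
open scoped Classical

variable {F : Type*} [Field F] [NumberField F]

/-- The archimedean part of an adele, as an element of `ℝ^r₁ × ℂ^r₂`. -/
def archPart : Adele F →+* mixedSpace F where
  toFun x := InfiniteAdeleRing.ringEquiv_mixedSpace F x.1
  map_one' := map_one (InfiniteAdeleRing.ringEquiv_mixedSpace F)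
  map_mul' x y := map_mul (InfiniteAdeleRing.ringEquiv_mixedSpace F) x.1 y.1
  map_zero' := map_zero (InfiniteAdeleRing.ringEquiv_mixedSpace F)
  map_add' x y := map_add (InfiniteAdeleRing.ringEquiv_mixedSpace F) x.1 y.1

/-- The finite part of an adele. -/
def finPart : Adele F →+* FiniteAdeleRing (𝓞 F) F where
  toFun x := x.2
  map_one' := rfl
  map_mul' _ _ := rfl
  map_zero' := rfl
  map_add' _ _ := rfl

/-- The adele with given archimedean and finite parts. -/
def adeleMk (w : mixedSpace F) (s : FiniteAdeleRing (𝓞 F) F) : Adele F :=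
  ((InfiniteAdeleRing.ringEquiv_mixedSpace F).symm w, s)

@[simp] theorem archPart_adeleMk (w : mixedSpace F) (s : FiniteAdeleRing (𝓞 F) F) :
    archPart (adeleMk w s) = w := (InfiniteAdeleRing.ringEquiv_mixedSpace F).apply_symm_apply w

@[simp] theorem finPart_adeleMk (w : mixedSpace F) (s : FiniteAdeleRing (𝓞 F) F) :
    finPart (adeleMk w s) = s := rfl

theorem adele_ext {x y : Adele F} (h : archPart x = archPart y) (h' : finPart x = finPart y) :
    x = y :=
  Prod.ext ((InfiniteAdeleRing.ringEquiv_mixedSpace F).injective h) h'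

@[simp] theorem adeleMk_parts (x : Adele F) : adeleMk (archPart x) (finPart x) = x :=
  adele_ext (by simp) (by simp)

theorem adeleMk_add (w w' : mixedSpace F) (s s' : FiniteAdeleRing (𝓞 F) F) :
    adeleMk (w + w') (s + s') = adeleMk w s + adeleMk w' s' :=
  adele_ext (by simp) (by simp)

theorem adeleMk_mul (w w' : mixedSpace F) (s s' : FiniteAdeleRing (𝓞 F) F) :
    adeleMk (w * w') (s * s') = adeleMk w s * adeleMk w' s' :=
  adele_ext (by simp) (by simp)

@[simp] theorem adeleMk_zero : adeleMk (0 : mixedSpace F) 0 = 0 :=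
  adele_ext (by simp) (by simp)

@[simp] theorem adeleMk_one : adeleMk (1 : mixedSpace F) 1 = 1 :=
  adele_ext (by simp) (by simp)

@[simp] theorem archPart_algebraMap (a : F) :
    archPart (algebraMap F (Adele F) a) = mixedEmbedding F a :=
  (InfiniteAdeleRing.mixedEmbedding_eq_algebraMap_comp F).symm

@[simp] theorem finPart_algebraMap (a : F) :
    finPart (algebraMap F (Adele F) a) = algebraMap F (FiniteAdeleRing (𝓞 F) F) a := rfl

theorem continuous_ringEquiv_mixedSpace :
    Continuous (InfiniteAdeleRing.ringEquiv_mixedSpace F) := by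
  have h : ∀ v : InfinitePlace F, Continuous fun x : InfiniteAdeleRing F => x v :=
    fun v => continuous_apply v
  change Continuous fun x => InfiniteAdeleRing.ringEquiv_mixedSpace F x
  simp only [InfiniteAdeleRing.ringEquiv_mixedSpace_apply]
  refine Continuous.prodMk (continuous_pi fun v => ?_) (continuous_pi fun v => ?_)
  · exact (isometry_extensionEmbeddingOfIsReal v.2).continuous.comp (h v)
  · exact (isometry_extensionEmbedding v.1).continuous.comp (h v)

theorem continuous_ringEquiv_mixedSpace_symm :
    Continuous (InfiniteAdeleRing.ringEquiv_mixedSpace F).symm := by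
  refine continuous_pi fun v => ?_
  have key : ∀ w, InfiniteAdeleRing.ringEquiv_mixedSpace F
      ((InfiniteAdeleRing.ringEquiv_mixedSpace F).symm w) = w :=
    fun w => (InfiniteAdeleRing.ringEquiv_mixedSpace F).apply_symm_apply w
  by_cases hv : v.IsReal
  · rw [(isometry_extensionEmbeddingOfIsReal hv).isEmbedding.isInducing.continuous_iff]
    have : (extensionEmbeddingOfIsReal hv ∘ fun w =>
        (InfiniteAdeleRing.ringEquiv_mixedSpace F).symm w v) = fun w : mixedSpace F => w.1 ⟨v, hv⟩ := by
      funext w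
      conv_rhs => rw [← key w]
      rfl
    rw [this]
    fun_prop
  · have hv' : v.IsComplex := not_isReal_iff_isComplex.1 hv
    rw [(isometry_extensionEmbedding v).isEmbedding.isInducing.continuous_iff]
    have : (extensionEmbedding v ∘ fun w =>
        (InfiniteAdeleRing.ringEquiv_mixedSpace F).symm w v) = fun w : mixedSpace F => w.2 ⟨v, hv'⟩ := by
      funext w
      conv_rhs => rw [← key w]
      rfl
    rw [this]
    fun_prop

@[fun_prop] theorem continuous_archPart : Continuous (archPart (F := F)) :=
  continuous_ringEquiv_mixedSpace.comp
    (continuous_fst (X := InfiniteAdeleRing F) (Y := FiniteAdeleRing (𝓞 F) F))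

@[fun_prop] theorem continuous_finPart : Continuous (finPart (F := F)) :=
  continuous_snd (X := InfiniteAdeleRing F) (Y := FiniteAdeleRing (𝓞 F) F)

theorem continuous_adeleMk :
    Continuous fun p : mixedSpace F × FiniteAdeleRing (𝓞 F) F => adeleMk p.1 p.2 :=
  Continuous.prodMk (continuous_ringEquiv_mixedSpace_symm.comp continuous_fst) continuous_snd

/-- The adele ring as the product of `ℝ^r₁ × ℂ^r₂` and the finite adeles. -/
def adeleHomeomorph : Adele F ≃ₜ mixedSpace F × FiniteAdeleRing (𝓞 F) F where
  toFun x := (archPart x, finPart x)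
  invFun p := adeleMk p.1 p.2
  left_inv x := adeleMk_parts x
  right_inv p := by simp
  continuous_toFun := by fun_prop
  continuous_invFun := continuous_adeleMk

instance : T2Space (Adele F) := adeleHomeomorph.symm.t2Space

instance : LocallyCompactSpace (Adele F) :=
  adeleHomeomorph.isClosedEmbedding.locallyCompactSpace

instance : SecondCountableTopology (Adele F) :=
  adeleHomeomorph.isEmbedding.secondCountableTopology

instance : SecondCountableTopology (Adele F)ˣ :=
  haveI : SecondCountableTopology (Adele F)ᵐᵒᵖ :=
    MulOpposite.opHomeomorph.symm.isEmbedding.secondCountableTopology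
  Units.isEmbedding_embedProduct.secondCountableTopology

/-- The norm at an infinite place in terms of `archPart`. -/
theorem norm_fst_apply (x : Adele F) (v : InfinitePlace F) :
    ‖x.1 v‖ = normAtPlace v (archPart x) := by
  by_cases hv : v.IsReal
  · rw [normAtPlace_apply_of_isReal hv]
    have h := (isometry_extensionEmbeddingOfIsReal hv).norm_map_of_map_zero (map_zero _) (x.1 v)
    exact h.symm
  · have hv' : v.IsComplex := not_isReal_iff_isComplex.1 hv
    rw [normAtPlace_apply_of_isComplex hv']
    have h := (isometry_extensionEmbedding v).norm_map_of_map_zero (map_zero _) (x.1 v)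
    exact h.symm

theorem norm_fst (x : Adele F) : ‖x.1‖ = mixedEmbedding.norm (archPart x) := by
  rw [InfiniteAdeleRing.norm_def, mixedEmbedding.norm_apply]
  exact Finset.prod_congr rfl fun v _ => by rw [norm_fst_apply]

theorem denseRange_mixedEmbedding : DenseRange (mixedEmbedding F) := by
  have h := (InfiniteAdeleRing.denseRange_algebraMap F)
  have h2 := (InfiniteAdeleRing.ringEquiv_mixedSpace F).surjective.denseRange.comp h
    continuous_ringEquiv_mixedSpace
  have h3 : (InfiniteAdeleRing.ringEquiv_mixedSpace F ∘ algebraMap F (InfiniteAdeleRing F)) =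
      mixedEmbedding F := by
    funext x
    exact (InfiniteAdeleRing.mixedEmbedding_eq_algebraMap_comp F).symm
  rwa [h3] at h2

end adeleTopology

/-! ### An explicit fundamental domain for `F` in `𝔸`. -/

section fundamentalDomain

open IsDedekindDomain NumberField.mixedEmbedding
open scoped Classical

variable (F : Type*) [Field F] [NumberField F]

/-- A fundamental domain for `F` in the adele ring. -/
def adeleBox : Set (Adele F) :=
  {x | archPart x ∈ ZSpan.fundamentalDomain (latticeBasis F) ∧ finPart x ∈ integralAdeles F}

variable {F}

/-- `D` meets every coset of `F` in exactly one point. -/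
def IsStrictFundDomain (D : Set (Adele F)) : Prop :=
  MeasurableSet D ∧ ∀ x : Adele F, ∃! a : F, x + algebraMap F (Adele F) a ∈ D

theorem measurableSet_adeleBox : MeasurableSet (adeleBox F) := by
  have h1 : MeasurableSet (ZSpan.fundamentalDomain (latticeBasis F)) :=
    ZSpan.fundamentalDomain_measurableSet _
  exact (continuous_archPart.measurable h1).inter
    (isOpen_integralAdeles.preimage continuous_finPart).measurableSet

/-- Strong approximation moves the finite part into the integral adeles. The translations that keep
it there are those by `𝓞 F`, whose image in `ℝ^r₁ × ℂ^r₂` is the lattice with basis `latticeBasis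
F`; this lattice moves the archimedean part into its fundamental parallelotope in exactly one way.
-/
theorem isStrictFundDomain_adeleBox : IsStrictFundDomain (adeleBox F) := by
  refine ⟨measurableSet_adeleBox, fun x => ?_⟩
  obtain ⟨a, s, hs, hx⟩ := exists_sub_mem_smul_integralAdeles (finPart x) (one_ne_zero (α := 𝓞 F))
  obtain ⟨l, hl, hluniq⟩ := ZSpan.exist_unique_vadd_mem_fundamentalDomain (latticeBasis F)
    (archPart x - mixedEmbedding F a)
  obtain ⟨b, hb⟩ := (mem_span_latticeBasis F).1 l.2
  have hb' : mixedEmbedding F (b : F) = l := hb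
  have hs' : finPart x - algebraMap F _ a ∈ integralAdeles F := by
    rw [hx]; simpa using hs
  refine ⟨(b : F) - a, ⟨?_, ?_⟩, ?_⟩
  · have : archPart (x + algebraMap F (Adele F) ((b : F) - a)) =
        l +ᵥ (archPart x - mixedEmbedding F a) := by
      rw [map_add, archPart_algebraMap, map_sub, hb']
      change _ = (l : mixedSpace F) + _
      ring
    rw [this]; exact hl
  · have : finPart (x + algebraMap F (Adele F) ((b : F) - a)) =
        (finPart x - algebraMap F _ a) + algebraMap F _ (b : F) := by
      rw [map_add, finPart_algebraMap, map_sub]; ring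
    rw [this]
    exact add_mem hs' ((algebraMap_mem_integralAdeles_iff _).2 ⟨b, rfl⟩)
  · intro c hc
    have h1 : algebraMap F (FiniteAdeleRing (𝓞 F) F) (c + a) ∈ integralAdeles F := by
      have h2 := sub_mem hc.2 hs'
      have h3 : finPart (x + algebraMap F (Adele F) c) - (finPart x - algebraMap F _ a) =
          algebraMap F (FiniteAdeleRing (𝓞 F) F) (c + a) := by
        rw [map_add, finPart_algebraMap, map_add]; ring
      rwa [h3] at h2
    obtain ⟨b', hb'c⟩ := (algebraMap_mem_integralAdeles_iff _).1 h1
    have h4 : mixedEmbedding F (b' : F) ∈ Submodule.span ℤ (Set.range (latticeBasis F)) :=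
      (mem_span_latticeBasis F).2 ⟨b', rfl⟩
    have h5 := hluniq ⟨_, h4⟩ (by
      have : archPart (x + algebraMap F (Adele F) c) =
          (⟨_, h4⟩ : Submodule.span ℤ (Set.range (latticeBasis F))) +ᵥ
            (archPart x - mixedEmbedding F a) := by
        change _ = mixedEmbedding F (b' : F) + _
        rw [map_add, archPart_algebraMap, hb'c, map_add]; ring
      simpa [this] using hc.1)
    have h6 : mixedEmbedding F (b' : F) = mixedEmbedding F (b : F) := by
      rw [hb']; exact congrArg Subtype.val h5
    have h7 : (b' : F) = b := mixedEmbedding_injective F h6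
    rw [← h7, hb'c]; ring

variable (F) in
/-- A compact set that contains the fundamental domain. -/
def adeleCompactBox : Set (Adele F) :=
  {x | ‖archPart x‖ ≤ ∑ i, ‖latticeBasis F i‖ ∧ finPart x ∈ integralAdeles F}

theorem isCompact_setOf_norm_le (r : ℝ) :
    IsCompact {x : Adele F | ‖archPart x‖ ≤ r ∧ finPart x ∈ integralAdeles F} := by
  have h : IsCompact (Metric.closedBall (0 : mixedSpace F) r ×ˢ
      (integralAdeles F : Set (FiniteAdeleRing (𝓞 F) F))) :=
    (isCompact_closedBall _ _).prod isCompact_integralAdeles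
  have h2 := adeleHomeomorph.isCompact_preimage.2 h
  convert h2 using 1
  ext x
  simp [adeleHomeomorph]

theorem isCompact_adeleCompactBox : IsCompact (adeleCompactBox F) := isCompact_setOf_norm_le _

theorem adeleBox_subset : adeleBox F ⊆ adeleCompactBox F := by
  intro x hx
  refine ⟨?_, hx.2⟩
  have h := ZSpan.norm_fract_le (latticeBasis F) (archPart x)
  rwa [ZSpan.fract_eq_self.2 hx.1] at h

end fundamentalDomain

/-! ### Integration over `𝔸/F` as integration over a fundamental domain. -/

section quotientMeasure

open NumberField.mixedEmbedding

variable {F : Type*} [Field F] [NumberField F]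

/-- A function on the adeles that is invariant under translation by `F`. -/
def IsPeriodic {β : Type*} (f : Adele F → β) : Prop :=
  ∀ (x : Adele F) (a : F), f (x + algebraMap F (Adele F) a) = f x

instance countable_principalAdeles : Countable (principalAdeles F) := by
  have := countable_numberField (F := F)
  have : (Set.range (algebraMap F (Adele F))).Countable := Set.countable_range _
  exact this.to_subtype

/-- The elements of `F`, as elements of the subgroup of principal adeles. -/
def principalEquiv : F ≃ principalAdeles F :=
  Equiv.ofBijective (fun a => ⟨algebraMap F (Adele F) a, ⟨a, rfl⟩⟩) ⟨fun a b h =>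
    mixedEmbedding_injective F (by
      have h' := congrArg (fun z => archPart (Subtype.val z)) h
      simpa using h'), fun ⟨_, a, ha⟩ => ⟨a, Subtype.ext ha⟩⟩

theorem principalEquiv_apply (a : F) : (principalEquiv a : Adele F) = algebraMap F (Adele F) a := rfl

theorem IsPeriodic.out {β : Type*} {f : Adele F → β} (hf : IsPeriodic f) (x : Adele F) :
    f (Quotient.out (QuotientAddGroup.mk x : Adele F ⧸ principalAdeles F)) = f x := by
  obtain ⟨⟨_, a, rfl⟩, ha⟩ := QuotientAddGroup.mk_out_eq_add (principalAdeles F) x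
  exact (congrArg f ha).trans (hf x a)

theorem IsPeriodic.measurable_out {f : Adele F → ℂ} (hf : IsPeriodic f) (hm : Measurable f) :
    Measurable fun q : Adele F ⧸ principalAdeles F => f (Quotient.out q) := by
  refine measurable_from_quotient.2 ?_
  have : ((fun q : Adele F ⧸ principalAdeles F => f (Quotient.out q)) ∘ Quotient.mk'') = f :=
    funext fun x => hf.out x
  rw [this]
  exact hm

theorem IsStrictFundDomain.isAddFundamentalDomain {D : Set (Adele F)} (hD : IsStrictFundDomain D)
    (dx : Measure (Adele F)) : IsAddFundamentalDomain (principalAdeles F) D dx := by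
  refine IsAddFundamentalDomain.mk' hD.1.nullMeasurableSet fun x => ?_
  obtain ⟨a, ha, hu⟩ := hD.2 x
  refine ⟨principalEquiv a, ?_, fun b hb => ?_⟩
  · change algebraMap F (Adele F) a + x ∈ D
    rwa [add_comm]
  · obtain ⟨b, rfl⟩ := principalEquiv.surjective b
    change algebraMap F (Adele F) b + x ∈ D at hb
    rw [add_comm] at hb
    rw [hu b hb]

variable {dx : Measure (Adele F)} {dxq : Measure (Adele F ⧸ principalAdeles F)}

/-- The quotient formula is applied to `f` times the indicator of `D`: every coset meets `D` once,
so each inner sum has a single nonzero term. -/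
theorem IsAddQuotientMeasure.lintegral_out (hdx : IsAddQuotientMeasure (principalAdeles F) dx dxq)
    {D : Set (Adele F)} (hD : IsStrictFundDomain D) {f : Adele F → ℝ≥0∞} (hf : IsPeriodic f)
    (hm : Measurable f) : ∫⁻ q, f (Quotient.out q) ∂dxq = ∫⁻ x in D, f x ∂dx := by
  rw [← lintegral_indicator hD.1, hdx _ (hm.indicator hD.1)]
  refine lintegral_congr fun q => ?_
  obtain ⟨a, ha, hu⟩ := hD.2 (Quotient.out q)
  rw [tsum_eq_single (principalEquiv a)]
  · rw [principalEquiv_apply, Set.indicator_of_mem ha, hf]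
  · intro b hb
    obtain ⟨b, rfl⟩ := principalEquiv.surjective b
    refine Set.indicator_of_notMem (fun h => hb ?_) _
    rw [hu b h]

/-- `IsAddQuotientMeasure` speaks only of nonnegative functions. Writing the quotient measure as a
push-forward makes it usable for complex integrals. -/
theorem IsAddQuotientMeasure.eq_map (hdx : IsAddQuotientMeasure (principalAdeles F) dx dxq)
    {D : Set (Adele F)} (hD : IsStrictFundDomain D) :
    dxq = (dx.restrict D).map (QuotientAddGroup.mk : Adele F → Adele F ⧸ principalAdeles F) := by
  have hmk : Measurable (QuotientAddGroup.mk : Adele F → Adele F ⧸ principalAdeles F) :=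
    measurable_quotient_mk''
  ext A hA
  rw [Measure.map_apply hmk hA, ← lintegral_indicator_one hA,
    ← lintegral_indicator_one (hmk hA)]
  have h := hdx.lintegral_out hD (f := (QuotientAddGroup.mk ⁻¹' A).indicator 1) (fun x a => by
    have : (QuotientAddGroup.mk (x + algebraMap F (Adele F) a) : Adele F ⧸ principalAdeles F) =
      QuotientAddGroup.mk x := by
      rw [eq_comm, QuotientAddGroup.eq]
      simp
    by_cases hx : (QuotientAddGroup.mk x : Adele F ⧸ principalAdeles F) ∈ A <;>
      simp [Set.indicator, this, hx])
    (measurable_one.indicator (hmk hA))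
  rw [← h]
  refine lintegral_congr fun q => ?_
  have : (QuotientAddGroup.mk (Quotient.out q) : Adele F ⧸ principalAdeles F) = q :=
    Quotient.out_eq' q
  by_cases hx : q ∈ A <;> simp [Set.indicator, this, hx]

/-- Integration over a fundamental domain for `F` in the adeles. -/
theorem IsAddQuotientMeasure.intMod_eq (hdx : IsAddQuotientMeasure (principalAdeles F) dx dxq)
    {D : Set (Adele F)} (hD : IsStrictFundDomain D) {f : Adele F → ℂ} (hf : IsPeriodic f)
    (hm : Measurable f) : intMod dxq f = ∫ x in D, f x ∂dx := by
  have hmk : Measurable (QuotientAddGroup.mk : Adele F → Adele F ⧸ principalAdeles F) :=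
    measurable_quotient_mk''
  rw [intMod, hdx.eq_map hD, integral_map hmk.aemeasurable
    (hf.measurable_out hm).aestronglyMeasurable]
  exact integral_congr_ae (Filter.Eventually.of_forall fun x => hf.out x)

theorem IsAddQuotientMeasure.measure_eq_one
    (hdx : IsAddQuotientMeasure (principalAdeles F) dx dxq) (hvol : dxq Set.univ = 1)
    {D : Set (Adele F)} (hD : IsStrictFundDomain D) : dx D = 1 := by
  rw [hdx.eq_map hD, Measure.map_apply measurable_quotient_mk'' MeasurableSet.univ] at hvol
  simpa using hvol

theorem IsPeriodic.vadd {β : Type*} {f : Adele F → β} (hf : IsPeriodic f) (g : principalAdeles F)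
    (x : Adele F) : f (g +ᵥ x) = f x := by
  obtain ⟨a, rfl⟩ := principalEquiv.surjective g
  change f (algebraMap F (Adele F) a + x) = f x
  rw [add_comm, hf]

theorem IsStrictFundDomain.translate {D : Set (Adele F)} (hD : IsStrictFundDomain D)
    (c : Adele F) : IsStrictFundDomain ((fun x => x + c) ⁻¹' D) := by
  refine ⟨(continuous_add_const c).measurable hD.1, fun x => ?_⟩
  obtain ⟨a, ha, hu⟩ := hD.2 (x + c)
  refine ⟨a, ?_, fun b hb => hu b ?_⟩
  · change _ + c ∈ D
    convert ha using 1; ring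
  · change _ + c ∈ D at hb
    convert hb using 1; ring

theorem IsStrictFundDomain.scale {D : Set (Adele F)} (hD : IsStrictFundDomain D)
    {η : F} (hη : η ≠ 0) : IsStrictFundDomain ((fun x => algebraMap F (Adele F) η * x) ⁻¹' D) := by
  refine ⟨(continuous_const_mul _).measurable hD.1, fun x => ?_⟩
  obtain ⟨a, ha, hu⟩ := hD.2 (algebraMap F (Adele F) η * x)
  refine ⟨η⁻¹ * a, ?_, fun b hb => ?_⟩
  · change _ * _ ∈ D
    rw [mul_add, ← map_mul, mul_inv_cancel_left₀ hη]
    exact ha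
  · change _ * _ ∈ D at hb
    rw [mul_add, ← map_mul] at hb
    rw [← hu _ hb, inv_mul_cancel_left₀ hη]

variable [dx.IsAddHaarMeasure]

instance : VAddInvariantMeasure (principalAdeles F) (Adele F) dx :=
  ⟨fun c s _ => measure_preimage_add dx (c : Adele F) s⟩

theorem IsPeriodic.setIntegral_eq {f : Adele F → ℂ} (hf : IsPeriodic f) {D D' : Set (Adele F)}
    (hD : IsStrictFundDomain D) (hD' : IsStrictFundDomain D') :
    ∫ x in D, f x ∂dx = ∫ x in D', f x ∂dx :=
  (hD.isAddFundamentalDomain dx).setIntegral_eq (hD'.isAddFundamentalDomain dx) fun g x => hf.vadd g x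

variable (dx) in
theorem measure_adeleBox_lt_top : dx (adeleBox F) < ∞ :=
  (measure_mono adeleBox_subset).trans_lt isCompact_adeleCompactBox.measure_lt_top

variable (dx) in
theorem measure_adeleBox_ne_zero : dx (adeleBox F) ≠ 0 := by
  intro h
  have h1 := (isStrictFundDomain_adeleBox (F := F)).isAddFundamentalDomain dx
  have h2 := h1.measure_zero_of_invariant Set.univ (fun g => by simp)
    (by simpa using h)
  exact (NeZero.ne dx) (Measure.measure_univ_eq_zero.1 h2)

/-- Translation invariance of the integral over `𝔸/F`. -/
theorem IsPeriodic.setIntegral_add {f : Adele F → ℂ} (hf : IsPeriodic f) {D : Set (Adele F)}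
    (hD : IsStrictFundDomain D) (c : Adele F) :
    ∫ x in D, f (x + c) ∂dx = ∫ x in D, f x ∂dx := by
  have h := (measurePreserving_add_right dx c).setIntegral_preimage_emb
    (Homeomorph.addRight c).measurableEmbedding f D
  rw [← h]
  exact IsPeriodic.setIntegral_eq (fun x a => by rw [add_right_comm, hf]) hD (hD.translate c)

instance : TopologicalSpace.MetrizableSpace (Adele F) :=
  TopologicalSpace.metrizableSpace_of_t3_secondCountable _

variable (dx) in
theorem map_mul_unit (y : (Adele F)ˣ) :
    dx.map (fun x => (y : Adele F) * x) = (distribHaarChar (Adele F) y)⁻¹ • dx := by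
  ext s hs
  rw [Measure.map_apply (continuous_const_mul _).measurable hs, Measure.smul_apply, ← map_inv,
    ENNReal.smul_def, smul_eq_mul, distribHaarChar_mul]
  congr 1
  ext x
  rw [Set.mem_inv_smul_set_iff]
  rfl

/-- Multiplication by an element of `Fˣ` preserves the Haar measure of the adeles. -/
theorem measurePreserving_mul_principal {η : F} (hη : η ≠ 0) :
    MeasurePreserving (fun x => algebraMap F (Adele F) η * x) dx dx := by
  have hu : IsUnit (algebraMap F (Adele F) η) := (IsUnit.mk0 η hη).map _
  have hD := isStrictFundDomain_adeleBox (F := F)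
  have h0 := measure_adeleBox_ne_zero dx
  -- The box and its preimage under multiplication by `η` are both fundamental domains for `F`, so
  -- they have the same finite nonzero measure and the modulus of `η` is `1`.
  have h1 : distribHaarChar (Adele F) hu.unit = 1 := by
    refine distribHaarChar_eq_of_measure_smul_eq_mul (μ := dx)
      (s := (fun x => algebraMap F (Adele F) η * x) ⁻¹' adeleBox F) ?_ ?_ ?_
    all_goals
      have h2 := ((hD.scale hη).isAddFundamentalDomain dx).measure_eq (hD.isAddFundamentalDomain dx)
      rw [h2]
    · exact h0
    · exact (measure_adeleBox_lt_top dx).ne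
    · rw [ENNReal.coe_one, one_mul]
      congr 1
      exact Set.image_preimage_eq _ (MulAction.surjective hu.unit)
  have h3 := map_mul_unit dx hu.unit
  rw [h1, inv_one, one_smul] at h3
  exact ⟨(continuous_const_mul _).measurable, h3⟩

theorem IsPeriodic.setIntegral_mul {f : Adele F → ℂ} (hf : IsPeriodic f) {D : Set (Adele F)}
    (hD : IsStrictFundDomain D) {η : F} (hη : η ≠ 0) :
    ∫ x in D, f (algebraMap F (Adele F) η * x) ∂dx = ∫ x in D, f x ∂dx := by
  have hu : IsUnit (algebraMap F (Adele F) η) := (IsUnit.mk0 η hη).map _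
  have h := (measurePreserving_mul_principal (dx := dx) hη).setIntegral_preimage_emb
    (Homeomorph.smul hu.unit).measurableEmbedding f D
  rw [← h]
  exact IsPeriodic.setIntegral_eq (fun x a => by rw [mul_add, ← map_mul, hf]) hD (hD.scale hη)

/-- Unfolding: an integral over the adeles is the integral over a fundamental domain of the sum over
translates by `F`. -/
theorem lintegral_eq_setLIntegral_tsum {D : Set (Adele F)} (hD : IsStrictFundDomain D)
    {f : Adele F → ℝ≥0∞} (hf : Measurable f) :
    ∫⁻ x, f x ∂dx = ∫⁻ x in D, ∑' a : F, f (x + algebraMap F (Adele F) a) ∂dx := by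
  have := countable_numberField (F := F)
  rw [(hD.isAddFundamentalDomain dx).lintegral_eq_tsum'' f, lintegral_tsum]
  · rw [← principalEquiv.tsum_eq]
    refine tsum_congr fun a => lintegral_congr fun x => ?_
    change f (algebraMap F (Adele F) a + x) = _
    rw [add_comm]
  · exact fun a => (hf.comp (continuous_add_const _).measurable).aemeasurable

theorem integral_eq_setIntegral_tsum {D : Set (Adele F)} (hD : IsStrictFundDomain D)
    {f : Adele F → ℂ} (hf : Measurable f) (hi : Integrable f dx) :
    ∫ x, f x ∂dx = ∫ x in D, ∑' a : F, f (x + algebraMap F (Adele F) a) ∂dx := by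
  have := countable_numberField (F := F)
  rw [(hD.isAddFundamentalDomain dx).integral_eq_tsum'' f hi, integral_tsum]
  · rw [← principalEquiv.tsum_eq]
    refine tsum_congr fun a => integral_congr_ae (Filter.Eventually.of_forall fun x => ?_)
    change f (algebraMap F (Adele F) a + x) = _
    rw [add_comm]
  · exact fun a => (hf.comp (continuous_add_const _).measurable).aestronglyMeasurable
  · rw [← lintegral_tsum (f := fun (a : F) x => ‖f (x + algebraMap F (Adele F) a)‖ₑ) fun a =>
      ((hf.comp (continuous_add_const _).measurable).enorm).aemeasurable]
    have h := lintegral_eq_setLIntegral_tsum (dx := dx) hD hf.enorm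
    exact h ▸ hi.2.ne

end quotientMeasure

/-! ### The idele norm is the modulus of the Haar measure. -/

section ideleNorm

open IsDedekindDomain IsDedekindDomain.HeightOneSpectrum NumberField.mixedEmbedding
open scoped Classical NNReal Pointwise

variable {F : Type*} [Field F] [NumberField F]

theorem norm_eq_one_iff_valued (v : HeightOneSpectrum (𝓞 F)) (x : v.adicCompletion F) :
    ‖x‖ = 1 ↔ Valued.v x = 1 := by
  by_cases hx : x = 0
  · subst hx; simp
  have h1 : ∀ z : v.adicCompletion F, ‖z‖ ≤ 1 ↔ Valued.v z ≤ 1 := fun z =>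
    norm_le_one_iff_mem_adicCompletionIntegers v z
  have h2 : 0 < ‖x‖ := norm_pos_iff.2 hx
  have h3 : Valued.v x ≠ 0 := by simpa using hx
  constructor
  · intro h
    refine le_antisymm ((h1 x).1 h.le) ?_
    have := (h1 x⁻¹).1 (by rw [norm_inv, h, inv_one])
    rw [map_inv₀] at this
    exact (inv_le_one₀ (zero_lt_iff.2 h3)).1 this
  · intro h
    refine le_antisymm ((h1 x).2 h.le) ?_
    have := (h1 x⁻¹).2 (by rw [map_inv₀, h, inv_one])
    rw [norm_inv] at this
    exact (inv_le_one₀ h2).1 this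

theorem finiteAdele_pow_apply (x : FiniteAdeleRing (𝓞 F) F) (n : ℕ) (v : HeightOneSpectrum (𝓞 F)) :
    (x ^ n) v = x v ^ n := by
  induction n with
  | zero => rw [pow_zero, pow_zero]; rfl
  | succ n ih => rw [pow_succ, pow_succ, finiteAdele_mul_apply, ih]

theorem idele_finPart_ne_zero (y : (Adele F)ˣ) (v : HeightOneSpectrum (𝓞 F)) :
    finPart (y : Adele F) v ≠ 0 := by
  have h : finPart (y : Adele F) v * finPart ((y⁻¹ : (Adele F)ˣ) : Adele F) v = 1 := by
    rw [← finiteAdele_mul_apply, ← map_mul, Units.mul_inv, map_one]; rfl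
  exact left_ne_zero_of_mul_eq_one h

theorem norm_finPart_inv (y : (Adele F)ˣ) (v : HeightOneSpectrum (𝓞 F)) :
    ‖finPart ((y⁻¹ : (Adele F)ˣ) : Adele F) v‖ = ‖finPart (y : Adele F) v‖⁻¹ := by
  have h : finPart (y : Adele F) v * finPart ((y⁻¹ : (Adele F)ˣ) : Adele F) v = 1 := by
    rw [← finiteAdele_mul_apply, ← map_mul, Units.mul_inv, map_one]; rfl
  rw [← norm_inv]
  congr 1
  exact eq_inv_of_mul_eq_one_right h

theorem idele_finite_norm_ne_one (y : (Adele F)ˣ) :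
    {v : HeightOneSpectrum (𝓞 F) | ‖finPart (y : Adele F) v‖ ≠ 1}.Finite := by
  have h1 := finiteAdele_eventually_integral (finPart (y : Adele F))
  have h2 := finiteAdele_eventually_integral (finPart ((y⁻¹ : (Adele F)ˣ) : Adele F))
  have h3 : ∀ᶠ v : HeightOneSpectrum (𝓞 F) in Filter.cofinite, ‖finPart (y : Adele F) v‖ = 1 := by
    filter_upwards [h1, h2] with v hv1 hv2
    have hv1' := (norm_le_one_iff_mem_adicCompletionIntegers v _).2 hv1
    have hv2' := (norm_le_one_iff_mem_adicCompletionIntegers v _).2 hv2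
    rw [norm_finPart_inv] at hv2'
    exact le_antisymm hv1' ((inv_le_one₀ (norm_pos_iff.2 (idele_finPart_ne_zero y v))).1 hv2')
  exact h3

theorem ideleNorm_eq (y : (Adele F)ˣ) : ideleNorm y =
    mixedEmbedding.norm (archPart (y : Adele F)) *
      ∏ᶠ v : HeightOneSpectrum (𝓞 F), ‖finPart (y : Adele F) v‖ := by
  rw [ideleNorm, norm_fst]; rfl

theorem ideleNorm_mul (y z : (Adele F)ˣ) : ideleNorm (y * z) = ideleNorm y * ideleNorm z := by
  rw [ideleNorm_eq, ideleNorm_eq, ideleNorm_eq, Units.val_mul, map_mul, map_mul, map_mul]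
  have : (fun v : HeightOneSpectrum (𝓞 F) =>
      ‖(finPart (y : Adele F) * finPart (z : Adele F) : FiniteAdeleRing (𝓞 F) F) v‖) =
      fun v => ‖finPart (y : Adele F) v‖ * ‖finPart (z : Adele F) v‖ := by
    funext v
    rw [finiteAdele_mul_apply, norm_mul]
  rw [this, finprod_mul_distrib (idele_finite_norm_ne_one y) (idele_finite_norm_ne_one z)]
  ring

theorem ideleNorm_one : ideleNorm (1 : (Adele F)ˣ) = 1 := by
  rw [ideleNorm_eq, Units.val_one, map_one, map_one, map_one, one_mul]
  exact finprod_eq_one_of_forall_eq_one fun v => norm_one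

theorem ideleNorm_pos (y : (Adele F)ˣ) : 0 < ideleNorm y := by
  have h0 : 0 ≤ ideleNorm y := by
    rw [ideleNorm_eq]
    exact mul_nonneg (mixedEmbedding.norm_nonneg _)
      (finprod_nonneg fun v => norm_nonneg _)
  refine lt_of_le_of_ne h0 fun h => ?_
  have h1 := ideleNorm_mul y y⁻¹
  rw [mul_inv_cancel, ideleNorm_one, ← h, zero_mul] at h1
  exact one_ne_zero h1

/-- The idele norm as a homomorphism. -/
def ideleNormHom : (Adele F)ˣ →* ℝ where
  toFun := ideleNorm
  map_one' := ideleNorm_one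
  map_mul' := ideleNorm_mul

/-- The principal idele of a nonzero element of `F`. -/
abbrev principalIdele (η : Fˣ) : (Adele F)ˣ := Units.map (algebraMap F (Adele F)).toMonoidHom η

theorem principalIdele_val (η : Fˣ) :
    ((principalIdele η : (Adele F)ˣ) : Adele F) = algebraMap F (Adele F) η := rfl

theorem ideleNorm_principal (η : Fˣ) : ideleNorm (principalIdele η) = 1 := by
  rw [ideleNorm_eq, principalIdele_val, archPart_algebraMap, norm_eq_norm, finPart_algebraMap]
  have h := FinitePlace.prod_eq_inv_abs_norm (x := (η : F)) η.ne_zero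
  rw [← finprod_comp_equiv FinitePlace.equivHeightOneSpectrum.symm] at h
  have h2 : ∏ᶠ v : HeightOneSpectrum (𝓞 F),
      ‖(algebraMap F (FiniteAdeleRing (𝓞 F) F) (η : F)) v‖ =
      ((|(Algebra.norm ℚ) (η : F)| : ℚ) : ℝ)⁻¹ := by
    rw [← Rat.cast_inv, ← h]
    rfl
  rw [h2]
  refine mul_inv_cancel₀ ?_
  simp

theorem ideleNorm_inv (y : (Adele F)ˣ) : ideleNorm y⁻¹ = (ideleNorm y)⁻¹ := by
  have h1 := ideleNorm_mul y⁻¹ y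
  rw [inv_mul_cancel, ideleNorm_one] at h1
  exact eq_inv_of_mul_eq_one_left h1.symm

theorem det_mul_mixedSpace (w : mixedSpace F) :
    |LinearMap.det (LinearMap.mulLeft ℝ w)| = mixedEmbedding.norm w := by
  have h : LinearMap.mulLeft ℝ w = LinearMap.prodMap
      (LinearMap.pi fun i => (LinearMap.mulLeft ℝ (w.1 i)).comp (LinearMap.proj i))
      (LinearMap.pi fun i => (LinearMap.mulLeft ℝ (w.2 i)).comp (LinearMap.proj i)) := by
    ext <;> rfl
  rw [h, LinearMap.det_prodMap, LinearMap.det_pi, LinearMap.det_pi, abs_mul, Finset.abs_prod,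
    Finset.abs_prod, mixedEmbedding.norm_apply, InfinitePlace.prod_eq_prod_mul_prod]
  congr 1
  · refine Finset.prod_congr rfl fun v _ => ?_
    rw [normAtPlace_apply_of_isReal v.2, InfinitePlace.mult_isReal, pow_one, Real.norm_eq_abs]
    congr 1
    have : LinearMap.mulLeft ℝ (w.1 v) = (w.1 v) • LinearMap.id := by ext; simp
    rw [this, LinearMap.det_smul]
    simp
  · refine Finset.prod_congr rfl fun v _ => ?_
    rw [normAtPlace_apply_of_isComplex v.2, InfinitePlace.mult_isComplex, ← Complex.normSq_eq_norm_sq]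
    have h2 := Algebra.norm_complex_apply (w.2 v)
    rw [Algebra.norm_apply] at h2
    have h3 : LinearMap.mulLeft ℝ (w.2 v) = (Algebra.lmul ℝ ℂ) (w.2 v) := rfl
    rw [h3, h2, abs_of_nonneg (Complex.normSq_nonneg _)]

/-- The measure on `ℝ^r₁ × ℂ^r₂` of the archimedean parts of adeles that are integral at the finite
places. -/
def archMeasure (dx : Measure (Adele F)) : Measure (mixedSpace F) :=
  (dx.restrict (finPart ⁻¹' (integralAdeles F : Set (FiniteAdeleRing (𝓞 F) F)))).map archPart

theorem archMeasure_apply (dx : Measure (Adele F)) {E : Set (mixedSpace F)} (hE : MeasurableSet E) :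
    archMeasure dx E = dx {x | archPart x ∈ E ∧ finPart x ∈ integralAdeles F} := by
  rw [archMeasure, Measure.map_apply continuous_archPart.measurable hE,
    Measure.restrict_apply (continuous_archPart.measurable hE)]
  rfl

instance isAddHaarMeasure_archMeasure (dx : Measure (Adele F)) [dx.IsAddHaarMeasure] :
    (archMeasure dx).IsAddHaarMeasure where
  lt_top_of_isCompact := by
    intro K hK
    rw [archMeasure_apply dx hK.measurableSet]
    obtain ⟨r, hr⟩ := hK.isBounded.subset_closedBall 0
    refine (measure_mono ?_).trans_lt (isCompact_setOf_norm_le r).measure_lt_top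
    exact fun x hx => ⟨by simpa using hr hx.1, hx.2⟩
  map_add_left_eq_self := by
    intro c
    ext E hE
    rw [Measure.map_apply (continuous_const_add c).measurable hE, archMeasure_apply dx hE,
      archMeasure_apply dx ((continuous_const_add c).measurable hE),
      ← measure_preimage_add dx (adeleMk c 0) {x | archPart x ∈ E ∧ finPart x ∈ integralAdeles F}]
    congr 1
    ext x
    simp
  open_pos := by
    intro U hU hne
    rw [archMeasure_apply dx hU.measurableSet]
    refine IsOpen.measure_ne_zero dx ((hU.preimage continuous_archPart).inter
      (isOpen_integralAdeles.preimage continuous_finPart)) ?_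
    obtain ⟨w, hw⟩ := hne
    exact ⟨adeleMk w 0, by simpa using hw, by simp⟩

/-- Such an idele preserves the integral adeles, so its modulus is read off from `archMeasure`,
where multiplication is a real linear map with known determinant. -/
theorem distribHaarChar_of_norm_eq_one {y : (Adele F)ˣ}
    (hy : ∀ v : HeightOneSpectrum (𝓞 F), ‖finPart (y : Adele F) v‖ = 1) :
    (distribHaarChar (Adele F) y : ℝ) = mixedEmbedding.norm (archPart (y : Adele F)) := by
  let dx : Measure (Adele F) := Measure.addHaar
  let E : Set (mixedSpace F) := Metric.ball 0 1
  have hE : MeasurableSet E := measurableSet_ball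
  let w := archPart (y : Adele F)
  have hinv : archPart (y : Adele F) * archPart ((y⁻¹ : (Adele F)ˣ) : Adele F) = 1 := by
    rw [← map_mul, Units.mul_inv, map_one]
  have hwE : (LinearMap.mulLeft ℝ w) '' E =
      (fun z => archPart ((y⁻¹ : (Adele F)ˣ) : Adele F) * z) ⁻¹' E := by
    ext z
    constructor
    · rintro ⟨z', hz', rfl⟩
      change _ * (archPart (y : Adele F) * z') ∈ E
      rwa [mul_left_comm, ← mul_assoc, hinv, one_mul]
    · intro hz
      refine ⟨_, hz, ?_⟩
      change archPart (y : Adele F) * (_ * z) = z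
      rw [← mul_assoc, hinv, one_mul]
  have hint : ∀ (x : Adele F), finPart ((y⁻¹ : (Adele F)ˣ) : Adele F) * finPart x ∈
      integralAdeles F ↔ finPart x ∈ integralAdeles F := by
    intro x
    rw [mem_integralAdeles, mem_integralAdeles]
    refine forall_congr' fun v => ?_
    rw [← norm_le_one_iff_mem_adicCompletionIntegers, ← norm_le_one_iff_mem_adicCompletionIntegers,
      finiteAdele_mul_apply, norm_mul, norm_finPart_inv, hy v, inv_one, one_mul]
  have h1 := Measure.addHaar_image_linearMap (archMeasure dx) (LinearMap.mulLeft ℝ w) E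
  rw [det_mul_mixedSpace, archMeasure_apply dx hE, hwE,
    archMeasure_apply dx ((continuous_const_mul _).measurable hE)] at h1
  have h2 : dx {x | archPart x ∈ E ∧ finPart x ∈ integralAdeles F} ≠ 0 := by
    rw [← archMeasure_apply dx hE]
    exact (Metric.isOpen_ball.measure_pos _ ⟨0, by simp⟩).ne'
  have h3 : dx {x | archPart x ∈ E ∧ finPart x ∈ integralAdeles F} ≠ ∞ := by
    rw [← archMeasure_apply dx hE]
    exact Metric.isBounded_ball.measure_lt_top.ne
  have h4 := distribHaarChar_eq_of_measure_smul_eq_mul (g := y) h2 h3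
    (r := (mixedEmbedding.norm w).toNNReal) (by
      rw [ENNReal.ofReal] at h1
      rw [← h1]
      congr 1
      ext x
      rw [Set.mem_smul_set_iff_inv_smul_mem]
      change archPart (((y⁻¹ : (Adele F)ˣ) : Adele F) * x) ∈ E ∧
        finPart (((y⁻¹ : (Adele F)ˣ) : Adele F) * x) ∈ integralAdeles F ↔ _
      rw [map_mul, map_mul, hint]
      rfl)
  rw [h4, Real.coe_toNNReal _ (mixedEmbedding.norm_nonneg _)]

/-- The class group is finite, so a power of the prime is principal; a generator is a unit at every
other place. These elements change an idele at one place at a time, and also serve as denominators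
concentrated at one place. -/
theorem exists_generator_of_prime_power (v : HeightOneSpectrum (𝓞 F)) : ∃ π : Fˣ, ∃ l : ℕ, l ≠ 0 ∧
    v.valuation F (π : F) = WithZero.exp (-(l : ℤ)) ∧
      ∀ w : HeightOneSpectrum (𝓞 F), w ≠ v → w.valuation F (π : F) = 1 := by
  let h := Fintype.card (ClassGroup (𝓞 F))
  have hh : h ≠ 0 := Fintype.card_ne_zero
  have hv0 : v.asIdeal ∈ nonZeroDivisors (Ideal (𝓞 F)) := mem_nonZeroDivisors_of_ne_zero v.ne_bot
  have h1 : ClassGroup.mk0 (⟨v.asIdeal, hv0⟩ ^ h : nonZeroDivisors (Ideal (𝓞 F))) = 1 := by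
    rw [map_pow, pow_card_eq_one]
  rw [ClassGroup.mk0_eq_one_iff] at h1
  obtain ⟨π, hπ⟩ := h1
  have hπ' : v.asIdeal ^ h = Ideal.span {π} := by simpa using hπ
  have hmem : ∀ w : HeightOneSpectrum (𝓞 F), π ∈ w.asIdeal ↔ w = v := by
    intro w
    have h2 : π ∈ w.asIdeal ↔ v.asIdeal ^ h ≤ w.asIdeal := by
      rw [hπ', Ideal.span_singleton_le_iff_mem]
    rw [h2, w.isPrime.pow_le_iff hh]
    constructor
    · intro h3
      exact (HeightOneSpectrum.ext ((v.isMaximal).eq_of_le w.isPrime.ne_top h3)).symm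
    · rintro rfl; exact le_rfl
  have hπ0 : π ≠ 0 := by
    rintro rfl
    have : v.asIdeal ^ h = ⊥ := by rw [hπ']; simp
    exact pow_ne_zero h v.ne_bot this
  have hπ0' : (π : F) ≠ 0 := by simpa using hπ0
  have h4 : v.intValuation π < 1 := (v.intValuation_lt_one_iff_mem π).2 ((hmem v).2 rfl)
  have h5 := v.intValuation_if_neg hπ0
  refine ⟨Units.mk0 _ hπ0', _, ?_, (v.valuation_of_algebraMap (K := F) π).trans h5, ?_⟩
  · intro h6
    rw [h6] at h5
    simp [h5] at h4
  · intro w hw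
    exact (w.valuation_eq_one_iff_notMem (K := F)).2 fun h => hw ((hmem w).1 h)

theorem distribHaarChar_principal (η : Fˣ) : distribHaarChar (Adele F) (principalIdele η) = 1 := by
  let dx : Measure (Adele F) := Measure.addHaar
  have h1 := map_mul_unit dx (principalIdele η)
  have h2 := (measurePreserving_mul_principal (dx := dx) η.ne_zero).map_eq
  rw [principalIdele_val, h2] at h1
  have h3 := congrArg (fun m => m (adeleBox F)) h1
  simp only [Measure.smul_apply, ENNReal.smul_def, smul_eq_mul] at h3
  have h4 := (ENNReal.mul_eq_right (measure_adeleBox_ne_zero dx)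
    (measure_adeleBox_lt_top dx).ne).1 h3.symm
  have h5 : (distribHaarChar (Adele F) (principalIdele η))⁻¹ = 1 := by exact_mod_cast h4
  simpa using h5

/-- The modulus of multiplication by an idele is the idele norm. -/
theorem distribHaarChar_eq_ideleNorm (y : (Adele F)ˣ) :
    (distribHaarChar (Adele F) y : ℝ) = ideleNorm y := by
  suffices H : ∀ (S : Finset (HeightOneSpectrum (𝓞 F))) (y : (Adele F)ˣ),
      (∀ v, v ∉ S → ‖finPart (y : Adele F) v‖ = 1) →
      (distribHaarChar (Adele F) y : ℝ) = ideleNorm y from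
    H (idele_finite_norm_ne_one y).toFinset y (by intro v hv; simpa using hv)
  intro S
  induction S using Finset.induction_on with
  | empty =>
    intro y hy
    rw [distribHaarChar_of_norm_eq_one fun v => hy v (by simp), ideleNorm_eq,
      finprod_eq_one_of_forall_eq_one fun v => hy v (by simp), mul_one]
  | insert v S hv ih =>
    intro y hy
    obtain ⟨π, l, hl, hπ, hπ'⟩ := exists_generator_of_prime_power v
    have hne : Valued.v (finPart (y : Adele F) v) ≠ 0 := by
      simpa using idele_finPart_ne_zero y v
    let k := WithZero.log (Valued.v (finPart (y : Adele F) v))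
    have hk : Valued.v (finPart (y : Adele F) v) = WithZero.exp k := (WithZero.exp_log hne).symm
    have hval : ∀ w : HeightOneSpectrum (𝓞 F),
        Valued.v (finPart ((y ^ l * principalIdele (π ^ k) : (Adele F)ˣ) : Adele F) w) =
        Valued.v (finPart (y : Adele F) w) ^ l * w.valuation F (π : F) ^ k := by
      intro w
      rw [Units.val_mul, map_mul, finiteAdele_mul_apply, map_mul]
      congr 1
      · rw [Units.val_pow_eq_pow_val, map_pow, finiteAdele_pow_apply, map_pow]
      · rw [principalIdele_val, finPart_algebraMap, Units.val_zpow_eq_zpow_val, ← map_zpow₀]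
        exact valuedAdicCompletion_eq_valuation' w _
    -- Since `π` has valuation `exp (-l)` at `v`, it is `y ^ l` that can be made a unit at `v`
    -- without changing absolute values at the other finite places. Modulus and norm are
    -- multiplicative and trivial on principal ideles, so the `l`-th powers of the two sides agree,
    -- and both sides are nonnegative.
    have h1 := ih (y ^ l * principalIdele (π ^ k)) (by
      intro w hw
      rw [norm_eq_one_iff_valued, hval]
      by_cases hwv : w = v
      · subst hwv
        rw [hk, hπ, ← WithZero.exp_nsmul, ← WithZero.exp_zsmul, ← WithZero.exp_add]
        simp [mul_comm]
      · rw [hπ' w hwv, (norm_eq_one_iff_valued w _).1 (hy w (by simp [hwv, hw]))]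
        simp)
    rw [map_mul, distribHaarChar_principal, mul_one, ideleNorm_mul, ideleNorm_principal, mul_one,
      map_pow] at h1
    have h2 : ideleNorm (y ^ l) = ideleNorm y ^ l := map_pow ideleNormHom y l
    rw [h2] at h1
    exact (pow_left_inj₀ (NNReal.coe_nonneg _) (ideleNorm_pos y).le hl).1 (by simpa using h1)

theorem map_mul_idele (dx : Measure (Adele F)) [dx.IsAddHaarMeasure] (y : (Adele F)ˣ) :
    dx.map (fun x => (y : Adele F) * x) = ENNReal.ofReal (ideleNorm y)⁻¹ • dx := by
  rw [map_mul_unit dx y, ← distribHaarChar_eq_ideleNorm, ← NNReal.coe_inv, ENNReal.ofReal_coe_nnreal]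
  rfl

theorem integral_comp_mul_idele (dx : Measure (Adele F)) [dx.IsAddHaarMeasure] (y : (Adele F)ˣ)
    (f : Adele F → ℂ) : ∫ x, f ((y : Adele F) * x) ∂dx = (ideleNorm y : ℂ)⁻¹ * ∫ x, f x ∂dx := by
  have h := (Homeomorph.smul y).measurableEmbedding.integral_map (μ := dx) f
  change ∫ x, f ((y : Adele F) * x) ∂dx = _
  rw [← show _ = ∫ x, f ((y : Adele F) * x) ∂dx from h]
  change ∫ x, f x ∂(dx.map (fun x => (y : Adele F) * x)) = _
  rw [map_mul_idele, integral_smul_measure, ENNReal.toReal_ofReal (inv_nonneg.2 (ideleNorm_pos y).le)]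
  simp

end ideleNorm

/-! ### Compactness of the norm-one idele classes. -/

section ideleClasses

open IsDedekindDomain IsDedekindDomain.HeightOneSpectrum NumberField.mixedEmbedding
open scoped Classical NNReal Pointwise

variable {F : Type*} [Field F] [NumberField F]

theorem principalIdele_mul (η ξ : Fˣ) :
    (principalIdele (η * ξ) : (Adele F)ˣ) = principalIdele η * principalIdele ξ :=
  (Units.map (algebraMap F (Adele F)).toMonoidHom).map_mul η ξ

theorem principalIdele_inv (η : Fˣ) : (principalIdele η⁻¹ : (Adele F)ˣ) = (principalIdele η)⁻¹ :=
  (Units.map (algebraMap F (Adele F)).toMonoidHom).map_inv η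

/-- For `y` near `y₀` the quotient `y₀⁻¹ * y` is a unit at every finite place, so locally the norm
is a constant times the continuous archimedean norm. -/
theorem continuous_ideleNorm : Continuous (ideleNorm (F := F)) := by
  rw [continuous_iff_continuousAt]
  intro y₀
  have hinv : Continuous fun y : (Adele F)ˣ => y₀⁻¹ * y := continuous_const_mul _
  have h1 : ∀ᶠ y : (Adele F)ˣ in 𝓝 y₀,
      ideleNorm y = ideleNorm y₀ * mixedEmbedding.norm (archPart ((y₀⁻¹ * y : (Adele F)ˣ) : Adele F)) := by
    have ho : ∀ᶠ u : (Adele F)ˣ in 𝓝 1, finPart (u : Adele F) ∈ integralAdeles F ∧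
        finPart ((u⁻¹ : (Adele F)ˣ) : Adele F) ∈ integralAdeles F := by
      refine Filter.Eventually.and ?_ ?_
      · refine (isOpen_integralAdeles.preimage
          (continuous_finPart.comp Units.continuous_val)).mem_nhds ?_
        simp
      · refine (isOpen_integralAdeles.preimage
          (continuous_finPart.comp (Units.continuous_val.comp continuous_inv))).mem_nhds ?_
        simp
    have hc : Filter.Tendsto (fun y : (Adele F)ˣ => y₀⁻¹ * y) (𝓝 y₀) (𝓝 1) := by
      have := hinv.tendsto y₀
      rwa [inv_mul_cancel] at this
    filter_upwards [hc.eventually ho] with y hy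
    obtain ⟨u, rfl⟩ : ∃ u, y = y₀ * u := ⟨y₀⁻¹ * y, by group⟩
    rw [inv_mul_cancel_left] at hy ⊢
    rw [ideleNorm_mul, ideleNorm_eq u, finprod_eq_one_of_forall_eq_one, mul_one]
    intro v
    have hv1 := (norm_le_one_iff_mem_adicCompletionIntegers v _).2 (mem_integralAdeles.1 hy.1 v)
    have hv2 := (norm_le_one_iff_mem_adicCompletionIntegers v _).2 (mem_integralAdeles.1 hy.2 v)
    rw [norm_finPart_inv] at hv2
    exact le_antisymm hv1 ((inv_le_one₀ (norm_pos_iff.2 (idele_finPart_ne_zero u v))).1 hv2)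
  refine ContinuousAt.congr ?_ (h1.mono fun y hy => hy.symm)
  refine Continuous.continuousAt (continuous_const.mul ?_)
  exact (mixedEmbedding.continuous_norm F).comp
    (continuous_archPart.comp (Units.continuous_val.comp hinv))

/-- The idele with all archimedean components `exp t` and finite components `1`. -/
def posIdele (t : ℝ) : (Adele F)ˣ where
  val := adeleMk (Real.exp t • 1) 1
  inv := adeleMk (Real.exp (-t) • 1) 1
  val_inv := by
    rw [← adeleMk_mul, smul_mul_smul_comm, ← Real.exp_add]; simp
  inv_val := by
    rw [← adeleMk_mul, smul_mul_smul_comm, ← Real.exp_add]; simp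

theorem posIdele_val (t : ℝ) :
    ((posIdele t : (Adele F)ˣ) : Adele F) = adeleMk (Real.exp t • 1) 1 := rfl

theorem posIdele_add (s t : ℝ) : (posIdele (s + t) : (Adele F)ˣ) = posIdele s * posIdele t := by
  ext1
  rw [Units.val_mul, posIdele_val, posIdele_val, posIdele_val, ← adeleMk_mul, smul_mul_smul_comm,
    Real.exp_add, mul_one, mul_one]

theorem posIdele_zero : (posIdele 0 : (Adele F)ˣ) = 1 := by
  ext1
  rw [posIdele_val]; simp

theorem posIdele_neg (t : ℝ) : (posIdele (-t) : (Adele F)ˣ) = (posIdele t)⁻¹ := by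
  rw [eq_inv_iff_mul_eq_one, ← posIdele_add, neg_add_cancel, posIdele_zero]

theorem ideleNorm_posIdele (t : ℝ) :
    ideleNorm (posIdele t : (Adele F)ˣ) = Real.exp (Module.finrank ℚ F * t) := by
  rw [ideleNorm_eq, posIdele_val, archPart_adeleMk, finPart_adeleMk,
    show ∏ᶠ v : HeightOneSpectrum (𝓞 F), ‖(1 : FiniteAdeleRing (𝓞 F) F) v‖ = 1 from
      finprod_eq_one_of_forall_eq_one fun v => norm_one, mul_one, mixedEmbedding.norm_smul, map_one, mul_one,
    abs_of_pos (Real.exp_pos t), Real.exp_nat_mul]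

theorem continuous_posIdele : Continuous (posIdele : ℝ → (Adele F)ˣ) := by
  rw [Units.continuous_iff]
  constructor
  · exact continuous_adeleMk.comp ((Real.continuous_exp.smul continuous_const).prodMk
      continuous_const)
  · exact continuous_adeleMk.comp (((Real.continuous_exp.comp continuous_neg).smul
      continuous_const).prodMk continuous_const)

/-- A compact set of adeles contains finitely many elements of `F`. -/
theorem finite_principal_of_isCompact {X : Set (Adele F)} (hX : IsCompact X) :
    {a : F | algebraMap F (Adele F) a ∈ X}.Finite := by
  let dx : Measure (Adele F) := Measure.addHaar
  have hD := isStrictFundDomain_adeleBox (F := F)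
  have hXD : IsCompact (X + -adeleCompactBox F) := hX.add isCompact_adeleCompactBox.neg
  -- For `a ∈ X` this set is `a - adeleBox F`. These sets are disjoint, have equal positive measure
  -- and lie in one compact set, so there are finitely many of them.
  let As : F → Set (Adele F) := fun a =>
    (fun x => -x + algebraMap F (Adele F) a) ⁻¹' adeleBox F ∩ (X + -adeleCompactBox F)
  have hm : ∀ a, MeasurableSet (As a) := fun a =>
    ((continuous_neg.add continuous_const).measurable measurableSet_adeleBox).inter
      hXD.measurableSet
  have h := Measure.finite_const_le_meas_of_disjoint_iUnion dx
    (pos_iff_ne_zero.2 (measure_adeleBox_ne_zero dx)) (As := As) hm (by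
      intro a b hab
      rw [Function.onFun, Set.disjoint_left]
      intro x hxa hxb
      exact hab ((hD.2 (-x)).unique hxa.1 hxb.1))
    (((measure_mono (Set.iUnion_subset fun a => Set.inter_subset_right)).trans_lt
      hXD.measure_lt_top).ne)
  refine h.subset fun a ha => ?_
  have h1 : (fun x => -x + algebraMap F (Adele F) a) ⁻¹' adeleBox F ⊆ X + -adeleCompactBox F := by
    intro x hx
    refine Set.mem_add.2 ⟨algebraMap F (Adele F) a, ha, -(-x + algebraMap F (Adele F) a), ?_, by ring⟩
    exact Set.neg_mem_neg.2 (adeleBox_subset hx)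
  have h2 : dx (As a) = dx (adeleBox F) := by
    simp only [As]
    rw [Set.inter_eq_left.2 h1]
    have h3 : (fun x : Adele F => -x + algebraMap F (Adele F) a) =
      fun x => algebraMap F (Adele F) a - x := by funext x; ring
    rw [h3]
    exact (Measure.measurePreserving_sub_left dx _).measure_preimage
      measurableSet_adeleBox.nullMeasurableSet
  exact h2.ge

/-- Minkowski's argument: a compact `X` of measure larger than the covolume of `F` keeps its measure
under multiplication by an idele of norm one. Hence two points of `y⁻¹ X` differ by some `η ∈ Fˣ`,
and `ηy` lies in `X - X`. -/
theorem exists_principal_mul_mem : ∃ C : Set (Adele F), IsCompact C ∧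
    ∀ y : (Adele F)ˣ, ideleNorm y = 1 → ∃ η : Fˣ, algebraMap F (Adele F) η * (y : Adele F) ∈ C := by
  let dx : Measure (Adele F) := Measure.addHaar
  have hD := isStrictFundDomain_adeleBox (F := F)
  -- The box and its translate by `-1` are disjoint because `1 ∈ F`, so `X` has at least twice the
  -- measure of the box.
  let X : Set (Adele F) := adeleCompactBox F ∪ (fun x => x + 1) ⁻¹' adeleCompactBox F
  have hX : IsCompact X := isCompact_adeleCompactBox.union
    ((Homeomorph.addRight (1 : Adele F)).isCompact_preimage.2 isCompact_adeleCompactBox)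
  have hXm : dx (adeleBox F) < dx X := by
    have h1 : adeleBox F ∪ (fun x => x + 1) ⁻¹' adeleBox F ⊆ X :=
      Set.union_subset_union adeleBox_subset (Set.preimage_mono adeleBox_subset)
    refine lt_of_lt_of_le ?_ (measure_mono h1)
    rw [measure_union _ ((continuous_add_const _).measurable measurableSet_adeleBox),
      measure_preimage_add_right]
    · exact ENNReal.lt_add_right (measure_adeleBox_lt_top dx).ne (measure_adeleBox_ne_zero dx)
    · rw [Set.disjoint_left]
      intro x hx hx1
      have := (hD.2 x).unique (y₁ := 0) (y₂ := 1) (by simpa using hx) (by simpa using hx1)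
      exact zero_ne_one this
  refine ⟨X + -X, hX.add hX.neg, fun y hy => ?_⟩
  have h1 : dx (y⁻¹ • X) = dx X := by
    rw [← distribHaarChar_mul]
    have : distribHaarChar (Adele F) y⁻¹ = 1 := by
      have h := distribHaarChar_eq_ideleNorm y⁻¹
      rw [ideleNorm_inv, hy, inv_one] at h
      exact_mod_cast h
    rw [this]; simp
  have hXn : NullMeasurableSet (y⁻¹ • X) dx := (hX.smul y⁻¹).measurableSet.nullMeasurableSet
  obtain ⟨a, b, hab, hnd⟩ := exists_pair_mem_lattice_not_disjoint_vadd
    (hD.isAddFundamentalDomain dx) hXn (h1 ▸ hXm)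
  obtain ⟨a, rfl⟩ := principalEquiv.surjective a
  obtain ⟨b, rfl⟩ := principalEquiv.surjective b
  rw [Set.not_disjoint_iff] at hnd
  obtain ⟨z, ⟨z1, hz1, h1z⟩, ⟨z2, hz2, h2z⟩⟩ := hnd
  obtain ⟨c1, hc1, rfl⟩ := hz1
  obtain ⟨c2, hc2, rfl⟩ := hz2
  have hne : a - b ≠ 0 := sub_ne_zero.2 fun h => hab (by rw [h])
  refine ⟨Units.mk0 (a - b) hne, Set.mem_add.2 ⟨c2, hc2, -c1, Set.neg_mem_neg.2 hc1, ?_⟩⟩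
  have h1z' : algebraMap F (Adele F) a + ((y⁻¹ : (Adele F)ˣ) : Adele F) * c1 = z := h1z
  have h2z' : algebraMap F (Adele F) b + ((y⁻¹ : (Adele F)ˣ) : Adele F) * c2 = z := h2z
  have h3 : algebraMap F (Adele F) (a - b) = ((y⁻¹ : (Adele F)ˣ) : Adele F) * (c2 - c1) := by
    rw [map_sub]
    linear_combination h1z' - h2z'
  rw [Units.val_mk0, h3, mul_right_comm, Units.inv_mul, one_mul, sub_eq_add_neg]

theorem isCompact_units_of_isCompact {X Y : Set (Adele F)} (hX : IsCompact X) (hY : IsCompact Y) :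
    IsCompact {y : (Adele F)ˣ | (y : Adele F) ∈ X ∧ ((y⁻¹ : (Adele F)ˣ) : Adele F) ∈ Y} := by
  have h : IsClosedEmbedding (Units.embedProduct (Adele F)) :=
    Units.isClosedEmbedding_embedProduct
  have h2 := h.isCompact_preimage (hX.prod (MulOpposite.opHomeomorph.isCompact_image.2 hY))
  convert h2 using 1
  ext y
  simp [Units.embedProduct]

/-- The ideles are the product of the principal ideles, the positive reals and a compact set of
ideles of norm one. -/
theorem exists_compact_idele_representatives (F : Type*) [Field F] [NumberField F] : ∃ K : Set (Adele F)ˣ, IsCompact K ∧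
    (∀ k ∈ K, ideleNorm k = 1) ∧
    ∀ y : (Adele F)ˣ, ∃ (η : Fˣ) (t : ℝ) (k : (Adele F)ˣ), k ∈ K ∧ y = principalIdele η * (posIdele t * k) := by
  obtain ⟨C, hC, hCy⟩ := exists_principal_mul_mem (F := F)
  have hT := finite_principal_of_isCompact (hC.mul hC)
  -- If `ηy` and `η'y⁻¹` lie in `C`, then `ηη'` lies in the finite set `T`, and `(ηy)⁻¹ = (ηη')⁻¹ ·
  -- η'y⁻¹` lies in the compact set `Y`. Control of the inverse is what compactness in the unit
  -- topology requires.
  set T : Set F := {a : F | algebraMap F (Adele F) a ∈ C * C} with hTdef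
  let Y : Set (Adele F) := ⋃ τ ∈ T, (fun x => algebraMap F (Adele F) τ⁻¹ * x) '' C
  have hY : IsCompact Y := hT.isCompact_biUnion fun τ _ => hC.image (continuous_const_mul _)
  refine ⟨{y : (Adele F)ˣ | (y : Adele F) ∈ C ∧ ((y⁻¹ : (Adele F)ˣ) : Adele F) ∈ Y} ∩
    {y | ideleNorm y = 1}, (isCompact_units_of_isCompact hC hY).inter_right
      (isClosed_eq continuous_ideleNorm continuous_const), fun k hk => hk.2, fun y => ?_⟩
  let n : ℝ := Module.finrank ℚ F
  have hn : n ≠ 0 := by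
    simp only [n]
    exact_mod_cast Module.finrank_pos.ne'
  let t := Real.log (ideleNorm y) / n
  have ht : ideleNorm (posIdele t : (Adele F)ˣ) = ideleNorm y := by
    rw [ideleNorm_posIdele, mul_div_cancel₀ _ hn, Real.exp_log (ideleNorm_pos y)]
  have hy1 : ideleNorm ((posIdele t)⁻¹ * y) = 1 := by
    rw [ideleNorm_mul, ideleNorm_inv, ht, inv_mul_cancel₀ (ideleNorm_pos y).ne']
  clear_value t
  obtain ⟨y, rfl⟩ : ∃ z, y = posIdele t * z := ⟨(posIdele t)⁻¹ * y, by group⟩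
  rw [inv_mul_cancel_left] at hy1
  clear ht
  obtain ⟨η, hη⟩ := hCy y hy1
  obtain ⟨η', hη'⟩ := hCy y⁻¹ (by rw [ideleNorm_inv, hy1, inv_one])
  refine ⟨η⁻¹, t, principalIdele η * y, ⟨⟨hη, ?_⟩, ?_⟩, ?_⟩
  · have h1 : (η : F) * η' ∈ T := by
      refine Set.mem_mul.2 ⟨_, hη, _, hη', ?_⟩
      rw [mul_mul_mul_comm, Units.mul_inv, mul_one, map_mul]
    refine Set.mem_iUnion₂.2 ⟨_, h1, _, hη', ?_⟩
    change algebraMap F (Adele F) ((η : F) * η')⁻¹ * (algebraMap F (Adele F) η' * _) = _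
    rw [mul_inv, mul_inv_rev, Units.val_mul, ← mul_assoc, ← map_mul, mul_assoc,
      inv_mul_cancel₀ η'.ne_zero, mul_one, mul_comm]
    congr 1
    rw [← map_inv, principalIdele_val, Units.val_inv_eq_inv_val]
  · change ideleNorm _ = 1
    rw [ideleNorm_mul, ideleNorm_principal, hy1, mul_one]
  · rw [principalIdele_inv, mul_left_comm (posIdele t), inv_mul_cancel_left]

end ideleClasses

/-! ### Integration over `𝔸ˣ/Fˣ`. -/

section ideleQuotient

variable {F : Type*} [Field F] [NumberField F]

open scoped Classical NNReal Pointwise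

/-- A function on the ideles that is invariant under `Fˣ`. -/
def IsIdelePeriodic {β : Type*} (f : (Adele F)ˣ → β) : Prop :=
  ∀ (η : Fˣ) (y : (Adele F)ˣ), f (principalIdele η * y) = f y

theorem IsIdelePeriodic.out {β : Type*} {f : (Adele F)ˣ → β} (hf : IsIdelePeriodic f)
    (y : (Adele F)ˣ) :
    f (Quotient.out (QuotientGroup.mk y : (Adele F)ˣ ⧸ principalIdeles F)) = f y := by
  obtain ⟨⟨_, a, rfl⟩, ha⟩ := QuotientGroup.mk_out_eq_mul (principalIdeles F) y
  rw [mul_comm] at ha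
  exact (congrArg f ha).trans (hf a y)

theorem IsIdelePeriodic.measurable_out {β : Type*} [MeasurableSpace β] {f : (Adele F)ˣ → β}
    (hf : IsIdelePeriodic f) (hm : Measurable f) :
    Measurable fun q : (Adele F)ˣ ⧸ principalIdeles F => f (Quotient.out q) := by
  refine measurable_from_quotient.2 ?_
  have : ((fun q : (Adele F)ˣ ⧸ principalIdeles F => f (Quotient.out q)) ∘ Quotient.mk'') = f :=
    funext fun x => hf.out x
  rw [this]
  exact hm

/-- The elements of `Fˣ`, as elements of the group of principal ideles. -/
def principalIdeleEquiv : Fˣ ≃ principalIdeles F :=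
  Equiv.ofBijective (fun a => ⟨principalIdele a, ⟨a, rfl⟩⟩) ⟨fun a b h => by
    have h' := congrArg (fun z => archPart (Subtype.val z : (Adele F)ˣ).val) h
    simp only [principalIdele_val, archPart_algebraMap] at h'
    exact Units.ext (mixedEmbedding_injective F h'), fun ⟨_, a, ha⟩ => ⟨a, Subtype.ext ha⟩⟩

theorem principalIdeleEquiv_apply (a : Fˣ) :
    (principalIdeleEquiv a : (Adele F)ˣ) = principalIdele a := rfl

variable {dy : Measure (Adele F)ˣ} {dyq : Measure ((Adele F)ˣ ⧸ principalIdeles F)}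

theorem IsQuotientMeasure.lintegral_eq (hdy : IsQuotientMeasure (principalIdeles F) dy dyq)
    {f : (Adele F)ˣ → ℝ≥0∞} (hf : Measurable f) :
    ∫⁻ y, f y ∂dy = ∫⁻ q, ∑' η : Fˣ, f (principalIdele η * Quotient.out q) ∂dyq := by
  rw [hdy f hf]
  refine lintegral_congr fun q => ?_
  rw [← principalIdeleEquiv.tsum_eq]
  exact tsum_congr fun η => by rw [principalIdeleEquiv_apply, mul_comm]

/-- Only an inequality is needed for convergence, so `E` may meet a coset several times; this avoids
an exact fundamental domain for `Fˣ`. -/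
theorem IsQuotientMeasure.lintegral_out_le (hdy : IsQuotientMeasure (principalIdeles F) dy dyq)
    {f : (Adele F)ˣ → ℝ≥0∞} (hf : Measurable f) (hp : IsIdelePeriodic f) {E : Set (Adele F)ˣ}
    (hE : MeasurableSet E) (hcov : ∀ y, ∃ η : Fˣ, principalIdele η * y ∈ E) :
    ∫⁻ q, f (Quotient.out q) ∂dyq ≤ ∫⁻ y in E, f y ∂dy := by
  rw [← lintegral_indicator hE, hdy.lintegral_eq (hf.indicator hE)]
  refine lintegral_mono fun q => ?_
  obtain ⟨η, hη⟩ := hcov (Quotient.out q)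
  refine le_trans ?_ (ENNReal.le_tsum η)
  rw [Set.indicator_of_mem hη, hp]

/-- Unfolding of an absolutely convergent integral over the ideles. -/
theorem IsQuotientMeasure.integral_eq (hdy : IsQuotientMeasure (principalIdeles F) dy dyq)
    {f : (Adele F)ˣ → ℂ} (hf : Measurable f) (hi : Integrable f dy) :
    ∫ y, f y ∂dy = ∫ q, ∑' η : Fˣ, f (principalIdele η * Quotient.out q) ∂dyq := by
  have := countable_numberField (F := F)
  have : Countable Fˣ := Units.val_injective.countable
  -- the real nonnegative case
  have hpos : ∀ g : (Adele F)ˣ → ℝ, Measurable g → (∀ y, 0 ≤ g y) → Integrable g dy →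
      Integrable (fun q : (Adele F)ˣ ⧸ principalIdeles F => ∑' η : Fˣ, g (principalIdele η * Quotient.out q)) dyq ∧
      (∀ᵐ q : (Adele F)ˣ ⧸ principalIdeles F ∂dyq, Summable fun η : Fˣ => g (principalIdele η * Quotient.out q)) ∧
      ∫ y, g y ∂dy = ∫ q, ∑' η : Fˣ, g (principalIdele η * Quotient.out q) ∂dyq := by
    intro g hg h0 hgi
    have h1 := hdy.lintegral_eq (f := fun y => ENNReal.ofReal (g y)) hg.ennreal_ofReal
    have hfin : ∫⁻ y, ENNReal.ofReal (g y) ∂dy < ∞ := by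
      have := hgi.2
      rw [HasFiniteIntegral] at this
      simpa only [← ofReal_norm, Real.norm_of_nonneg (h0 _)] using this
    have hperm : IsIdelePeriodic fun y =>
        ∑' η : Fˣ, ENNReal.ofReal (g (principalIdele η * y)) := by
      intro ξ y
      change ∑' η : Fˣ, ENNReal.ofReal (g (principalIdele η * (principalIdele ξ * y))) =
        ∑' η : Fˣ, ENNReal.ofReal (g (principalIdele η * y))
      rw [← (Equiv.mulRight ξ).tsum_eq fun η => ENNReal.ofReal (g (principalIdele η * y))]
      refine tsum_congr fun η => ?_
      rw [Equiv.coe_mulRight]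
      change _ = ENNReal.ofReal (g (principalIdele (η * ξ) * y))
      rw [principalIdele_mul, mul_assoc]
    have hmeas : Measurable fun y : (Adele F)ˣ =>
        ∑' η : Fˣ, ENNReal.ofReal (g (principalIdele η * y)) :=
      Measurable.tsum fun η => (hg.comp (continuous_const_mul _).measurable).ennreal_ofReal
    have hqm := hperm.measurable_out hmeas
    have hae := ae_lt_top hqm (h1 ▸ hfin.ne)
    have hsum : ∀ q : (Adele F)ˣ ⧸ principalIdeles F,
        ∑' η : Fˣ, ENNReal.ofReal (g (principalIdele η * Quotient.out q)) < ∞ →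
        Summable fun η : Fˣ => g (principalIdele η * Quotient.out q) := by
      intro q hq
      have := ENNReal.summable_toReal hq.ne
      simpa only [ENNReal.toReal_ofReal (h0 _)] using this
    have heq : ∀ q : (Adele F)ˣ ⧸ principalIdeles F,
        ∑' η : Fˣ, g (principalIdele η * Quotient.out q) =
        (∑' η : Fˣ, ENNReal.ofReal (g (principalIdele η * Quotient.out q))).toReal := by
      intro q
      rw [ENNReal.tsum_toReal_eq fun η => ENNReal.ofReal_ne_top]
      exact tsum_congr fun η => (ENNReal.toReal_ofReal (h0 _)).symm
    refine ⟨?_, hae.mono hsum, ?_⟩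
    · simp only [heq]
      exact integrable_toReal_of_lintegral_ne_top hqm.aemeasurable (h1 ▸ hfin.ne)
    · simp only [heq]
      rw [integral_toReal hqm.aemeasurable hae, integral_eq_lintegral_of_nonneg_ae
        (Filter.Eventually.of_forall h0) hg.aestronglyMeasurable, h1]
  -- real valued functions
  have hreal : ∀ g : (Adele F)ˣ → ℝ, Measurable g → Integrable g dy →
      Integrable (fun q : (Adele F)ˣ ⧸ principalIdeles F => ∑' η : Fˣ, g (principalIdele η * Quotient.out q)) dyq ∧
      (∀ᵐ q : (Adele F)ˣ ⧸ principalIdeles F ∂dyq, Summable fun η : Fˣ => g (principalIdele η * Quotient.out q)) ∧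
      ∫ y, g y ∂dy = ∫ q, ∑' η : Fˣ, g (principalIdele η * Quotient.out q) ∂dyq := by
    intro g hg hgi
    obtain ⟨hp1, hp2, hp3⟩ := hpos (fun y => max (g y) 0) (hg.max measurable_const)
      (fun y => le_max_right _ _) hgi.pos_part
    obtain ⟨hn1, hn2, hn3⟩ := hpos (fun y => max (-g y) 0) (hg.neg.max measurable_const)
      (fun y => le_max_right _ _) hgi.neg_part
    have hdec : ∀ y, g y = max (g y) 0 - max (-g y) 0 := fun y => (max_zero_sub_eq_self (g y)).symm
    have hae : ∀ᵐ q : (Adele F)ˣ ⧸ principalIdeles F ∂dyq, (∑' η : Fˣ, g (principalIdele η * Quotient.out q)) =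
        (∑' η : Fˣ, max (g (principalIdele η * Quotient.out q)) 0) -
        ∑' η : Fˣ, max (-g (principalIdele η * Quotient.out q)) 0 := by
      filter_upwards [hp2, hn2] with q h1 h2
      rw [← h1.tsum_sub h2]
      exact tsum_congr fun η => hdec _
    refine ⟨(hp1.sub hn1).congr (hae.mono fun q h => h.symm), ?_, ?_⟩
    · filter_upwards [hp2, hn2] with q h1 h2
      exact (h1.sub h2).congr fun η => (hdec _).symm
    · rw [integral_congr_ae hae, integral_sub hp1 hn1, ← hp3, ← hn3,
        ← integral_sub hgi.pos_part hgi.neg_part]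
      exact integral_congr_ae (Filter.Eventually.of_forall hdec)
  obtain ⟨hr1, hr2, hr3⟩ := hreal (fun y => (f y).re) (Complex.measurable_re.comp hf) hi.re
  obtain ⟨hi1, hi2, hi3⟩ := hreal (fun y => (f y).im) (Complex.measurable_im.comp hf) hi.im
  have hae : ∀ᵐ q : (Adele F)ˣ ⧸ principalIdeles F ∂dyq, (∑' η : Fˣ, f (principalIdele η * Quotient.out q)) =
      ((∑' η : Fˣ, (f (principalIdele η * Quotient.out q)).re : ℝ) : ℂ) +
      ((∑' η : Fˣ, (f (principalIdele η * Quotient.out q)).im : ℝ) : ℂ) * Complex.I := by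
    filter_upwards [hr2, hi2] with q h1 h2
    rw [Complex.ofReal_tsum, Complex.ofReal_tsum, ← tsum_mul_right, ← Summable.tsum_add]
    · exact tsum_congr fun η => (Complex.re_add_im _).symm
    · exact Complex.ofRealCLM.summable h1
    · exact (Complex.ofRealCLM.summable h2).mul_right _
  rw [integral_congr_ae hae, integral_add hr1.ofReal (hi1.ofReal.mul_const _), integral_mul_const]
  have e1 : ∫ q : (Adele F)ˣ ⧸ principalIdeles F, ((∑' η : Fˣ, (f (principalIdele η * Quotient.out q)).re : ℝ) : ℂ) ∂dyq =
      ((∫ y, (f y).re ∂dy : ℝ) : ℂ) := by rw [hr3]; exact integral_ofReal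
  have e2 : ∫ q : (Adele F)ˣ ⧸ principalIdeles F, ((∑' η : Fˣ, (f (principalIdele η * Quotient.out q)).im : ℝ) : ℂ) ∂dyq =
      ((∫ y, (f y).im ∂dy : ℝ) : ℂ) := by rw [hi3]; exact integral_ofReal
  rw [e1, e2]
  exact (integral_re_add_im hi).symm

variable [dy.IsHaarMeasure]

/-- An `Fˣ`-invariant function on the ideles that decreases rapidly in the idele norm is integrable
on the quotient. -/
theorem IsQuotientMeasure.lintegral_out_lt_top
    (hdy : IsQuotientMeasure (principalIdeles F) dy dyq) {K : Set (Adele F)ˣ} (hK : IsCompact K)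
    (hcov : ∀ y : (Adele F)ˣ, ∃ (η : Fˣ) (t : ℝ) (k : (Adele F)ˣ), k ∈ K ∧
      y = principalIdele η * (posIdele t * k))
    {f : (Adele F)ˣ → ℝ≥0∞} (hf : Measurable f) (hp : IsIdelePeriodic f) {C : ℝ≥0}
    (hdecay : ∀ t : ℝ, ∀ k ∈ K, f (posIdele t * k) ≤ C * ENNReal.ofReal (Real.exp (-|t|))) :
    ∫⁻ q, f (Quotient.out q) ∂dyq < ∞ := by
  let K' : Set (Adele F)ˣ := posIdele '' (Set.Icc 0 1) * K
  have hK' : IsCompact K' := (isCompact_Icc.image continuous_posIdele).mul hK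
  have hmem : ∀ (t : ℝ) (k : (Adele F)ˣ), k ∈ K → posIdele t * k ∈ (posIdele (⌊t⌋ : ℝ) : (Adele F)ˣ) • K' := by
    intro t k hk
    refine Set.mem_smul_set.2 ⟨posIdele (Int.fract t) * k, Set.mul_mem_mul
      ⟨_, ⟨Int.fract_nonneg t, (Int.fract_lt_one t).le⟩, rfl⟩ hk, ?_⟩
    rw [smul_eq_mul, ← mul_assoc, ← posIdele_add, Int.floor_add_fract]
  -- `K'` is `K` thickened by one unit of the real direction, so its integer translates meet every
  -- `Fˣ`-orbit. They all have the same measure, and on the `n`-th one `f` is of order `exp (-|n|)`.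
  let E : Set (Adele F)ˣ := ⋃ n : ℤ, (posIdele (n : ℝ) : (Adele F)ˣ) • K'
  have hE : MeasurableSet E := MeasurableSet.iUnion fun n => (hK'.smul _).measurableSet
  have h1 := hdy.lintegral_out_le hf hp hE (fun y => by
    obtain ⟨η, t, k, hk, rfl⟩ := hcov y
    refine ⟨η⁻¹, ?_⟩
    rw [principalIdele_inv, inv_mul_cancel_left]
    exact Set.mem_iUnion.2 ⟨⌊t⌋, hmem t k hk⟩)
  refine h1.trans_lt ((lintegral_iUnion_le _ _).trans_lt ?_)
  have h2 : ∀ n : ℤ, ∫⁻ y in (posIdele (n : ℝ) : (Adele F)ˣ) • K', f y ∂dy ≤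
      (C * dy K') * ENNReal.ofReal (Real.exp 1 * Real.exp (-|(n : ℝ)|)) := by
    intro n
    have h3 : ∀ y ∈ (posIdele (n : ℝ) : (Adele F)ˣ) • K',
        f y ≤ C * ENNReal.ofReal (Real.exp 1 * Real.exp (-|(n : ℝ)|)) := by
      intro y hy
      obtain ⟨_, ⟨_, ⟨s, hs, rfl⟩, k, hk, rfl⟩, rfl⟩ := Set.mem_smul_set.1 hy
      simp only [smul_eq_mul]
      rw [← mul_assoc, ← posIdele_add]
      refine (hdecay _ k hk).trans ?_
      gcongr
      rw [← Real.exp_add]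
      refine Real.exp_le_exp.2 ?_
      have h4 : |(n : ℝ)| ≤ |(n : ℝ) + s| + |s| := by
        have := abs_sub (n + s : ℝ) s
        simpa using this
      have h5 : |s| ≤ 1 := abs_le.2 ⟨by linarith [hs.1], hs.2⟩
      linarith
    calc ∫⁻ y in (posIdele (n : ℝ) : (Adele F)ˣ) • K', f y ∂dy
        ≤ ∫⁻ y in (posIdele (n : ℝ) : (Adele F)ˣ) • K',
            C * ENNReal.ofReal (Real.exp 1 * Real.exp (-|(n : ℝ)|)) ∂dy :=
          setLIntegral_mono measurable_const h3
      _ = _ := by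
          rw [setLIntegral_const, measure_smul]
          ring
  refine (ENNReal.tsum_le_tsum h2).trans_lt ?_
  rw [ENNReal.tsum_mul_left]
  refine ENNReal.mul_lt_top (ENNReal.mul_lt_top ENNReal.coe_lt_top hK'.measure_lt_top) ?_
  rw [← ENNReal.ofReal_tsum_of_nonneg (fun n => by positivity)]
  · exact ENNReal.ofReal_lt_top
  · refine Summable.mul_left _ ?_
    have hs : Summable fun n : ℕ => Real.exp (-(n : ℝ)) := Real.summable_exp_neg_nat
    refine Summable.of_nat_of_neg ?_ ?_
    · simpa using hs
    · simpa using hs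

end ideleQuotient

/-! ### Unitary characters of real vector spaces. -/

section realCharacters

/-- The circle has no small subgroups: as `z² - 1 = (z - 1)(z + 1)` and `|z + 1| ≥ 3/2`, each
squaring would increase the distance from `1` by the factor `3/2`. -/
theorem eq_one_of_norm_pow_sub_one_le {z : ℂ} (h : ∀ n : ℕ, ‖z ^ n - 1‖ ≤ 1 / 2) : z = 1 := by
  by_contra hz
  have hpos : 0 < ‖z - 1‖ := norm_pos_iff.2 (sub_ne_zero.2 hz)
  have key : ∀ k : ℕ, (3 / 2 : ℝ) ^ k * ‖z - 1‖ ≤ ‖z ^ (2 ^ k) - 1‖ := by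
    intro k
    induction k with
    | zero => simp
    | succ k ih =>
      have h1 : z ^ (2 ^ (k + 1)) - 1 = (z ^ (2 ^ k) - 1) * (z ^ (2 ^ k) + 1) := by ring
      have h2 : (3 / 2 : ℝ) ≤ ‖z ^ (2 ^ k) + 1‖ := by
        have h3 : ‖(2 : ℂ)‖ ≤ ‖z ^ (2 ^ k) + 1‖ + ‖z ^ (2 ^ k) - 1‖ := by
          have := norm_sub_le (z ^ (2 ^ k) + 1) (z ^ (2 ^ k) - 1)
          rwa [show z ^ (2 ^ k) + 1 - (z ^ (2 ^ k) - 1) = 2 by ring] at this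
        have h4 : ‖(2 : ℂ)‖ = 2 := by simp
        linarith [h (2 ^ k)]
      rw [h1, norm_mul, pow_succ]
      nlinarith [norm_nonneg (z ^ (2 ^ k) - 1)]
  obtain ⟨k, hk⟩ := pow_unbounded_of_one_lt (1 / ‖z - 1‖) (by norm_num : (1 : ℝ) < 3 / 2)
  rw [div_lt_iff₀ hpos] at hk
  linarith [key k, h (2 ^ k)]

/-- A continuous unitary character of `ℝ` is of the form `t ↦ exp(iθt)`. -/
theorem exists_eq_circleExp (f : ℝ → Circle) (hf : Continuous f)
    (hadd : ∀ s t, f (s + t) = f s * f t) : ∃ θ : ℝ, ∀ t, f t = Circle.exp (θ * t) := by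
  have h0 : f 0 = 1 := by
    have := hadd 0 0
    rw [add_zero] at this
    exact left_eq_mul.1 this
  let F : ℝ → ℂ := fun t => (f t : ℂ)
  have hF : Continuous F := continuous_subtype_val.comp hf
  have hFadd : ∀ s t, F (s + t) = F s * F t := fun s t => by simp [F, hadd]
  let P : ℝ → ℂ := fun t => ∫ u in (0 : ℝ)..t, F u
  have hP : ∀ t, HasDerivAt P (F t) t := fun t =>
    intervalIntegral.integral_hasDerivAt_right (hF.intervalIntegrable _ _)
      (hF.stronglyMeasurableAtFilter _ _) hF.continuousAt
  obtain ⟨a, ha⟩ : ∃ a, P a ≠ 0 := by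
    by_contra! h
    have h1 := hP 0
    have h2 : P = fun _ => 0 := funext h
    rw [h2] at h1
    have h3 := h1.unique (hasDerivAt_const 0 (0 : ℂ))
    simp [F, h0] at h3
  -- Expressing `F` through its own primitive shows that a merely continuous character is
  -- differentiable.
  have hshift : ∀ t, F t * P a = P (t + a) - P t := by
    intro t
    have h1 : F t * P a = ∫ u in (0 : ℝ)..a, F (t + u) := by
      simp only [hFadd]
      rw [intervalIntegral.integral_const_mul]
    rw [h1, intervalIntegral.integral_comp_add_left]
    rw [eq_sub_iff_add_eq, add_comm]
    simp only [P, add_zero]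
    exact intervalIntegral.integral_add_adjacent_intervals (hF.intervalIntegrable _ _)
      (hF.intervalIntegrable _ _)
  have hFd : ∀ t, DifferentiableAt ℝ F t := by
    intro t
    have h1 : F = fun t => (P (t + a) - P t) * (P a)⁻¹ := by
      funext t
      rw [← hshift, mul_assoc, mul_inv_cancel₀ ha, mul_one]
    rw [h1]
    exact (((hP (t + a)).comp_add_const t a).differentiableAt.sub (hP t).differentiableAt).mul_const _
  let κ := deriv F 0
  have hder : ∀ t, HasDerivAt F (F t * κ) t := by
    intro t
    have h1 : HasDerivAt (fun s => F t * F (s - t)) (F t * κ) t := by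
      have h2 : HasDerivAt F κ (t - t) := by rw [sub_self]; exact (hFd 0).hasDerivAt
      exact (h2.comp_sub_const t t).const_mul _
    convert h1 using 1
    funext s
    rw [← hFadd]; congr 1; ring
  have hexp : ∀ t : ℝ, F t = Complex.exp (κ * t) := by
    have hc : ∀ t : ℝ, HasDerivAt (fun t : ℝ => F t * Complex.exp (-(κ * t))) 0 t := by
      intro t
      have h1 : HasDerivAt (fun t : ℝ => Complex.exp (-(κ * t)))
          (Complex.exp (-(κ * t)) * (-(κ * 1))) t :=
        ((Complex.ofRealCLM.hasDerivAt (x := t)).const_mul κ).neg.cexp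
      have h2 := (hder t).mul h1
      exact h2.congr_deriv (by ring)
    intro t
    have h1 := is_const_of_deriv_eq_zero (fun t => (hc t).differentiableAt)
      (fun t => (hc t).deriv) t 0
    simp only [F, h0] at h1
    simp only [Complex.ofReal_zero, mul_zero, neg_zero, Complex.exp_zero, Circle.coe_one, mul_one] at h1
    calc F t = F t * Complex.exp (-(κ * t)) * Complex.exp (κ * t) := by
          rw [mul_assoc, ← Complex.exp_add]; simp
      _ = _ := by rw [show F t * Complex.exp (-(κ * t)) = 1 from h1, one_mul]
  have hre : κ.re = 0 := by
    have h1 : ‖F 1‖ = 1 := Circle.norm_coe _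
    rw [hexp 1, Complex.norm_exp] at h1
    have h2 := Real.exp_eq_one_iff _ |>.1 h1
    simpa using h2
  refine ⟨κ.im, fun t => Circle.ext ?_⟩
  rw [Circle.coe_exp]
  refine (hexp t).trans ?_
  congr 1
  apply Complex.ext <;> simp [hre]

theorem circleExp_linear_injective {θ θ' : ℝ} (h : ∀ t : ℝ, Circle.exp (θ * t) = Circle.exp (θ' * t)) :
    θ = θ' := by
  by_contra hne
  have h1 : ∀ t : ℝ, Circle.exp ((θ - θ') * t) = 1 := by
    intro t
    rw [sub_mul, Circle.exp_sub, h t, div_self']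
  have h2 := h1 (Real.pi / (θ - θ'))
  rw [mul_div_cancel₀ _ (sub_ne_zero.2 hne)] at h2
  have h3 := congrArg (fun z : Circle => (z : ℂ)) h2
  simp only [Circle.coe_exp, Complex.exp_pi_mul_I, Circle.coe_one] at h3
  norm_num at h3

/-- A continuous unitary character of a finite-dimensional real vector space. -/
theorem exists_eq_circleExp_linear {V : Type*} [NormedAddCommGroup V] [NormedSpace ℝ V]
    [FiniteDimensional ℝ V] (f : V → Circle) (hf : Continuous f)
    (hadd : ∀ v w, f (v + w) = f v * f w) :
    ∃ l : V →L[ℝ] ℝ, ∀ v, f v = Circle.exp (2 * Real.pi * l v) := by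
  have h : ∀ v, ∃ θ : ℝ, ∀ t : ℝ, f (t • v) = Circle.exp (θ * t) := fun v =>
    exists_eq_circleExp (fun t => f (t • v)) (hf.comp (continuous_id.smul continuous_const))
      fun s t => by rw [add_smul, hadd]
  choose θ hθ using h
  let l : V →ₗ[ℝ] ℝ :=
    { toFun := fun v => (2 * Real.pi)⁻¹ * θ v
      map_add' := fun v w => by
        rw [← mul_add]
        congr 1
        refine circleExp_linear_injective fun t => ?_
        rw [← hθ, smul_add, hadd, hθ, hθ, add_mul, Circle.exp_add]
      map_smul' := fun c v => by
        rw [RingHom.id_apply, smul_eq_mul, mul_left_comm]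
        congr 1
        refine circleExp_linear_injective fun t => ?_
        rw [← hθ, smul_smul, hθ]
        congr 1; ring }
  refine ⟨LinearMap.toContinuousLinearMap l, fun v => ?_⟩
  have h1 := hθ v 1
  rw [one_smul, mul_one] at h1
  rw [h1]
  congr 1
  change _ = 2 * Real.pi * ((2 * Real.pi)⁻¹ * θ v)
  rw [mul_inv_cancel_left₀ (by positivity)]

end realCharacters

/-! ### Characters of `𝔸/F` and the linear form at the archimedean places. -/

section adeleCharacters

open IsDedekindDomain IsDedekindDomain.HeightOneSpectrum NumberField.mixedEmbedding
open scoped Classical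

variable {F : Type*} [Field F] [NumberField F]

/-- A non-trivial character of `𝔸/F`, with the linear form that describes it on the archimedean
part, and the basis of `F` that is dual to an integral basis with respect to this form. -/
structure AdeleCharacter (ψ : AddChar (Adele F) Circle) where
  continuous : Continuous ψ
  principal : ∀ a : F, ψ (algebraMap F (Adele F) a) = 1
  lin : mixedSpace F →L[ℝ] ℝ
  apply_arch : ∀ w, ψ (adeleMk w 0) = Circle.exp (2 * Real.pi * lin w)
  dual : Module.Free.ChooseBasisIndex ℤ (𝓞 F) → F
  expand_dual : ∀ w, w = ∑ j, lin (w * latticeBasis F j) • mixedEmbedding F (dual j)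
  expand_basis : ∀ w, w = ∑ j, lin (w * mixedEmbedding F (dual j)) • latticeBasis F j

/-- A continuous character is trivial on a subgroup `d Ô` of the finite adeles. -/
theorem exists_trivial_on_smul_integralAdeles (ψ : AddChar (Adele F) Circle) (hψ : Continuous ψ)
    (c : Adele F) :
    ∃ d : 𝓞 F, d ≠ 0 ∧ ∀ s ∈ integralAdeles F,
      ψ (c * adeleMk 0 (algebraMap F (FiniteAdeleRing (𝓞 F) F) d * s)) = 1 := by
  let f : FiniteAdeleRing (𝓞 F) F → ℂ := fun s => ψ (c * adeleMk 0 s)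
  have hc : Continuous f := continuous_subtype_val.comp (hψ.comp (continuous_const.mul
    (continuous_adeleMk.comp (continuous_const.prodMk continuous_id))))
  have h0 : f 0 = 1 := by simp [f]
  have hU : {s | ‖f s - 1‖ < 1 / 2} ∈ 𝓝 (0 : FiniteAdeleRing (𝓞 F) F) :=
    (isOpen_lt (hc.sub continuous_const).norm continuous_const).mem_nhds (by simp [h0])
  obtain ⟨d, hd, hdU⟩ := exists_smul_integralAdeles_subset hU
  refine ⟨d, hd, fun s hs => ?_⟩
  have h1 : f (algebraMap F (FiniteAdeleRing (𝓞 F) F) d * s) = 1 := by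
    refine eq_one_of_norm_pow_sub_one_le fun n => ?_
    have h2 := hdU (n • s) (nsmul_mem hs n)
    have h3 : f (algebraMap F (FiniteAdeleRing (𝓞 F) F) d * n • s) =
        f (algebraMap F (FiniteAdeleRing (𝓞 F) F) d * s) ^ n := by
      have h4 : adeleMk (0 : mixedSpace F) (algebraMap F (FiniteAdeleRing (𝓞 F) F) d * n • s) =
          n • adeleMk 0 (algebraMap F (FiniteAdeleRing (𝓞 F) F) d * s) := by
        refine adele_ext ?_ ?_
        · rw [map_nsmul]; simp
        · rw [map_nsmul, finPart_adeleMk, finPart_adeleMk, mul_smul_comm]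
      simp only [f]
      rw [h4, mul_smul_comm, AddChar.map_nsmul_eq_pow, Circle.coe_pow]
    rw [← h3]
    exact le_of_lt h2
  exact Circle.ext h1

theorem adeleMk_zero_left_add (w : mixedSpace F) (s : FiniteAdeleRing (𝓞 F) F) :
    adeleMk w s = adeleMk w 0 + adeleMk 0 s := by
  rw [← adeleMk_add]; simp

theorem circleExp_two_pi_mul_eq_one_iff (x : ℝ) :
    Circle.exp (2 * Real.pi * x) = 1 ↔ ∃ n : ℤ, x = n := by
  rw [Circle.exp_eq_one]
  constructor
  · rintro ⟨n, hn⟩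
    refine ⟨n, ?_⟩
    have : 2 * Real.pi * x = 2 * Real.pi * n := by rw [hn]; ring
    exact mul_left_cancel₀ (by positivity) this
  · rintro ⟨n, rfl⟩
    exact ⟨n, by ring⟩

theorem algebraMap_adele_eq (a : F) : algebraMap F (Adele F) a =
    adeleMk (mixedEmbedding F a) (algebraMap F (FiniteAdeleRing (𝓞 F) F) a) :=
  adele_ext (by simp) (by simp)

theorem denseRange_finiteAdele : DenseRange (algebraMap F (FiniteAdeleRing (𝓞 F) F)) := by
  intro x
  rw [mem_closure_iff_nhds]
  intro U hU
  have hU' : (fun s => x - s) ⁻¹' U ∈ 𝓝 (0 : FiniteAdeleRing (𝓞 F) F) := by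
    refine (continuous_const.sub continuous_id).continuousAt.preimage_mem_nhds ?_
    simpa using hU
  obtain ⟨d, hd, hdU⟩ := exists_smul_integralAdeles_subset hU'
  obtain ⟨a, s, hs, rfl⟩ := exists_sub_mem_smul_integralAdeles x hd
  refine ⟨algebraMap F _ a, ?_, ⟨a, rfl⟩⟩
  have := hdU s hs
  simpa using this

/-- `ψ` is trivial on `F` and on some `d Ô`, so its archimedean form is integral on `d 𝓞`, hence
rational on `F`, where it is a nonzero functional `L`. The form `(a, b) ↦ L(ab)` is then
nondegenerate over `ℚ`. Expansions in an integral basis and in its dual hold on `F` and extend to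
`ℝ^r₁ × ℂ^r₂` by density. -/
theorem exists_adeleCharacter (ψ : AddChar (Adele F) Circle) (hψ_cont : Continuous ψ)
    (hψ_nontrivial : ψ ≠ 1) (hψ_F : ∀ a : F, ψ (algebraMap F (Adele F) a) = 1) :
    Nonempty (AdeleCharacter ψ) := by
  obtain ⟨lin, hlin⟩ := exists_eq_circleExp_linear (fun w : mixedSpace F => ψ (adeleMk w 0))
    (hψ_cont.comp (continuous_adeleMk.comp (continuous_id.prodMk continuous_const)))
    (fun v w => by rw [← AddChar.map_add_eq_mul, ← adeleMk_add, add_zero])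
  obtain ⟨d, hd, htriv⟩ := exists_trivial_on_smul_integralAdeles ψ hψ_cont 1
  simp only [one_mul] at htriv
  have hint : ∀ a : 𝓞 F, ∃ n : ℤ, lin (mixedEmbedding F ((d : F) * a)) = n := by
    intro a
    rw [← circleExp_two_pi_mul_eq_one_iff, ← hlin]
    have h1 := hψ_F ((d : F) * a)
    rw [algebraMap_adele_eq, adeleMk_zero_left_add, AddChar.map_add_eq_mul, map_mul (algebraMap F _),
      htriv _ ((algebraMap_mem_integralAdeles_iff _).2 ⟨a, rfl⟩), mul_one] at h1
    exact h1
  have hrat : ∀ a : F, ∃ q : ℚ, lin (mixedEmbedding F a) = q := by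
    intro a
    obtain ⟨m, hm, c, hc⟩ : ∃ m : ℤ, m ≠ 0 ∧ ∃ c : 𝓞 F, (m : F) * (a / d) = c := by
      have hx : IsAlgebraic ℤ (a / d) := by
        have : IsAlgebraic ℚ (a / d) := Algebra.IsAlgebraic.isAlgebraic _
        exact (IsFractionRing.isAlgebraic_iff ℤ ℚ F).2 this
      obtain ⟨m, hm, hint⟩ := hx.exists_integral_multiple
      exact ⟨m, hm, ⟨m • (a / d), hint⟩, by simp⟩
    obtain ⟨n, hn⟩ := hint c
    refine ⟨n / m, ?_⟩
    have hd' : (d : F) ≠ 0 := by simpa using hd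
    have h1 : (d : F) * c = m • a := by
      rw [← hc, zsmul_eq_mul]; field_simp
    rw [h1, map_zsmul, map_zsmul, zsmul_eq_mul] at hn
    have hm' : (m : ℝ) ≠ 0 := by exact_mod_cast hm
    push_cast
    rw [eq_div_iff hm', mul_comm, hn]
  choose ℓ hℓ using hrat
  let L : F →ₗ[ℚ] ℚ := AddMonoidHom.toRatLinearMap
    { toFun := ℓ
      map_zero' := by
        have := hℓ 0
        rw [map_zero, map_zero] at this
        exact_mod_cast this.symm
      map_add' := fun a b => by
        have := hℓ (a + b)
        rw [map_add, map_add, hℓ, hℓ] at this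
        exact_mod_cast this.symm }
  have hL : ∀ a, lin (mixedEmbedding F a) = (L a : ℝ) := hℓ
  -- If `L` vanished, `ψ` would be trivial on the archimedean part by density. Triviality on the
  -- diagonal copy of `F` would then give triviality on its dense image in the finite adeles, and
  -- `ψ` would be trivial.
  have hL0 : ∃ a, L a ≠ 0 := by
    by_contra! hall
    have hlin0 : ∀ w, lin w = 0 := by
      have : (fun w => lin w) = fun _ => 0 := by
        refine Continuous.ext_on denseRange_mixedEmbedding lin.continuous continuous_const ?_
        rintro _ ⟨a, rfl⟩
        simp only
        rw [hL, hall]; simp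
      exact fun w => congrFun this w
    have hfin : ∀ s, ψ (adeleMk 0 s) = 1 := by
      have : (fun s => ψ (adeleMk 0 s)) = fun _ => 1 := by
        refine Continuous.ext_on denseRange_finiteAdele (hψ_cont.comp (continuous_adeleMk.comp
          (continuous_const.prodMk continuous_id))) continuous_const ?_
        rintro _ ⟨a, rfl⟩
        have h1 := hψ_F a
        rw [algebraMap_adele_eq, adeleMk_zero_left_add, AddChar.map_add_eq_mul, hlin, hlin0] at h1
        simpa using h1
      exact fun s => congrFun this s
    refine hψ_nontrivial (DFunLike.ext _ _ fun x => ?_)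
    rw [← adeleMk_parts x, adeleMk_zero_left_add, AddChar.map_add_eq_mul, hlin, hlin0, hfin]
    simp
  let B : LinearMap.BilinForm ℚ F := (LinearMap.mul ℚ F).compr₂ L
  have hB : ∀ a b, B a b = L (a * b) := fun a b => rfl
  have hsymm : B.IsSymm := ⟨fun a b => by simp only [hB, mul_comm]⟩
  have hnd : B.Nondegenerate := by
    refine hsymm.isRefl.nondegenerate_iff_separatingLeft.2 fun a ha => ?_
    by_contra ha0
    obtain ⟨c, hc⟩ := hL0
    have := ha (a⁻¹ * c)
    rw [hB, mul_inv_cancel_left₀ ha0] at this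
    exact hc this
  let bd := B.dualBasis hnd (integralBasis F)
  have hF1 : ∀ a : F, a = ∑ j, L (a * integralBasis F j) • bd j := by
    intro a
    conv_lhs => rw [← bd.sum_repr a]
    refine Finset.sum_congr rfl fun j _ => ?_
    rw [LinearMap.BilinForm.dualBasis_repr_apply, hB]
  have hF2 : ∀ a : F, a = ∑ j, L (a * bd j) • integralBasis F j := by
    intro a
    conv_lhs => rw [← (integralBasis F).sum_repr a]
    refine Finset.sum_congr rfl fun j _ => ?_
    have h1 := LinearMap.BilinForm.dualBasis_repr_apply hnd bd a j
    rw [LinearMap.BilinForm.dualBasis_dualBasis hnd hsymm] at h1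
    rw [h1, hB]
  have hsmul : ∀ (q : ℚ) (a : F), mixedEmbedding F (q • a) = (q : ℝ) • mixedEmbedding F a := by
    intro q a
    rw [Algebra.smul_def, map_mul]
    have : mixedEmbedding F (algebraMap ℚ F q) = (q : ℝ) • 1 := by
      have h2 := congrArg (fun f : ℚ →+* mixedSpace F => f q) (Subsingleton.elim
        ((mixedEmbedding F).comp (algebraMap ℚ F))
        ((algebraMap ℝ (mixedSpace F)).comp (algebraMap ℚ ℝ)))
      simp only [RingHom.comp_apply] at h2
      rw [h2, Algebra.algebraMap_eq_smul_one, eq_ratCast]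
    rw [this, smul_mul_assoc, one_mul]
  have hcont : ∀ c : mixedSpace F, Continuous fun w => lin (w * c) := fun c =>
    lin.continuous.comp (continuous_mul_const c)
  refine ⟨⟨hψ_cont, hψ_F, lin, hlin, bd, ?_, ?_⟩⟩
  · have : (fun w => w) = fun w => ∑ j, lin (w * latticeBasis F j) • mixedEmbedding F (bd j) := by
      refine Continuous.ext_on denseRange_mixedEmbedding continuous_id
        (continuous_finsetSum _ fun j _ => (hcont _).smul continuous_const) ?_
      rintro _ ⟨a, rfl⟩
      simp only
      conv_lhs => rw [hF1 a, map_sum]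
      refine Finset.sum_congr rfl fun j _ => ?_
      rw [hsmul, latticeBasis_apply, ← map_mul, hL]
    exact fun w => congrFun this w
  · have : (fun w => w) = fun w => ∑ j, lin (w * mixedEmbedding F (bd j)) • latticeBasis F j := by
      refine Continuous.ext_on denseRange_mixedEmbedding continuous_id
        (continuous_finsetSum _ fun j _ => (hcont _).smul continuous_const) ?_
      rintro _ ⟨a, rfl⟩
      simp only
      conv_lhs => rw [hF2 a, map_sum]
      refine Finset.sum_congr rfl fun j _ => ?_
      rw [hsmul, latticeBasis_apply, ← map_mul, hL]
    exact fun w => congrFun this w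

end adeleCharacters

/-! ### Self-duality of `𝔸/F`. -/

section dual

open IsDedekindDomain IsDedekindDomain.HeightOneSpectrum NumberField.mixedEmbedding
open scoped Classical

variable {F : Type*} [Field F] [NumberField F] {ψ : AddChar (Adele F) Circle}

theorem AdeleCharacter.eq_sum_dual (Ψ : AdeleCharacter ψ) {a : F}
    {k : Module.Free.ChooseBasisIndex ℤ (𝓞 F) → ℤ}
    (hk : ∀ j, Ψ.lin (mixedEmbedding F a * latticeBasis F j) = k j) : a = ∑ j, k j • Ψ.dual j := by
  apply mixedEmbedding_injective F
  rw [Ψ.expand_dual (mixedEmbedding F a), map_sum]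
  refine Finset.sum_congr rfl fun j _ => ?_
  rw [hk, map_zsmul, Int.cast_smul_eq_zsmul]

theorem exists_common_denominator {ι : Type*} [Fintype ι] (f : ι → F) :
    ∃ N : 𝓞 F, N ≠ 0 ∧ ∀ j, ∃ c : 𝓞 F, (N : F) * f j = c := by
  obtain ⟨b, hb⟩ := IsLocalization.exist_integer_multiples_of_finite (nonZeroDivisors (𝓞 F)) f
  refine ⟨b, nonZeroDivisors.ne_zero b.2, fun j => ?_⟩
  obtain ⟨c, hc⟩ := hb j
  exact ⟨c, by rw [Algebra.smul_def] at hc; exact hc.symm⟩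

/-- Such an `a` is an integral combination of the dual basis, so a common denominator of that basis
serves for all of them. -/
theorem AdeleCharacter.exists_dual_denominator (Ψ : AdeleCharacter ψ) :
    ∃ N : 𝓞 F, N ≠ 0 ∧ ∀ a : F, (∀ j, ∃ k : ℤ, Ψ.lin (mixedEmbedding F a * latticeBasis F j) = k) →
      ∃ c : 𝓞 F, (N : F) * a = c := by
  obtain ⟨N, hN, hc⟩ := exists_common_denominator Ψ.dual
  refine ⟨N, hN, fun a ha => ?_⟩
  choose k hk using ha
  choose c hc using hc
  refine ⟨∑ j, k j • c j, ?_⟩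
  have h1 : ((∑ j, k j • c j : 𝓞 F) : F) = ∑ j, k j • (c j : F) := by
    refine (map_sum (algebraMap (𝓞 F) F) _ _).trans ?_
    exact Finset.sum_congr rfl fun j _ => map_zsmul (algebraMap (𝓞 F) F) _ _
  rw [h1, Ψ.eq_sum_dual hk, Finset.mul_sum]
  refine Finset.sum_congr rfl fun j _ => ?_
  rw [mul_smul_comm, hc]

theorem AdeleCharacter.lin_of_trivial (Ψ : AdeleCharacter ψ) {a : F}
    (ha : ψ (adeleMk 0 (algebraMap F (FiniteAdeleRing (𝓞 F) F) a)) = 1) :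
    ∃ k : ℤ, Ψ.lin (mixedEmbedding F a) = k := by
  rw [← circleExp_two_pi_mul_eq_one_iff, ← Ψ.apply_arch]
  have h1 := Ψ.principal a
  rwa [algebraMap_adele_eq, adeleMk_zero_left_add, AddChar.map_add_eq_mul, ha, mul_one] at h1

theorem integralBasis_mem_integralAdeles (j : Module.Free.ChooseBasisIndex ℤ (𝓞 F)) :
    algebraMap F (FiniteAdeleRing (𝓞 F) F) (integralBasis F j) ∈ integralAdeles F :=
  (algebraMap_mem_integralAdeles_iff _).2 ⟨RingOfIntegers.basis F j, (integralBasis_apply F j).symm⟩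

/-- The conductor of the character: a finite adele `s` such that `ψ` is trivial on `s Ô` has bounded
denominator. -/
theorem AdeleCharacter.exists_conductor (Ψ : AdeleCharacter ψ) :
    ∃ N : 𝓞 F, N ≠ 0 ∧ ∀ s : FiniteAdeleRing (𝓞 F) F,
      (∀ o ∈ integralAdeles F, ψ (adeleMk 0 (s * o)) = 1) →
      algebraMap F (FiniteAdeleRing (𝓞 F) F) N * s ∈ integralAdeles F := by
  obtain ⟨d, hd, htriv⟩ := exists_trivial_on_smul_integralAdeles ψ Ψ.continuous 1
  simp only [one_mul] at htriv
  obtain ⟨N, hN, hNa⟩ := Ψ.exists_dual_denominator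
  refine ⟨N, hN, fun s hs => ?_⟩
  -- Modulo `d Ô`, on which `ψ` is trivial, the finite adele `s` may be replaced by an element `a`
  -- of `F`, and for `a` the condition is about the lattice dual to `𝓞 F`.
  obtain ⟨a, o', ho', rfl⟩ := exists_sub_mem_smul_integralAdeles s hd
  have h1 : ∀ o ∈ integralAdeles F,
      ψ (adeleMk 0 (algebraMap F (FiniteAdeleRing (𝓞 F) F) a * o)) = 1 := by
    intro o ho
    have h2 := hs o ho
    rwa [add_mul, show adeleMk (0 : mixedSpace F) (algebraMap F (FiniteAdeleRing (𝓞 F) F) a * o +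
      algebraMap F (FiniteAdeleRing (𝓞 F) F) d * o' * o) =
      adeleMk 0 (algebraMap F (FiniteAdeleRing (𝓞 F) F) a * o) +
      adeleMk 0 (algebraMap F (FiniteAdeleRing (𝓞 F) F) d * (o' * o)) by
        rw [← adeleMk_add, add_zero, mul_assoc], AddChar.map_add_eq_mul,
      htriv _ (mul_mem ho' ho), mul_one] at h2
  obtain ⟨c, hc⟩ := hNa a fun j => by
    rw [latticeBasis_apply, ← map_mul]
    refine Ψ.lin_of_trivial ?_
    rw [map_mul]
    exact h1 _ (integralBasis_mem_integralAdeles j)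
  rw [mul_add, ← map_mul, hc]
  exact add_mem ((algebraMap_mem_integralAdeles_iff _).2 ⟨c, rfl⟩)
    (mul_mem ((algebraMap_mem_integralAdeles_iff _).2 ⟨N, rfl⟩)
      (mul_mem ((algebraMap_mem_integralAdeles_iff _).2 ⟨d, rfl⟩) ho'))

/-- The finite adele supported at one place. -/
theorem exists_finiteAdele_single (v : HeightOneSpectrum (𝓞 F)) (x : v.adicCompletion F) :
    ∃ s : FiniteAdeleRing (𝓞 F) F, s v = x ∧ ∀ w, w ≠ v → s w = 0 := by
  refine ⟨⟨Function.update (fun _ => 0) v x, ?_⟩,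
    Function.update_self (β := fun w : HeightOneSpectrum (𝓞 F) => w.adicCompletion F) v x
      (fun _ => 0),
    fun w hw => Function.update_of_ne
      (β := fun w : HeightOneSpectrum (𝓞 F) => w.adicCompletion F) hw x (fun _ => 0)⟩
  have : ∀ᶠ w : HeightOneSpectrum (𝓞 F) in Filter.cofinite, w ≠ v :=
    (Set.finite_singleton v).compl_mem_cofinite
  filter_upwards [this] with w hw
  rw [Function.update_of_ne hw]
  exact zero_mem (w.adicCompletionIntegers F)

theorem finiteAdele_ext {x y : FiniteAdeleRing (𝓞 F) F} (h : ∀ v, x v = y v) : x = y :=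
  Subtype.ext (funext h)

/-- By density of `F`, `ψ` is trivial on all multiples of `s`. If `s` were nonzero at `v`, `ψ` would
be trivial on the adeles supported at `v`. The elements `d π⁻ᵏ`, with `π` a unit off `v`, would then
lie in the lattice dual to `𝓞 F` for every `k`, although the denominators in that lattice are
bounded. -/
theorem AdeleCharacter.finPart_eq_zero (Ψ : AdeleCharacter ψ) {s : FiniteAdeleRing (𝓞 F) F}
    (hs : ∀ η : F, ψ (adeleMk 0 (algebraMap F (FiniteAdeleRing (𝓞 F) F) η * s)) = 1) : s = 0 := by
  have hall : ∀ z, ψ (adeleMk 0 (z * s)) = 1 := by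
    have : (fun z => ψ (adeleMk 0 (z * s))) = fun _ => 1 := by
      refine Continuous.ext_on denseRange_finiteAdele (Ψ.continuous.comp (continuous_adeleMk.comp
        (continuous_const.prodMk (continuous_mul_const s)))) continuous_const ?_
      rintro _ ⟨a, rfl⟩
      exact hs a
    exact fun z => congrFun this z
  by_contra hne
  obtain ⟨v, hv⟩ : ∃ v : HeightOneSpectrum (𝓞 F), s v ≠ 0 := by
    by_contra! h
    exact hne (finiteAdele_ext h)
  have hsingle : ∀ x : FiniteAdeleRing (𝓞 F) F, (∀ w, w ≠ v → x w = 0) →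
      ψ (adeleMk 0 x) = 1 := by
    intro x hx
    obtain ⟨z, hz1, hz2⟩ := exists_finiteAdele_single v (x v / s v)
    rw [show x = z * s from finiteAdele_ext fun w => by
      rw [finiteAdele_mul_apply]
      by_cases hw : w = v
      · subst hw; rw [hz1, div_mul_cancel₀ _ hv]
      · rw [hz2 w hw, zero_mul, hx w hw]]
    exact hall z
  obtain ⟨d, hd, htriv⟩ := exists_trivial_on_smul_integralAdeles ψ Ψ.continuous 1
  simp only [one_mul] at htriv
  obtain ⟨π, l, hl, hπ, hπ'⟩ := exists_generator_of_prime_power v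
  obtain ⟨N, hN, hNa⟩ := Ψ.exists_dual_denominator
  have htriv2 : ∀ (k : ℕ) (a : 𝓞 F), ψ (adeleMk 0 (algebraMap F (FiniteAdeleRing (𝓞 F) F)
      ((d : F) * ((a : F) * ((π : F) ^ k)⁻¹)))) = 1 := by
    intro k a
    let η : F := (a : F) * ((π : F) ^ k)⁻¹
    obtain ⟨z, hz1, hz2⟩ := exists_finiteAdele_single v
      ((algebraMap F (FiniteAdeleRing (𝓞 F) F) η) v)
    let o := algebraMap F (FiniteAdeleRing (𝓞 F) F) η - z
    have ho : o ∈ integralAdeles F := by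
      rw [mem_integralAdeles]
      intro w
      by_cases hw : w = v
      · subst hw
        have : o w = 0 := by rw [finiteAdele_sub_apply, hz1, sub_self]
        rw [this]; exact zero_mem _
      · have h1 : o w = (algebraMap F (FiniteAdeleRing (𝓞 F) F) η) w := by
          rw [finiteAdele_sub_apply, hz2 w hw, sub_zero]
        rw [h1]
        change Valued.v _ ≤ (1 : WithZero (Multiplicative ℤ))
        refine (valuedAdicCompletion_eq_valuation' w η).le.trans ?_
        simp only [η]
        rw [map_mul, map_inv₀, map_pow, hπ' w hw, one_pow, inv_one, mul_one]
        exact w.valuation_le_one a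
    have h2 : algebraMap F (FiniteAdeleRing (𝓞 F) F) ((d : F) * η) =
        algebraMap F (FiniteAdeleRing (𝓞 F) F) d * z +
        algebraMap F (FiniteAdeleRing (𝓞 F) F) d * o := by
      rw [map_mul, ← mul_add]; congr 1; simp [o]
    have h3 : adeleMk (0 : mixedSpace F) (algebraMap F (FiniteAdeleRing (𝓞 F) F) ((d : F) * η)) =
        adeleMk 0 (algebraMap F (FiniteAdeleRing (𝓞 F) F) d * z) +
        adeleMk 0 (algebraMap F (FiniteAdeleRing (𝓞 F) F) d * o) := by
      rw [← adeleMk_add, add_zero, h2]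
    rw [h3, AddChar.map_add_eq_mul, htriv o ho, mul_one]
    refine hsingle _ fun w hw => ?_
    rw [finiteAdele_mul_apply, hz2 w hw, mul_zero]
  have hint : ∀ k : ℕ, ∃ c : 𝓞 F, (N : F) * ((d : F) * ((π : F) ^ k)⁻¹) = c := by
    intro k
    refine hNa _ fun j => ?_
    rw [latticeBasis_apply, ← map_mul]
    refine Ψ.lin_of_trivial ?_
    have := htriv2 k (RingOfIntegers.basis F j)
    rw [show ((RingOfIntegers.basis F j : 𝓞 F) : F) = integralBasis F j from
      (integralBasis_apply F j).symm] at this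
    rwa [show (d : F) * ((π : F) ^ k)⁻¹ * integralBasis F j =
      (d : F) * (integralBasis F j * ((π : F) ^ k)⁻¹) by ring]
  have hNd : ((N * d : 𝓞 F) : F) ≠ 0 := by
    simpa using ⟨hN, hd⟩
  have hval0 : v.valuation F ((N * d : 𝓞 F) : F) ≠ 0 := by simpa using hNd
  let m := WithZero.log (v.valuation F ((N * d : 𝓞 F) : F))
  have hm : v.valuation F ((N * d : 𝓞 F) : F) = WithZero.exp m := (WithZero.exp_log hval0).symm
  -- The element has valuation `exp (m + (|m| + 1) l)` with `l ≥ 1`, which exceeds `1` whatever the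
  -- sign of `m`.
  obtain ⟨c, hc⟩ := hint (m.natAbs + 1)
  have h5 := v.valuation_le_one (K := F) c
  have h6 : v.valuation F (c : F) = WithZero.exp (m + (m.natAbs + 1) * l) := by
    rw [← hc, show (N : F) * ((d : F) * ((π : F) ^ (m.natAbs + 1))⁻¹) =
      ((N * d : 𝓞 F) : F) * ((π : F) ^ (m.natAbs + 1))⁻¹ by push_cast; ring, map_mul, hm, map_inv₀,
      map_pow, hπ, ← WithZero.exp_nsmul, ← WithZero.exp_neg, ← WithZero.exp_add]
    congr 1
    simp
  have h7 : WithZero.exp (m + (m.natAbs + 1) * l) ≤ (WithZero.exp 0 : WithZero (Multiplicative ℤ)) := by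
    rw [← h6, WithZero.exp_zero]; exact h5
  rw [WithZero.exp_le_exp] at h7
  have hl1 : (1 : ℤ) ≤ l := by exact_mod_cast Nat.one_le_iff_ne_zero.2 hl
  have h8 : -m ≤ m.natAbs := by rw [Int.natCast_natAbs]; exact neg_le_abs m
  nlinarith [abs_nonneg m, Int.natCast_natAbs m]

/-- The annihilator of `F` with respect to the character is `F`. -/
theorem AdeleCharacter.mem_range_of_forall (Ψ : AdeleCharacter ψ) {x : Adele F}
    (hx : ∀ η : F, ψ (algebraMap F (Adele F) η * x) = 1) : ∃ a : F, x = algebraMap F (Adele F) a := by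
  -- On the multiples `e b` with `b` integral, the finite part of `x` does not contribute to `ψ`.
  -- The hypothesis then says that the coordinates of `e · archPart x` in the dual basis are
  -- integers, so `archPart x` comes from some `ξ ∈ F`; the finite part minus `ξ` is treated by
  -- `finPart_eq_zero`.
  obtain ⟨e, he, htriv⟩ := exists_trivial_on_smul_integralAdeles ψ Ψ.continuous
    (adeleMk 0 (finPart x))
  have he' : (e : F) ≠ 0 := by simpa using he
  have h1 : ∀ j, ∃ k : ℤ, Ψ.lin (mixedEmbedding F e * archPart x * latticeBasis F j) = k := by
    intro j
    rw [← circleExp_two_pi_mul_eq_one_iff, ← Ψ.apply_arch]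
    have h2 := hx ((e : F) * integralBasis F j)
    have h3 : algebraMap F (Adele F) ((e : F) * integralBasis F j) * x =
        adeleMk (mixedEmbedding F e * archPart x * latticeBasis F j) 0 +
        adeleMk 0 (finPart x) * adeleMk 0 (algebraMap F (FiniteAdeleRing (𝓞 F) F) e *
          algebraMap F (FiniteAdeleRing (𝓞 F) F) (integralBasis F j)) := by
      rw [← adeleMk_mul, ← adeleMk_add]
      refine adele_ext ?_ ?_
      · simp only [map_mul, archPart_algebraMap, archPart_adeleMk, latticeBasis_apply]; ring
      · simp only [map_mul, finPart_algebraMap, finPart_adeleMk]; ring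
    rw [h3, AddChar.map_add_eq_mul, htriv _ (integralBasis_mem_integralAdeles j), mul_one] at h2
    exact h2
  choose k hk using h1
  have h4 : mixedEmbedding F e * archPart x = mixedEmbedding F (∑ j, k j • Ψ.dual j) := by
    rw [Ψ.expand_dual (mixedEmbedding F e * archPart x), map_sum]
    refine Finset.sum_congr rfl fun j _ => ?_
    rw [hk, map_zsmul, Int.cast_smul_eq_zsmul]
  let ξ : F := (e : F)⁻¹ * ∑ j, k j • Ψ.dual j
  have h5 : archPart x = mixedEmbedding F ξ := by
    simp only [ξ]
    rw [map_mul, ← h4, ← mul_assoc, ← map_mul, inv_mul_cancel₀ he', map_one, one_mul]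
  have h6 : finPart x - algebraMap F _ ξ = 0 := by
    refine Ψ.finPart_eq_zero fun η => ?_
    have h7 := hx η
    have h8 : algebraMap F (Adele F) η * x = algebraMap F (Adele F) (η * ξ) +
        adeleMk 0 (algebraMap F (FiniteAdeleRing (𝓞 F) F) η * (finPart x - algebraMap F _ ξ)) := by
      refine adele_ext ?_ ?_
      · simp only [map_mul, map_add, archPart_algebraMap, archPart_adeleMk, h5]; ring
      · simp only [map_mul, map_add, finPart_algebraMap, finPart_adeleMk]; ring
    rwa [h8, AddChar.map_add_eq_mul, Ψ.principal, one_mul] at h7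
  refine ⟨ξ, adele_ext (by rw [h5, archPart_algebraMap]) ?_⟩
  rw [finPart_algebraMap]
  exact sub_eq_zero.1 h6

/-- Summability over the elements of `F` with bounded denominator. -/
theorem summable_norm_mixedEmbedding {N : 𝓞 F} (hN : N ≠ 0) {m : ℕ} (hm : Module.finrank ℚ F < m) :
    Summable fun η : {η : F // ∃ c : 𝓞 F, (N : F) * η = c} =>
      (‖mixedEmbedding F (η : F)‖ ^ m)⁻¹ := by
  let L := Submodule.span ℤ (Set.range (latticeBasis F))
  have hN' : (N : F) ≠ 0 := by simpa using hN
  have hmem : ∀ η : {η : F // ∃ c : 𝓞 F, (N : F) * η = c}, mixedEmbedding F ((N : F) * η) ∈ L :=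
    fun ⟨η, c, hc⟩ => (mem_span_latticeBasis F).2 ⟨c, by rw [hc]; rfl⟩
  have hrank : Module.finrank ℤ L = Module.finrank ℚ F := by
    rw [ZLattice.rank ℝ L, mixedEmbedding.finrank]
  have h1 := ZLattice.summable_norm_pow_inv (L := L) m (by rw [hrank]; exact hm)
  have h2 := h1.comp_injective (i := fun η => ⟨_, hmem η⟩) (by
    intro η ξ h
    have h3 := mixedEmbedding_injective F (congrArg Subtype.val h)
    exact Subtype.ext (mul_left_cancel₀ hN' h3))
  refine Summable.of_nonneg_of_le (fun η => by positivity) (fun η => ?_)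
    (h2.mul_left (‖mixedEmbedding F (N : F)‖ ^ m))
  simp only [Function.comp]
  rw [inv_pow]
  change _ ≤ _ * (‖mixedEmbedding F ((N : F) * η)‖ ^ m)⁻¹
  by_cases hη : (η : F) = 0
  · rw [hη]
    have : m ≠ 0 := by omega
    simp [this]
  have hpos : 0 < ‖mixedEmbedding F (η : F)‖ :=
    norm_pos_iff.2 fun h => hη (mixedEmbedding_injective F (by rw [h, map_zero]))
  have hpos2 : 0 < ‖mixedEmbedding F ((N : F) * η)‖ :=
    norm_pos_iff.2 fun h => (mul_ne_zero hN' hη) (mixedEmbedding_injective F (by rw [h, map_zero]))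
  rw [← div_eq_mul_inv, le_div_iff₀ (by positivity), inv_mul_le_iff₀ (by positivity), mul_comm,
    ← mul_pow, map_mul]
  gcongr
  rw [← map_mul, map_mul]
  exact norm_mul_le _ _

end dual

/-! ### Fourier series on the compact group `𝔸/F`. -/

section fourier

open scoped Classical

variable {F : Type*} [Field F] [NumberField F] {ψ : AddChar (Adele F) Circle}

instance : CompactSpace (Adele F ⧸ principalAdeles F) := by
  refine ⟨?_⟩
  have h : (QuotientAddGroup.mk : Adele F → Adele F ⧸ principalAdeles F) '' adeleCompactBox F =
      Set.univ := by
    refine Set.eq_univ_of_forall fun q => ?_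
    obtain ⟨x, rfl⟩ := QuotientAddGroup.mk_surjective q
    obtain ⟨a, ha, -⟩ := (isStrictFundDomain_adeleBox (F := F)).2 x
    refine ⟨_, adeleBox_subset ha, ?_⟩
    rw [eq_comm, QuotientAddGroup.eq]
    simp
  rw [← h]
  exact isCompact_adeleCompactBox.image continuous_quot_mk

/-- A continuous periodic function as a function on the compact quotient. -/
def IsPeriodic.lift {f : Adele F → ℂ} (hf : IsPeriodic f) (hc : Continuous f) :
    C(Adele F ⧸ principalAdeles F, ℂ) where
  toFun := Quotient.lift f fun x y h => by
    obtain ⟨a, ha⟩ := QuotientAddGroup.leftRel_apply.1 h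
    have : y = x + algebraMap F (Adele F) a := by
      rw [show algebraMap F (Adele F) a = -x + y from ha]; ring
    rw [this, hf]
  continuous_toFun := hc.quotient_lift _

theorem AdeleCharacter.isPeriodic (Ψ : AdeleCharacter ψ) (η : F) :
    IsPeriodic fun x => (ψ (algebraMap F (Adele F) η * x) : ℂ) := by
  intro x a
  simp only
  rw [mul_add, AddChar.map_add_eq_mul, ← map_mul (algebraMap F (Adele F)), Ψ.principal, mul_one]

theorem AdeleCharacter.continuous_mul (Ψ : AdeleCharacter ψ) (η : F) :
    Continuous fun x => (ψ (algebraMap F (Adele F) η * x) : ℂ) :=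
  continuous_subtype_val.comp (Ψ.continuous.comp (continuous_const_mul _))

/-- The characters `x ↦ ψ(ηx)` of `𝔸/F`. -/
def AdeleCharacter.monomial (Ψ : AdeleCharacter ψ) (η : F) : C(Adele F ⧸ principalAdeles F, ℂ) :=
  (Ψ.isPeriodic η).lift (Ψ.continuous_mul η)

theorem AdeleCharacter.monomial_mk (Ψ : AdeleCharacter ψ) (η : F) (x : Adele F) :
    Ψ.monomial η (QuotientAddGroup.mk x) = (ψ (algebraMap F (Adele F) η * x) : ℂ) := rfl

/-- The algebra of trigonometric polynomials on `𝔸/F`. -/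
def AdeleCharacter.trigAlgebra (Ψ : AdeleCharacter ψ) :
    StarSubalgebra ℂ C(Adele F ⧸ principalAdeles F, ℂ) where
  toSubalgebra := Algebra.adjoin ℂ (Set.range Ψ.monomial)
  star_mem' := by
    change Algebra.adjoin ℂ (Set.range Ψ.monomial) ≤ star (Algebra.adjoin ℂ (Set.range Ψ.monomial))
    refine Algebra.adjoin_le ?_
    rintro - ⟨η, rfl⟩
    refine Algebra.subset_adjoin ⟨-η, ContinuousMap.ext fun q => ?_⟩
    obtain ⟨x, rfl⟩ := QuotientAddGroup.mk_surjective q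
    rw [ContinuousMap.star_apply, Ψ.monomial_mk, Ψ.monomial_mk, map_neg, neg_mul,
      AddChar.map_neg_eq_inv, Circle.coe_inv_eq_conj]
    rfl

theorem AdeleCharacter.trigAlgebra_coe (Ψ : AdeleCharacter ψ) :
    Subalgebra.toSubmodule Ψ.trigAlgebra.toSubalgebra =
      Submodule.span ℂ (Set.range Ψ.monomial) := by
  apply Algebra.adjoin_eq_span_of_subset
  refine Set.Subset.trans ?_ Submodule.subset_span
  intro x hx
  refine Submonoid.closure_induction (fun _ => id) ⟨0, ?_⟩ ?_ hx
  · ext q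
    obtain ⟨x, rfl⟩ := QuotientAddGroup.mk_surjective q
    rw [Ψ.monomial_mk]; simp
  · rintro _ _ - - ⟨m, rfl⟩ ⟨n, rfl⟩
    refine ⟨m + n, ?_⟩
    ext q
    obtain ⟨x, rfl⟩ := QuotientAddGroup.mk_surjective q
    rw [ContinuousMap.mul_apply, Ψ.monomial_mk, Ψ.monomial_mk, Ψ.monomial_mk, map_add, add_mul,
      AddChar.map_add_eq_mul, Circle.coe_mul]

/-- Stone–Weierstrass; the characters separate points exactly because an adele annihilated by all of
them lies in `F` (`mem_range_of_forall`). -/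
theorem AdeleCharacter.span_closure_eq_top (Ψ : AdeleCharacter ψ) :
    (Submodule.span ℂ (Set.range Ψ.monomial)).topologicalClosure = ⊤ := by
  rw [← Ψ.trigAlgebra_coe]
  refine congr_arg (Subalgebra.toSubmodule <| StarSubalgebra.toSubalgebra ·)
    (ContinuousMap.starSubalgebra_topologicalClosure_eq_top_of_separatesPoints Ψ.trigAlgebra ?_)
  intro p q hpq
  obtain ⟨x, rfl⟩ := QuotientAddGroup.mk_surjective p
  obtain ⟨y, rfl⟩ := QuotientAddGroup.mk_surjective q
  by_contra! hall
  refine hpq ?_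
  have h1 : ∀ η : F, ψ (algebraMap F (Adele F) η * (-x + y)) = 1 := by
    intro η
    have h2 := hall _ ⟨Ψ.monomial η, Algebra.subset_adjoin ⟨η, rfl⟩, rfl⟩
    change (ψ (algebraMap F (Adele F) η * x) : ℂ) = (ψ (algebraMap F (Adele F) η * y) : ℂ) at h2
    have h3 := Circle.ext h2
    rw [mul_add, AddChar.map_add_eq_mul, ← h3, mul_neg, AddChar.map_neg_eq_inv, inv_mul_cancel]
  obtain ⟨a, ha⟩ := Ψ.mem_range_of_forall h1
  rw [QuotientAddGroup.eq]
  exact ⟨a, ha.symm⟩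

variable {dx : Measure (Adele F)} [dx.IsAddHaarMeasure]

theorem integrableOn_adeleBox {f : Adele F → ℂ} (hf : Continuous f) :
    IntegrableOn f (adeleBox F) dx :=
  (hf.continuousOn.integrableOn_compact isCompact_adeleCompactBox).mono_set adeleBox_subset

/-- Orthogonality of characters. -/
theorem AdeleCharacter.integral_monomial (Ψ : AdeleCharacter ψ) {η : F} (hη : η ≠ 0) :
    ∫ x in adeleBox F, (ψ (algebraMap F (Adele F) η * x) : ℂ) ∂dx = 0 := by
  obtain ⟨c, hc⟩ : ∃ c : Adele F, ψ (algebraMap F (Adele F) η * c) ≠ 1 := by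
    by_contra! hall
    have h0 : ∀ w, Ψ.lin w = 0 := by
      intro w
      have h1 : 2 * Real.pi * Ψ.lin w = 0 := by
        refine circleExp_linear_injective fun t => ?_
        have h2 := hall (algebraMap F (Adele F) η⁻¹ * adeleMk (t • w) 0)
        rw [← mul_assoc, ← map_mul, mul_inv_cancel₀ hη, map_one, one_mul, Ψ.apply_arch, map_smul,
          smul_eq_mul] at h2
        rw [mul_assoc, mul_comm (Ψ.lin w), h2]; simp
      exact (mul_eq_zero.1 h1).resolve_left (by positivity)
    have h1 := Ψ.expand_dual 1
    simp only [h0, zero_smul, Finset.sum_const_zero] at h1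
    exact one_ne_zero h1
  have h := (Ψ.isPeriodic η).setIntegral_add (dx := dx) isStrictFundDomain_adeleBox c
  simp only [mul_add, AddChar.map_add_eq_mul, Circle.coe_mul] at h
  rw [integral_mul_const] at h
  by_contra hne
  refine hc (Circle.ext ?_)
  exact mul_left_cancel₀ hne (by rw [h, Circle.coe_one, mul_one])

/-- A continuous function on `𝔸/F` all of whose Fourier coefficients vanish is zero. -/
theorem AdeleCharacter.eq_zero_of_fourier_eq_zero (Ψ : AdeleCharacter ψ) {f : Adele F → ℂ}
    (hf : IsPeriodic f) (hc : Continuous f)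
    (h : ∀ η : F, ∫ x in adeleBox F, f x * (ψ (algebraMap F (Adele F) η * x) : ℂ) ∂dx = 0) :
    f = 0 := by
  have := countable_numberField (F := F)
  have hspan : ∀ p ∈ Submodule.span ℂ (Set.range Ψ.monomial),
      ∫ x in adeleBox F, f x * p (QuotientAddGroup.mk x) ∂dx = 0 := by
    intro p hp
    have hint : ∀ p : C(Adele F ⧸ principalAdeles F, ℂ),
        IntegrableOn (fun x => f x * p (QuotientAddGroup.mk x)) (adeleBox F) dx := fun p =>
      integrableOn_adeleBox (hc.mul (p.continuous.comp continuous_quot_mk))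
    induction hp using Submodule.span_induction with
    | mem p hp => obtain ⟨η, rfl⟩ := hp; exact h η
    | zero => simp
    | add p q _ _ hp hq =>
      simp only [ContinuousMap.add_apply, mul_add]
      rw [integral_add (hint p) (hint q), hp, hq, add_zero]
    | smul c p _ hp =>
      simp only [ContinuousMap.smul_apply, smul_eq_mul, mul_left_comm]
      rw [integral_const_mul, hp, mul_zero]
  have hconj : IsPeriodic fun x => (starRingEnd ℂ) (f x) := fun x a => by simp only [hf x a]
  let fb := hconj.lift (Complex.continuous_conj.comp hc)
  have hmem : fb ∈ (Submodule.span ℂ (Set.range Ψ.monomial)).topologicalClosure := by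
    rw [Ψ.span_closure_eq_top]; trivial
  have hfi := integrableOn_adeleBox (dx := dx) hc
  -- The conjugate of `f` is a uniform limit of trigonometric polynomials, against each of which `f`
  -- integrates to zero.
  have hzero : ∫ x in adeleBox F, f x * (starRingEnd ℂ) (f x) ∂dx = 0 := by
    by_contra hne
    have hpos : 0 < ‖∫ x in adeleBox F, f x * (starRingEnd ℂ) (f x) ∂dx‖ := norm_pos_iff.2 hne
    let I := ∫ x in adeleBox F, ‖f x‖ ∂dx
    have hI : 0 ≤ I := integral_nonneg fun x => norm_nonneg _
    obtain ⟨p, hp, hdist⟩ := Metric.mem_closure_iff.1 hmem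
      (‖∫ x in adeleBox F, f x * (starRingEnd ℂ) (f x) ∂dx‖ / (I + 1)) (by positivity)
    have hle : ‖∫ x in adeleBox F, f x * (starRingEnd ℂ) (f x) ∂dx‖ ≤ I * dist fb p := by
      have h1 : ∫ x in adeleBox F, f x * (starRingEnd ℂ) (f x) ∂dx =
          ∫ x in adeleBox F, f x * ((fb - p) (QuotientAddGroup.mk x)) ∂dx := by
        have i1 : IntegrableOn (fun x => f x * (starRingEnd ℂ) (f x)) (adeleBox F) dx :=
          integrableOn_adeleBox (hc.mul (Complex.continuous_conj.comp hc))
        have i2 : IntegrableOn (fun x => f x * p (QuotientAddGroup.mk x)) (adeleBox F) dx :=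
          integrableOn_adeleBox (hc.mul (p.continuous.comp continuous_quot_mk))
        rw [← sub_zero (∫ x in adeleBox F, f x * (starRingEnd ℂ) (f x) ∂dx), ← hspan p hp,
          ← integral_sub i1 i2]
        refine integral_congr_ae (Filter.Eventually.of_forall fun x => ?_)
        simp only [ContinuousMap.sub_apply, mul_sub]
        rfl
      rw [h1, ← integral_mul_const]
      refine norm_integral_le_of_norm_le (hfi.norm.mul_const _)
        (Filter.Eventually.of_forall fun x => ?_)
      rw [norm_mul]
      gcongr
      rw [dist_eq_norm]
      exact ContinuousMap.norm_coe_le_norm _ _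
    have h2 : I * dist fb p ≤ (I + 1) * dist fb p := by
      gcongr; linarith
    rw [lt_div_iff₀ (by positivity)] at hdist
    linarith [mul_comm (dist fb p) (I + 1)]
  have hsq : ∫ x in adeleBox F, ‖f x‖ ^ 2 ∂dx = 0 := by
    have h1 : ∫ x in adeleBox F, f x * (starRingEnd ℂ) (f x) ∂dx =
        ((∫ x in adeleBox F, ‖f x‖ ^ 2 ∂dx : ℝ) : ℂ) := by
      rw [← integral_complex_ofReal]
      refine integral_congr_ae (Filter.Eventually.of_forall fun x => ?_)
      simp only
      rw [Complex.mul_conj, Complex.normSq_eq_norm_sq]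
    rw [h1] at hzero
    exact_mod_cast hzero
  have hae : ∀ᵐ x ∂(dx.restrict (adeleBox F)), f x = 0 := by
    have h1 := (integral_eq_zero_iff_of_nonneg (fun x => sq_nonneg ‖f x‖)
      (IntegrableOn.integrable ((hc.norm.pow 2).continuousOn.integrableOn_compact
        isCompact_adeleCompactBox |>.mono_set adeleBox_subset))).1 hsq
    filter_upwards [h1] with x hx
    simpa using hx
  have hall : ∫⁻ x, ‖f x‖ₑ ∂dx = 0 := by
    rw [lintegral_eq_setLIntegral_tsum isStrictFundDomain_adeleBox hc.measurable.enorm]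
    have hm : Measurable fun x => ∑' a : F, ‖f (x + algebraMap F (Adele F) a)‖ₑ :=
      Measurable.tsum fun a => (hc.comp (continuous_add_const _)).measurable.enorm
    rw [lintegral_eq_zero_iff hm]
    filter_upwards [hae] with x hx
    simp only [hf x, hx, enorm_zero, tsum_zero, Pi.zero_apply]
  have hae2 : f =ᵐ[dx] 0 := by
    rw [lintegral_eq_zero_iff hc.measurable.enorm] at hall
    filter_upwards [hall] with x hx
    simpa using hx
  exact (hc.ae_eq_iff_eq dx continuous_const).1 hae2

/-- Fourier inversion on `𝔸/F`. -/
theorem AdeleCharacter.hasSum_fourier (Ψ : AdeleCharacter ψ) (hvol : dx (adeleBox F) = 1)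
    {f : Adele F → ℂ} (hf : IsPeriodic f) (hc : Continuous f)
    (hs : Summable fun η : F =>
      ‖∫ x in adeleBox F, f x * (ψ (-(algebraMap F (Adele F) η * x)) : ℂ) ∂dx‖) (x : Adele F) :
    HasSum (fun η : F => (∫ x in adeleBox F, f x *
      (ψ (-(algebraMap F (Adele F) η * x)) : ℂ) ∂dx) * (ψ (algebraMap F (Adele F) η * x) : ℂ))
      (f x) := by
  have := countable_numberField (F := F)
  set c : F → ℂ := fun η =>
    ∫ x in adeleBox F, f x * (ψ (-(algebraMap F (Adele F) η * x)) : ℂ) ∂dx with hcdef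
  have hsx : ∀ x, Summable fun η => c η * (ψ (algebraMap F (Adele F) η * x) : ℂ) := fun x =>
    Summable.of_norm (by simp only [norm_mul, Circle.norm_coe, mul_one]; exact hs)
  let g : Adele F → ℂ := fun x => ∑' η, c η * (ψ (algebraMap F (Adele F) η * x) : ℂ)
  have hgc : Continuous g := continuous_tsum (fun η => continuous_const.mul (Ψ.continuous_mul η)) hs
    fun η x => by rw [norm_mul, Circle.norm_coe, mul_one]
  have hgp : IsPeriodic g := fun x a => tsum_congr fun η =>
    congrArg (c η * ·) (Ψ.isPeriodic η x a)
  -- The sum of the series is a continuous function with the same coefficients as `f`, so uniqueness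
  -- identifies the two.
  have hcoef : ∀ ξ, ∫ x in adeleBox F, g x * (ψ (-(algebraMap F (Adele F) ξ * x)) : ℂ) ∂dx = c ξ := by
    intro ξ
    have h1 : ∀ x, g x * (ψ (-(algebraMap F (Adele F) ξ * x)) : ℂ) =
        ∑' η, c η * (ψ (algebraMap F (Adele F) (η - ξ) * x) : ℂ) := by
      intro x
      rw [← tsum_mul_right]
      refine tsum_congr fun η => ?_
      rw [map_sub, sub_mul, sub_eq_add_neg, AddChar.map_add_eq_mul, Circle.coe_mul, mul_assoc]
    simp only [h1]
    rw [← integral_tsum_of_summable_integral_norm]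
    · rw [tsum_eq_single ξ]
      · rw [integral_const_mul]
        simp [Measure.real, hvol]
      · intro η hη
        rw [integral_const_mul, Ψ.integral_monomial (sub_ne_zero.2 hη), mul_zero]
    · exact fun η => integrableOn_adeleBox (continuous_const.mul (Ψ.continuous_mul _))
    · simp only [norm_mul, Circle.norm_coe, mul_one]
      simpa [Measure.real, hvol] using hs
  have hfg : f - g = 0 := by
    refine Ψ.eq_zero_of_fourier_eq_zero (dx := dx) (fun x a => by simp only [Pi.sub_apply, hf x, hgp x])
      (hc.sub hgc) fun η => ?_
    have h2 : ∀ x, (f - g) x * (ψ (algebraMap F (Adele F) η * x) : ℂ) =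
        f x * (ψ (-(algebraMap F (Adele F) (-η) * x)) : ℂ) -
        g x * (ψ (-(algebraMap F (Adele F) (-η) * x)) : ℂ) := by
      intro x
      rw [map_neg (algebraMap F (Adele F)), neg_mul, neg_neg, Pi.sub_apply, sub_mul]
    have hk : Continuous fun x => (ψ (-(algebraMap F (Adele F) (-η) * x)) : ℂ) :=
      continuous_subtype_val.comp (Ψ.continuous.comp (continuous_const_mul _).neg)
    simp only [h2]
    have i1 : IntegrableOn (fun x => f x * (ψ (-(algebraMap F (Adele F) (-η) * x)) : ℂ))
        (adeleBox F) dx := integrableOn_adeleBox (hc.mul hk)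
    have i2 : IntegrableOn (fun x => g x * (ψ (-(algebraMap F (Adele F) (-η) * x)) : ℂ))
        (adeleBox F) dx := integrableOn_adeleBox (hgc.mul hk)
    rw [integral_sub i1 i2, hcoef (-η), sub_self]
  have h3 : f x = g x := sub_eq_zero.1 (congrFun hfg x)
  rw [h3]
  exact (hsx x).hasSum

end fourier

/-! ### Matrix identities in `GSp(4)`. -/

namespace GSp4

section identities

variable {R : Type*} [CommRing R]

theorem ext_matrix {g h : GSp4 R}
    (H : ((g : GL (Fin 4) R) : Matrix (Fin 4) (Fin 4) R) =
      ((h : GL (Fin 4) R) : Matrix (Fin 4) (Fin 4) R)) : g = h :=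
  Subtype.ext (Units.ext H)

theorem coe_mul (g h : GSp4 R) :
    (((g * h : GSp4 R) : GL (Fin 4) R) : Matrix (Fin 4) (Fin 4) R) =
      ((g : GL (Fin 4) R) : Matrix (Fin 4) (Fin 4) R) *
      ((h : GL (Fin 4) R) : Matrix (Fin 4) (Fin 4) R) := rfl

theorem coe_one : (((1 : GSp4 R) : GL (Fin 4) R) : Matrix (Fin 4) (Fin 4) R) = 1 := rfl

theorem coe_ofMatrix (M : Matrix (Fin 4) (Fin 4) R) (ν : Rˣ)
    (h : Mᵀ * sympJ R * M = (ν : R) • sympJ R) :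
    ((ofMatrix M ν h : GL (Fin 4) R) : Matrix (Fin 4) (Fin 4) R) = M := rfl

/-- The unipotent element with entry `x` in the fourth row and second column. -/
def lower (x : R) : GSp4 R := novo 1 x

/-- The element `diag(y, y, 1, 1)`. -/
def siegelTorus (y : Rˣ) : GSp4 R := novo y 0

/-- The permutation matrix of `(1 2)(3 4)`. -/
def swap : GSp4 R :=
  ofMatrix !![0, 1, 0, 0; 1, 0, 0, 0; 0, 0, 0, 1; 0, 0, 1, 0] 1 (by
      ext i j
      fin_cases i <;> fin_cases j <;>
        simp [sympJ, Matrix.mul_apply, Fin.sum_univ_four])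

theorem u_mul (a b c a' b' c' : R) : u a b c * u a' b' c' = u (a + a') (b + b') (c + c') := by
  refine ext_matrix ?_
  simp only [coe_mul, u, coe_ofMatrix]
  ext i j
  fin_cases i <;> fin_cases j <;> simp [Matrix.mul_apply, Fin.sum_univ_four, add_comm]

theorem u_zero : u (0 : R) 0 0 = 1 := by
  refine ext_matrix ?_
  simp only [u, coe_ofMatrix, coe_one]
  ext i j
  fin_cases i <;> fin_cases j <;> simp

theorem n_mul (a b : R) : n a * n b = n (a + b) := by
  refine ext_matrix ?_
  simp only [coe_mul, n, coe_ofMatrix]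
  ext i j
  fin_cases i <;> fin_cases j <;> simp [Matrix.mul_apply, Fin.sum_univ_four, add_comm]

theorem lower_mul (a b : R) : lower a * lower b = lower (a + b) := by
  refine ext_matrix ?_
  simp only [coe_mul, lower, novo, coe_ofMatrix]
  ext i j
  fin_cases i <;> fin_cases j <;> simp [Matrix.mul_apply, Fin.sum_univ_four]

theorem lower_zero : lower (0 : R) = 1 := by
  refine ext_matrix ?_
  simp only [lower, novo, coe_ofMatrix, coe_one]
  ext i j
  fin_cases i <;> fin_cases j <;> simp

theorem siegelTorus_mul (y z : Rˣ) : siegelTorus y * siegelTorus z = siegelTorus (y * z) := by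
  refine ext_matrix ?_
  simp only [coe_mul, siegelTorus, novo, coe_ofMatrix]
  ext i j
  fin_cases i <;> fin_cases j <;> simp [Matrix.mul_apply, Fin.sum_univ_four]

theorem novo_eq (y : Rˣ) (x : R) : novo y x = siegelTorus y * lower x := by
  refine ext_matrix ?_
  simp only [coe_mul, siegelTorus, lower, novo, coe_ofMatrix]
  ext i j
  fin_cases i <;> fin_cases j <;> simp [Matrix.mul_apply, Fin.sum_univ_four]

theorem lower_mul_siegelTorus (x : R) (y : Rˣ) :
    lower x * siegelTorus y = siegelTorus y * lower (y * x) := by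
  refine ext_matrix ?_
  simp only [coe_mul, siegelTorus, lower, novo, coe_ofMatrix]
  ext i j
  fin_cases i <;> fin_cases j <;> simp [Matrix.mul_apply, Fin.sum_univ_four, mul_comm]

theorem u_mul_siegelTorus (y : Rˣ) (a b c : R) :
    u (y * a) (y * b) (y * c) * siegelTorus y = siegelTorus y * u a b c := by
  refine ext_matrix ?_
  simp only [coe_mul, siegelTorus, u, novo, coe_ofMatrix]
  ext i j
  fin_cases i <;> fin_cases j <;> simp [Matrix.mul_apply, Fin.sum_univ_four]

theorem n_mul_siegelTorus (y : Rˣ) (b : R) : n b * siegelTorus y = siegelTorus y * n b := by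
  refine ext_matrix ?_
  simp only [coe_mul, siegelTorus, n, novo, coe_ofMatrix]
  ext i j
  fin_cases i <;> fin_cases j <;> simp [Matrix.mul_apply, Fin.sum_univ_four, mul_comm]

theorem n_mul_lower (b x : R) : n b * lower x = lower x * n b := by
  refine ext_matrix ?_
  simp only [coe_mul, n, lower, novo, coe_ofMatrix]
  ext i j
  fin_cases i <;> fin_cases j <;> simp [Matrix.mul_apply, Fin.sum_univ_four]

theorem u_mul_lower (a x : R) : u a 0 0 * lower x = lower x * u a 0 0 := by
  refine ext_matrix ?_
  simp only [coe_mul, u, lower, novo, coe_ofMatrix]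
  ext i j
  fin_cases i <;> fin_cases j <;> simp [Matrix.mul_apply, Fin.sum_univ_four]

theorem n_mul_u (x a b c : R) :
    n x * u a b c = u (a + 2 * x * b + c * x ^ 2) (b + c * x) c * n x := by
  refine ext_matrix ?_
  simp only [coe_mul, u, n, coe_ofMatrix]
  ext i j
  fin_cases i <;> fin_cases j <;> simp [Matrix.mul_apply, Fin.sum_univ_four] <;> ring

/-- The factor `n (-(x * b))` carries the character `ψ(-xb)`. It is used twice: to identify the
Fourier coefficients along `u 0 b 0`, and to prove decay and bounded support in `x`. -/
theorem lower_mul_u (x b : R) :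
    lower x * u 0 b 0 = n (-(x * b)) * u (x * b ^ 2) b 0 * lower x := by
  refine ext_matrix ?_
  simp only [coe_mul, u, n, lower, novo, coe_ofMatrix]
  ext i j
  fin_cases i <;> fin_cases j <;> simp [Matrix.mul_apply, Fin.sum_univ_four] <;> ring

/-- After this conjugation the variable `b`, which carries `ψ` in the Bessel coefficient, sits in `n
b`, as in the Whittaker function. -/
theorem weyl_mul_identity (a b c : R) (y : Rˣ) :
    u a b c * besselTorus y * weyl = weyl * (u a 0 0 * n b * lower (-c) * siegelTorus y) := by
  refine ext_matrix ?_
  simp only [coe_mul, u, n, lower, novo, siegelTorus, besselTorus, weyl, coe_ofMatrix]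
  ext i j
  fin_cases i <;> fin_cases j <;> simp [Matrix.mul_apply, Fin.sum_univ_four]

theorem swap_mul_u (a b c : R) : swap * u a b c = u c b a * swap := by
  refine ext_matrix ?_
  simp only [coe_mul, u, swap, coe_ofMatrix]
  ext i j
  fin_cases i <;> fin_cases j <;> simp [Matrix.mul_apply, Fin.sum_univ_four]

/-- The source of the symmetry `y ↦ y⁻¹` of the Bessel coefficient, with the central character at
`y` as the multiplier. -/
theorem swap_mul_besselTorus (y : Rˣ) :
    swap * besselTorus y = scalar y * (besselTorus y⁻¹ * swap) := by
  refine ext_matrix ?_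
  simp only [coe_mul, besselTorus, swap, scalar, coe_ofMatrix]
  ext i j
  fin_cases i <;> fin_cases j <;> simp [Matrix.mul_apply, Fin.sum_univ_four]

theorem scalar_comm (z : Rˣ) (g : GSp4 R) : scalar z * g = g * scalar z := by
  refine ext_matrix ?_
  have h : ((scalar z : GL (Fin 4) R) : Matrix (Fin 4) (Fin 4) R) = (z : R) • 1 := by
    simp only [scalar, coe_ofMatrix]
    ext i j
    fin_cases i <;> fin_cases j <;> simp
  rw [coe_mul, coe_mul, h]
  simp

/-- The unipotent subgroup conjugate to `u(0, 0, ·)` by `lower 1`. -/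
def mixed (q : R) : GSp4 R := lower (-1) * u 0 0 q * lower 1

theorem mixed_mul (p q : R) : mixed p * mixed q = mixed (p + q) := by
  have h : lower (1 : R) * lower (-1) = 1 := by rw [lower_mul, add_neg_cancel, lower_zero]
  calc mixed p * mixed q = lower (-1) * u 0 0 p * (lower 1 * lower (-1)) * u 0 0 q * lower 1 := by
        simp only [mixed, mul_assoc]
    _ = lower (-1) * (u 0 0 p * u 0 0 q) * lower 1 := by rw [h]; simp only [mul_assoc, one_mul]
    _ = _ := by rw [u_mul]; simp [mixed]

/-- An identity in the `SL(2)` of rows and columns two and four: for `1 - cx` invertible, the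
conjugate of `u 0 0 c` by `lower x` is a product of three unipotents. To first order in `c` the
parameters are `c(1 - x)`, `cx` and `cx(1 - x)`. Using `mixed` in place of the diagonal torus makes
every factor the image of a homomorphism from the additive group. -/
theorem u_mul_lower_eq (c x q : R) (hq : q * (1 - c * x) = 1) :
    u 0 0 c * lower x = lower x * (u 0 0 (c * (1 - x) * q) * mixed (c * x) *
      lower (c * x * (1 - x) * q)) := by
  refine ext_matrix ?_
  simp only [coe_mul, u, mixed, lower, novo, coe_ofMatrix]
  ext i j
  fin_cases i <;> fin_cases j <;> simp [Matrix.mul_apply, Fin.sum_univ_four]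
  · linear_combination (-(c * (1 - x) * (c * x * (1 - x) * q))) * hq
  · linear_combination (-(c * (1 - x))) * hq
  · linear_combination (-(x * (c * (1 - x) * (c * x * (1 - x) * q))) - c * x * (1 - x)) * hq
  · linear_combination (-(x * (c * (1 - x)))) * hq

end identities

end GSp4

/-! ### Functoriality and continuity of the standard elements. -/

namespace GSp4

section functoriality

variable {R S : Type*} [CommRing R] [CommRing S] (f : R →+* S)

theorem coe_map (g : GSp4 R) :
    ((GSp4.map f g : GL (Fin 4) S) : Matrix (Fin 4) (Fin 4) S) =
      ((g : GL (Fin 4) R) : Matrix (Fin 4) (Fin 4) R).map f := rfl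

theorem map_u (a b c : R) : GSp4.map f (u a b c) = u (f a) (f b) (f c) := by
  refine ext_matrix ?_
  simp only [coe_map, u, coe_ofMatrix]
  ext i j
  fin_cases i <;> fin_cases j <;> simp

theorem map_n (a : R) : GSp4.map f (n a) = n (f a) := by
  refine ext_matrix ?_
  simp only [coe_map, n, coe_ofMatrix]
  ext i j
  fin_cases i <;> fin_cases j <;> simp

theorem map_novo (y : Rˣ) (x : R) :
    GSp4.map f (novo y x) = novo (Units.map f.toMonoidHom y) (f x) := by
  refine ext_matrix ?_
  simp only [coe_map, novo, coe_ofMatrix]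
  ext i j
  fin_cases i <;> fin_cases j <;> simp

theorem map_lower (x : R) : GSp4.map f (lower x) = lower (f x) := by
  rw [lower, map_novo, map_one]; rfl

theorem map_siegelTorus (y : Rˣ) :
    GSp4.map f (siegelTorus y) = siegelTorus (Units.map f.toMonoidHom y) := by
  rw [siegelTorus, map_novo, map_zero]; rfl

theorem map_weyl : GSp4.map f (weyl : GSp4 R) = weyl := by
  refine ext_matrix ?_
  simp only [coe_map, weyl, coe_ofMatrix]
  ext i j
  fin_cases i <;> fin_cases j <;> simp

theorem map_swap : GSp4.map f (swap : GSp4 R) = swap := by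
  refine ext_matrix ?_
  simp only [coe_map, swap, coe_ofMatrix]
  ext i j
  fin_cases i <;> fin_cases j <;> simp

end functoriality

section continuity

variable {R : Type*} [CommRing R] [TopologicalSpace R] [IsTopologicalRing R]

theorem continuous_ofMatrix {X : Type*} [TopologicalSpace X] {M : X → Matrix (Fin 4) (Fin 4) R}
    {ν : X → Rˣ} (h : ∀ x, (M x)ᵀ * sympJ R * M x = (ν x : R) • sympJ R) (hM : Continuous M)
    (hν : Continuous ν) : Continuous fun x => ofMatrix (M x) (ν x) (h x) := by
  refine Continuous.subtype_mk ?_ _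
  rw [Units.continuous_iff]
  refine ⟨hM, ?_⟩
  have h1 : Continuous fun x => (((ν x)⁻¹ : Rˣ) : R) • -(sympJ R * (M x)ᵀ * sympJ R) :=
    (Units.continuous_val.comp hν.inv).smul
      (((continuous_const.mul hM.matrix_transpose).mul continuous_const).neg)
  exact h1

variable {X : Type*} [TopologicalSpace X]

@[fun_prop]
theorem continuous_u {a b c : X → R} (ha : Continuous a) (hb : Continuous b) (hc : Continuous c) :
    Continuous fun x => u (a x) (b x) (c x) := by
  refine continuous_ofMatrix _ (continuous_matrix fun i j => ?_) continuous_const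
  fin_cases i <;> fin_cases j <;> simp <;> fun_prop

@[fun_prop]
theorem continuous_n {a : X → R} (ha : Continuous a) : Continuous fun x => n (a x) := by
  refine continuous_ofMatrix _ (continuous_matrix fun i j => ?_) continuous_const
  fin_cases i <;> fin_cases j <;> simp <;> fun_prop

@[fun_prop]
theorem continuous_novo {y : X → Rˣ} {a : X → R} (hy : Continuous y) (ha : Continuous a) :
    Continuous fun x => novo (y x) (a x) := by
  refine continuous_ofMatrix _ (continuous_matrix fun i j => ?_) hy
  have := Units.continuous_val.comp hy
  fin_cases i <;> fin_cases j <;> simp <;> first | exact this | fun_prop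

@[fun_prop]
theorem continuous_lower {a : X → R} (ha : Continuous a) : Continuous fun x => lower (a x) :=
  continuous_novo continuous_const ha

@[fun_prop]
theorem continuous_siegelTorus {y : X → Rˣ} (hy : Continuous y) :
    Continuous fun x => siegelTorus (y x) :=
  continuous_novo hy continuous_const

@[fun_prop]
theorem continuous_scalar {y : X → Rˣ} (hy : Continuous y) :
    Continuous fun x => scalar (y x) := by
  refine continuous_ofMatrix _ (continuous_matrix fun i j => ?_) (hy.mul hy)
  have := Units.continuous_val.comp hy
  fin_cases i <;> fin_cases j <;> simp <;> first | exact this | fun_prop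

@[fun_prop]
theorem continuous_mixed {a : X → R} (ha : Continuous a) : Continuous fun x => mixed (a x) :=
  (continuous_const.mul (continuous_u continuous_const continuous_const ha)).mul continuous_const

theorem continuous_entry (i j : Fin 4) :
    Continuous fun g : GSp4 R => ((g : GL (Fin 4) R) : Matrix (Fin 4) (Fin 4) R) i j :=
  (Units.continuous_val.comp continuous_subtype_val).matrix_elem i j

end continuity

end GSp4

/-! ### The adelic height is submultiplicative up to a constant, and its growth on the relevant
elements. -/

section heights

open IsDedekindDomain mixedEmbedding GSp4
open scoped Classical

variable {F : Type*} [Field F] [NumberField F]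

/-- The largest value of `N` at the entries of `g` and `g⁻¹`. -/
def entrySup (N : Adele F → ℝ) (g : GSp4 (Adele F)) : ℝ :=
  ⨆ p : Fin 4 × Fin 4, max (N ((g : GL (Fin 4) (Adele F)) p.1 p.2))
    (N (((g⁻¹ : GSp4 (Adele F)) : GL (Fin 4) (Adele F)) p.1 p.2))

theorem adelicHeight_eq (g : GSp4 (Adele F)) :
    adelicHeight g = (∏ v : InfinitePlace F, entrySup (fun x => ‖x.1 v‖) g ^ v.mult) *
      ∏ᶠ v : HeightOneSpectrum (𝓞 F), entrySup (fun x => ‖x.2 v‖) g := rfl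

theorem entrySup_le {N : Adele F → ℝ} {g : GSp4 (Adele F)} {B : ℝ}
    (h : ∀ i j, N ((g : GL (Fin 4) (Adele F)) i j) ≤ B)
    (h' : ∀ i j, N (((g⁻¹ : GSp4 (Adele F)) : GL (Fin 4) (Adele F)) i j) ≤ B) :
    entrySup N g ≤ B :=
  ciSup_le fun _ => max_le (h _ _) (h' _ _)

theorem le_entrySup (N : Adele F → ℝ) (g : GSp4 (Adele F)) (i j : Fin 4) :
    N ((g : GL (Fin 4) (Adele F)) i j) ≤ entrySup N g :=
  (le_max_left _ _).trans (le_ciSup (f := fun p : Fin 4 × Fin 4 =>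
    max (N ((g : GL (Fin 4) (Adele F)) p.1 p.2))
    (N (((g⁻¹ : GSp4 (Adele F)) : GL (Fin 4) (Adele F)) p.1 p.2))) (Set.finite_range _).bddAbove
    (i, j))

theorem entrySup_inv (N : Adele F → ℝ) (g : GSp4 (Adele F)) : entrySup N g⁻¹ = entrySup N g := by
  simp only [entrySup, inv_inv, max_comm]

theorem entrySup_nonneg {N : Adele F → ℝ} (hN : ∀ x, 0 ≤ N x) (g : GSp4 (Adele F)) :
    0 ≤ entrySup N g := (hN _).trans (le_entrySup N g 0 0)

theorem entry_mul (g h : GSp4 (Adele F)) (i j : Fin 4) :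
    ((g * h : GSp4 (Adele F)) : GL (Fin 4) (Adele F)) i j =
      ∑ k, (g : GL (Fin 4) (Adele F)) i k * (h : GL (Fin 4) (Adele F)) k j :=
  Matrix.mul_apply

theorem entrySup_mul_le {N : Adele F → ℝ} (hN : ∀ x, 0 ≤ N x)
    (hadd : ∀ x y, N (x + y) ≤ N x + N y) (hmul : ∀ x y, N (x * y) = N x * N y)
    (g h : GSp4 (Adele F)) : entrySup N (g * h) ≤ 4 * (entrySup N g * entrySup N h) := by
  have key : ∀ (g h : GSp4 (Adele F)) (i j : Fin 4),
      N (((g * h : GSp4 (Adele F)) : GL (Fin 4) (Adele F)) i j) ≤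
        4 * (entrySup N g * entrySup N h) := by
    intro g h i j
    have h1 : ∀ k, N ((g : GL (Fin 4) (Adele F)) i k * (h : GL (Fin 4) (Adele F)) k j) ≤
        entrySup N g * entrySup N h := fun k => by
      rw [hmul]
      exact mul_le_mul (le_entrySup _ _ _ _) (le_entrySup _ _ _ _) (hN _) (entrySup_nonneg hN _)
    rw [entry_mul, Fin.sum_univ_four]
    linarith [hadd ((g : GL (Fin 4) (Adele F)) i 0 * (h : GL (Fin 4) (Adele F)) 0 j +
      (g : GL (Fin 4) (Adele F)) i 1 * (h : GL (Fin 4) (Adele F)) 1 j +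
      (g : GL (Fin 4) (Adele F)) i 2 * (h : GL (Fin 4) (Adele F)) 2 j)
      ((g : GL (Fin 4) (Adele F)) i 3 * (h : GL (Fin 4) (Adele F)) 3 j),
      hadd ((g : GL (Fin 4) (Adele F)) i 0 * (h : GL (Fin 4) (Adele F)) 0 j +
      (g : GL (Fin 4) (Adele F)) i 1 * (h : GL (Fin 4) (Adele F)) 1 j)
      ((g : GL (Fin 4) (Adele F)) i 2 * (h : GL (Fin 4) (Adele F)) 2 j),
      hadd ((g : GL (Fin 4) (Adele F)) i 0 * (h : GL (Fin 4) (Adele F)) 0 j)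
      ((g : GL (Fin 4) (Adele F)) i 1 * (h : GL (Fin 4) (Adele F)) 1 j), h1 0, h1 1, h1 2, h1 3]
  refine entrySup_le (key g h) fun i j => ?_
  rw [mul_inv_rev]
  refine (key _ _ i j).trans_eq ?_
  rw [entrySup_inv, entrySup_inv, mul_comm (entrySup N h)]

theorem entrySup_mul_le_of_ultrametric {N : Adele F → ℝ} (hN : ∀ x, 0 ≤ N x)
    (hadd : ∀ x y, N (x + y) ≤ max (N x) (N y)) (hmul : ∀ x y, N (x * y) = N x * N y)
    (g h : GSp4 (Adele F)) : entrySup N (g * h) ≤ entrySup N g * entrySup N h := by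
  have key : ∀ (g h : GSp4 (Adele F)) (i j : Fin 4),
      N (((g * h : GSp4 (Adele F)) : GL (Fin 4) (Adele F)) i j) ≤
        entrySup N g * entrySup N h := by
    intro g h i j
    have h1 : ∀ k, N ((g : GL (Fin 4) (Adele F)) i k * (h : GL (Fin 4) (Adele F)) k j) ≤
        entrySup N g * entrySup N h := fun k => by
      rw [hmul]
      exact mul_le_mul (le_entrySup _ _ _ _) (le_entrySup _ _ _ _) (hN _) (entrySup_nonneg hN _)
    rw [entry_mul, Fin.sum_univ_four]
    exact (hadd _ _).trans (max_le ((hadd _ _).trans (max_le ((hadd _ _).trans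
      (max_le (h1 0) (h1 1))) (h1 2))) (h1 3))
  refine entrySup_le (key g h) fun i j => ?_
  rw [mul_inv_rev]
  refine (key _ _ i j).trans_eq ?_
  rw [entrySup_inv, entrySup_inv, mul_comm (entrySup N h)]

theorem norm_snd_add_le (v : HeightOneSpectrum (𝓞 F)) (x y : Adele F) :
    ‖(x + y).2 v‖ ≤ max ‖x.2 v‖ ‖y.2 v‖ :=
  IsUltrametricDist.norm_add_le_max (x.2 v) (y.2 v)

theorem norm_snd_mul (v : HeightOneSpectrum (𝓞 F)) (x y : Adele F) :
    ‖(x * y).2 v‖ = ‖x.2 v‖ * ‖y.2 v‖ := norm_mul (x.2 v) (y.2 v)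

theorem entrySup_snd_mul_le (v : HeightOneSpectrum (𝓞 F)) (g h : GSp4 (Adele F)) :
    entrySup (fun x => ‖x.2 v‖) (g * h) ≤
      entrySup (fun x => ‖x.2 v‖) g * entrySup (fun x => ‖x.2 v‖) h :=
  entrySup_mul_le_of_ultrametric (fun _ => norm_nonneg _) (norm_snd_add_le v) (norm_snd_mul v) g h

/-- Ultrametric submultiplicativity applied to `g g⁻¹ = 1` shows that the square of this quantity is
at least `1`. -/
theorem one_le_entrySup_snd (v : HeightOneSpectrum (𝓞 F)) (g : GSp4 (Adele F)) :
    1 ≤ entrySup (fun x => ‖x.2 v‖) g := by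
  have h1 := entrySup_snd_mul_le v g g⁻¹
  rw [mul_inv_cancel, entrySup_inv] at h1
  have h2 : (1 : ℝ) ≤ entrySup (fun x : Adele F => ‖x.2 v‖) 1 := by
    refine le_trans ?_ (le_entrySup _ _ 0 0)
    exact (norm_one (α := v.adicCompletion F)).ge
  nlinarith [entrySup_nonneg (N := fun x : Adele F => ‖x.2 v‖) (fun _ => norm_nonneg _) g]

theorem entrySup_snd_eq_one {v : HeightOneSpectrum (𝓞 F)} {g : GSp4 (Adele F)}
    (h : ∀ i j, ((g : GL (Fin 4) (Adele F)) i j).2 v ∈ v.adicCompletionIntegers F)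
    (h' : ∀ i j, (((g⁻¹ : GSp4 (Adele F)) : GL (Fin 4) (Adele F)) i j).2 v ∈
      v.adicCompletionIntegers F) : entrySup (fun x => ‖x.2 v‖) g = 1 :=
  le_antisymm (entrySup_le (fun i j => (norm_le_one_iff_mem_adicCompletionIntegers v _).2 (h i j))
    fun i j => (norm_le_one_iff_mem_adicCompletionIntegers v _).2 (h' i j))
    (one_le_entrySup_snd v g)

theorem hasFiniteMulSupport_entrySup (g : GSp4 (Adele F)) :
    Function.HasFiniteMulSupport fun v : HeightOneSpectrum (𝓞 F) =>
      entrySup (fun x => ‖x.2 v‖) g := by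
  have h : ∀ g : GSp4 (Adele F), ∀ᶠ v : HeightOneSpectrum (𝓞 F) in Filter.cofinite, ∀ i j,
      ((g : GL (Fin 4) (Adele F)) i j).2 v ∈ v.adicCompletionIntegers F := fun g => by
    simp only [Filter.eventually_all]
    exact fun i j => finiteAdele_eventually_integral _
  have h3 : ∀ᶠ v : HeightOneSpectrum (𝓞 F) in Filter.cofinite,
      entrySup (fun x => ‖x.2 v‖) g = 1 := by
    filter_upwards [h g, h g⁻¹] with v h1 h2 using entrySup_snd_eq_one h1 h2
  exact h3

theorem adelicHeight_nonneg (g : GSp4 (Adele F)) : 0 ≤ adelicHeight g := by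
  rw [adelicHeight_eq]
  exact mul_nonneg (Finset.prod_nonneg fun v _ => pow_nonneg (entrySup_nonneg
    (fun _ => norm_nonneg _) _) _)
    (zero_le_one.trans (one_le_finprod fun v => one_le_entrySup_snd v g))

/-- Only the archimedean places cost a factor: `4` is the number of summands in an entry of the
product, and the local degrees add up to `[F : ℚ]`. -/
theorem adelicHeight_mul_le (g h : GSp4 (Adele F)) :
    adelicHeight (g * h) ≤
      4 ^ Module.finrank ℚ F * (adelicHeight g * adelicHeight h) := by
  have h1 : (∏ v : InfinitePlace F, entrySup (fun x => ‖x.1 v‖) (g * h) ^ v.mult) ≤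
      4 ^ Module.finrank ℚ F * ((∏ v : InfinitePlace F, entrySup (fun x => ‖x.1 v‖) g ^ v.mult) *
        ∏ v : InfinitePlace F, entrySup (fun x => ‖x.1 v‖) h ^ v.mult) := by
    rw [← InfinitePlace.sum_mult_eq (K := F), ← Finset.prod_pow_eq_pow_sum,
      ← Finset.prod_mul_distrib, ← Finset.prod_mul_distrib]
    refine Finset.prod_le_prod (fun v _ => pow_nonneg (entrySup_nonneg
      (fun _ => norm_nonneg _) _) _) fun v _ => ?_
    rw [← mul_pow, ← mul_pow]
    refine pow_le_pow_left₀ (entrySup_nonneg (fun _ => norm_nonneg _) _) ?_ _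
    exact entrySup_mul_le (fun _ => norm_nonneg _) (fun x y => norm_add_le (x.1 v) (y.1 v))
      (fun x y => norm_mul (x.1 v) (y.1 v)) g h
  have h2 : (∏ᶠ v : HeightOneSpectrum (𝓞 F), entrySup (fun x => ‖x.2 v‖) (g * h)) ≤
      (∏ᶠ v : HeightOneSpectrum (𝓞 F), entrySup (fun x => ‖x.2 v‖) g) *
      ∏ᶠ v : HeightOneSpectrum (𝓞 F), entrySup (fun x => ‖x.2 v‖) h := by
    rw [← finprod_mul_distrib (hasFiniteMulSupport_entrySup g) (hasFiniteMulSupport_entrySup h)]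
    exact finprod_le_finprod (hasFiniteMulSupport_entrySup _)
      (fun v => zero_le_one.trans (one_le_entrySup_snd v _))
      ((hasFiniteMulSupport_entrySup g).mul (hasFiniteMulSupport_entrySup h))
      (fun v => entrySup_snd_mul_le v g h)
  rw [adelicHeight_eq, adelicHeight_eq, adelicHeight_eq]
  refine (mul_le_mul h1 h2 (zero_le_one.trans (one_le_finprod fun v => one_le_entrySup_snd v _))
    ?_).trans_eq (by ring)
  have h3 : ∀ g : GSp4 (Adele F),
      0 ≤ ∏ v : InfinitePlace F, entrySup (fun x => ‖x.1 v‖) g ^ v.mult := fun g =>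
    Finset.prod_nonneg fun v _ => pow_nonneg (entrySup_nonneg (fun _ => norm_nonneg _) _) _
  exact mul_nonneg (by positivity) (mul_nonneg (h3 _) (h3 _))

theorem adelicHeight_le_of_forall {g : GSp4 (Adele F)} {B : ℝ}
    (h : ∀ i j, finPart ((g : GL (Fin 4) (Adele F)) i j) ∈ integralAdeles F ∧
      ‖archPart ((g : GL (Fin 4) (Adele F)) i j)‖ ≤ B)
    (h' : ∀ i j, finPart (((g⁻¹ : GSp4 (Adele F)) : GL (Fin 4) (Adele F)) i j) ∈
        integralAdeles F ∧
      ‖archPart (((g⁻¹ : GSp4 (Adele F)) : GL (Fin 4) (Adele F)) i j)‖ ≤ B) :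
    adelicHeight g ≤ B ^ Module.finrank ℚ F := by
  have h1 : (∏ᶠ v : HeightOneSpectrum (𝓞 F), entrySup (fun x => ‖x.2 v‖) g) = 1 := by
    refine finprod_eq_one_of_forall_eq_one fun v => entrySup_snd_eq_one
      (fun i j => (h i j).1 v) fun i j => (h' i j).1 v
  rw [adelicHeight_eq, h1, mul_one, ← InfinitePlace.sum_mult_eq (K := F),
    ← Finset.prod_pow_eq_pow_sum]
  refine Finset.prod_le_prod (fun v _ => pow_nonneg (entrySup_nonneg
      (fun _ => norm_nonneg _) _) _) fun v _ => ?_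
  refine pow_le_pow_left₀ (entrySup_nonneg (fun _ => norm_nonneg _) _) ?_ _
  have key : ∀ x : Adele F, ‖archPart x‖ ≤ B → ‖x.1 v‖ ≤ B := fun x hx => by
    rw [norm_fst_apply]
    rw [norm_eq_sup'_normAtPlace] at hx
    exact (Finset.le_sup' (fun w => normAtPlace w (archPart x)) (Finset.mem_univ v)).trans hx
  exact entrySup_le (fun i j => key _ (h i j).2) fun i j => key _ (h' i j).2

theorem exists_nhds_one_adelicHeight_le :
    ∃ U ∈ 𝓝 (1 : GSp4 (Adele F)), ∀ g ∈ U, adelicHeight g ≤ 2 ^ Module.finrank ℚ F := by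
  have h1 : ∀ᶠ g : GSp4 (Adele F) in 𝓝 1, ∀ i j,
      finPart ((g : GL (Fin 4) (Adele F)) i j) ∈ integralAdeles F ∧
      ‖archPart ((g : GL (Fin 4) (Adele F)) i j)‖ ≤ 2 := by
    simp only [Filter.eventually_all, Filter.eventually_and]
    intro i j
    have hc : Continuous fun g : GSp4 (Adele F) => (g : GL (Fin 4) (Adele F)) i j :=
      continuous_entry i j
    have hij : (((1 : GSp4 (Adele F)) : GL (Fin 4) (Adele F)) i j) = if i = j then 1 else 0 :=
      Matrix.one_apply
    constructor
    · refine (continuous_finPart.comp hc).continuousAt.eventually_mem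
        (isOpen_integralAdeles.mem_nhds ?_)
      change finPart (((1 : GSp4 (Adele F)) : GL (Fin 4) (Adele F)) i j) ∈ integralAdeles F
      rw [hij]
      split_ifs
      · rw [map_one]; exact one_mem _
      · rw [map_zero]; exact zero_mem _
    · have h2 : Continuous fun g : GSp4 (Adele F) =>
          ‖archPart ((g : GL (Fin 4) (Adele F)) i j)‖ := (continuous_archPart.comp hc).norm
      refine (h2.continuousAt.eventually_lt (x₀ := (1 : GSp4 (Adele F)))
        (g := fun _ => (2 : ℝ)) continuousAt_const ?_).mono
        fun g hg => hg.le
      rw [hij]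
      split_ifs
      · rw [map_one, norm_one]; norm_num
      · rw [map_zero, norm_zero]; norm_num
  have h2 : ∀ᶠ g : GSp4 (Adele F) in 𝓝 1, ∀ i j,
      finPart (((g⁻¹ : GSp4 (Adele F)) : GL (Fin 4) (Adele F)) i j) ∈ integralAdeles F ∧
      ‖archPart (((g⁻¹ : GSp4 (Adele F)) : GL (Fin 4) (Adele F)) i j)‖ ≤ 2 := by
    have := (continuous_inv (G := GSp4 (Adele F))).tendsto 1
    rw [inv_one] at this
    exact this.eventually h1
  exact ⟨_, h1.and h2, fun g hg => adelicHeight_le_of_forall hg.1 hg.2⟩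

/-- The height is bounded near `1`, and submultiplicativity transports this bound to a neighbourhood
of every point of `K`. -/
theorem exists_adelicHeight_le_of_isCompact {K : Set (GSp4 (Adele F))} (hK : IsCompact K) :
    ∃ C : ℝ, 0 < C ∧ ∀ g ∈ K, adelicHeight g ≤ C := by
  suffices h : ∃ C : ℝ, ∀ g ∈ K, adelicHeight g ≤ C by
    obtain ⟨C, hC⟩ := h
    exact ⟨max C 1, by positivity, fun g hg => (hC g hg).trans (le_max_left _ _)⟩
  obtain ⟨U, hU, hb⟩ := exists_nhds_one_adelicHeight_le (F := F)
  refine hK.induction_on ⟨0, by simp⟩ (fun s t hst ⟨C, hC⟩ => ⟨C, fun g hg => hC g (hst hg)⟩)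
    (fun s t ⟨C, hC⟩ ⟨C', hC'⟩ => ⟨max C C', fun g hg => hg.elim
      (fun h => (hC g h).trans (le_max_left _ _)) fun h => (hC' g h).trans (le_max_right _ _)⟩)
    fun k _ => ?_
  refine ⟨{g | k⁻¹ * g ∈ U}, mem_nhdsWithin_of_mem_nhds ?_,
    4 ^ Module.finrank ℚ F * (adelicHeight k * 2 ^ Module.finrank ℚ F), fun g hg => ?_⟩
  · have : Continuous fun g : GSp4 (Adele F) => k⁻¹ * g := by fun_prop
    exact this.continuousAt.preimage_mem_nhds (by simpa using hU)
  · have h1 := adelicHeight_mul_le k (k⁻¹ * g)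
    rw [mul_inv_cancel_left] at h1
    refine h1.trans ?_
    gcongr
    · exact adelicHeight_nonneg _
    · exact hb _ hg

theorem adelicHeight_siegelTorus_posIdele_le (t : ℝ) :
    adelicHeight (siegelTorus (posIdele t : (Adele F)ˣ)) ≤
      Real.exp |t| ^ Module.finrank ℚ F := by
  have key : ∀ (s : ℝ), |s| = |t| → ∀ i j,
      finPart ((siegelTorus (posIdele s : (Adele F)ˣ) : GL (Fin 4) (Adele F)) i j) ∈
        integralAdeles F ∧
      ‖archPart ((siegelTorus (posIdele s : (Adele F)ˣ) : GL (Fin 4) (Adele F)) i j)‖ ≤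
        Real.exp |t| := by
    intro s hs i j
    have h0 : finPart (0 : Adele F) ∈ integralAdeles F ∧ ‖archPart (0 : Adele F)‖ ≤
        Real.exp |t| := by
      simp only [map_zero, norm_zero]; exact ⟨zero_mem _, (Real.exp_pos _).le⟩
    have h1 : finPart (1 : Adele F) ∈ integralAdeles F ∧ ‖archPart (1 : Adele F)‖ ≤
        Real.exp |t| := by
      simp only [map_one, norm_one]
      exact ⟨one_mem _, Real.one_le_exp (abs_nonneg _)⟩
    have h2 : finPart ((posIdele s : (Adele F)ˣ) : Adele F) ∈ integralAdeles F ∧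
        ‖archPart ((posIdele s : (Adele F)ˣ) : Adele F)‖ ≤ Real.exp |t| := by
      rw [posIdele_val]
      simp only [finPart_adeleMk, archPart_adeleMk]
      refine ⟨one_mem _, ?_⟩
      rw [_root_.norm_smul, norm_one, mul_one, Real.norm_eq_abs, abs_of_pos (Real.exp_pos _), ← hs]
      exact Real.exp_le_exp.2 (le_abs_self _)
    fin_cases i <;> fin_cases j <;> first | exact h0 | exact h1 | exact h2
  refine adelicHeight_le_of_forall (key t rfl) ?_
  have h3 : (siegelTorus (posIdele t : (Adele F)ˣ))⁻¹ = siegelTorus (posIdele (-t)) := by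
    rw [inv_eq_iff_mul_eq_one, siegelTorus_mul, ← posIdele_add, add_neg_cancel, posIdele_zero]
    exact lower_zero
  rw [h3]
  exact key (-t) (abs_neg t)

theorem adelicHeight_lower_le (w : mixedSpace F) :
    adelicHeight (lower (adeleMk w 0)) ≤ (1 + ‖w‖) ^ Module.finrank ℚ F := by
  have key : ∀ w' : mixedSpace F, ‖w'‖ = ‖w‖ → ∀ i j,
      finPart ((lower (adeleMk w' 0) : GL (Fin 4) (Adele F)) i j) ∈ integralAdeles F ∧
      ‖archPart ((lower (adeleMk w' 0) : GL (Fin 4) (Adele F)) i j)‖ ≤ 1 + ‖w‖ := by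
    intro w' hw i j
    have h0 : finPart (0 : Adele F) ∈ integralAdeles F ∧ ‖archPart (0 : Adele F)‖ ≤ 1 + ‖w‖ := by
      simp only [map_zero, norm_zero]; exact ⟨zero_mem _, by positivity⟩
    have h1 : finPart (1 : Adele F) ∈ integralAdeles F ∧ ‖archPart (1 : Adele F)‖ ≤ 1 + ‖w‖ := by
      simp only [map_one, norm_one]
      exact ⟨one_mem _, by linarith [norm_nonneg w]⟩
    have h2 : finPart (adeleMk w' 0) ∈ integralAdeles F ∧ ‖archPart (adeleMk w' 0)‖ ≤ 1 + ‖w‖ := by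
      simp only [finPart_adeleMk, archPart_adeleMk]
      exact ⟨zero_mem _, by linarith⟩
    fin_cases i <;> fin_cases j <;> first | exact h0 | exact h1 | exact h2
  refine adelicHeight_le_of_forall (key w rfl) ?_
  have h3 : (lower (adeleMk w 0))⁻¹ = lower (adeleMk (-w) 0) := by
    rw [inv_eq_iff_mul_eq_one, lower_mul, ← adeleMk_add]
    simp [lower_zero]
  rw [h3]
  exact key (-w) (norm_neg w)

/-- Growth of the height on the elements `diag(y, y, 1, 1) * lower x`. -/
theorem exists_adelicHeight_novo_le {K : Set (Adele F)ˣ} (hK : IsCompact K)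
    {S : Set (FiniteAdeleRing (𝓞 F) F)} (hS : IsCompact S) :
    ∃ C : ℝ, 0 < C ∧ ∀ (t : ℝ), ∀ k ∈ K, ∀ (w : mixedSpace F), ∀ s ∈ S,
      adelicHeight (siegelTorus (posIdele t * k) * lower (adeleMk w s)) ≤
        C * (Real.exp |t| * (1 + ‖w‖)) ^ Module.finrank ℚ F := by
  obtain ⟨C₁, hC₁, h₁⟩ := exists_adelicHeight_le_of_isCompact
    (hK.image (f := fun y => siegelTorus y) (continuous_siegelTorus continuous_id))
  obtain ⟨C₂, hC₂, h₂⟩ := exists_adelicHeight_le_of_isCompact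
    (hS.image (f := fun s => lower (adeleMk (0 : mixedSpace F) s))
      (continuous_lower (continuous_adeleMk.comp (by fun_prop : Continuous fun s =>
        ((0 : mixedSpace F), s)))))
  set n := Module.finrank ℚ F
  refine ⟨4 ^ n * (4 ^ n * C₁ * (4 ^ n * C₂)), by positivity, fun t k hk w s hs => ?_⟩
  have e1 : siegelTorus (posIdele t * k) * lower (adeleMk w s) =
      (siegelTorus (posIdele t) * siegelTorus k) * (lower (adeleMk w 0) * lower (adeleMk 0 s)) := by
    rw [siegelTorus_mul, lower_mul, ← adeleMk_add, add_zero, zero_add]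
  have a1 := adelicHeight_siegelTorus_posIdele_le (F := F) t
  have a2 := h₁ _ (Set.mem_image_of_mem _ hk)
  have a3 := adelicHeight_lower_le w
  have a4 := h₂ _ (Set.mem_image_of_mem _ hs)
  have p := adelicHeight_nonneg (F := F)
  rw [e1]
  calc _ ≤ 4 ^ n * ((4 ^ n * (Real.exp |t| ^ n * C₁)) * (4 ^ n * ((1 + ‖w‖) ^ n * C₂))) := by
        refine (adelicHeight_mul_le _ _).trans ?_
        have b1 := (adelicHeight_mul_le (siegelTorus (posIdele t)) (siegelTorus k)).trans
          (mul_le_mul_of_nonneg_left (mul_le_mul a1 a2 (p _) (by positivity)) (by positivity))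
        have b2 := (adelicHeight_mul_le (lower (adeleMk w 0)) (lower (adeleMk 0 s))).trans
          (mul_le_mul_of_nonneg_left (mul_le_mul a3 a4 (p _) (by positivity)) (by positivity))
        exact mul_le_mul_of_nonneg_left (mul_le_mul b1 b2 (p _) (by positivity)) (by positivity)
    _ = _ := by rw [mul_pow]; ring

end heights

/-! ### Smooth functions of uniform moderate growth. -/

section smooth

variable {F : Type*} [Field F] [NumberField F]

theorem OneParam.map_add (γ : OneParam F) (s t : ℝ) :
    γ (Multiplicative.ofAdd (s + t)) =
      γ (Multiplicative.ofAdd s) * γ (Multiplicative.ofAdd t) := by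
  rw [ofAdd_add, map_mul]

theorem OneParam.map_zero (γ : OneParam F) : γ (Multiplicative.ofAdd 0) = 1 := by
  rw [ofAdd_zero, map_one]

theorem OneParam.continuous (γ : OneParam F) :
    Continuous fun t : ℝ => γ (Multiplicative.ofAdd t) :=
  γ.continuous_toFun.comp continuous_ofAdd

theorem iterLieDeriv_cons (γ : OneParam F) (L : List (OneParam F)) (Φ : GSp4 (Adele F) → ℂ) :
    iterLieDeriv (γ :: L) Φ = lieDeriv γ (iterLieDeriv L Φ) := rfl

theorem iterLieDeriv_append_singleton (γ : OneParam F) (L : List (OneParam F))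
    (Φ : GSp4 (Adele F) → ℂ) : iterLieDeriv (L ++ [γ]) Φ = iterLieDeriv L (lieDeriv γ Φ) := by
  simp [iterLieDeriv]

/-- Smooth functions all of whose derivatives satisfy the growth condition with exponent `N` and
with constants `C`. -/
structure IsSmoothMod (N : ℕ) (C : List (OneParam F) → ℝ) (Φ : GSp4 (Adele F) → ℂ) : Prop where
  nonneg : ∀ L, 0 ≤ C L
  differentiable : ∀ (L : List (OneParam F)) (γ : OneParam F) (g : GSp4 (Adele F)),
    DifferentiableAt ℝ (fun t : ℝ => iterLieDeriv L Φ (g * γ (Multiplicative.ofAdd t))) 0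
  continuous : ∀ L : List (OneParam F), Continuous (iterLieDeriv L Φ)
  growth : ∀ (L : List (OneParam F)) (g : GSp4 (Adele F)),
    ‖iterLieDeriv L Φ g‖ ≤ C L * adelicHeight g ^ N

theorem IsCuspForm.exists_isSmoothMod {ν : Measure (Adele F ⧸ principalAdeles F)}
    {φ : GSp4 (Adele F) → ℂ} (hφ : IsCuspForm ν φ) : ∃ N C, IsSmoothMod N C φ := by
  obtain ⟨N, hN⟩ := hφ.uniform_moderate_growth
  choose C hC using hN
  refine ⟨N, fun L => max (C L) 0, fun L => le_max_right _ _, hφ.differentiable, hφ.continuous,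
    fun L g => (hC L g).trans ?_⟩
  have := adelicHeight_nonneg g
  gcongr
  exact le_max_left _ _

namespace IsSmoothMod

variable {N : ℕ} {C : List (OneParam F) → ℝ} {Φ : GSp4 (Adele F) → ℂ}

theorem norm_le (h : IsSmoothMod N C Φ) (g : GSp4 (Adele F)) :
    ‖Φ g‖ ≤ C [] * adelicHeight g ^ N := h.growth [] g

/-- A derivative shifts the family of constants but keeps the exponent `N`. Every induction on the
order of decay depends on this. -/
theorem lie (h : IsSmoothMod N C Φ) (γ : OneParam F) :
    IsSmoothMod N (fun L => C (L ++ [γ])) (lieDeriv γ Φ) where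
  nonneg L := h.nonneg _
  differentiable L γ' g := by
    rw [← iterLieDeriv_append_singleton]; exact h.differentiable _ _ _
  continuous L := by rw [← iterLieDeriv_append_singleton]; exact h.continuous _
  growth L g := by rw [← iterLieDeriv_append_singleton]; exact h.growth _ _

end IsSmoothMod

theorem hasDerivAt_lieDeriv {Φ : GSp4 (Adele F) → ℂ} {γ : OneParam F}
    (h : ∀ g : GSp4 (Adele F),
      DifferentiableAt ℝ (fun t : ℝ => Φ (g * γ (Multiplicative.ofAdd t))) 0)
    (g : GSp4 (Adele F)) (t : ℝ) :
    HasDerivAt (fun t : ℝ => Φ (g * γ (Multiplicative.ofAdd t)))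
      (lieDeriv γ Φ (g * γ (Multiplicative.ofAdd t))) t := by
  have h1 := (h (g * γ (Multiplicative.ofAdd t))).hasDerivAt
  have h2 : HasDerivAt (fun s : ℝ => s - t) 1 t := (hasDerivAt_id t).sub_const t
  have h3 := HasDerivAt.scomp_of_eq (h := fun s : ℝ => s - t) t h1 h2 (sub_self t).symm
  rw [one_smul] at h3
  refine h3.congr_of_eventuallyEq (Filter.Eventually.of_forall fun s => ?_)
  simp only [Function.comp_apply]
  rw [mul_assoc, ← OneParam.map_add, add_sub_cancel]

theorem IsSmoothMod.hasDerivAt {N : ℕ} {C : List (OneParam F) → ℝ} {Φ : GSp4 (Adele F) → ℂ}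
    (h : IsSmoothMod N C Φ) (γ : OneParam F) (g : GSp4 (Adele F)) (t : ℝ) :
    HasDerivAt (fun t : ℝ => Φ (g * γ (Multiplicative.ofAdd t)))
      (lieDeriv γ Φ (g * γ (Multiplicative.ofAdd t))) t :=
  hasDerivAt_lieDeriv (h.differentiable [] γ) g t

end smooth

/-! ### Averages over `F\𝔸` of smooth functions. -/

section average

open GSp4

variable {F : Type*} [Field F] [NumberField F] (dx : Measure (Adele F)) [dx.IsAddHaarMeasure]

theorem continuous_setIntegral_adeleBox {X : Type*} [TopologicalSpace X] {f : X → Adele F → ℂ}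
    (hf : Continuous (Function.uncurry f)) :
    Continuous fun p => ∫ x in adeleBox F, f p x ∂dx := by
  have hc : ∀ p, Continuous (f p) := fun p => hf.comp (by fun_prop : Continuous fun x => (p, x))
  have hi : ∀ p, IntegrableOn (f p) (adeleBox F) dx := fun p => integrableOn_adeleBox (hc p)
  have hfin : dx (adeleBox F) < ∞ := measure_adeleBox_lt_top dx
  rw [continuous_iff_continuousAt]
  intro p
  rw [ContinuousAt, Metric.tendsto_nhds]
  intro ε hε
  set m := dx.real (adeleBox F)
  have hm : 0 ≤ m := measureReal_nonneg
  have h1 : ∀ᶠ q in 𝓝 p, ∀ x ∈ adeleCompactBox F, dist (f q x) (f p x) < ε / (m + 1) := by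
    refine isCompact_adeleCompactBox.eventually_forall_of_forall_eventually fun x _ => ?_
    have h2 : Continuous fun z : X × Adele F => dist (f z.1 z.2) (f p z.2) :=
      (hf.dist ((hc p).comp continuous_snd))
    refine h2.continuousAt.eventually_lt continuousAt_const ?_
    simp only [dist_self]
    positivity
  filter_upwards [h1] with q hq
  rw [dist_eq_norm, ← integral_sub (hi q) (hi p)]
  have h3 : ‖∫ x in adeleBox F, (f q x - f p x) ∂dx‖ ≤ ε / (m + 1) * m :=
    norm_setIntegral_le_of_norm_le_const hfin fun x hx => by
      rw [← dist_eq_norm]; exact (hq x (adeleBox_subset hx)).le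
  refine h3.trans_lt ?_
  rw [div_mul_eq_mul_div, div_lt_iff₀ (by positivity)]
  nlinarith

theorem hasDerivAt_setIntegral_adeleBox {f f' : ℝ → Adele F → ℂ}
    (hf : Continuous (Function.uncurry f)) (hf' : Continuous (Function.uncurry f'))
    (hd : ∀ t x, HasDerivAt (fun t => f t x) (f' t x) t) :
    HasDerivAt (fun t => ∫ x in adeleBox F, f t x ∂dx) (∫ x in adeleBox F, f' 0 x ∂dx) 0 := by
  have hc : ∀ p, Continuous (f p) := fun p => hf.comp (by fun_prop : Continuous fun x => (p, x))
  have hc' : ∀ p, Continuous (f' p) := fun p => hf'.comp (by fun_prop : Continuous fun x => (p, x))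
  obtain ⟨B, hB⟩ := ((isCompact_Icc (a := (-1 : ℝ)) (b := 1)).prod
    (isCompact_adeleCompactBox (F := F))).exists_bound_of_continuousOn hf'.continuousOn
  have hfin : dx (adeleBox F) < ∞ := measure_adeleBox_lt_top dx
  refine (hasDerivAt_integral_of_dominated_loc_of_deriv_le (μ := dx.restrict (adeleBox F))
    (F := f) (F' := f') (x₀ := (0 : ℝ)) (s := Metric.ball 0 1) (bound := fun _ => B)
    (Metric.ball_mem_nhds _ one_pos)
    (Filter.Eventually.of_forall fun t => (integrableOn_adeleBox (hc t)).aestronglyMeasurable)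
    (integrableOn_adeleBox (hc 0)) (integrableOn_adeleBox (hc' 0)).aestronglyMeasurable
    ?_ ?_ (Filter.Eventually.of_forall fun x t _ => hd t x)).2
  · refine (ae_restrict_iff' measurableSet_adeleBox).2 (Filter.Eventually.of_forall ?_)
    intro x hx t ht
    refine hB (t, x) ⟨?_, adeleBox_subset hx⟩
    rw [Metric.mem_ball, dist_zero_right, Real.norm_eq_abs, abs_lt] at ht
    exact ⟨ht.1.le, ht.2.le⟩
  · exact integrableOn_const hfin.ne

/-- The average of the left translates of `Φ` by `ι x`, `x` in the box, against `χ`. -/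
def boxAverage (ι : Adele F → GSp4 (Adele F)) (χ : Adele F → ℂ) (Φ : GSp4 (Adele F) → ℂ)
    (g : GSp4 (Adele F)) : ℂ :=
  ∫ x in adeleBox F, Φ (ι x * g) * χ x ∂dx

variable {dx} {ι : Adele F → GSp4 (Adele F)} {χ : Adele F → ℂ} {Φ : GSp4 (Adele F) → ℂ}

theorem continuous_boxAverage (hι : Continuous ι) (hχ : Continuous χ) (hΦ : Continuous Φ) :
    Continuous (boxAverage dx ι χ Φ) := by
  refine continuous_setIntegral_adeleBox dx (f := fun g x => Φ (ι x * g) * χ x) ?_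
  exact (hΦ.comp ((hι.comp continuous_snd).mul continuous_fst)).mul (hχ.comp continuous_snd)

theorem hasDerivAt_boxAverage (hι : Continuous ι) (hχ : Continuous χ) (hΦ : Continuous Φ)
    {γ : OneParam F} (hd : ∀ g : GSp4 (Adele F),
      DifferentiableAt ℝ (fun t : ℝ => Φ (g * γ (Multiplicative.ofAdd t))) 0)
    (hΦ' : Continuous (lieDeriv γ Φ)) (g : GSp4 (Adele F)) :
    HasDerivAt (fun t : ℝ => boxAverage dx ι χ Φ (g * γ (Multiplicative.ofAdd t)))
      (boxAverage dx ι χ (lieDeriv γ Φ) g) 0 := by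
  have key : ∀ Ψ : GSp4 (Adele F) → ℂ, Continuous Ψ → Continuous (Function.uncurry
      fun (t : ℝ) (x : Adele F) => Ψ (ι x * (g * γ (Multiplicative.ofAdd t))) * χ x) :=
    fun Ψ hΨ => (hΨ.comp ((hι.comp continuous_snd).mul (continuous_const.mul
      (γ.continuous.comp continuous_fst)))).mul (hχ.comp continuous_snd)
  have h := hasDerivAt_setIntegral_adeleBox dx (key Φ hΦ) (key _ hΦ') fun t x => by
    simp only [← mul_assoc]
    exact (hasDerivAt_lieDeriv hd (ι x * g) t).mul_const (χ x)
  simp only [OneParam.map_zero, mul_one] at h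
  exact h

theorem iterLieDeriv_boxAverage (hι : Continuous ι) (hχ : Continuous χ) {N : ℕ}
    {C : List (OneParam F) → ℝ} (hΦ : IsSmoothMod N C Φ) (L : List (OneParam F)) :
    iterLieDeriv L (boxAverage dx ι χ Φ) = boxAverage dx ι χ (iterLieDeriv L Φ) := by
  induction L with
  | nil => rfl
  | cons γ L ih =>
    rw [iterLieDeriv_cons, ih, iterLieDeriv_cons]
    funext g
    exact (hasDerivAt_boxAverage hι hχ (hΦ.continuous L) (hΦ.differentiable L γ)
      (hΦ.continuous (γ :: L)) g).deriv

/-- The constant `B` depends on `ι` and `N` but not on `χ`. Therefore the coefficients along all the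
characters `ψ(ηc)` satisfy bounds uniform in `η`. -/
theorem exists_isSmoothMod_boxAverage (dx : Measure (Adele F)) [dx.IsAddHaarMeasure]
    (hι : Continuous ι) (N : ℕ) :
    ∃ B : ℝ, 0 ≤ B ∧ ∀ (χ : Adele F → ℂ) (Φ : GSp4 (Adele F) → ℂ) (C : List (OneParam F) → ℝ),
      Continuous χ → (∀ x, ‖χ x‖ ≤ 1) → IsSmoothMod N C Φ →
      IsSmoothMod N (fun L => B * C L) (boxAverage dx ι χ Φ) := by
  obtain ⟨H, hH, hb⟩ := exists_adelicHeight_le_of_isCompact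
    (isCompact_adeleCompactBox.image hι)
  set n := Module.finrank ℚ F
  have hfin : dx (adeleBox F) < ∞ := measure_adeleBox_lt_top dx
  refine ⟨(4 ^ n * H) ^ N * dx.real (adeleBox F), by positivity, fun χ Φ C hχ hχ1 hΦ =>
    ⟨fun L => mul_nonneg (by positivity) (hΦ.nonneg L), fun L γ g => ?_, fun L => ?_, fun L g => ?_⟩⟩
  · rw [iterLieDeriv_boxAverage hι hχ hΦ]
    exact (hasDerivAt_boxAverage hι hχ (hΦ.continuous L) (hΦ.differentiable L γ)
      (hΦ.continuous (γ :: L)) g).differentiableAt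
  · rw [iterLieDeriv_boxAverage hι hχ hΦ]
    exact continuous_boxAverage hι hχ (hΦ.continuous L)
  · rw [iterLieDeriv_boxAverage hι hχ hΦ]
    have h1 : ‖boxAverage dx ι χ (iterLieDeriv L Φ) g‖ ≤
        (C L * (4 ^ n * (H * adelicHeight g)) ^ N) * dx.real (adeleBox F) :=
      norm_setIntegral_le_of_norm_le_const hfin fun x hx => by
        rw [norm_mul]
        refine (mul_le_of_le_one_right (norm_nonneg _) (hχ1 x)).trans ((hΦ.growth L _).trans ?_)
        refine mul_le_mul_of_nonneg_left (pow_le_pow_left₀ (adelicHeight_nonneg _) ?_ _)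
          (hΦ.nonneg L)
        refine (adelicHeight_mul_le _ _).trans (mul_le_mul_of_nonneg_left
          (mul_le_mul_of_nonneg_right (hb _ ⟨x, adeleBox_subset hx, rfl⟩)
            (adelicHeight_nonneg _)) (by positivity))
    refine h1.trans_eq ?_
    simp only [mul_pow]
    ring

end average

/-! ### Right translates of smooth functions. -/

section translation

variable {F : Type*} [Field F] [NumberField F]

/-- The conjugate `t ↦ g⁻¹ γ(t) g` of a one-parameter subgroup. -/
def OneParam.conj (g : GSp4 (Adele F)) (γ : OneParam F) : OneParam F where
  toFun t := g⁻¹ * γ t * g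
  map_one' := by simp
  map_mul' s t := by rw [map_mul]; group
  continuous_toFun := by
    have := γ.continuous_toFun
    exact (continuous_const.mul this).mul continuous_const

theorem lieDeriv_translate (g₀ : GSp4 (Adele F)) (Φ : GSp4 (Adele F) → ℂ) (γ : OneParam F) :
    lieDeriv γ (fun g => Φ (g * g₀)) = fun g => lieDeriv (γ.conj g₀) Φ (g * g₀) := by
  funext g
  simp only [lieDeriv]
  congr 1
  funext t
  congr 1
  change _ = g * g₀ * (g₀⁻¹ * γ (Multiplicative.ofAdd t) * g₀)
  group

theorem iterLieDeriv_translate (g₀ : GSp4 (Adele F)) (Φ : GSp4 (Adele F) → ℂ)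
    (L : List (OneParam F)) :
    iterLieDeriv L (fun g => Φ (g * g₀)) =
      fun g => iterLieDeriv (L.map (OneParam.conj g₀)) Φ (g * g₀) := by
  induction L with
  | nil => rfl
  | cons γ L ih => rw [iterLieDeriv_cons, ih, lieDeriv_translate]; rfl

/-- One-parameter subgroups are stable under conjugation by `g₀`, so translation permutes the
iterated derivatives; the height of `g₀` enters only the constants. -/
theorem IsSmoothMod.translate {N : ℕ} {C : List (OneParam F) → ℝ} {Φ : GSp4 (Adele F) → ℂ}
    (h : IsSmoothMod N C Φ) (g₀ : GSp4 (Adele F)) :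
    IsSmoothMod N (fun L => C (L.map (OneParam.conj g₀)) *
      (4 ^ Module.finrank ℚ F * adelicHeight g₀) ^ N) (fun g => Φ (g * g₀)) where
  nonneg L := mul_nonneg (h.nonneg _) (pow_nonneg (mul_nonneg (by positivity)
    (adelicHeight_nonneg _)) _)
  differentiable L γ g := by
    rw [iterLieDeriv_translate]
    refine (h.differentiable (L.map (OneParam.conj g₀)) (γ.conj g₀) (g * g₀)).congr_of_eventuallyEq
      (Filter.Eventually.of_forall fun t => ?_)
    simp only
    congr 1
    change _ = g * g₀ * (g₀⁻¹ * γ (Multiplicative.ofAdd t) * g₀)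
    group
  continuous L := by
    rw [iterLieDeriv_translate]
    exact (h.continuous _).comp (continuous_id.mul continuous_const)
  growth L g := by
    rw [iterLieDeriv_translate]
    refine (h.growth _ _).trans ?_
    rw [mul_assoc, ← mul_pow]
    refine mul_le_mul_of_nonneg_left (pow_le_pow_left₀ (adelicHeight_nonneg _) ?_ _) (h.nonneg _)
    exact (adelicHeight_mul_le _ _).trans_eq (by ring)

end translation

/-! ### Derivatives along root subgroups of functions of Whittaker type. -/

section curves

open GSp4 mixedEmbedding IsDedekindDomain
open scoped Classical

variable {F : Type*} [Field F] [NumberField F] {N : ℕ} {C : List (OneParam F) → ℝ}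
  {Φ : GSp4 (Adele F) → ℂ}

/-- A chain rule for a function known to be differentiable only along one-parameter subgroups. The
mean value inequality along `γ`, together with the continuity of `lieDeriv γ Φ` on the whole group,
takes the place of total differentiability. -/
theorem IsSmoothMod.hasDerivAt_curve (hΦ : IsSmoothMod N C Φ) {c : ℝ → GSp4 (Adele F)} {D : ℂ}
    (hc : ContinuousAt c 0) (hD : HasDerivAt (fun t => Φ (c t)) D 0) (γ : OneParam F)
    {p : ℝ → ℝ} {p' : ℝ} (hp0 : p 0 = 0) (hp : HasDerivAt p p' 0) :
    HasDerivAt (fun t => Φ (c t * γ (Multiplicative.ofAdd (p t))))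
      (D + p' * lieDeriv γ Φ (c 0)) 0 := by
  set D₀ := lieDeriv γ Φ (c 0)
  have hcont : Continuous (lieDeriv γ Φ) := hΦ.continuous [γ]
  have key : (fun t => Φ (c t * γ (Multiplicative.ofAdd (p t))) - Φ (c t) - (p t : ℂ) * D₀)
      =o[𝓝 0] fun t : ℝ => t - 0 := by
    have hpO : p =O[𝓝 0] fun t : ℝ => t - 0 := by simpa [hp0] using hp.isBigO_sub
    refine Asymptotics.IsLittleO.trans_isBigO ?_ hpO
    rw [Asymptotics.isLittleO_iff]
    intro ε hε
    have h1 : ContinuousAt (fun z : ℝ × ℝ =>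
        ‖lieDeriv γ Φ (c z.1 * γ (Multiplicative.ofAdd z.2)) - D₀‖) (0, 0) := by
      have h2 : ContinuousAt (fun z : ℝ × ℝ => c z.1) (0, 0) :=
        ContinuousAt.comp (f := Prod.fst) hc continuousAt_fst
      have h3 : ContinuousAt (fun z : ℝ × ℝ => γ (Multiplicative.ofAdd z.2)) (0, 0) :=
        (γ.continuous.comp continuous_snd).continuousAt
      exact ((hcont.continuousAt.comp (h2.mul h3)).sub continuousAt_const).norm
    have h4 : ∀ᶠ z : ℝ × ℝ in 𝓝 (0, 0),
        ‖lieDeriv γ Φ (c z.1 * γ (Multiplicative.ofAdd z.2)) - D₀‖ < ε := by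
      refine h1.eventually_lt continuousAt_const ?_
      simp only [OneParam.map_zero, mul_one]
      simpa [D₀] using hε
    rw [Metric.eventually_nhds_iff] at h4
    obtain ⟨δ, hδ, h4⟩ := h4
    have h5 : ∀ᶠ t in 𝓝 (0 : ℝ), |p t| < δ := by
      refine hp.continuousAt.abs.eventually_lt continuousAt_const ?_
      simpa [hp0] using hδ
    have h6 : ∀ᶠ t in 𝓝 (0 : ℝ), |t| < δ :=
      continuousAt_id.abs.eventually_lt continuousAt_const (by simpa using hδ)
    filter_upwards [h5, h6] with t ht1 ht2
    have hconv := (convex_uIcc (0 : ℝ) (p t)).norm_image_sub_le_of_norm_hasDerivWithin_le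
      (f := fun s : ℝ => Φ (c t * γ (Multiplicative.ofAdd s)) - (s : ℂ) * D₀)
      (f' := fun s => lieDeriv γ Φ (c t * γ (Multiplicative.ofAdd s)) - 1 * D₀) (C := ε)
      (fun s _ => ((hΦ.hasDerivAt γ (c t) s).sub
        ((Complex.ofRealCLM.hasDerivAt (x := s)).mul_const D₀)).hasDerivWithinAt)
      (fun s hs => by
        rw [one_mul]
        refine (h4 (y := (t, s)) ?_).le
        have hs' : |s| ≤ |p t| := by
          have := Set.abs_sub_left_of_mem_uIcc hs
          simpa using this
        rw [Prod.dist_eq, max_lt_iff]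
        simp only [dist_zero_right, Real.norm_eq_abs]
        exact ⟨ht2, hs'.trans_lt ht1⟩) Set.left_mem_uIcc Set.right_mem_uIcc
    simp only [OneParam.map_zero, mul_one, Complex.ofReal_zero, zero_mul, sub_zero] at hconv
    refine le_trans (le_of_eq ?_) hconv
    congr 1
    ring
  have h7 : HasDerivAt (fun t => Φ (c t * γ (Multiplicative.ofAdd (p t))) - Φ (c t) -
      (p t : ℂ) * D₀) 0 0 := by
    rw [hasDerivAt_iff_isLittleO]
    simpa [hp0, OneParam.map_zero] using key
  have h8 : HasDerivAt (fun t => (p t : ℂ) * D₀) (p' * D₀) 0 := hp.ofReal_comp.mul_const D₀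
  have h9 := (h7.add hD).add h8
  rw [zero_add] at h9
  refine h9.congr_of_eventuallyEq (Filter.Eventually.of_forall fun t => ?_)
  simp only [Pi.add_apply]
  ring

variable (F) in
/-- Continuous homomorphisms from the adeles to `GSp(4, 𝔸)`. -/
abbrev RootHom : Type _ := Multiplicative (Adele F) →ₜ* GSp4 (Adele F)

namespace RootHom

/-- Build a `RootHom` from a function on the adeles. -/
def mk' (f : Adele F → GSp4 (Adele F)) (h0 : f 0 = 1) (h : ∀ a b, f a * f b = f (a + b))
    (hc : Continuous f) : RootHom F where
  toFun x := f x.toAdd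
  map_one' := h0
  map_mul' _ _ := (h _ _).symm
  continuous_toFun := hc.comp continuous_toAdd

/-- The restriction of a `RootHom` to the real line spanned by `z ∈ F ⊗ ℝ`. -/
def oneParam (r : RootHom F) (z : mixedSpace F) : OneParam F where
  toFun t := r (Multiplicative.ofAdd (adeleMk (t.toAdd • z) 0))
  map_one' := by simp
  map_mul' s t := by
    rw [← map_mul, ← ofAdd_add, ← adeleMk_add, toAdd_mul, add_smul, add_zero]
  continuous_toFun := by
    refine r.continuous_toFun.comp (continuous_ofAdd.comp (continuous_adeleMk.comp
      (f := fun t : Multiplicative ℝ => (t.toAdd • z, (0 : FiniteAdeleRing (𝓞 F) F))) ?_))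
    exact (continuous_toAdd.smul continuous_const).prodMk continuous_const

theorem oneParam_apply (r : RootHom F) (z : mixedSpace F) (t : ℝ) :
    r.oneParam z (Multiplicative.ofAdd t) = r (Multiplicative.ofAdd (adeleMk (t • z) 0)) := rfl

end RootHom

theorem continuousAt_rootHom (r : RootHom F) {v : ℝ → mixedSpace F} (hv : ContinuousAt v 0) :
    ContinuousAt (fun t => r (Multiplicative.ofAdd (adeleMk (v t) 0))) 0 := by
  have h : Continuous fun w : mixedSpace F =>
      r (Multiplicative.ofAdd (adeleMk w (0 : FiniteAdeleRing (𝓞 F) F))) :=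
    r.continuous_toFun.comp (continuous_ofAdd.comp (continuous_adeleMk.comp
      (f := fun w : mixedSpace F => (w, (0 : FiniteAdeleRing (𝓞 F) F)))
      (continuous_id.prodMk continuous_const)))
  exact ContinuousAt.comp (f := v) h.continuousAt hv

variable {ψ : AddChar (Adele F) Circle}

/-- The coordinates of a vector of `F ⊗ ℝ` with respect to the lattice basis. -/
def AdeleCharacter.coord (Ψ : AdeleCharacter ψ) (j : Module.Free.ChooseBasisIndex ℤ (𝓞 F))
    (w : mixedSpace F) : ℝ := Ψ.lin (w * mixedEmbedding F (Ψ.dual j))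

/-- Differentiation along a curve of the form `c(t) r(v(t))`. -/
theorem IsSmoothMod.hasDerivAt_curve_rootHom (hΦ : IsSmoothMod N C Φ) (Ψ : AdeleCharacter ψ)
    {c : ℝ → GSp4 (Adele F)}
    {D : ℂ} (hc : ContinuousAt c 0) (hD : HasDerivAt (fun t => Φ (c t)) D 0) (r : RootHom F)
    {v : ℝ → mixedSpace F} {v' : mixedSpace F} (hv0 : v 0 = 0) (hv : HasDerivAt v v' 0) :
    HasDerivAt (fun t => Φ (c t * r (Multiplicative.ofAdd (adeleMk (v t) 0))))
      (D + ∑ j, (Ψ.coord j v' : ℂ) *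
        lieDeriv (r.oneParam (latticeBasis F j)) Φ (c 0)) 0 := by
  have hco : ∀ j, HasDerivAt (fun t => Ψ.coord j (v t)) (Ψ.coord j v') 0 := fun j =>
    Ψ.lin.hasFDerivAt.comp_hasDerivAt 0 (hv.mul_const (mixedEmbedding F (Ψ.dual j)))
  have hco0 : ∀ j, Ψ.coord j (v 0) = 0 := fun j => by
    rw [hv0, AdeleCharacter.coord, zero_mul, map_zero]
  -- The vector `v t` is built up one lattice coordinate at a time, so that each new factor is a
  -- one-parameter subgroup.
  have key : ∀ s : Finset (Module.Free.ChooseBasisIndex ℤ (𝓞 F)),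
      ContinuousAt (fun t => ∑ j ∈ s, Ψ.coord j (v t) • latticeBasis F j) 0 ∧
      HasDerivAt (fun t => Φ (c t * r (Multiplicative.ofAdd
        (adeleMk (∑ j ∈ s, Ψ.coord j (v t) • latticeBasis F j) 0))))
      (D + ∑ j ∈ s, (Ψ.coord j v' : ℂ) *
        lieDeriv (r.oneParam (latticeBasis F j)) Φ (c 0)) 0 := by
    intro s
    induction s using Finset.induction_on with
    | empty =>
      refine ⟨?_, ?_⟩
      · simp only [Finset.sum_empty]; exact continuousAt_const
      · simpa using hD
    | insert j s hj ih =>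
      have h1 : ContinuousAt (fun t => Ψ.coord j (v t) • latticeBasis F j) 0 :=
        (hco j).continuousAt.smul continuousAt_const
      refine ⟨?_, ?_⟩
      · simp only [Finset.sum_insert hj]
        exact h1.add ih.1
      · have h2 := hΦ.hasDerivAt_curve (hc.mul (continuousAt_rootHom r ih.1)) ih.2
          (r.oneParam (latticeBasis F j)) (hco0 j) (hco j)
        have h3 : c 0 * r (Multiplicative.ofAdd
            (adeleMk (∑ j ∈ s, Ψ.coord j (v 0) • latticeBasis F j) 0)) = c 0 := by
          simp [hco0]
        simp only [Pi.mul_apply, h3] at h2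
        rw [Finset.sum_insert hj, add_comm (_ * _), ← add_assoc]
        refine h2.congr_of_eventuallyEq (Filter.Eventually.of_forall fun t => ?_)
        simp only
        rw [RootHom.oneParam_apply, mul_assoc, ← map_mul, ← ofAdd_add, ← adeleMk_add, add_zero,
          Finset.sum_insert hj, add_comm]
  refine (key Finset.univ).2.congr_of_eventuallyEq (Filter.Eventually.of_forall fun t => ?_)
  simp only
  rw [show ∑ j, Ψ.coord j (v t) • latticeBasis F j = v t from (Ψ.expand_basis (v t)).symm]

/-- The root subgroups used below. -/
def rootE : RootHom F := RootHom.mk' (fun c => u 0 0 c) u_zero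
  (fun a b => by rw [u_mul, add_zero]) (by fun_prop)

/-- The subgroup `u(0, ·, 0)`. -/
def rootB : RootHom F := RootHom.mk' (fun c => u 0 c 0) u_zero
  (fun a b => by rw [u_mul, add_zero]) (by fun_prop)

/-- The subgroup `lower`. -/
def rootF : RootHom F := RootHom.mk' (fun c => lower c) lower_zero lower_mul (by fun_prop)

/-- The subgroup `mixed`. -/
def rootC : RootHom F := RootHom.mk' (fun c => mixed c)
  (by rw [mixed, u_zero, mul_one, lower_mul, neg_add_cancel, lower_zero])
  mixed_mul (by fun_prop)

/-- Left equivariance of the functions `W_η`. -/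
structure IsWhittakerType (ψ : AddChar (Adele F) Circle) (η : F) (Φ : GSp4 (Adele F) → ℂ) :
    Prop where
  left_n : ∀ b g, Φ (n b * g) = (ψ b : ℂ) * Φ g
  left_u : ∀ a b g, Φ (u a b 0 * g) = Φ g
  left_c : ∀ c g, Φ (u 0 0 c * g) = (ψ (algebraMap F (Adele F) η * c) : ℂ) * Φ g

theorem IsWhittakerType.lie {η : F} (h : IsWhittakerType ψ η Φ) (γ : OneParam F) :
    IsWhittakerType ψ η (lieDeriv γ Φ) where
  left_n b g := by
    simp only [lieDeriv, mul_assoc, h.left_n, deriv_const_mul_field]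
  left_u a b g := by
    simp only [lieDeriv, mul_assoc, h.left_u]
  left_c c g := by
    simp only [lieDeriv, mul_assoc, h.left_c, deriv_const_mul_field]

/-- `lower_mul_u` produces a factor `n` that is moved to the left past the torus and evaluated by
`ψ`, and a factor in the group of the `u a b 0`, on which `Φ` is left invariant. -/
theorem IsWhittakerType.mul_u {η : F} (h : IsWhittakerType ψ η Φ) (y : (Adele F)ˣ)
    (x b : Adele F) :
    Φ (siegelTorus y * lower x * u 0 b 0) = (ψ (-(x * b)) : ℂ) * Φ (siegelTorus y * lower x) := by
  have h1 : siegelTorus y * lower x * u 0 b 0 =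
      n (-(x * b)) * (u (y * (x * b ^ 2)) (y * b) 0 * (siegelTorus y * lower x)) := by
    have h2 := u_mul_siegelTorus y (x * b ^ 2) b 0
    rw [mul_zero] at h2
    calc siegelTorus y * lower x * u 0 b 0
        = (siegelTorus y * n (-(x * b))) * u (x * b ^ 2) b 0 * lower x := by
          rw [mul_assoc, lower_mul_u]; simp only [mul_assoc]
      _ = n (-(x * b)) * (siegelTorus y * u (x * b ^ 2) b 0) * lower x := by
          rw [← n_mul_siegelTorus]; simp only [mul_assoc]
      _ = _ := by rw [← h2]; simp only [mul_assoc]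
  rw [h1, h.left_n, h.left_u]

theorem IsWhittakerType.u_mul_novo {η : F} (h : IsWhittakerType ψ η Φ) (y : (Adele F)ˣ)
    (x c q : Adele F) (hq : q * (1 - c * x) = 1) :
    Φ (siegelTorus y * lower x * u 0 0 (c * (1 - x) * q) * mixed (c * x) *
      lower (c * x * (1 - x) * q)) =
      (ψ (algebraMap F (Adele F) η * (y * c)) : ℂ) * Φ (siegelTorus y * lower x) := by
  have h2 := u_mul_siegelTorus y 0 0 c
  rw [mul_zero] at h2
  rw [← h.left_c, ← mul_assoc, h2, mul_assoc (siegelTorus y) (u 0 0 c), u_mul_lower_eq c x q hq]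
  simp only [mul_assoc]

theorem AdeleCharacter.hasDerivAt (Ψ : AdeleCharacter ψ) (w : mixedSpace F) :
    HasDerivAt (fun t : ℝ => (ψ (adeleMk (t • w) 0) : ℂ))
      (2 * Real.pi * Ψ.lin w * Complex.I) 0 := by
  have h1 : (fun t : ℝ => (ψ (adeleMk (t • w) 0) : ℂ)) =
      fun t : ℝ => Complex.exp ((t : ℂ) * (2 * Real.pi * Ψ.lin w * Complex.I)) := by
    funext t
    rw [Ψ.apply_arch, Circle.coe_exp, map_smul]
    congr 1
    push_cast [smul_eq_mul]
    ring
  rw [h1]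
  have h2 : HasDerivAt (fun t : ℝ => (t : ℂ) * (2 * Real.pi * Ψ.lin w * Complex.I))
      (1 * (2 * Real.pi * Ψ.lin w * Complex.I)) 0 :=
    (Complex.ofRealCLM.hasDerivAt (x := 0)).mul_const _
  have h3 := h2.cexp
  simpa using h3

theorem IsWhittakerType.lieDeriv_rootB {η : F} (h : IsWhittakerType ψ η Φ)
    (Ψ : AdeleCharacter ψ) (y : (Adele F)ˣ) (x : Adele F) (z : mixedSpace F) :
    lieDeriv (rootB.oneParam z) Φ (siegelTorus y * lower x) =
      -(2 * Real.pi * Ψ.lin (archPart x * z) * Complex.I) * Φ (siegelTorus y * lower x) := by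
  have h1 : (fun t : ℝ => Φ (siegelTorus y * lower x *
      rootB.oneParam z (Multiplicative.ofAdd t))) = fun t : ℝ =>
      (ψ (adeleMk (t • -(archPart x * z)) 0) : ℂ) * Φ (siegelTorus y * lower x) := by
    funext t
    refine (h.mul_u y x _).trans ?_
    congr 3
    refine adele_ext ?_ ?_
    · simp
    · simp
  rw [lieDeriv, h1]
  refine ((Ψ.hasDerivAt _).mul_const _).deriv.trans ?_
  rw [map_neg]
  push_cast
  ring

theorem hasDerivAt_smul_of_continuousAt {E : Type*} [NormedAddCommGroup E] [NormedSpace ℝ E]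
    {G : ℝ → E} (hG : ContinuousAt G 0) : HasDerivAt (fun t => t • G t) (G 0) 0 := by
  rw [hasDerivAt_iff_tendsto_slope]
  have h1 : Filter.Tendsto G (𝓝[≠] 0) (𝓝 (G 0)) := hG.tendsto.mono_left nhdsWithin_le_nhds
  refine h1.congr' ?_
  filter_upwards [self_mem_nhdsWithin] with t ht
  rw [slope_def_module]
  simp only [sub_zero, zero_smul]
  rw [smul_smul, inv_mul_cancel₀ ht, one_smul]

/-- Both sides of `u_mul_novo` are differentiated at `t = 0` with `c = t z` in the archimedean
direction. The left equivariance yields multiplication by `2πi` times the linear form at `ηyz`, and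
the three unipotent factors yield Lie derivatives weighted by their first-order parameters. -/
theorem IsWhittakerType.lin_mul_eq {η : F} (h : IsWhittakerType ψ η Φ) (hΦ : IsSmoothMod N C Φ)
    (Ψ : AdeleCharacter ψ) (y : (Adele F)ˣ) (x : Adele F) (z : mixedSpace F) :
    2 * Real.pi * Ψ.lin (mixedEmbedding F η * archPart (y : Adele F) * z) * Complex.I *
        Φ (siegelTorus y * lower x) =
      (∑ j, (Ψ.coord j (z * (1 - archPart x)) : ℂ) *
        lieDeriv (rootE.oneParam (latticeBasis F j)) Φ (siegelTorus y * lower x)) +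
      (∑ j, (Ψ.coord j (z * archPart x) : ℂ) *
        lieDeriv (rootC.oneParam (latticeBasis F j)) Φ (siegelTorus y * lower x)) +
      ∑ j, (Ψ.coord j (z * archPart x * (1 - archPart x)) : ℂ) *
        lieDeriv (rootF.oneParam (latticeBasis F j)) Φ (siegelTorus y * lower x) := by
  set g := siegelTorus y * lower x
  set X := archPart x
  have hinv : ContinuousAt (fun t : ℝ => Ring.inverse (1 - t • (z * X))) 0 := by
    have h1 : ContinuousAt (fun t : ℝ => (1 : mixedSpace F) - t • (z * X)) 0 := by fun_prop
    have h2 : ContinuousAt Ring.inverse ((1 : mixedSpace F) - (0 : ℝ) • (z * X)) := by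
      rw [zero_smul, sub_zero]
      exact NormedRing.inverse_continuousAt (1 : (mixedSpace F)ˣ)
    exact ContinuousAt.comp (f := fun t : ℝ => (1 : mixedSpace F) - t • (z * X)) h2 h1
  have hG : ∀ w : mixedSpace F,
      HasDerivAt (fun t : ℝ => t • (w * Ring.inverse (1 - t • (z * X)))) w 0 := fun w => by
    have h1 := hasDerivAt_smul_of_continuousAt (G := fun t : ℝ =>
      w * Ring.inverse (1 - t • (z * X))) (continuousAt_const.mul hinv)
    simpa using h1
  have hL : HasDerivAt (fun t : ℝ => t • (z * X)) (z * X) 0 := by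
    simpa using (hasDerivAt_id (0 : ℝ)).smul_const (z * X)
  have e0 : HasDerivAt (fun _ : ℝ => Φ g) 0 0 := hasDerivAt_const _ _
  have e1 := hΦ.hasDerivAt_curve_rootHom Ψ (c := fun _ => g) continuousAt_const e0 rootE
    (by simp) (hG (z * (1 - X)))
  have k1 : ContinuousAt (fun t : ℝ => g * rootE (Multiplicative.ofAdd (adeleMk
      (t • (z * (1 - X) * Ring.inverse (1 - t • (z * X)))) 0))) 0 :=
    continuousAt_const.mul (continuousAt_rootHom _ (hG _).continuousAt)
  have e2 := hΦ.hasDerivAt_curve_rootHom Ψ k1 e1 rootC (by simp) hL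
  have k2 := k1.mul (continuousAt_rootHom rootC hL.continuousAt)
  have e3 := hΦ.hasDerivAt_curve_rootHom Ψ k2 e2 rootF (by simp) (hG (z * X * (1 - X)))
  have e4 : HasDerivAt (fun t : ℝ => (ψ (adeleMk (t • (mixedEmbedding F η *
      archPart (y : Adele F) * z)) 0) : ℂ) * Φ g)
      (2 * Real.pi * Ψ.lin (mixedEmbedding F η * archPart (y : Adele F) * z) * Complex.I *
        Φ g) 0 := (Ψ.hasDerivAt _).mul_const _
  -- The factorisation needs `1 - cx` to be invertible, which holds for small `t`; this is enough
  -- for a derivative at `0`.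
  have hsmall : ∀ᶠ t : ℝ in 𝓝 0, IsUnit (1 - t • (z * X)) := by
    have h1 : ContinuousAt (fun t : ℝ => ‖t • (z * X)‖) 0 := by fun_prop
    filter_upwards [h1.eventually_lt (g := fun _ => (1 : ℝ)) continuousAt_const (by simp)] with t ht
    exact isUnit_one_sub_of_norm_lt_one ht
  have e5 := e3.congr_of_eventuallyEq (f₁ := fun t : ℝ => (ψ (adeleMk (t • (mixedEmbedding F η *
      archPart (y : Adele F) * z)) 0) : ℂ) * Φ g) (by
    filter_upwards [hsmall] with t ht
    have hq := Ring.inverse_mul_cancel _ ht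
    -- The finite part of `c` is `0`, so the finite part of `q = (1 - cx)⁻¹` is `1`.
    have key := h.u_mul_novo y x (adeleMk (t • z) 0)
      (adeleMk (Ring.inverse (1 - t • (z * X))) 1) (by
        refine adele_ext ?_ ?_
        · simpa [X] using hq
        · simp)
    have a1 : adeleMk (t • z) 0 * (1 - x) * adeleMk (Ring.inverse (1 - t • (z * X))) 1 =
        adeleMk (t • (z * (1 - X) * Ring.inverse (1 - t • (z * X)))) 0 :=
      adele_ext (by simp [X]) (by simp)
    have a2 : adeleMk (t • z) 0 * x = adeleMk (t • (z * X)) 0 := adele_ext (by simp [X]) (by simp)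
    have a3 : adeleMk (t • z) 0 * x * (1 - x) * adeleMk (Ring.inverse (1 - t • (z * X))) 1 =
        adeleMk (t • (z * X * (1 - X) * Ring.inverse (1 - t • (z * X)))) 0 :=
      adele_ext (by simp [X]) (by simp)
    have a4 : algebraMap F (Adele F) η * (y * adeleMk (t • z) 0) =
        adeleMk (t • (mixedEmbedding F η * archPart (y : Adele F) * z)) 0 :=
      adele_ext (by simp [mul_assoc]) (by simp)
    rw [a1, a3, a2, a4] at key
    exact key.symm)
  have e6 := e4.unique e5
  rw [e6]
  simp

end curves

/-! ### Rapid decay of functions of Whittaker type. -/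

section decay

open GSp4 mixedEmbedding IsDedekindDomain
open scoped Classical

variable {F : Type*} [Field F] [NumberField F] {ψ : AddChar (Adele F) Circle}

theorem AdeleCharacter.exists_abs_coord_le (Ψ : AdeleCharacter ψ) :
    ∃ M : ℝ, 0 ≤ M ∧ ∀ j w, |Ψ.coord j w| ≤ M * ‖w‖ := by
  refine ⟨∑ j, ‖Ψ.lin‖ * ‖mixedEmbedding F (Ψ.dual j)‖,
    Finset.sum_nonneg fun j _ => by positivity, fun j w => ?_⟩
  have h1 : |Ψ.coord j w| ≤ (‖Ψ.lin‖ * ‖mixedEmbedding F (Ψ.dual j)‖) * ‖w‖ := by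
    refine (Ψ.lin.le_opNorm _).trans ?_
    rw [mul_assoc, mul_comm ‖mixedEmbedding F (Ψ.dual j)‖]
    exact mul_le_mul_of_nonneg_left (norm_mul_le _ _) (norm_nonneg _)
  refine h1.trans (mul_le_mul_of_nonneg_right ?_ (norm_nonneg _))
  exact Finset.single_le_sum (f := fun j => ‖Ψ.lin‖ * ‖mixedEmbedding F (Ψ.dual j)‖)
    (fun j _ => by positivity) (Finset.mem_univ j)

theorem norm_two_pi_mul_I (a : ℝ) (b : ℂ) :
    ‖2 * (Real.pi : ℂ) * a * Complex.I * b‖ = 2 * Real.pi * (|a| * ‖b‖) := by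
  rw [norm_mul, norm_mul, norm_mul, norm_mul, Complex.norm_I, Complex.norm_real, Complex.norm_real,
    Real.norm_eq_abs, Real.norm_eq_abs, abs_of_pos Real.pi_pos, Complex.norm_two]
  ring

/-- The coordinates of `archPart x` in the lattice basis are the numbers `lin (archPart x * dual
j)`, and by `lieDeriv_rootB` each of them, times `Φ`, is a derivative of `Φ` up to a constant of
modulus `2π`. -/
theorem AdeleCharacter.exists_one_add_norm_mul_le (Ψ : AdeleCharacter ψ) :
    ∃ M : ℝ, 0 ≤ M ∧ ∀ (η : F) (Φ : GSp4 (Adele F) → ℂ), IsWhittakerType ψ η Φ →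
      ∀ (y : (Adele F)ˣ) (x : Adele F),
      (1 + ‖archPart x‖) * ‖Φ (siegelTorus y * lower x)‖ ≤ ‖Φ (siegelTorus y * lower x)‖ +
        M * ∑ j, ‖lieDeriv (rootB.oneParam (mixedEmbedding F (Ψ.dual j))) Φ
          (siegelTorus y * lower x)‖ := by
  refine ⟨∑ j, ‖latticeBasis F j‖, Finset.sum_nonneg fun _ _ => norm_nonneg _,
    fun η Φ h y x => ?_⟩
  set g := siegelTorus y * lower x
  have h1 : ∀ j, |Ψ.lin (archPart x * mixedEmbedding F (Ψ.dual j))| * ‖Φ g‖ ≤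
      ‖lieDeriv (rootB.oneParam (mixedEmbedding F (Ψ.dual j))) Φ g‖ := fun j => by
    rw [h.lieDeriv_rootB Ψ, neg_mul, norm_neg, norm_two_pi_mul_I]
    have : 0 ≤ |Ψ.lin (archPart x * mixedEmbedding F (Ψ.dual j))| * ‖Φ g‖ := by positivity
    nlinarith [Real.pi_gt_three]
  have h2 : ‖archPart x‖ ≤ ∑ j, |Ψ.lin (archPart x * mixedEmbedding F (Ψ.dual j))| *
      ‖latticeBasis F j‖ := by
    conv_lhs => rw [Ψ.expand_basis (archPart x)]
    refine (norm_sum_le _ _).trans (Finset.sum_le_sum fun j _ => ?_)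
    rw [_root_.norm_smul, Real.norm_eq_abs]
  rw [add_mul, one_mul, add_le_add_iff_left]
  refine (mul_le_mul_of_nonneg_right h2 (norm_nonneg _)).trans ?_
  rw [Finset.sum_mul, Finset.mul_sum]
  refine Finset.sum_le_sum fun j _ => ?_
  calc |Ψ.lin (archPart x * mixedEmbedding F (Ψ.dual j))| * ‖latticeBasis F j‖ * ‖Φ g‖
      = ‖latticeBasis F j‖ * (|Ψ.lin (archPart x * mixedEmbedding F (Ψ.dual j))| * ‖Φ g‖) := by
        ring
    _ ≤ _ := mul_le_mul (Finset.single_le_sum (f := fun j => ‖latticeBasis F j‖)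
        (fun _ _ => norm_nonneg _) (Finset.mem_univ j)) (h1 j) (by positivity)
        (Finset.sum_nonneg fun _ _ => norm_nonneg _)

/-- The sum of the norms of the derivatives of `Φ` along three root subgroups. -/
def rootDerivSum (Φ : GSp4 (Adele F) → ℂ) (g : GSp4 (Adele F)) : ℝ :=
  ∑ j, (‖lieDeriv (rootE.oneParam (latticeBasis F j)) Φ g‖ +
    ‖lieDeriv (rootC.oneParam (latticeBasis F j)) Φ g‖ +
    ‖lieDeriv (rootF.oneParam (latticeBasis F j)) Φ g‖)

/-- This is the gain of one factor `exp t * ‖η‖` from `lin_mul_eq`. The coefficients there are of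
degree at most two in `x`, whence the square, and the compactness of `K` bounds the effect of `k`.
-/
theorem AdeleCharacter.exists_exp_mul_norm_le (Ψ : AdeleCharacter ψ) {K : Set (Adele F)ˣ}
    (hK : IsCompact K) :
    ∃ M : ℝ, 0 ≤ M ∧ ∀ (η : F) (Φ : GSp4 (Adele F) → ℂ) (N : ℕ) (C : List (OneParam F) → ℝ),
      IsWhittakerType ψ η Φ → IsSmoothMod N C Φ → ∀ (t : ℝ), ∀ k ∈ K, ∀ x : Adele F,
      Real.exp t * ‖mixedEmbedding F η‖ * ‖Φ (siegelTorus (posIdele t * k) * lower x)‖ ≤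
        M * ((1 + ‖archPart x‖) ^ 2 *
          rootDerivSum Φ (siegelTorus (posIdele t * k) * lower x)) := by
  obtain ⟨M, hM, hco⟩ := Ψ.exists_abs_coord_le
  obtain ⟨R, hR⟩ := hK.exists_bound_of_continuousOn
    (f := fun k : (Adele F)ˣ => archPart ((k⁻¹ : (Adele F)ˣ) : Adele F))
    (continuous_archPart.comp (Units.continuous_val.comp continuous_inv)).continuousOn
  set R' := max R 0
  have hR' : 0 ≤ R' := le_max_right _ _
  refine ⟨∑ j, M * R' * ‖latticeBasis F j‖ * ‖mixedEmbedding F (Ψ.dual j)‖,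
    Finset.sum_nonneg fun _ _ => by positivity, fun η Φ N C h hΦ t k hk x => ?_⟩
  set g := siegelTorus (posIdele t * k) * lower x
  set X := archPart x
  have hS0 : 0 ≤ rootDerivSum Φ g := Finset.sum_nonneg fun _ _ => by positivity
  have h1 : ∀ j, Real.exp t * |Ψ.lin (mixedEmbedding F η * latticeBasis F j)| * ‖Φ g‖ ≤
      M * R' * ‖latticeBasis F j‖ * ((1 + ‖X‖) ^ 2 * rootDerivSum Φ g) := by
    intro j
    -- With this direction `η y z = exp t • (η b_j)`, so the linear form returns the coordinates of
    -- `η` in the dual basis.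
    set z := archPart ((k⁻¹ : (Adele F)ˣ) : Adele F) * latticeBasis F j
    have hz : ‖z‖ ≤ R' * ‖latticeBasis F j‖ := by
      refine (norm_mul_le _ _).trans (mul_le_mul_of_nonneg_right ?_ (norm_nonneg _))
      exact (hR k hk).trans (le_max_left _ _)
    have e1 := h.lin_mul_eq hΦ Ψ (posIdele t * k) x z
    have e2 : mixedEmbedding F η * archPart ((posIdele t * k : (Adele F)ˣ) : Adele F) * z =
        Real.exp t • (mixedEmbedding F η * latticeBasis F j) := by
      have h3 : archPart (k : Adele F) * archPart ((k⁻¹ : (Adele F)ˣ) : Adele F) = 1 := by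
        rw [← map_mul, Units.mul_inv, map_one]
      rw [Units.val_mul, map_mul, posIdele_val, archPart_adeleMk]
      calc _ = Real.exp t • (mixedEmbedding F η * (archPart (k : Adele F) *
            archPart ((k⁻¹ : (Adele F)ˣ) : Adele F)) * latticeBasis F j) := by
            simp only [z, smul_mul_assoc, one_mul, mul_smul_comm]; congr 1; ring
        _ = _ := by rw [h3, mul_one]
    rw [e2, map_smul, smul_eq_mul] at e1
    have e3 : ‖2 * (Real.pi : ℂ) * ((Real.exp t * Ψ.lin (mixedEmbedding F η *
        latticeBasis F j) : ℝ) : ℂ) * Complex.I * Φ g‖ ≤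
        (M * R' * ‖latticeBasis F j‖ * (1 + ‖X‖) ^ 2) * rootDerivSum Φ g := by
      rw [e1]
      have b1 : ‖(1 : mixedSpace F) - X‖ ≤ 1 + ‖X‖ := by
        refine (norm_sub_le _ _).trans ?_
        rw [norm_one]
      have hX := norm_nonneg X
      have hzz : 0 ≤ R' * ‖latticeBasis F j‖ := by positivity
      have c1 : ∀ i, |Ψ.coord i (z * (1 - X))| ≤ M * R' * ‖latticeBasis F j‖ * (1 + ‖X‖) ^ 2 := by
        intro i
        refine (hco i _).trans ?_
        rw [show M * R' * ‖latticeBasis F j‖ * (1 + ‖X‖) ^ 2 =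
          M * (R' * ‖latticeBasis F j‖ * (1 + ‖X‖) ^ 2) by ring]
        refine mul_le_mul_of_nonneg_left ?_ hM
        refine (norm_mul_le _ _).trans ((mul_le_mul hz b1 (norm_nonneg _) hzz).trans ?_)
        refine mul_le_mul_of_nonneg_left ?_ hzz
        nlinarith
      have c2 : ∀ i, |Ψ.coord i (z * X)| ≤ M * R' * ‖latticeBasis F j‖ * (1 + ‖X‖) ^ 2 := by
        intro i
        refine (hco i _).trans ?_
        rw [show M * R' * ‖latticeBasis F j‖ * (1 + ‖X‖) ^ 2 =
          M * (R' * ‖latticeBasis F j‖ * (1 + ‖X‖) ^ 2) by ring]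
        refine mul_le_mul_of_nonneg_left ?_ hM
        refine (norm_mul_le _ _).trans ((mul_le_mul_of_nonneg_right hz hX).trans ?_)
        refine mul_le_mul_of_nonneg_left ?_ hzz
        nlinarith
      have c3 : ∀ i, |Ψ.coord i (z * X * (1 - X))| ≤
          M * R' * ‖latticeBasis F j‖ * (1 + ‖X‖) ^ 2 := by
        intro i
        refine (hco i _).trans ?_
        rw [show M * R' * ‖latticeBasis F j‖ * (1 + ‖X‖) ^ 2 =
          M * (R' * ‖latticeBasis F j‖ * (1 + ‖X‖) ^ 2) by ring]
        refine mul_le_mul_of_nonneg_left ?_ hM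
        refine (norm_mul_le _ _).trans ((mul_le_mul ((norm_mul_le _ _).trans
          (mul_le_mul_of_nonneg_right hz hX)) b1 (norm_nonneg _) (by positivity)).trans ?_)
        rw [mul_assoc (R' * ‖latticeBasis F j‖)]
        refine mul_le_mul_of_nonneg_left ?_ hzz
        nlinarith
      have c4 : ∀ (a : ℝ) (b : ℂ), |a| ≤ M * R' * ‖latticeBasis F j‖ * (1 + ‖X‖) ^ 2 →
          ‖(a : ℂ) * b‖ ≤ (M * R' * ‖latticeBasis F j‖ * (1 + ‖X‖) ^ 2) * ‖b‖ := by
        intro a b hab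
        rw [norm_mul, Complex.norm_real, Real.norm_eq_abs]
        exact mul_le_mul_of_nonneg_right hab (norm_nonneg _)
      refine (norm_add₃_le).trans ?_
      rw [rootDerivSum, Finset.mul_sum]
      simp only [mul_add, Finset.sum_add_distrib]
      refine add_le_add (add_le_add ?_ ?_) ?_
      · exact (norm_sum_le _ _).trans (Finset.sum_le_sum fun i _ => c4 _ _ (c1 i))
      · exact (norm_sum_le _ _).trans (Finset.sum_le_sum fun i _ => c4 _ _ (c2 i))
      · exact (norm_sum_le _ _).trans (Finset.sum_le_sum fun i _ => c4 _ _ (c3 i))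
    rw [norm_two_pi_mul_I, abs_mul, abs_of_pos (Real.exp_pos t)] at e3
    have e4 : 0 ≤ Real.exp t * |Ψ.lin (mixedEmbedding F η * latticeBasis F j)| * ‖Φ g‖ := by
      positivity
    rw [← mul_assoc (M * R' * ‖latticeBasis F j‖)]
    nlinarith [Real.pi_gt_three]
  have h2 : ‖mixedEmbedding F η‖ ≤ ∑ j, |Ψ.lin (mixedEmbedding F η * latticeBasis F j)| *
      ‖mixedEmbedding F (Ψ.dual j)‖ := by
    conv_lhs => rw [Ψ.expand_dual (mixedEmbedding F η)]
    refine (norm_sum_le _ _).trans (Finset.sum_le_sum fun j _ => ?_)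
    rw [_root_.norm_smul, Real.norm_eq_abs]
  calc Real.exp t * ‖mixedEmbedding F η‖ * ‖Φ g‖
      ≤ Real.exp t * (∑ j, |Ψ.lin (mixedEmbedding F η * latticeBasis F j)| *
        ‖mixedEmbedding F (Ψ.dual j)‖) * ‖Φ g‖ := by gcongr
    _ = ∑ j, (Real.exp t * |Ψ.lin (mixedEmbedding F η * latticeBasis F j)| * ‖Φ g‖) *
        ‖mixedEmbedding F (Ψ.dual j)‖ := by
        rw [Finset.mul_sum, Finset.sum_mul]
        exact Finset.sum_congr rfl fun j _ => by ring
    _ ≤ ∑ j, (M * R' * ‖latticeBasis F j‖ * ((1 + ‖X‖) ^ 2 * rootDerivSum Φ g)) *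
        ‖mixedEmbedding F (Ψ.dual j)‖ :=
        Finset.sum_le_sum fun j _ => mul_le_mul_of_nonneg_right (h1 j) (norm_nonneg _)
    _ = _ := by
        rw [Finset.sum_mul]
        exact Finset.sum_congr rfl fun j _ => by ring

/-- Rapid decay in the archimedean part of `x`. -/
theorem AdeleCharacter.exists_decay_lower (Ψ : AdeleCharacter ψ) (N m : ℕ) :
    ∀ C : List (OneParam F) → ℝ, ∃ B : ℝ, 0 ≤ B ∧ ∀ (η : F) (Φ : GSp4 (Adele F) → ℂ),
      IsWhittakerType ψ η Φ → IsSmoothMod N C Φ → ∀ (y : (Adele F)ˣ) (x : Adele F),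
      (1 + ‖archPart x‖) ^ m * ‖Φ (siegelTorus y * lower x)‖ ≤
        B * adelicHeight (siegelTorus y * lower x) ^ N := by
  induction m with
  | zero =>
    intro C
    refine ⟨max (C []) 0, le_max_right _ _, fun η Φ _ hΦ y x => ?_⟩
    rw [pow_zero, one_mul]
    exact (hΦ.norm_le _).trans (mul_le_mul_of_nonneg_right (le_max_left _ _)
      (pow_nonneg (adelicHeight_nonneg _) _))
  | succ m ih =>
    intro C
    obtain ⟨M, hM, hstep⟩ := Ψ.exists_one_add_norm_mul_le
    obtain ⟨B, hB, hb⟩ := ih C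
    -- The induction hypothesis is applied to Lie derivatives, which are again of Whittaker type for
    -- the same `η` and have the same exponent `N`.
    choose B' hB' hb' using fun j => ih fun L =>
      C (L ++ [rootB.oneParam (mixedEmbedding F (Ψ.dual j))])
    refine ⟨B + M * ∑ j, B' j, add_nonneg hB (mul_nonneg hM (Finset.sum_nonneg fun j _ => hB' j)),
      fun η Φ h hΦ y x => ?_⟩
    set g := siegelTorus y * lower x
    calc (1 + ‖archPart x‖) ^ (m + 1) * ‖Φ g‖
        = (1 + ‖archPart x‖) ^ m * ((1 + ‖archPart x‖) * ‖Φ g‖) := by rw [pow_succ, mul_assoc]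
      _ ≤ (1 + ‖archPart x‖) ^ m * (‖Φ g‖ + M * ∑ j, ‖lieDeriv (rootB.oneParam
          (mixedEmbedding F (Ψ.dual j))) Φ g‖) :=
          mul_le_mul_of_nonneg_left (hstep η Φ h y x) (by positivity)
      _ = (1 + ‖archPart x‖) ^ m * ‖Φ g‖ + M * ∑ j, (1 + ‖archPart x‖) ^ m *
          ‖lieDeriv (rootB.oneParam (mixedEmbedding F (Ψ.dual j))) Φ g‖ := by
          rw [← Finset.mul_sum]; ring
      _ ≤ B * adelicHeight g ^ N + M * ∑ j, B' j * adelicHeight g ^ N :=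
          add_le_add (hb η Φ h hΦ y x) (mul_le_mul_of_nonneg_left (Finset.sum_le_sum fun j _ =>
            hb' j η _ (h.lie _) (hΦ.lie _) y x) hM)
      _ = _ := by rw [← Finset.sum_mul]; ring

/-- Rapid decay in `η` and in the archimedean part of `x`. -/
theorem AdeleCharacter.exists_decay (Ψ : AdeleCharacter ψ) {K : Set (Adele F)ˣ}
    (hK : IsCompact K) (N m : ℕ) :
    ∀ (k : ℕ) (C : List (OneParam F) → ℝ), ∃ B : ℝ, 0 ≤ B ∧
      ∀ (η : F) (Φ : GSp4 (Adele F) → ℂ), IsWhittakerType ψ η Φ → IsSmoothMod N C Φ →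
      ∀ (t : ℝ), ∀ κ ∈ K, ∀ x : Adele F,
      (Real.exp t * ‖mixedEmbedding F η‖) ^ m * ((1 + ‖archPart x‖) ^ k *
        ‖Φ (siegelTorus (posIdele t * κ) * lower x)‖) ≤
        B * adelicHeight (siegelTorus (posIdele t * κ) * lower x) ^ N := by
  induction m with
  | zero =>
    intro k C
    obtain ⟨B, hB, hb⟩ := Ψ.exists_decay_lower N k C
    exact ⟨B, hB, fun η Φ h hΦ t κ _ x => by simpa using hb η Φ h hΦ (posIdele t * κ) x⟩
  | succ m ih =>
    intro k C
    obtain ⟨M, hM, hstep⟩ := Ψ.exists_exp_mul_norm_le hK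
    -- Each gain in `exp t * ‖η‖` costs two powers of `1 + ‖archPart x‖`, hence `k + 2`.
    choose B₁ hB₁ hb₁ using fun j => ih (k + 2) fun L =>
      C (L ++ [rootE.oneParam (latticeBasis F j)])
    choose B₂ hB₂ hb₂ using fun j => ih (k + 2) fun L =>
      C (L ++ [rootC.oneParam (latticeBasis F j)])
    choose B₃ hB₃ hb₃ using fun j => ih (k + 2) fun L =>
      C (L ++ [rootF.oneParam (latticeBasis F j)])
    refine ⟨M * ∑ j, (B₁ j + B₂ j + B₃ j), mul_nonneg hM (Finset.sum_nonneg fun j _ =>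
      add_nonneg (add_nonneg (hB₁ j) (hB₂ j)) (hB₃ j)), fun η Φ h hΦ t κ hκ x => ?_⟩
    set g := siegelTorus (posIdele t * κ) * lower x
    set q := (Real.exp t * ‖mixedEmbedding F η‖) ^ m * (1 + ‖archPart x‖) ^ (k + 2)
    calc (Real.exp t * ‖mixedEmbedding F η‖) ^ (m + 1) * ((1 + ‖archPart x‖) ^ k * ‖Φ g‖)
        = ((Real.exp t * ‖mixedEmbedding F η‖) ^ m * (1 + ‖archPart x‖) ^ k) *
          (Real.exp t * ‖mixedEmbedding F η‖ * ‖Φ g‖) := by rw [pow_succ]; ring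
      _ ≤ ((Real.exp t * ‖mixedEmbedding F η‖) ^ m * (1 + ‖archPart x‖) ^ k) *
          (M * ((1 + ‖archPart x‖) ^ 2 * rootDerivSum Φ g)) :=
          mul_le_mul_of_nonneg_left (hstep η Φ N C h hΦ t κ hκ x) (by positivity)
      _ = M * (q * rootDerivSum Φ g) := by simp only [q, pow_add]; ring
      _ ≤ M * ∑ j, (B₁ j * adelicHeight g ^ N + B₂ j * adelicHeight g ^ N +
          B₃ j * adelicHeight g ^ N) := by
          refine mul_le_mul_of_nonneg_left ?_ hM
          rw [rootDerivSum, Finset.mul_sum]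
          refine Finset.sum_le_sum fun j _ => ?_
          rw [mul_add, mul_add]
          refine add_le_add (add_le_add ?_ ?_) ?_
          · have := hb₁ j η _ (h.lie _) (hΦ.lie _) t κ hκ x
            rwa [← mul_assoc] at this
          · have := hb₂ j η _ (h.lie _) (hΦ.lie _) t κ hκ x
            rwa [← mul_assoc] at this
          · have := hb₃ j η _ (h.lie _) (hΦ.lie _) t κ hκ x
            rwa [← mul_assoc] at this
      _ = _ := by simp only [← add_mul, ← Finset.sum_mul]; ring

end decay

/-! ### Right translates of cusp forms are cusp forms. -/

section translates

open GSp4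

variable {F : Type*} [Field F] [NumberField F]

theorem GSp4.map_mul_eq {R S : Type*} [CommRing R] [CommRing S] (f : R →+* S) (g h : GSp4 R) :
    GSp4.map f (g * h) = GSp4.map f g * GSp4.map f h :=
  Subtype.ext (map_mul (Matrix.GeneralLinearGroup.map f) (g : GL (Fin 4) R) h)

theorem GSp4.map_one_eq {R S : Type*} [CommRing R] [CommRing S] (f : R →+* S) :
    GSp4.map f (1 : GSp4 R) = 1 :=
  Subtype.ext (map_one (Matrix.GeneralLinearGroup.map f))

theorem map_archPart_eq_one_iff (k : GSp4 (Adele F)) :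
    GSp4.map archPart k = 1 ↔ ∀ i j, ((k : GL (Fin 4) (Adele F)) i j).1 =
      ((1 : GL (Fin 4) (Adele F)) i j).1 := by
  have h : ∀ x y : Adele F, archPart x = archPart y ↔ x.1 = y.1 := fun x y =>
    ⟨fun h => (InfiniteAdeleRing.ringEquiv_mixedSpace F).injective h,
      fun h => congrArg (InfiniteAdeleRing.ringEquiv_mixedSpace F) h⟩
  have h0 : ∀ i j, archPart ((1 : GL (Fin 4) (Adele F)) i j) =
      (1 : Matrix (Fin 4) (Fin 4) (mixedEmbedding.mixedSpace F)) i j := fun i j => by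
    rw [Units.val_one, Matrix.one_apply, Matrix.one_apply]
    split_ifs
    · exact map_one _
    · exact map_zero _
  constructor
  · intro hk i j
    rw [← h, h0]
    have := congrArg (fun g : GSp4 (mixedEmbedding.mixedSpace F) =>
      ((g : GL (Fin 4) (mixedEmbedding.mixedSpace F)) :
        Matrix (Fin 4) (Fin 4) (mixedEmbedding.mixedSpace F)) i j) hk
    exact this
  · intro hk
    refine ext_matrix ?_
    refine Matrix.ext fun i j => ?_
    have := (h _ _).2 (hk i j)
    rw [h0] at this
    exact this

/-- Right invariance under the elements of `O` with trivial archimedean part. -/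
def IsFiniteInvariant (O : Set (GSp4 (Adele F))) (Φ : GSp4 (Adele F) → ℂ) : Prop :=
  ∀ k ∈ O, GSp4.map archPart k = 1 → ∀ g, Φ (g * k) = Φ g

theorem IsCuspForm.exists_isFiniteInvariant {ν : Measure (Adele F ⧸ principalAdeles F)}
    {φ : GSp4 (Adele F) → ℂ} (hφ : IsCuspForm ν φ) : ∃ O ∈ 𝓝 1, IsFiniteInvariant O φ := by
  obtain ⟨O, hO, h⟩ := hφ.finite_invariant
  exact ⟨O, hO, fun k hk h1 g => h k hk ((map_archPart_eq_one_iff k).1 h1) g⟩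

theorem IsCuspForm.translate {ν : Measure (Adele F ⧸ principalAdeles F)}
    {φ : GSp4 (Adele F) → ℂ} (hφ : IsCuspForm ν φ) (g₀ : GSp4 (Adele F)) :
    IsCuspForm ν (fun g => φ (g * g₀)) := by
  obtain ⟨N, C, hs⟩ := hφ.exists_isSmoothMod
  have hs' := hs.translate g₀
  refine ⟨fun γ g => ?_, ?_, ?_, hs'.differentiable, hs'.continuous,
    ⟨N, fun L => ⟨_, hs'.growth L⟩⟩, fun g => ?_, fun g => ?_⟩
  · rw [mul_assoc, hφ.left_invariant]
  · obtain ⟨ω, hω⟩ := hφ.central_character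
    exact ⟨ω, fun z g => by rw [mul_assoc, hω]⟩
  · obtain ⟨O, hO, h⟩ := hφ.exists_isFiniteInvariant
    refine ⟨{k | g₀⁻¹ * k * g₀ ∈ O}, ?_, fun k hk h1 g => ?_⟩
    · have : Continuous fun k : GSp4 (Adele F) => g₀⁻¹ * k * g₀ := by fun_prop
      exact this.continuousAt.preimage_mem_nhds (by simpa using hO)
    · rw [← map_archPart_eq_one_iff] at h1
      have h2 : g * k * g₀ = (g * g₀) * (g₀⁻¹ * k * g₀) := by group
      rw [h2]
      refine h _ hk ?_ _
      rw [GSp4.map_mul_eq, GSp4.map_mul_eq, h1, mul_one, ← GSp4.map_mul_eq, inv_mul_cancel, GSp4.map_one_eq]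
  · simp only [mul_assoc]
    exact hφ.siegel (g * g₀)
  · simp only [mul_assoc]
    simpa only [mul_assoc] using hφ.klingen (g * g₀)

end translates

/-! ### The partial Fourier coefficients of `φ` and their equivariance. -/

section coefficients

open GSp4

variable {F : Type*} [Field F] [NumberField F] (dx : Measure (Adele F)) [dx.IsAddHaarMeasure]

theorem setIntegral_adeleBox_swap {f : Adele F → Adele F → ℂ}
    (hf : Continuous (Function.uncurry f)) :
    ∫ x in adeleBox F, ∫ y in adeleBox F, f x y ∂dx ∂dx =
      ∫ y in adeleBox F, ∫ x in adeleBox F, f x y ∂dx ∂dx := by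
  refine integral_integral_swap ?_
  rw [Measure.prod_restrict]
  exact (hf.continuousOn.integrableOn_compact
    (isCompact_adeleCompactBox.prod isCompact_adeleCompactBox)).mono_set
    (Set.prod_mono adeleBox_subset adeleBox_subset)

variable {dx}

/-- The substitution `x ↦ x + c`, legitimate over the box because the integrand is periodic. -/
theorem boxAverage_mul_left {ι : Adele F → GSp4 (Adele F)} {χ : Adele F → ℂ}
    {Φ : GSp4 (Adele F) → ℂ} {c : Adele F} {k : ℂ} (hι : ∀ x, ι x * ι c = ι (x + c))
    (hχ : ∀ x, χ x = k * χ (x + c)) {g : GSp4 (Adele F)}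
    (hp : IsPeriodic fun x => Φ (ι x * g) * χ x) :
    boxAverage dx ι χ Φ (ι c * g) = k * boxAverage dx ι χ Φ g := by
  simp only [boxAverage]
  rw [← hp.setIntegral_add isStrictFundDomain_adeleBox c, ← integral_const_mul]
  refine integral_congr_ae (Filter.Eventually.of_forall fun x => ?_)
  simp only
  rw [← mul_assoc, hι, hχ x]
  ring

theorem boxAverage_congr {ι : Adele F → GSp4 (Adele F)} {χ : Adele F → ℂ}
    {Φ : GSp4 (Adele F) → ℂ} {g g' : GSp4 (Adele F)} {k : ℂ}
    (h : ∀ x, Φ (ι x * g') = k * Φ (ι x * g)) :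
    boxAverage dx ι χ Φ g' = k * boxAverage dx ι χ Φ g := by
  simp only [boxAverage]
  rw [← integral_const_mul]
  refine integral_congr_ae (Filter.Eventually.of_forall fun x => ?_)
  simp only
  rw [h]
  ring

theorem boxAverage_isFiniteInvariant {ι : Adele F → GSp4 (Adele F)} {χ : Adele F → ℂ}
    {Φ : GSp4 (Adele F) → ℂ} {O : Set (GSp4 (Adele F))} (h : IsFiniteInvariant O Φ) :
    IsFiniteInvariant O (boxAverage dx ι χ Φ) := by
  intro k hk h1 g
  simp only [boxAverage, ← mul_assoc, h k hk h1]

variable (dx) (ψ : AddChar (Adele F) Circle) (φ : GSp4 (Adele F) → ℂ)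

/-- The integral of `φ` over `u(a, 0, 0)`. -/
def centerAverage : GSp4 (Adele F) → ℂ :=
  boxAverage dx (fun a => u a 0 0) (fun _ => 1) φ

/-- The integral of `φ` over `u(a, b, 0)`. -/
def klingenAverage : GSp4 (Adele F) → ℂ :=
  boxAverage dx (fun b => u 0 b 0) (fun _ => 1) (centerAverage dx φ)

/-- The `ψ`-coefficient of `centerAverage` along `n(b)`. -/
def centerCoeff : GSp4 (Adele F) → ℂ :=
  boxAverage dx (fun b => n b) (fun b => (ψ (-b) : ℂ)) (centerAverage dx φ)

/-- The `ψ`-coefficient of `klingenAverage` along `n(b)`. -/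
def klingenCoeff : GSp4 (Adele F) → ℂ :=
  boxAverage dx (fun b => n b) (fun b => (ψ (-b) : ℂ)) (klingenAverage dx φ)

/-- The Whittaker functions `W_η`. -/
def whittakerCoeff (η : F) : GSp4 (Adele F) → ℂ :=
  boxAverage dx (fun c => u 0 0 c) (fun c => (ψ (-(algebraMap F (Adele F) η * c)) : ℂ))
    (klingenCoeff dx ψ φ)

variable {dx ψ φ} (Ψ : AdeleCharacter ψ)
  (hL : ∀ (γ : GSp4 F) (g : GSp4 (Adele F)), φ (GSp4.map (algebraMap F (Adele F)) γ * g) = φ g)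

local notation "κ" => algebraMap F (Adele F)

theorem left_u_of_left_invariant (hL : ∀ (γ : GSp4 F) (g : GSp4 (Adele F)),
    φ (GSp4.map (algebraMap F (Adele F)) γ * g) = φ g) (a b c : F) (g : GSp4 (Adele F)) :
    φ (u (κ a) (κ b) (κ c) * g) = φ g := by
  rw [← map_u, hL]

theorem left_n_of_left_invariant (hL : ∀ (γ : GSp4 F) (g : GSp4 (Adele F)),
    φ (GSp4.map (algebraMap F (Adele F)) γ * g) = φ g) (b : F) (g : GSp4 (Adele F)) :
    φ (n (κ b) * g) = φ g := by
  rw [← map_n, hL]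

theorem left_lower_of_left_invariant (hL : ∀ (γ : GSp4 F) (g : GSp4 (Adele F)),
    φ (GSp4.map (algebraMap F (Adele F)) γ * g) = φ g) (b : F) (g : GSp4 (Adele F)) :
    φ (lower (κ b) * g) = φ g := by
  rw [← map_lower, hL]

theorem u_comm (a b c a' b' c' : Adele F) (g : GSp4 (Adele F)) :
    u a b c * (u a' b' c' * g) = u a' b' c' * (u a b c * g) := by
  rw [← mul_assoc, ← mul_assoc, u_mul, u_mul, add_comm a, add_comm b, add_comm c]

theorem n_mul_u' (x a b c : Adele F) (g : GSp4 (Adele F)) :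
    n x * (u a b c * g) = u (a + 2 * x * b + c * x ^ 2) (b + c * x) c * (n x * g) := by
  rw [← mul_assoc, n_mul_u, mul_assoc]

/-- Invariance properties of `centerAverage`. -/
theorem centerAverage_u (hL : ∀ (γ : GSp4 F) (g : GSp4 (Adele F)),
    φ (GSp4.map (algebraMap F (Adele F)) γ * g) = φ g) (a : Adele F) (b c : F)
    (g : GSp4 (Adele F)) :
    centerAverage dx φ (u a (κ b) (κ c) * g) = centerAverage dx φ g := by
  have h1 : ∀ g, centerAverage dx φ (u a 0 0 * g) = centerAverage dx φ g := fun g => by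
    have := boxAverage_mul_left (dx := dx) (ι := fun a => u a 0 0) (χ := fun _ => (1 : ℂ)) (Φ := φ)
      (c := a) (k := 1) (g := g) (fun x => by rw [u_mul, add_zero]) (fun x => by simp) (by
        intro x α
        simp only [mul_one]
        have : u (x + κ α) 0 0 * g = u (κ α) (κ 0) (κ 0) * (u x 0 0 * g) := by
          rw [← mul_assoc, map_zero, u_mul, add_zero, add_comm]
        rw [this, left_u_of_left_invariant hL])
    rwa [one_mul] at this
  have h2 : u a (κ b) (κ c) * g = u a 0 0 * (u (κ 0) (κ b) (κ c) * g) := by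
    rw [← mul_assoc, u_mul, map_zero, add_zero, zero_add, zero_add]
  rw [h2, h1]
  have := boxAverage_congr (dx := dx) (ι := fun a => u a 0 0) (χ := fun _ => (1 : ℂ)) (Φ := φ)
    (g := g) (g' := u (κ 0) (κ b) (κ c) * g) (k := 1) (fun x => by
      rw [u_comm, left_u_of_left_invariant hL, one_mul])
  rwa [one_mul] at this

theorem centerAverage_n (hL : ∀ (γ : GSp4 F) (g : GSp4 (Adele F)),
    φ (GSp4.map (algebraMap F (Adele F)) γ * g) = φ g) (b : F) (g : GSp4 (Adele F)) :
    centerAverage dx φ (n (κ b) * g) = centerAverage dx φ g := by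
  have := boxAverage_congr (dx := dx) (ι := fun a => u a 0 0) (χ := fun _ => (1 : ℂ)) (Φ := φ)
    (g := g) (g' := n (κ b) * g) (k := 1) (fun x => by
      have h := n_mul_u' (κ b) x 0 0 g
      rw [mul_zero, zero_mul, zero_mul, add_zero, add_zero, add_zero] at h
      rw [← h, left_n_of_left_invariant hL, one_mul])
  rwa [one_mul] at this

theorem centerAverage_lower (hL : ∀ (γ : GSp4 F) (g : GSp4 (Adele F)),
    φ (GSp4.map (algebraMap F (Adele F)) γ * g) = φ g) (b : F) (g : GSp4 (Adele F)) :
    centerAverage dx φ (lower (κ b) * g) = centerAverage dx φ g := by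
  have := boxAverage_congr (dx := dx) (ι := fun a => u a 0 0) (χ := fun _ => (1 : ℂ)) (Φ := φ)
    (g := g) (g' := lower (κ b) * g) (k := 1) (fun x => by
      rw [← mul_assoc, u_mul_lower, mul_assoc, left_lower_of_left_invariant hL, one_mul])
  rwa [one_mul] at this

theorem klingenAverage_u (hL : ∀ (γ : GSp4 F) (g : GSp4 (Adele F)),
    φ (GSp4.map (algebraMap F (Adele F)) γ * g) = φ g) (a b : Adele F) (c : F)
    (g : GSp4 (Adele F)) :
    klingenAverage dx φ (u a b (κ c) * g) = klingenAverage dx φ g := by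
  have h1 : ∀ g, klingenAverage dx φ (u 0 b 0 * g) = klingenAverage dx φ g := fun g => by
    have := boxAverage_mul_left (dx := dx) (ι := fun b => u 0 b 0) (χ := fun _ => (1 : ℂ))
      (Φ := centerAverage dx φ)
      (c := b) (k := 1) (g := g) (fun x => by rw [u_mul, add_zero]) (fun x => by simp) (by
        intro x α
        simp only [mul_one]
        have : u 0 (x + κ α) 0 * g = u 0 (κ α) (κ 0) * (u 0 x 0 * g) := by
          rw [← mul_assoc, map_zero, u_mul, add_zero, add_comm]
        rw [this, centerAverage_u hL])
    rwa [one_mul] at this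
  have h2 : u a b (κ c) * g = u 0 b 0 * (u a (κ 0) (κ c) * g) := by
    rw [← mul_assoc, u_mul, map_zero, add_zero, zero_add, zero_add]
  rw [h2, h1]
  have := boxAverage_congr (dx := dx) (ι := fun b => u 0 b 0) (χ := fun _ => (1 : ℂ))
    (Φ := centerAverage dx φ) (g := g) (g' := u a (κ 0) (κ c) * g) (k := 1) (fun x => by
      rw [u_comm, centerAverage_u hL, one_mul])
  rwa [one_mul] at this

/-- `n x` and `u 0 b 0` commute up to an element `u a 0 0`, over which the average has been taken.
-/
theorem centerAverage_n_mul_u (hL : ∀ (γ : GSp4 F) (g : GSp4 (Adele F)),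
    φ (GSp4.map (algebraMap F (Adele F)) γ * g) = φ g) (x b : Adele F) (g : GSp4 (Adele F)) :
    centerAverage dx φ (n x * (u 0 b 0 * g)) = centerAverage dx φ (u 0 b 0 * (n x * g)) := by
  have h2 : n x * (u 0 b 0 * g) = u (2 * x * b) (κ 0) (κ 0) * (u 0 b 0 * (n x * g)) := by
    rw [n_mul_u', map_zero, ← mul_assoc (u _ _ _) (u _ _ _), u_mul]
    simp
  rw [h2, centerAverage_u hL]

theorem klingenAverage_n (hL : ∀ (γ : GSp4 F) (g : GSp4 (Adele F)),
    φ (GSp4.map (algebraMap F (Adele F)) γ * g) = φ g) (b : F) (g : GSp4 (Adele F)) :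
    klingenAverage dx φ (n (κ b) * g) = klingenAverage dx φ g := by
  have := boxAverage_congr (dx := dx) (ι := fun b => u 0 b 0) (χ := fun _ => (1 : ℂ))
    (Φ := centerAverage dx φ) (g := g) (g' := n (κ b) * g) (k := 1) (fun x => by
      rw [← centerAverage_n_mul_u hL, centerAverage_n hL, one_mul])
  rwa [one_mul] at this

theorem AdeleCharacter.neg_mul_periodic (Ψ : AdeleCharacter ψ) (η : F) (x : Adele F) (α : F) :
    ψ (-(κ η * (x + κ α))) = ψ (-(κ η * x)) := by
  rw [mul_add, neg_add, AddChar.map_add_eq_mul, ← map_mul (algebraMap F (Adele F)),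
    ← map_neg (algebraMap F (Adele F)), Ψ.principal, mul_one]

theorem AdeleCharacter.neg_periodic (Ψ : AdeleCharacter ψ) (x : Adele F) (α : F) :
    ψ (-(x + κ α)) = ψ (-x) := by
  simpa using Ψ.neg_mul_periodic 1 x α

theorem coe_psi_neg (ψ : AddChar (Adele F) Circle) (x c : Adele F) :
    (ψ (-x) : ℂ) = (ψ c : ℂ) * (ψ (-(x + c)) : ℂ) := by
  rw [← Circle.coe_mul, ← AddChar.map_add_eq_mul]
  congr 2
  ring

/-- A function with `Φ(n(β) g) = Φ(g)` for `β ∈ F` has a `ψ`-coefficient that is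
`ψ`-equivariant. -/
theorem boxAverage_n (Ψ : AdeleCharacter ψ) {Φ : GSp4 (Adele F) → ℂ}
    (h : ∀ (b : F) g, Φ (n (κ b) * g) = Φ g) (b : Adele F) (g : GSp4 (Adele F)) :
    boxAverage dx (fun b => n b) (fun b => (ψ (-b) : ℂ)) Φ (n b * g) =
      (ψ b : ℂ) * boxAverage dx (fun b => n b) (fun b => (ψ (-b) : ℂ)) Φ g :=
  boxAverage_mul_left (fun x => n_mul x b) (fun x => coe_psi_neg ψ x b) (by
    intro x α
    simp only
    rw [Ψ.neg_periodic, add_comm, ← n_mul, mul_assoc, h])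

theorem centerCoeff_n (Ψ : AdeleCharacter ψ) (hL : ∀ (γ : GSp4 F) (g : GSp4 (Adele F)),
    φ (GSp4.map (algebraMap F (Adele F)) γ * g) = φ g) (b : Adele F) (g : GSp4 (Adele F)) :
    centerCoeff dx ψ φ (n b * g) = (ψ b : ℂ) * centerCoeff dx ψ φ g :=
  boxAverage_n Ψ (centerAverage_n hL) b g

theorem klingenCoeff_n (Ψ : AdeleCharacter ψ) (hL : ∀ (γ : GSp4 F) (g : GSp4 (Adele F)),
    φ (GSp4.map (algebraMap F (Adele F)) γ * g) = φ g) (b : Adele F) (g : GSp4 (Adele F)) :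
    klingenCoeff dx ψ φ (n b * g) = (ψ b : ℂ) * klingenCoeff dx ψ φ g :=
  boxAverage_n Ψ (klingenAverage_n hL) b g

theorem centerCoeff_lower (hL : ∀ (γ : GSp4 F) (g : GSp4 (Adele F)),
    φ (GSp4.map (algebraMap F (Adele F)) γ * g) = φ g) (b : F) (g : GSp4 (Adele F)) :
    centerCoeff dx ψ φ (lower (κ b) * g) = centerCoeff dx ψ φ g := by
  have := boxAverage_congr (dx := dx) (ι := fun b => n b) (χ := fun b => (ψ (-b) : ℂ))
    (Φ := centerAverage dx φ) (g := g) (g' := lower (κ b) * g) (k := 1) (fun x => by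
      rw [← mul_assoc, n_mul_lower, mul_assoc, centerAverage_lower hL, one_mul])
  rwa [one_mul] at this

theorem centerCoeff_u (hL : ∀ (γ : GSp4 F) (g : GSp4 (Adele F)),
    φ (GSp4.map (algebraMap F (Adele F)) γ * g) = φ g) (a : Adele F) (b : F)
    (g : GSp4 (Adele F)) :
    centerCoeff dx ψ φ (u a (κ b) 0 * g) = centerCoeff dx ψ φ g := by
  have := boxAverage_congr (dx := dx) (ι := fun b => n b) (χ := fun b => (ψ (-b) : ℂ))
    (Φ := centerAverage dx φ) (g := g) (g' := u a (κ b) 0 * g) (k := 1) (fun x => by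
      have h := centerAverage_u (dx := dx) hL (a + 2 * x * κ b) b 0 (n x * g)
      rw [map_zero] at h
      rw [n_mul_u', zero_mul, zero_mul, add_zero, add_zero, h, one_mul])
  rwa [one_mul] at this

theorem klingenCoeff_u (hL : ∀ (γ : GSp4 F) (g : GSp4 (Adele F)),
    φ (GSp4.map (algebraMap F (Adele F)) γ * g) = φ g) (a b : Adele F) (c : F)
    (g : GSp4 (Adele F)) :
    klingenCoeff dx ψ φ (u a b (κ c) * g) = klingenCoeff dx ψ φ g := by
  have := boxAverage_congr (dx := dx) (ι := fun b => n b) (χ := fun b => (ψ (-b) : ℂ))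
    (Φ := klingenAverage dx φ) (g := g) (g' := u a b (κ c) * g) (k := 1) (fun x => by
      rw [n_mul_u', klingenAverage_u hL, one_mul])
  rwa [one_mul] at this

theorem klingenCoeff_u_zero (hL : ∀ (γ : GSp4 F) (g : GSp4 (Adele F)),
    φ (GSp4.map (algebraMap F (Adele F)) γ * g) = φ g) (a b : Adele F)
    (g : GSp4 (Adele F)) :
    klingenCoeff dx ψ φ (u a b 0 * g) = klingenCoeff dx ψ φ g := by
  simpa using klingenCoeff_u (dx := dx) (ψ := ψ) hL a b 0 g

/-- For the equivariance under `n b`: it commutes with `u 0 0 x` up to the group of the `u a b' 0`,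
under which `klingenCoeff` is invariant. The other two properties come from the commutativity of the
Siegel radical and from translating the last integral. -/
theorem isWhittakerType_whittakerCoeff (Ψ : AdeleCharacter ψ)
    (hL : ∀ (γ : GSp4 F) (g : GSp4 (Adele F)),
      φ (GSp4.map (algebraMap F (Adele F)) γ * g) = φ g) (η : F) :
    IsWhittakerType ψ η (whittakerCoeff dx ψ φ η) where
  left_n b g := by
    refine boxAverage_congr fun x => ?_
    have h : u 0 0 x * (n b * g) = n b * (u (x * b ^ 2) (-(x * b)) 0 * (u 0 0 x * g)) := by
      rw [← mul_assoc (u _ _ _) (u _ _ _), u_mul, n_mul_u']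
      congr 2 <;> ring
    rw [h, klingenCoeff_n Ψ hL, klingenCoeff_u_zero hL]
  left_u a b g := by
    have := boxAverage_congr (dx := dx) (ι := fun c => u 0 0 c)
      (χ := fun c => (ψ (-(algebraMap F (Adele F) η * c)) : ℂ))
      (Φ := klingenCoeff dx ψ φ) (g := g) (g' := u a b 0 * g) (k := 1) (fun x => by
      rw [u_comm, klingenCoeff_u_zero hL, one_mul])
    rwa [one_mul] at this
  left_c c g := by
    refine boxAverage_mul_left (fun x => by rw [u_mul, add_zero])
      (fun x => ?_) ?_
    · rw [mul_add]; exact coe_psi_neg ψ _ _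
    · intro x α
      simp only
      rw [Ψ.neg_mul_periodic]
      have : u 0 0 (x + κ α) * g = u 0 0 (κ α) * (u 0 0 x * g) := by
        rw [← mul_assoc, u_mul, add_zero, add_comm]
      rw [this, klingenCoeff_u hL]

/-- Multiplication by `η ∈ Fˣ` preserves the integral over `F\𝔸`, so a rational element that scales
the root subgroup only rescales the character. -/
theorem boxAverage_scale {ι : Adele F → GSp4 (Adele F)} {χ : Adele F → ℂ}
    {Φ : GSp4 (Adele F) → ℂ} {σ : GSp4 (Adele F)} {η : F} (hη : η ≠ 0)
    (hι : ∀ x g, Φ (ι (κ η * x) * (σ * g)) = Φ (ι x * g)) {g : GSp4 (Adele F)}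
    (hp : IsPeriodic fun x => Φ (ι x * (σ * g)) * χ x) :
    boxAverage dx ι χ Φ (σ * g) = boxAverage dx ι (fun x => χ (κ η * x)) Φ g := by
  simp only [boxAverage]
  rw [← hp.setIntegral_mul isStrictFundDomain_adeleBox hη]
  refine integral_congr_ae (Filter.Eventually.of_forall fun x => ?_)
  simp only [hι]

theorem u_mul_siegelTorus_principal (η : Fˣ) (a b c : Adele F) (g : GSp4 (Adele F)) :
    u (κ η * a) (κ η * b) (κ η * c) * (siegelTorus (principalIdele η) * g) =
      siegelTorus (principalIdele η) * (u a b c * g) := by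
  have h := u_mul_siegelTorus (principalIdele η) a b c
  rw [principalIdele_val] at h
  rw [← mul_assoc, h, mul_assoc]

theorem centerAverage_siegelTorus (hL : ∀ (γ : GSp4 F) (g : GSp4 (Adele F)),
    φ (GSp4.map (algebraMap F (Adele F)) γ * g) = φ g) (η : Fˣ) (g : GSp4 (Adele F)) :
    centerAverage dx φ (siegelTorus (principalIdele η) * g) = centerAverage dx φ g := by
  refine boxAverage_scale η.ne_zero (fun x g => ?_) fun x α => ?_
  · have h := u_mul_siegelTorus_principal η x 0 0 g
    rw [mul_zero] at h
    have h' := hL (siegelTorus η) (u x 0 0 * g)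
    rw [map_siegelTorus] at h'
    rw [h]
    exact h'
  · simp only [mul_one]
    have : u (x + κ α) 0 0 = u (κ α) (κ 0) (κ 0) * u x 0 0 := by
      rw [map_zero, u_mul, add_zero, add_comm]
    rw [this, mul_assoc, left_u_of_left_invariant hL]

theorem klingenAverage_siegelTorus (hL : ∀ (γ : GSp4 F) (g : GSp4 (Adele F)),
    φ (GSp4.map (algebraMap F (Adele F)) γ * g) = φ g) (η : Fˣ) (g : GSp4 (Adele F)) :
    klingenAverage dx φ (siegelTorus (principalIdele η) * g) = klingenAverage dx φ g := by
  refine boxAverage_scale η.ne_zero (fun x g => ?_) fun x α => ?_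
  · have h := u_mul_siegelTorus_principal η 0 x 0 g
    rw [mul_zero] at h
    rw [h, centerAverage_siegelTorus hL]
  · simp only [mul_one]
    have : u 0 (x + κ α) 0 = u 0 (κ α) (κ 0) * u 0 x 0 := by
      rw [map_zero, u_mul, add_zero, add_comm]
    rw [this, mul_assoc, centerAverage_u hL]

theorem klingenCoeff_siegelTorus (hL : ∀ (γ : GSp4 F) (g : GSp4 (Adele F)),
    φ (GSp4.map (algebraMap F (Adele F)) γ * g) = φ g) (η : Fˣ) (g : GSp4 (Adele F)) :
    klingenCoeff dx ψ φ (siegelTorus (principalIdele η) * g) = klingenCoeff dx ψ φ g := by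
  have := boxAverage_congr (dx := dx) (ι := fun b => n b) (χ := fun b => (ψ (-b) : ℂ))
    (Φ := klingenAverage dx φ) (g := g) (g' := siegelTorus (principalIdele η) * g) (k := 1)
    (fun x => by rw [← mul_assoc, n_mul_siegelTorus, mul_assoc, klingenAverage_siegelTorus hL,
      one_mul])
  rwa [one_mul] at this

/-- `W_η(g) = W_1(diag(η, η, 1, 1) g)`. -/
theorem whittakerCoeff_siegelTorus (Ψ : AdeleCharacter ψ)
    (hL : ∀ (γ : GSp4 F) (g : GSp4 (Adele F)),
      φ (GSp4.map (algebraMap F (Adele F)) γ * g) = φ g) (η : Fˣ) (g : GSp4 (Adele F)) :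
    whittakerCoeff dx ψ φ 1 (siegelTorus (principalIdele η) * g) =
      whittakerCoeff dx ψ φ (η : F) g := by
  rw [whittakerCoeff, boxAverage_scale η.ne_zero (fun x g => ?_) fun x α => ?_]
  · simp only [map_one, one_mul]
    rfl
  · have h := u_mul_siegelTorus_principal η 0 0 x g
    rw [mul_zero] at h
    rw [h, klingenCoeff_siegelTorus hL]
  · simp only
    have : u 0 0 (x + κ α) = u 0 0 (κ α) * u 0 0 x := by
      rw [u_mul, add_zero, add_comm]
    rw [Ψ.neg_mul_periodic, this, mul_assoc, klingenCoeff_u hL]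

/-- `centerCoeff` integrated over `u(0, b, 0)` is `klingenCoeff`. -/
theorem klingenCoeff_eq (Ψ : AdeleCharacter ψ)
    (hL : ∀ (γ : GSp4 F) (g : GSp4 (Adele F)),
      φ (GSp4.map (algebraMap F (Adele F)) γ * g) = φ g)
    (hc : Continuous φ) (g : GSp4 (Adele F)) :
    klingenCoeff dx ψ φ g = ∫ b in adeleBox F, centerCoeff dx ψ φ (u 0 b 0 * g) ∂dx := by
  have hψ : Continuous fun b => (ψ (-b) : ℂ) :=
    continuous_subtype_val.comp (Ψ.continuous.comp continuous_neg)
  have hc1 : Continuous (centerAverage dx φ) :=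
    continuous_boxAverage (by fun_prop) continuous_const hc
  simp only [klingenCoeff, centerCoeff, boxAverage, klingenAverage, mul_one]
  rw [setIntegral_adeleBox_swap dx (f := fun b' b =>
    centerAverage dx φ (n b * (u 0 b' 0 * g)) * (ψ (-b) : ℂ))]
  · refine integral_congr_ae (Filter.Eventually.of_forall fun b => ?_)
    simp only
    rw [← integral_mul_const]
    refine integral_congr_ae (Filter.Eventually.of_forall fun b' => ?_)
    simp only
    rw [centerAverage_n_mul_u hL]
  · exact (hc1.comp ((continuous_n continuous_snd).mul ((continuous_u continuous_const
      continuous_fst continuous_const).mul continuous_const))).mul (hψ.comp continuous_snd)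

/-- The Fourier coefficients of `b ↦ centerCoeff(u(0, b, 0) g)`. -/
theorem integral_centerCoeff_mul (Ψ : AdeleCharacter ψ)
    (hL : ∀ (γ : GSp4 F) (g : GSp4 (Adele F)),
      φ (GSp4.map (algebraMap F (Adele F)) γ * g) = φ g)
    (hc : Continuous φ) (ξ : F) (g : GSp4 (Adele F)) :
    ∫ b in adeleBox F, centerCoeff dx ψ φ (u 0 b 0 * g) * (ψ (-(κ ξ * b)) : ℂ) ∂dx =
      klingenCoeff dx ψ φ (lower (-κ ξ) * g) := by
  rw [klingenCoeff_eq Ψ hL hc]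
  refine integral_congr_ae (Filter.Eventually.of_forall fun b => ?_)
  simp only
  -- Moving `u 0 b 0` past the rational `lower (-ξ)` leaves the factor `n (-ξb)`, which
  -- `centerCoeff` turns into `ψ(-ξb)`. The remaining extra factors act trivially.
  have h1 : u 0 b 0 * (lower (-κ ξ) * g) = lower (κ (-ξ)) *
      (n (-(κ ξ * b)) * (u (κ ξ * b ^ 2) (κ 0) 0 * (u 0 b 0 * g))) := by
    have h2 := lower_mul_u (κ ξ) b
    have h3 : u 0 b 0 * lower (-κ ξ) = lower (-κ ξ) * (lower (κ ξ) * u 0 b 0) * lower (-κ ξ) := by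
      rw [← mul_assoc, lower_mul, neg_add_cancel, lower_zero, one_mul]
    have h4 : u (κ ξ * b ^ 2) b 0 = u (κ ξ * b ^ 2) 0 0 * u 0 b 0 := by
      rw [u_mul]; simp
    rw [← mul_assoc, h3, h2, h4, map_neg, map_zero]
    have h5 : lower (κ ξ) * lower (-κ ξ) = 1 := by rw [lower_mul, add_neg_cancel, lower_zero]
    calc _ = lower (-κ ξ) * n (-(κ ξ * b)) * u (κ ξ * b ^ 2) 0 0 * u 0 b 0 *
          (lower (κ ξ) * lower (-κ ξ)) * g := by simp only [mul_assoc]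
      _ = _ := by rw [h5, mul_one]; simp only [mul_assoc]
  rw [h1, centerCoeff_lower hL, centerCoeff_n Ψ hL, centerCoeff_u hL, mul_comm]

end coefficients

/-! ### The Whittaker function and the Bessel coefficient as iterated integrals. -/

section unfolding

open GSp4

variable {F : Type*} [Field F] [NumberField F] {dx : Measure (Adele F)} [dx.IsAddHaarMeasure]
  {dxq : Measure (Adele F ⧸ principalAdeles F)} {ψ : AddChar (Adele F) Circle}
  {φ : GSp4 (Adele F) → ℂ}

local notation "κ" => algebraMap F (Adele F)

theorem continuous_centerAverage (hc : Continuous φ) : Continuous (centerAverage dx φ) :=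
  continuous_boxAverage (by fun_prop) continuous_const hc

theorem continuous_klingenAverage (hc : Continuous φ) : Continuous (klingenAverage dx φ) :=
  continuous_boxAverage (by fun_prop) continuous_const (continuous_centerAverage hc)

theorem AdeleCharacter.continuous_coe_neg (Ψ : AdeleCharacter ψ) :
    Continuous fun b => (ψ (-b) : ℂ) :=
  continuous_subtype_val.comp (Ψ.continuous.comp continuous_neg)

theorem continuous_centerCoeff (Ψ : AdeleCharacter ψ) (hc : Continuous φ) :
    Continuous (centerCoeff dx ψ φ) :=
  continuous_boxAverage (by fun_prop) Ψ.continuous_coe_neg (continuous_centerAverage hc)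

theorem continuous_klingenCoeff (Ψ : AdeleCharacter ψ) (hc : Continuous φ) :
    Continuous (klingenCoeff dx ψ φ) :=
  continuous_boxAverage (by fun_prop) Ψ.continuous_coe_neg (continuous_klingenAverage hc)

theorem continuous_whittakerCoeff (Ψ : AdeleCharacter ψ) (hc : Continuous φ) (η : F) :
    Continuous (whittakerCoeff dx ψ φ η) :=
  continuous_boxAverage (by fun_prop) (Ψ.continuous_coe_neg.comp (continuous_const_mul _))
    (continuous_klingenCoeff Ψ hc)

theorem IsCuspForm.continuous_self (hφ : IsCuspForm dxq φ) : Continuous φ := hφ.continuous []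

theorem klingenAverage_eq (g : GSp4 (Adele F)) :
    klingenAverage dx φ g = ∫ b in adeleBox F, ∫ a in adeleBox F, φ (u a b 0 * g) ∂dx ∂dx := by
  simp only [klingenAverage, centerAverage, boxAverage, mul_one, ← mul_assoc, u_mul, add_zero,
    zero_add]

theorem setIntegral_adeleBox_reverse {f : Adele F → Adele F → Adele F → ℂ}
    (hf : Continuous fun p : Adele F × Adele F × Adele F => f p.1 p.2.1 p.2.2) :
    ∫ a in adeleBox F, ∫ b in adeleBox F, ∫ c in adeleBox F, f a b c ∂dx ∂dx ∂dx =
      ∫ c in adeleBox F, ∫ b in adeleBox F, ∫ a in adeleBox F, f a b c ∂dx ∂dx ∂dx := by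
  have s1 : ∀ a, ∫ b in adeleBox F, ∫ c in adeleBox F, f a b c ∂dx ∂dx =
      ∫ c in adeleBox F, ∫ b in adeleBox F, f a b c ∂dx ∂dx := fun a =>
    setIntegral_adeleBox_swap dx (f := f a)
      (hf.comp (continuous_const.prodMk continuous_id))
  have s2 : ∀ c, ∫ a in adeleBox F, ∫ b in adeleBox F, f a b c ∂dx ∂dx =
      ∫ b in adeleBox F, ∫ a in adeleBox F, f a b c ∂dx ∂dx := fun c =>
    setIntegral_adeleBox_swap dx (f := fun a b => f a b c)
      (hf.comp (continuous_fst.prodMk (continuous_snd.prodMk continuous_const)))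
  have h3 : Continuous fun p : Adele F × Adele F => ∫ b in adeleBox F, f p.1 b p.2 ∂dx :=
    continuous_setIntegral_adeleBox dx (hf.comp ((continuous_fst.comp continuous_fst).prodMk
        (continuous_snd.prodMk (continuous_snd.comp continuous_fst))))
  simp only [s1]
  rw [setIntegral_adeleBox_swap dx (f := fun a c => ∫ b in adeleBox F, f a b c ∂dx) h3]
  simp only [s2]

/-- The order of integration is reversed as well, so that the innermost integral is the one over `a`
and can be recognised as a partial average. -/
theorem IsAddQuotientMeasure.intMod_three (hdx : IsAddQuotientMeasure (principalAdeles F) dx dxq)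
    {f : Adele F → Adele F → Adele F → ℂ}
    (hf : Continuous fun p : Adele F × Adele F × Adele F => f p.1 p.2.1 p.2.2)
    (ha : ∀ a b c α, f (a + κ α) b c = f a b c) (hb : ∀ a b c α, f a (b + κ α) c = f a b c)
    (hc : ∀ a b c α, f a b (c + κ α) = f a b c) :
    intMod dxq (fun a => intMod dxq fun b => intMod dxq fun c => f a b c) =
      ∫ c in adeleBox F, ∫ b in adeleBox F, ∫ a in adeleBox F, f a b c ∂dx ∂dx ∂dx := by
  have hD := isStrictFundDomain_adeleBox (F := F)
  have h0 : Continuous fun p : (Adele F × Adele F) × Adele F => f p.1.1 p.1.2 p.2 :=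
    hf.comp (Homeomorph.prodAssoc _ _ _).continuous
  have h1 : Continuous fun p : Adele F × Adele F => ∫ c in adeleBox F, f p.1 p.2 c ∂dx :=
    continuous_setIntegral_adeleBox dx h0
  have h2 : Continuous fun a : Adele F => ∫ b in adeleBox F, ∫ c in adeleBox F, f a b c ∂dx ∂dx :=
    continuous_setIntegral_adeleBox dx h1
  have e1 : ∀ a b, intMod dxq (f a b) = ∫ c in adeleBox F, f a b c ∂dx := fun a b =>
    hdx.intMod_eq hD (fun x α => hc a b x α)
      (h0.comp ((continuous_const (y := (a, b))).prodMk continuous_id)).measurable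
  have e2 : ∀ a, intMod dxq (fun b => ∫ c in adeleBox F, f a b c ∂dx) =
      ∫ b in adeleBox F, ∫ c in adeleBox F, f a b c ∂dx ∂dx := fun a =>
    hdx.intMod_eq hD (fun x α => by simp only [hb])
      (h1.comp (continuous_const.prodMk continuous_id)).measurable
  simp only [e1, e2]
  rw [hdx.intMod_eq hD (fun x α => by simp only [ha]) h2.measurable,
    setIntegral_adeleBox_reverse hf]

/-- The constant term along the Siegel unipotent radical, as an iterated integral over the box. -/
theorem IsCuspForm.setIntegral_siegel (hφ : IsCuspForm dxq φ)
    (hdx : IsAddQuotientMeasure (principalAdeles F) dx dxq) (g : GSp4 (Adele F)) :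
    ∫ c in adeleBox F, klingenAverage dx φ (u 0 0 c * g) ∂dx = 0 := by
  have hc := hφ.continuous_self
  have hu : ∀ (a b c : Adele F) (α β γ : F),
      φ (u (a + κ α) (b + κ β) (c + κ γ) * g) = φ (u a b c * g) := fun a b c α β γ => by
    rw [← left_u_of_left_invariant hφ.left_invariant α β γ (u a b c * g), ← mul_assoc, u_mul,
      add_comm a, add_comm b, add_comm c]
  have hs := hdx.intMod_three (f := fun a b c => φ (u a b c * g))
    (hc.comp ((continuous_u continuous_fst (continuous_fst.comp continuous_snd)
      (continuous_snd.comp continuous_snd)).mul continuous_const))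
    (fun a b c α => by simpa using hu a b c α 0 0) (fun a b c α => by simpa using hu a b c 0 α 0)
    (fun a b c α => by simpa using hu a b c 0 0 α)
  rw [← (hφ.siegel g).symm.trans hs |>.symm]
  refine integral_congr_ae (Filter.Eventually.of_forall fun c => ?_)
  simp only
  rw [klingenAverage_eq]
  simp only [← mul_assoc, u_mul, add_zero, zero_add]

/-- `n x` and `u 0 0 c` commute up to an element of the group of the `u a b 0`, over which
`klingenAverage` has been taken. -/
theorem klingenAverage_n_mul_u (hL : ∀ (γ : GSp4 F) (g : GSp4 (Adele F)),
    φ (GSp4.map (algebraMap F (Adele F)) γ * g) = φ g) (x c : Adele F) (g : GSp4 (Adele F)) :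
    klingenAverage dx φ (n x * (u 0 0 c * g)) = klingenAverage dx φ (u 0 0 c * (n x * g)) := by
  have h2 : n x * (u 0 0 c * g) = u (c * x ^ 2) (c * x) (κ 0) * (u 0 0 c * (n x * g)) := by
    rw [n_mul_u', map_zero, ← mul_assoc (u _ _ _) (u _ _ _), u_mul]
    simp
  rw [h2, klingenAverage_u hL]

/-- `W_0 = 0`. -/
theorem IsCuspForm.whittakerCoeff_zero (hφ : IsCuspForm dxq φ) (Ψ : AdeleCharacter ψ)
    (hdx : IsAddQuotientMeasure (principalAdeles F) dx dxq) (g : GSp4 (Adele F)) :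
    whittakerCoeff dx ψ φ 0 g = 0 := by
  have hc1 := continuous_klingenAverage (dx := dx) hφ.continuous_self
  simp only [whittakerCoeff, klingenCoeff, boxAverage, map_zero, zero_mul, neg_zero,
    AddChar.map_zero_eq_one, Circle.coe_one, mul_one]
  -- For `η = 0` there is no character in `c`; integrating over `c` first gives the constant term
  -- along the Siegel radical at `n b * g`.
  rw [setIntegral_adeleBox_swap dx (f := fun c b =>
    klingenAverage dx φ (n b * (u 0 0 c * g)) * (ψ (-b) : ℂ))]
  · refine integral_eq_zero_of_ae (Filter.Eventually.of_forall fun b => ?_)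
    simp only [klingenAverage_n_mul_u hφ.left_invariant]
    rw [integral_mul_const, hφ.setIntegral_siegel hdx, zero_mul]
    rfl
  · exact (hc1.comp ((continuous_n continuous_snd).mul ((continuous_u continuous_const
      continuous_const continuous_fst).mul continuous_const))).mul
      (Ψ.continuous_coe_neg.comp continuous_snd)

/-- The Whittaker function is `W_1`. -/
theorem IsCuspForm.whittaker_eq (hφ : IsCuspForm dxq φ) (Ψ : AdeleCharacter ψ)
    (hdx : IsAddQuotientMeasure (principalAdeles F) dx dxq) (g : GSp4 (Adele F)) :
    whittaker dxq ψ φ g = whittakerCoeff dx ψ φ 1 g := by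
  have hL := hφ.left_invariant
  have hc := hφ.continuous_self
  have hD := isStrictFundDomain_adeleBox (F := F)
  have hc1 := continuous_centerAverage (dx := dx) hc
  have hc2 := continuous_klingenAverage (dx := dx) hc
  have hψ := Ψ.continuous_coe_neg
  have e1 : ∀ x₂ x₁ x₃, intMod dxq (fun x₄ =>
      φ (n x₂ * u x₄ x₃ x₁ * g) * (ψ (-(x₁ + x₂)) : ℂ)) =
      centerAverage dx φ (n x₂ * (u 0 x₃ 0 * (u 0 0 x₁ * g))) * (ψ (-(x₁ + x₂)) : ℂ) := by
    intro x₂ x₁ x₃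
    have h1 : ∀ x₄, n x₂ * u x₄ x₃ x₁ * g =
        u x₄ 0 0 * (n x₂ * (u 0 x₃ 0 * (u 0 0 x₁ * g))) := fun x₄ => by
      have h2 : u x₄ x₃ x₁ = u x₄ 0 0 * (u 0 x₃ 0 * u 0 0 x₁) := by
        rw [u_mul, u_mul]; simp
      have h3 := n_mul_u' x₂ x₄ 0 0 (u 0 x₃ 0 * (u 0 0 x₁ * g))
      simp only [mul_zero, zero_mul, add_zero] at h3
      rw [h2, ← h3]
      simp only [mul_assoc]
    simp only [h1]
    have hm : Continuous fun x₄ => φ (u x₄ 0 0 * (n x₂ * (u 0 x₃ 0 * (u 0 0 x₁ * g)))) *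
        (ψ (-(x₁ + x₂)) : ℂ) :=
      (hc.comp ((continuous_u continuous_id continuous_const continuous_const).mul
        continuous_const)).mul continuous_const
    rw [hdx.intMod_eq hD (fun x α => ?_) hm.measurable, integral_mul_const]
    · simp only [centerAverage, boxAverage, mul_one]
    · have : ∀ g, u (x + κ α) 0 0 * g = u (κ α) (κ 0) (κ 0) * (u x 0 0 * g) := fun g => by
        rw [← mul_assoc, map_zero, u_mul, zero_add, add_comm]
      rw [this, left_u_of_left_invariant hL]
  have e2 : ∀ x₂ x₁, intMod dxq (fun x₃ =>
      centerAverage dx φ (n x₂ * (u 0 x₃ 0 * (u 0 0 x₁ * g))) * (ψ (-(x₁ + x₂)) : ℂ)) =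
      klingenAverage dx φ (n x₂ * (u 0 0 x₁ * g)) * (ψ (-(x₁ + x₂)) : ℂ) := by
    intro x₂ x₁
    simp only [centerAverage_n_mul_u hL]
    have hm : Continuous fun x₃ => centerAverage dx φ (u 0 x₃ 0 * (n x₂ * (u 0 0 x₁ * g))) *
        (ψ (-(x₁ + x₂)) : ℂ) :=
      (hc1.comp ((continuous_u continuous_const continuous_id continuous_const).mul
        continuous_const)).mul continuous_const
    rw [hdx.intMod_eq hD (fun x α => ?_) hm.measurable, integral_mul_const]
    · simp only [klingenAverage, boxAverage, mul_one]
    · have : ∀ g, u 0 (x + κ α) 0 * g = u 0 (κ α) (κ 0) * (u 0 x 0 * g) := fun g => by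
        rw [← mul_assoc, map_zero, u_mul, zero_add, add_comm]
      rw [this, centerAverage_u hL]
  have hψ2 : ∀ x₁ x₂, (ψ (-(x₁ + x₂)) : ℂ) = (ψ (-x₁) : ℂ) * (ψ (-x₂) : ℂ) := fun x₁ x₂ => by
    rw [neg_add, AddChar.map_add_eq_mul, Circle.coe_mul]
  have hcont : Continuous fun p : Adele F × Adele F =>
      klingenAverage dx φ (n p.1 * (u 0 0 p.2 * g)) * (ψ (-(p.2 + p.1)) : ℂ) :=
    (hc2.comp ((continuous_n continuous_fst).mul ((continuous_u continuous_const continuous_const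
      continuous_snd).mul continuous_const))).mul (hψ.comp (continuous_snd.add continuous_fst))
  have e3 : ∀ x₂, intMod dxq (fun x₁ =>
      klingenAverage dx φ (n x₂ * (u 0 0 x₁ * g)) * (ψ (-(x₁ + x₂)) : ℂ)) =
      ∫ x₁ in adeleBox F, klingenAverage dx φ (n x₂ * (u 0 0 x₁ * g)) *
        (ψ (-(x₁ + x₂)) : ℂ) ∂dx := by
    intro x₂
    refine hdx.intMod_eq hD (fun x α => ?_) (hcont.comp (continuous_const.prodMk continuous_id)).measurable
    have h1 : u 0 0 (x + κ α) * g = u 0 0 (κ α) * (u 0 0 x * g) := by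
      rw [← mul_assoc, u_mul, zero_add, add_comm]
    rw [hψ2 (x + κ α) x₂, hψ2 x x₂, Ψ.neg_periodic, h1, n_mul_u', klingenAverage_u hL]
  have e4 : whittaker dxq ψ φ g = ∫ x₂ in adeleBox F, ∫ x₁ in adeleBox F,
      klingenAverage dx φ (n x₂ * (u 0 0 x₁ * g)) * (ψ (-(x₁ + x₂)) : ℂ) ∂dx ∂dx := by
    simp only [whittaker, e1, e2, e3]
    refine hdx.intMod_eq hD (fun x α => ?_)
      (continuous_setIntegral_adeleBox dx hcont).measurable
    refine integral_congr_ae (Filter.Eventually.of_forall fun x₁ => ?_)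
    simp only
    rw [hψ2 x₁ (x + κ α), hψ2 x₁ x, Ψ.neg_periodic, add_comm x, ← n_mul, mul_assoc, klingenAverage_n hL]
  rw [e4, setIntegral_adeleBox_swap dx (f := fun x₂ x₁ =>
      klingenAverage dx φ (n x₂ * (u 0 0 x₁ * g)) * (ψ (-(x₁ + x₂)) : ℂ)) hcont]
  simp only [whittakerCoeff, klingenCoeff, boxAverage, map_one, one_mul]
  refine integral_congr_ae (Filter.Eventually.of_forall fun x₁ => ?_)
  simp only
  rw [← integral_mul_const]
  refine integral_congr_ae (Filter.Eventually.of_forall fun x₂ => ?_)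
  simp only [hψ2]
  ring

/-- These are the integrals of the Bessel coefficient after the Weyl conjugation. The integrals over
`a` and `b` form `centerCoeff`, and that over `c` is left outside. -/
theorem IsCuspForm.intMod_center (hφ : IsCuspForm dxq φ) (Ψ : AdeleCharacter ψ)
    (hdx : IsAddQuotientMeasure (principalAdeles F) dx dxq) (g : GSp4 (Adele F)) :
    intMod dxq (fun a => intMod dxq fun c => intMod dxq fun b =>
      φ (u a 0 0 * (n b * (lower (-c) * g))) * (ψ (-b) : ℂ)) =
    ∫ c in adeleBox F, centerCoeff dx ψ φ (lower (-c) * g) ∂dx := by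
  have hL := hφ.left_invariant
  have hc := hφ.continuous_self
  have hψ := Ψ.continuous_coe_neg
  rw [hdx.intMod_three (f := fun a c b => φ (u a 0 0 * (n b * (lower (-c) * g))) * (ψ (-b) : ℂ))
    ((hc.comp ((continuous_u continuous_fst continuous_const continuous_const).mul
      ((continuous_n (continuous_snd.comp continuous_snd)).mul ((continuous_lower
        (continuous_fst.comp continuous_snd).neg).mul continuous_const)))).mul
      (hψ.comp (continuous_snd.comp continuous_snd)))
    (fun a c b α => ?_) (fun a c b α => ?_) (fun a c b α => ?_)]
  · have h1 : ∀ c b, ∫ a in adeleBox F, φ (u a 0 0 * (n b * (lower (-c) * g))) * (ψ (-b) : ℂ) ∂dx =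
        centerAverage dx φ (n b * (lower (-c) * g)) * (ψ (-b) : ℂ) := fun c b => by
      rw [integral_mul_const]
      simp only [centerAverage, boxAverage, mul_one]
    simp only [h1]
    rw [setIntegral_adeleBox_swap dx (f := fun b c =>
      centerAverage dx φ (n b * (lower (-c) * g)) * (ψ (-b) : ℂ))]
    · rfl
    · exact ((continuous_centerAverage hc).comp ((continuous_n continuous_fst).mul
        ((continuous_lower continuous_snd.neg).mul continuous_const))).mul
        (hψ.comp continuous_fst)
  · have h3 : ∀ g, u (a + κ α) 0 0 * g = u (κ α) (κ 0) (κ 0) * (u a 0 0 * g) := fun g => by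
      rw [← mul_assoc, map_zero, u_mul, zero_add, add_comm]
    rw [h3, left_u_of_left_invariant hL]
  · have h3 : u a 0 0 * (n b * (lower (-(c + κ α)) * g)) =
        lower (κ (-α)) * (u a 0 0 * (n b * (lower (-c) * g))) := by
      rw [neg_add, add_comm, ← lower_mul, ← map_neg, mul_assoc, ← mul_assoc (n b), n_mul_lower,
        mul_assoc (GSp4.lower _), ← mul_assoc (u _ _ _), u_mul_lower, mul_assoc (GSp4.lower _)]
    rw [h3, left_lower_of_left_invariant hL]
  · have h3 := n_mul_u' (κ α) a 0 0 (n b * (lower (-c) * g))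
    simp only [mul_zero, zero_mul, add_zero] at h3
    rw [Ψ.neg_periodic, add_comm b, ← n_mul, mul_assoc, ← h3, left_n_of_left_invariant hL]

/-- The Bessel coefficient in terms of `centerCoeff`. -/
theorem IsCuspForm.besselCoeff_eq (hφ : IsCuspForm dxq φ) (Ψ : AdeleCharacter ψ)
    (hdx : IsAddQuotientMeasure (principalAdeles F) dx dxq) (y : (Adele F)ˣ) :
    besselCoeff dxq ψ φ (besselTorus y) = ∫ c in adeleBox F,
      centerCoeff dx ψ (fun g => φ (g * weyl⁻¹)) (lower (-c) * siegelTorus y) ∂dx := by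
  have hφ' : IsCuspForm dxq (fun g => φ (g * weyl⁻¹)) := hφ.translate weyl⁻¹
  -- The Weyl element is rational, so the factor produced on the left disappears, while its inverse
  -- stays on the right as a translation of `φ`.
  have h1 : ∀ a b c, φ (u a b c * besselTorus y) =
      φ (u a 0 0 * (n b * (lower (-c) * siegelTorus y)) * weyl⁻¹) := by
    intro a b c
    have h2 := weyl_mul_identity a b c y
    have h3 : u a b c * besselTorus y =
        weyl * ((u a 0 0 * (n b * (lower (-c) * siegelTorus y))) * weyl⁻¹) := by
      rw [← mul_assoc, eq_mul_inv_iff_mul_eq, h2]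
      simp only [mul_assoc]
    have h4 := hφ.left_invariant weyl ((u a 0 0 * (n b * (lower (-c) * siegelTorus y))) * weyl⁻¹)
    rw [map_weyl] at h4
    rw [h3, h4]
  simp only [besselCoeff, h1]
  exact hφ'.intMod_center Ψ hdx (siegelTorus y)

end unfolding

/-! ### Bounded denominators of `x` and `η`. -/

section support

open GSp4 IsDedekindDomain

variable {F : Type*} [Field F] [NumberField F] {dx : Measure (Adele F)} [dx.IsAddHaarMeasure]
  {dxq : Measure (Adele F ⧸ principalAdeles F)} {ψ : AddChar (Adele F) Circle}
  {φ : GSp4 (Adele F) → ℂ}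

local notation "κ" => algebraMap F (Adele F)
local notation "κf" => algebraMap F (FiniteAdeleRing (𝓞 F) F)

/-- `N` and `C` are chosen before `η`; without this uniformity the sum over `η` could not be
controlled. -/
theorem IsCuspForm.exists_isSmoothMod_whittakerCoeff (hφ : IsCuspForm dxq φ)
    (Ψ : AdeleCharacter ψ) :
    ∃ N C, ∀ η : F, IsSmoothMod N C (whittakerCoeff dx ψ φ η) := by
  obtain ⟨N, C, h⟩ := hφ.exists_isSmoothMod
  have hψ := Ψ.continuous_coe_neg
  have hn : ∀ x : Adele F, ‖(ψ x : ℂ)‖ ≤ 1 := fun x => (Circle.norm_coe _).le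
  obtain ⟨B₁, -, h₁⟩ := exists_isSmoothMod_boxAverage (ι := fun a : Adele F => u a 0 0) dx
    (by fun_prop) N
  obtain ⟨B₂, -, h₂⟩ := exists_isSmoothMod_boxAverage (ι := fun a : Adele F => u 0 a 0) dx
    (by fun_prop) N
  obtain ⟨B₃, -, h₃⟩ := exists_isSmoothMod_boxAverage (ι := fun a : Adele F => n a) dx
    (by fun_prop) N
  obtain ⟨B₄, -, h₄⟩ := exists_isSmoothMod_boxAverage (ι := fun a : Adele F => u 0 0 a) dx
    (by fun_prop) N
  have a₁ := h₁ (fun _ => 1) φ C continuous_const (by simp) h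
  have a₂ := h₂ (fun _ => 1) _ _ continuous_const (by simp) a₁
  have a₃ := h₃ (fun b => (ψ (-b) : ℂ)) _ _ hψ (fun _ => hn _) a₂
  exact ⟨N, _, fun η => h₄ (fun c => (ψ (-(κ η * c)) : ℂ)) _ _
    (hψ.comp (continuous_const_mul _)) (fun _ => hn _) a₃⟩

theorem IsCuspForm.exists_isFiniteInvariant_whittakerCoeff (hφ : IsCuspForm dxq φ) :
    ∃ O ∈ 𝓝 1, ∀ η : F, IsFiniteInvariant O (whittakerCoeff dx ψ φ η) := by
  obtain ⟨O, hO, h⟩ := hφ.exists_isFiniteInvariant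
  exact ⟨O, hO, fun η => boxAverage_isFiniteInvariant (boxAverage_isFiniteInvariant
    (boxAverage_isFiniteInvariant (boxAverage_isFiniteInvariant h)))⟩

theorem continuous_adeleMk_zero :
    Continuous fun s : FiniteAdeleRing (𝓞 F) F => (adeleMk 0 s : Adele F) :=
  continuous_adeleMk.comp (continuous_const.prodMk continuous_id)

/-- The support of a finitely invariant function of Whittaker type in the variable `x`. -/
theorem AdeleCharacter.exists_support_lower (Ψ : AdeleCharacter ψ) {O : Set (GSp4 (Adele F))}
    (hO : O ∈ 𝓝 1) :
    ∃ d : 𝓞 F, d ≠ 0 ∧ ∀ (η : F) (Φ : GSp4 (Adele F) → ℂ), IsWhittakerType ψ η Φ →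
      IsFiniteInvariant O Φ → ∀ (y : (Adele F)ˣ) (x : Adele F),
      Φ (siegelTorus y * lower x) ≠ 0 → κf d * finPart x ∈ integralAdeles F := by
  obtain ⟨N, hN, hcond⟩ := Ψ.exists_conductor
  have hU : {s : FiniteAdeleRing (𝓞 F) F | u 0 (adeleMk 0 s) 0 ∈ O} ∈ 𝓝 0 := by
    have hc : Continuous fun s : FiniteAdeleRing (𝓞 F) F => u 0 (adeleMk 0 s : Adele F) 0 :=
      continuous_u continuous_const continuous_adeleMk_zero continuous_const
    refine hc.continuousAt.preimage_mem_nhds ?_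
    rw [adeleMk_zero, u_zero]
    exact hO
  obtain ⟨d, hd, hdU⟩ := exists_smul_integralAdeles_subset hU
  refine ⟨N * d, mul_ne_zero hN hd, fun η Φ h hinv y x hne => ?_⟩
  -- Right translation by a small finite `u 0 b 0` fixes `Φ`, yet multiplies its value by `ψ(-xb)`.
  -- Where `Φ` does not vanish, `ψ` must therefore be trivial on these products.
  have h1 : ∀ o ∈ integralAdeles F, ψ (adeleMk 0 (finPart x * κf d * o)) = 1 := by
    intro o ho
    have h2 := hinv (u 0 (adeleMk 0 (κf d * o)) 0) (hdU o ho) (by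
      rw [map_u, map_zero, archPart_adeleMk, u_zero]) (siegelTorus y * lower x)
    rw [h.mul_u] at h2
    have h3 : (ψ (-(x * adeleMk 0 (κf d * o))) : ℂ) = 1 := mul_right_cancel₀ hne (by rw [h2, one_mul])
    have h4 : ψ (-(x * adeleMk 0 (κf d * o))) = 1 := Circle.ext (by rw [h3, Circle.coe_one])
    rw [AddChar.map_neg_eq_inv, inv_eq_one] at h4
    rw [← h4]
    congr 1
    refine adele_ext (by simp) (by simp [mul_assoc])
  have h5 := hcond _ h1
  have h6 : κf ((N * d : 𝓞 F) : F) * finPart x = κf N * (finPart x * κf d) := by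
    rw [RingOfIntegers.coe_eq_algebraMap, map_mul (algebraMap (𝓞 F) F), map_mul κf]
    ring
  rwa [h6]

theorem isCompact_setOf_mul_mem_integralAdeles {d : 𝓞 F} (hd : d ≠ 0) :
    IsCompact {s : FiniteAdeleRing (𝓞 F) F | κf d * s ∈ integralAdeles F} := by
  have hd' : (d : F) ≠ 0 := by simpa using hd
  have h : {s : FiniteAdeleRing (𝓞 F) F | κf d * s ∈ integralAdeles F} =
      (fun s => κf ((d : F)⁻¹) * s) '' (integralAdeles F : Set (FiniteAdeleRing (𝓞 F) F)) := by
    ext s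
    constructor
    · intro hs
      refine ⟨_, hs, ?_⟩
      simp only
      rw [← mul_assoc, ← map_mul κf, inv_mul_cancel₀ hd', map_one, one_mul]
    · rintro ⟨o, ho, rfl⟩
      change κf d * (κf ((d : F)⁻¹) * o) ∈ integralAdeles F
      rw [← mul_assoc, ← map_mul κf, mul_inv_cancel₀ hd', map_one, one_mul]
      exact ho
  rw [h]
  exact isCompact_integralAdeles.image (continuous_const_mul _)

theorem exists_mul_mem_integralAdeles_of_isCompact {S : Set (FiniteAdeleRing (𝓞 F) F)}
    (hS : IsCompact S) :
    ∃ d : 𝓞 F, d ≠ 0 ∧ ∀ s ∈ S, κf d * s ∈ integralAdeles F := by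
  have hmem : ∀ a : 𝓞 F, κf a ∈ integralAdeles F := fun a =>
    (algebraMap_mem_integralAdeles_iff _).2 ⟨a, rfl⟩
  have hmul : ∀ (a b : 𝓞 F) (x : FiniteAdeleRing (𝓞 F) F), κf ((a * b : 𝓞 F) : F) * x =
      κf a * (κf b * x) := fun a b x => by
    rw [RingOfIntegers.coe_eq_algebraMap, map_mul (algebraMap (𝓞 F) F), map_mul κf, mul_assoc]
  refine hS.induction_on (p := fun S => ∃ d : 𝓞 F, d ≠ 0 ∧ ∀ s ∈ S, κf d * s ∈ integralAdeles F)
    ⟨1, one_ne_zero, by simp⟩ (fun s t hst ⟨d, hd, h⟩ => ⟨d, hd, fun x hx => h x (hst hx)⟩) ?_ ?_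
  · rintro s t ⟨d, hd, h⟩ ⟨e, he, h'⟩
    refine ⟨d * e, mul_ne_zero hd he, fun x hx => ?_⟩
    rcases hx with hx | hx
    · rw [mul_comm d, hmul]
      exact mul_mem (hmem _) (h x hx)
    · rw [hmul]
      exact mul_mem (hmem _) (h' x hx)
  · intro x _
    obtain ⟨d, hd, h⟩ := exists_mul_mem_integralAdeles x
    refine ⟨{y | κf d * y ∈ integralAdeles F}, mem_nhdsWithin_of_mem_nhds ?_, d, hd, fun y hy => hy⟩
    exact (continuous_const_mul (κf d)).continuousAt.preimage_mem_nhds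
      (isOpen_integralAdeles.mem_nhds h)

theorem GSp4.lower_mul_u_comm {R : Type*} [CommRing R] {x c : R} (h : x * c = 0) :
    lower x * u 0 0 c = u 0 0 c * lower x := by
  have h' : c * x = 0 := by rw [mul_comm, h]
  refine ext_matrix ?_
  simp only [coe_mul, u, lower, novo, coe_ofMatrix]
  ext i j
  fin_cases i <;> fin_cases j <;> simp [Matrix.mul_apply, Fin.sum_univ_four, h, h']

/-- The support of a finitely invariant function of Whittaker type in the variable `η`. -/
theorem AdeleCharacter.exists_support_principal (Ψ : AdeleCharacter ψ)
    {O : Set (GSp4 (Adele F))} (hO : O ∈ 𝓝 1) {K : Set (Adele F)ˣ} (hK : IsCompact K) :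
    ∃ d : 𝓞 F, d ≠ 0 ∧ ∀ (η : F) (Φ : GSp4 (Adele F) → ℂ), IsWhittakerType ψ η Φ →
      IsFiniteInvariant O Φ → ∀ (t : ℝ), ∀ k ∈ K, ∀ x : Adele F,
      Φ (siegelTorus (posIdele t * k) * lower x) ≠ 0 → ∃ c : 𝓞 F, (d : F) * η = c := by
  obtain ⟨N, hN, hcond⟩ := Ψ.exists_conductor
  obtain ⟨d₁, hd₁, hsupp⟩ := Ψ.exists_support_lower hO
  set S := {s : FiniteAdeleRing (𝓞 F) F | κf d₁ * s ∈ integralAdeles F}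
  have hS : IsCompact S := isCompact_setOf_mul_mem_integralAdeles hd₁
  -- The finite part of `x` ranges over the compact set `S`, so one neighbourhood of `0` keeps all
  -- the conjugates of `u 0 0 c` inside `O`.
  have hU : {c : FiniteAdeleRing (𝓞 F) F | ∀ s ∈ S, lower (-(adeleMk 0 s)) *
      u 0 0 (adeleMk 0 c) * lower (adeleMk 0 s) ∈ O} ∈ 𝓝 0 := by
    refine hS.eventually_forall_of_forall_eventually (x₀ := (0 : FiniteAdeleRing (𝓞 F) F))
      (P := fun c s => lower (-(adeleMk 0 s)) * u 0 0 (adeleMk 0 c) * lower (adeleMk 0 s) ∈ O)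
      fun s _ => ?_
    have hc : Continuous fun z : FiniteAdeleRing (𝓞 F) F × FiniteAdeleRing (𝓞 F) F =>
        lower (-(adeleMk 0 z.2)) * u 0 0 (adeleMk 0 z.1) * lower (adeleMk 0 z.2 : Adele F) :=
      ((continuous_lower (continuous_adeleMk_zero.comp continuous_snd).neg).mul
        (continuous_u continuous_const continuous_const
          (continuous_adeleMk_zero.comp continuous_fst))).mul
        (continuous_lower (continuous_adeleMk_zero.comp continuous_snd))
    refine hc.continuousAt.eventually_mem ?_
    simp only [adeleMk_zero, u_zero, mul_one, lower_mul, neg_add_cancel, lower_zero]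
    exact hO
  obtain ⟨d₂, hd₂, hdU⟩ := exists_smul_integralAdeles_subset hU
  obtain ⟨d₃, hd₃, hK3⟩ := exists_mul_mem_integralAdeles_of_isCompact
    (hK.image (f := fun k : (Adele F)ˣ => finPart ((k⁻¹ : (Adele F)ˣ) : Adele F))
      (continuous_finPart.comp (Units.continuous_val.comp continuous_inv)))
  refine ⟨N * (d₂ * d₃), mul_ne_zero hN (mul_ne_zero hd₂ hd₃),
    fun η Φ h hinv t k hk x hne => ?_⟩
  have hx : finPart x ∈ S := hsupp η Φ h hinv _ _ hne
  set y := posIdele t * k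
  have hyf : finPart (y : Adele F) = finPart (k : Adele F) := by
    rw [Units.val_mul, map_mul, posIdele_val, finPart_adeleMk, one_mul]
  have h1 : ∀ o ∈ integralAdeles F,
      ψ (adeleMk 0 (κf η * finPart (k : Adele F) * κf d₂ * o)) = 1 := by
    intro o ho
    set c := κf d₂ * o
    have h2 := hinv _ (hdU o ho _ hx) (by
      rw [GSp4.map_mul_eq, GSp4.map_mul_eq, map_u, map_lower, map_lower, map_zero, map_neg,
        archPart_adeleMk, archPart_adeleMk, u_zero, mul_one, lower_mul, neg_add_cancel,
        lower_zero]) (siegelTorus y * lower x)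
    -- The archimedean part of `lower x` commutes with the finite element `u 0 0 c`, so the
    -- conjugate moves to the left as `u 0 0 (yc)`, where `Φ` transforms by `ψ(ηyc)`.
    have h3 : siegelTorus y * lower x * (lower (-(adeleMk 0 (finPart x))) *
        u 0 0 (adeleMk 0 c) * lower (adeleMk 0 (finPart x))) =
        u 0 0 (y * adeleMk 0 c) * (siegelTorus y * lower x) := by
      have h4 : lower x * lower (-(adeleMk 0 (finPart x))) = lower (adeleMk (archPart x) 0) := by
        rw [lower_mul]
        exact congrArg lower (adele_ext (by simp) (by simp))
      have h5 : lower (adeleMk (archPart x) 0) * lower (adeleMk 0 (finPart x)) = lower x := by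
        rw [lower_mul, ← adeleMk_add]
        simp
      have h6 : lower (adeleMk (archPart x) 0) * u 0 0 (adeleMk 0 c) =
          u 0 0 (adeleMk 0 c) * lower (adeleMk (archPart x) 0) :=
        lower_mul_u_comm (by rw [← adeleMk_mul]; simp)
      have h7 := u_mul_siegelTorus y 0 0 (adeleMk 0 c)
      rw [mul_zero] at h7
      calc _ = siegelTorus y * (lower x * lower (-(adeleMk 0 (finPart x)))) *
            u 0 0 (adeleMk 0 c) * lower (adeleMk 0 (finPart x)) := by simp only [mul_assoc]
        _ = siegelTorus y * (lower (adeleMk (archPart x) 0) * u 0 0 (adeleMk 0 c)) *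
            lower (adeleMk 0 (finPart x)) := by rw [h4]; simp only [mul_assoc]
        _ = siegelTorus y * u 0 0 (adeleMk 0 c) *
            (lower (adeleMk (archPart x) 0) * lower (adeleMk 0 (finPart x))) := by
            rw [h6]; simp only [mul_assoc]
        _ = _ := by rw [h5, ← h7, mul_assoc]
    rw [h3, h.left_c] at h2
    have h8 : (ψ (κ η * (y * adeleMk 0 c)) : ℂ) = 1 := mul_right_cancel₀ hne (by rw [h2, one_mul])
    have h9 : ψ (κ η * (y * adeleMk 0 c)) = 1 := Circle.ext (by rw [h8, Circle.coe_one])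
    rw [← h9]
    congr 1
    exact adele_ext (by simp) (by simp [hyf, c, mul_assoc])
  have h10 := hcond _ h1
  -- So far a denominator of `ηk` is bounded; multiplication by `k⁻¹`, whose denominator is bounded
  -- on `K`, isolates `η`.
  have h11 := mul_mem h10 (hK3 _ (Set.mem_image_of_mem _ hk))
  have h12 : finPart (k : Adele F) * finPart ((k⁻¹ : (Adele F)ˣ) : Adele F) = 1 := by
    rw [← map_mul, Units.mul_inv, map_one]
  have h13 : κf N * (κf η * finPart (k : Adele F) * κf d₂) *
      (κf d₃ * finPart ((k⁻¹ : (Adele F)ˣ) : Adele F)) =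
      κf (((N * (d₂ * d₃) : 𝓞 F) : F) * η) := by
    have hco : ((N * (d₂ * d₃) : 𝓞 F) : F) = N * (d₂ * d₃) :=
      (map_mul (algebraMap (𝓞 F) F) _ _).trans (congrArg _ (map_mul (algebraMap (𝓞 F) F) _ _))
    rw [map_mul κf, hco, map_mul κf, map_mul κf]
    linear_combination (κf N * κf η * κf d₂ * κf d₃) * h12
  rw [h13, algebraMap_mem_integralAdeles_iff] at h11
  obtain ⟨c, hc⟩ := h11
  exact ⟨c, hc.symm⟩

end support

/-! ### The main estimate for the Whittaker functions. -/

section weights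

open GSp4 IsDedekindDomain mixedEmbedding
open scoped Classical

variable {F : Type*} [Field F] [NumberField F] {dx : Measure (Adele F)} [dx.IsAddHaarMeasure]
  {dxq : Measure (Adele F ⧸ principalAdeles F)} {ψ : AddChar (Adele F) Circle}
  {φ : GSp4 (Adele F) → ℂ}

/-- The function `‖η‖⁻ᵐ` on the fractional ideal `e⁻¹ 𝓞`. -/
def principalWeight (e : 𝓞 F) (m : ℕ) : F → ℝ :=
  Set.indicator {η | ∃ c : 𝓞 F, (e : F) * η = c} fun η => (‖mixedEmbedding F η‖ ^ m)⁻¹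

/-- The function `(1 + ‖x‖)⁻ᵏ` on the adeles with finite part in `d⁻¹ Ô`. -/
def lowerWeight (d : 𝓞 F) (k : ℕ) : Adele F → ℝ :=
  Set.indicator {x | algebraMap F (FiniteAdeleRing (𝓞 F) F) d * finPart x ∈ integralAdeles F}
    fun x => ((1 + ‖archPart x‖) ^ k)⁻¹

theorem principalWeight_nonneg (e : 𝓞 F) (m : ℕ) (η : F) : 0 ≤ principalWeight e m η :=
  Set.indicator_nonneg (fun _ _ => by positivity) η

theorem lowerWeight_nonneg (d : 𝓞 F) (k : ℕ) (x : Adele F) : 0 ≤ lowerWeight d k x :=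
  Set.indicator_nonneg (fun _ _ => by positivity) x

theorem summable_principalWeight {e : 𝓞 F} (he : e ≠ 0) {m : ℕ} (hm : Module.finrank ℚ F < m) :
    Summable (principalWeight e m) :=
  summable_subtype_iff_indicator.1 (summable_norm_mixedEmbedding he hm)

/-- Scaling by `d⁻¹` preserves the Haar measure and makes the finite part integral. What remains is
a power of `1 + ‖w‖` on a real space of dimension `[F : ℚ]`. -/
theorem integrable_lowerWeight {d : 𝓞 F} (hd : d ≠ 0) {k : ℕ} (hk : Module.finrank ℚ F < k) :
    Integrable (lowerWeight d k) dx := by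
  have hd' : (d : F) ≠ 0 := by simpa using hd
  have hmp := measurePreserving_mul_principal (dx := dx) (inv_ne_zero hd')
  have hu : IsUnit (algebraMap F (Adele F) (d : F)⁻¹) := (IsUnit.mk0 _ (inv_ne_zero hd')).map _
  rw [← hmp.integrable_comp_emb (Homeomorph.smul hu.unit).measurableEmbedding]
  set A : Set (Adele F) := finPart ⁻¹' (integralAdeles F : Set (FiniteAdeleRing (𝓞 F) F))
  have hA : MeasurableSet A := (isOpen_integralAdeles.preimage continuous_finPart).measurableSet
  have h1 : (lowerWeight d k ∘ fun x => algebraMap F (Adele F) (d : F)⁻¹ * x) =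
      A.indicator fun x => ((1 + ‖mixedEmbedding F (d : F)⁻¹ * archPart x‖) ^ k)⁻¹ := by
    funext x
    have h2 : algebraMap F (FiniteAdeleRing (𝓞 F) F) d *
        finPart (algebraMap F (Adele F) (d : F)⁻¹ * x) = finPart x := by
      rw [map_mul, finPart_algebraMap, ← mul_assoc,
        ← map_mul (algebraMap F (FiniteAdeleRing (𝓞 F) F)), mul_inv_cancel₀ hd', map_one, one_mul]
    have h3 : archPart (algebraMap F (Adele F) (d : F)⁻¹ * x) =
        mixedEmbedding F (d : F)⁻¹ * archPart x := by rw [map_mul, archPart_algebraMap]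
    simp only [Function.comp_apply, lowerWeight, Set.indicator_apply, Set.mem_ofPred_eq, h2, h3]
    rfl
  rw [h1, integrable_indicator_iff hA]
  have hint : Integrable (fun w : mixedSpace F =>
      (1 + ‖mixedEmbedding F (d : F)‖) ^ k * (1 + ‖w‖) ^ (-(k : ℝ))) (archMeasure dx) := by
    refine (integrable_one_add_norm ?_).const_mul _
    rw [mixedEmbedding.finrank]
    exact_mod_cast hk
  have hint2 := (integrable_map_measure hint.aestronglyMeasurable
    continuous_archPart.measurable.aemeasurable).1 hint
  refine Integrable.mono' hint2 ?_ (Filter.Eventually.of_forall fun x => ?_)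
  · have : Continuous fun x : Adele F =>
        ((1 + ‖mixedEmbedding F (d : F)⁻¹ * archPart x‖) ^ k)⁻¹ := by
      refine Continuous.inv₀ ?_ fun x => by positivity
      exact (continuous_const.add (continuous_const.mul continuous_archPart).norm).pow k
    exact this.aestronglyMeasurable
  · simp only [Function.comp_apply]
    set w := archPart x
    have h3 : mixedEmbedding F (d : F) * (mixedEmbedding F (d : F)⁻¹ * w) = w := by
      rw [← mul_assoc, ← map_mul, mul_inv_cancel₀ hd', map_one, one_mul]
    have h4 : 1 + ‖w‖ ≤ (1 + ‖mixedEmbedding F (d : F)‖) *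
        (1 + ‖mixedEmbedding F (d : F)⁻¹ * w‖) := by
      have := norm_mul_le (mixedEmbedding F (d : F)) (mixedEmbedding F (d : F)⁻¹ * w)
      rw [h3] at this
      nlinarith [norm_nonneg (mixedEmbedding F (d : F)),
        norm_nonneg (mixedEmbedding F (d : F)⁻¹ * w)]
    rw [Real.norm_of_nonneg (by positivity), Real.rpow_neg (by positivity), Real.rpow_natCast,
      ← div_eq_mul_inv, inv_eq_one_div, div_le_div_iff₀ (by positivity) (by positivity), one_mul,
      ← mul_pow]
    exact pow_le_pow_left₀ (by positivity) h4 k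

/-- The main estimate for the Whittaker functions. -/
theorem IsCuspForm.exists_whittakerCoeff_le (hφ : IsCuspForm dxq φ) (Ψ : AdeleCharacter ψ)
    (hdx : IsAddQuotientMeasure (principalAdeles F) dx dxq) {K : Set (Adele F)ˣ}
    (hK : IsCompact K) :
    ∃ d e : 𝓞 F, d ≠ 0 ∧ e ≠ 0 ∧ ∃ b : ℕ, ∀ m k : ℕ, ∃ B : ℝ, 0 ≤ B ∧
      ∀ (η : F) (t : ℝ), ∀ y ∈ K, ∀ x : Adele F,
      ‖whittakerCoeff dx ψ φ η (siegelTorus (posIdele t * y) * lower x)‖ ≤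
        B * Real.exp (b * |t| - m * t) * principalWeight e m η * lowerWeight d k x := by
  obtain ⟨N, C, hsm⟩ := hφ.exists_isSmoothMod_whittakerCoeff (dx := dx) Ψ
  obtain ⟨O, hO, hinv⟩ := hφ.exists_isFiniteInvariant_whittakerCoeff (dx := dx) (ψ := ψ)
  obtain ⟨d, hd, hsupp⟩ := Ψ.exists_support_lower hO
  obtain ⟨e, he, hsupp'⟩ := Ψ.exists_support_principal hO hK
  obtain ⟨H, hH, hht⟩ := exists_adelicHeight_novo_le hK (isCompact_setOf_mul_mem_integralAdeles hd)
  have hW := fun η => isWhittakerType_whittakerCoeff (dx := dx) Ψ hφ.left_invariant η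
  set n := Module.finrank ℚ F
  -- The growth exponent `b = n * N` is fixed before `m` and `k`; this is where the uniformity in
  -- moderate growth is used.
  refine ⟨d, e, hd, he, n * N, fun m k => ?_⟩
  -- The additional `n * N` powers of `1 + ‖archPart x‖` absorb the growth of the height in `x`.
  obtain ⟨B, hB, hdecay⟩ := Ψ.exists_decay hK N m (k + n * N) C
  refine ⟨B * H ^ N, by positivity, fun η t y hy x => ?_⟩
  by_cases hne : whittakerCoeff dx ψ φ η (siegelTorus (posIdele t * y) * lower x) = 0
  · rw [hne, norm_zero]
    exact mul_nonneg (mul_nonneg (by positivity) (principalWeight_nonneg _ _ _))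
      (lowerWeight_nonneg _ _ _)
  have hη : η ≠ 0 := by
    rintro rfl
    exact hne (hφ.whittakerCoeff_zero Ψ hdx _)
  have hx := hsupp η _ (hW η) (hinv η) _ _ hne
  have he' := hsupp' η _ (hW η) (hinv η) t y hy x hne
  have h1 := hdecay η _ (hW η) (hsm η) t y hy x
  have h2 := hht t y hy (archPart x) (finPart x) hx
  rw [adeleMk_parts] at h2
  have hσ : 0 < ‖mixedEmbedding F η‖ := norm_pos_iff.2 fun h => hη
    ((map_eq_zero_iff _ (mixedEmbedding_injective F)).1 h)
  rw [principalWeight, lowerWeight, Set.indicator_of_mem (by exact he'),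
    Set.indicator_of_mem (by exact hx)]
  set Wv := ‖whittakerCoeff dx ψ φ η (siegelTorus (posIdele t * y) * lower x)‖
  set X := 1 + ‖archPart x‖
  have hX : 0 < X := by positivity
  have h3 : (Real.exp t * ‖mixedEmbedding F η‖) ^ m * (X ^ (k + n * N) * Wv) ≤
      B * (H * (Real.exp |t| * X) ^ n) ^ N :=
    h1.trans (mul_le_mul_of_nonneg_left (pow_le_pow_left₀ (adelicHeight_nonneg _) h2 _) hB)
  have h4 : (H * (Real.exp |t| * X) ^ n) ^ N =
      H ^ N * Real.exp ((n * N : ℕ) * |t|) * X ^ (n * N) := by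
    rw [mul_pow, ← pow_mul, mul_pow, Real.exp_nat_mul, mul_assoc]
  have h5 : Real.exp (((n * N : ℕ) : ℝ) * |t| - m * t) =
      Real.exp ((n * N : ℕ) * |t|) * (Real.exp t ^ m)⁻¹ := by
    rw [Real.exp_sub, Real.exp_nat_mul t m, div_eq_mul_inv]
  rw [h4, pow_add] at h3
  have h6 : Real.exp t ^ m * ‖mixedEmbedding F η‖ ^ m * X ^ k * Wv ≤
      B * H ^ N * Real.exp ((n * N : ℕ) * |t|) := by
    refine le_of_mul_le_mul_right ?_ (pow_pos hX (n * N))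
    refine (le_of_eq ?_).trans (h3.trans_eq ?_)
    · rw [mul_pow]; ring
    · ring
  rw [h5]
  have h7 : B * H ^ N * (Real.exp ((n * N : ℕ) * |t|) * (Real.exp t ^ m)⁻¹) *
      (‖mixedEmbedding F η‖ ^ m)⁻¹ * (X ^ k)⁻¹ =
      (B * H ^ N * Real.exp ((n * N : ℕ) * |t|)) /
        (Real.exp t ^ m * ‖mixedEmbedding F η‖ ^ m * X ^ k) := by
    field_simp
  rw [h7, le_div_iff₀ (by positivity)]
  linarith

end weights

/-! ### Fourier expansions and the unfolding of the integral over `F\𝔸`. -/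

section expansion

open GSp4 IsDedekindDomain

variable {F : Type*} [Field F] [NumberField F] {dx : Measure (Adele F)} [dx.IsAddHaarMeasure]
  {dxq : Measure (Adele F ⧸ principalAdeles F)} {ψ : AddChar (Adele F) Circle}
  {φ : GSp4 (Adele F) → ℂ}

local notation "κ" => algebraMap F (Adele F)

/-- The Fourier expansion of `klingenCoeff` along `u(0, 0, c)`. -/
theorem IsCuspForm.hasSum_whittakerCoeff (hφ : IsCuspForm dxq φ) (Ψ : AdeleCharacter ψ)
    (hvol : dx (adeleBox F) = 1) {g : GSp4 (Adele F)}
    (hs : Summable fun η : F => ‖whittakerCoeff dx ψ φ η g‖) :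
    HasSum (fun η : F => whittakerCoeff dx ψ φ η g) (klingenCoeff dx ψ φ g) := by
  have hc := continuous_klingenCoeff (dx := dx) Ψ hφ.continuous_self
  have hp : IsPeriodic fun c : Adele F => klingenCoeff dx ψ φ (u 0 0 c * g) := fun x α => by
    have : u 0 0 (x + κ α) * g = u 0 0 (κ α) * (u 0 0 x * g) := by
      rw [← mul_assoc, u_mul, add_zero, add_comm]
    simp only [this]
    rw [klingenCoeff_u hφ.left_invariant]
  have h := Ψ.hasSum_fourier hvol hp (hc.comp ((continuous_u continuous_const continuous_const
    continuous_id).mul continuous_const)) hs 0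
  simp only [mul_zero, AddChar.map_zero_eq_one, Circle.coe_one, mul_one, u_zero, one_mul] at h
  exact h

/-- The Fourier expansion of `centerCoeff` along `u(0, b, 0)`. -/
theorem IsCuspForm.hasSum_klingenCoeff (hφ : IsCuspForm dxq φ) (Ψ : AdeleCharacter ψ)
    (hvol : dx (adeleBox F) = 1) {g : GSp4 (Adele F)}
    (hs : Summable fun ξ : F => ‖klingenCoeff dx ψ φ (lower (-κ ξ) * g)‖) :
    HasSum (fun ξ : F => klingenCoeff dx ψ φ (lower (-κ ξ) * g)) (centerCoeff dx ψ φ g) := by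
  have hc := continuous_centerCoeff (dx := dx) Ψ hφ.continuous_self
  have hp : IsPeriodic fun c : Adele F => centerCoeff dx ψ φ (u 0 c 0 * g) := fun x α => by
    have : u 0 (x + κ α) 0 * g = u 0 (κ α) 0 * (u 0 x 0 * g) := by
      rw [← mul_assoc, u_mul, add_zero, add_comm]
    simp only [this]
    rw [centerCoeff_u hφ.left_invariant]
  have e := fun ξ => integral_centerCoeff_mul (dx := dx) Ψ hφ.left_invariant hφ.continuous_self ξ g
  simp only [← e] at hs ⊢
  have h := Ψ.hasSum_fourier hvol hp (hc.comp ((continuous_u continuous_const continuous_id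
    continuous_const).mul continuous_const)) hs 0
  simp only [mul_zero, AddChar.map_zero_eq_one, Circle.coe_one, mul_one, u_zero, one_mul] at h
  exact h

/-- Unfolding: the Fourier expansion along `u 0 b 0` writes the integrand as a sum over the
translates of `c` by `F`. Integrability makes that series absolutely convergent for almost every
`c`, and this is all that is needed. -/
theorem IsCuspForm.setIntegral_centerCoeff (hφ : IsCuspForm dxq φ) (Ψ : AdeleCharacter ψ)
    (hvol : dx (adeleBox F) = 1) {g : GSp4 (Adele F)}
    (hi : Integrable (fun x => klingenCoeff dx ψ φ (lower (-x) * g)) dx) :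
    ∫ c in adeleBox F, centerCoeff dx ψ φ (lower (-c) * g) ∂dx =
      ∫ x, klingenCoeff dx ψ φ (lower (-x) * g) ∂dx := by
  have := countable_numberField (F := F)
  have hD := isStrictFundDomain_adeleBox (F := F)
  have hc : Continuous fun x => klingenCoeff dx ψ φ (lower (-x) * g) :=
    (continuous_klingenCoeff Ψ hφ.continuous_self).comp
      ((continuous_lower continuous_neg).mul continuous_const)
  rw [integral_eq_setIntegral_tsum hD hc.measurable hi]
  have h1 := hi.2
  rw [HasFiniteIntegral, lintegral_eq_setLIntegral_tsum hD hc.measurable.enorm] at h1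
  have h2 : ∀ᵐ x ∂(dx.restrict (adeleBox F)),
      ∑' a : F, ‖klingenCoeff dx ψ φ (lower (-(x + κ a)) * g)‖ₑ < ∞ := by
    refine ae_lt_top ?_ h1.ne
    exact Measurable.tsum fun a => (hc.measurable.comp (measurable_add_const (κ a))).enorm
  refine integral_congr_ae ?_
  filter_upwards [h2] with x hx
  have h3 : ∀ a : F, lower (-(x + κ a)) * g = lower (-κ a) * (lower (-x) * g) := fun a => by
    rw [← mul_assoc, lower_mul, neg_add, add_comm]
  simp only [h3] at hx ⊢
  have h4 : Summable fun a : F => ‖klingenCoeff dx ψ φ (lower (-κ a) * (lower (-x) * g))‖ := by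
    have h5 := ENNReal.summable_toReal hx.ne
    simpa using h5
  exact (hφ.hasSum_klingenCoeff Ψ hvol h4).tsum_eq.symm

/-- Integrability of the Whittaker functions, and the expansion of the Bessel coefficient. -/
theorem IsCuspForm.exists_expansion (hφ : IsCuspForm dxq φ) (Ψ : AdeleCharacter ψ)
    (hdx : IsAddQuotientMeasure (principalAdeles F) dx dxq) (hvol : dx (adeleBox F) = 1)
    {K : Set (Adele F)ˣ} (hK : IsCompact K) :
    (∀ (t : ℝ), ∀ k ∈ K,
      (∀ η : F, Integrable (fun x => whittakerCoeff dx ψ φ η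
        (siegelTorus (posIdele t * k) * lower x)) dx) ∧
      (Summable fun η : F => ∫ x, ‖whittakerCoeff dx ψ φ η
        (siegelTorus (posIdele t * k) * lower x)‖ ∂dx) ∧
      ∫ c in adeleBox F, centerCoeff dx ψ φ (lower (-c) * siegelTorus (posIdele t * k)) ∂dx =
        (ideleNorm (posIdele t * k) : ℂ)⁻¹ * ∑' η : F, ∫ x, whittakerCoeff dx ψ φ η
          (siegelTorus (posIdele t * k) * lower x) ∂dx) ∧
    ∃ b : ℕ, ∀ m : ℕ, Module.finrank ℚ F < m → ∃ B : ℝ, 0 ≤ B ∧ ∀ (t : ℝ), ∀ k ∈ K,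
      ∑' η : F, ∫ x, ‖whittakerCoeff dx ψ φ η
        (siegelTorus (posIdele t * k) * lower x)‖ ∂dx ≤ B * Real.exp (b * |t| - m * t) := by
  have := countable_numberField (F := F)
  obtain ⟨d, e, hd, he, b, hbound⟩ := hφ.exists_whittakerCoeff_le Ψ hdx hK
  have hl := integrable_lowerWeight (dx := dx) hd (Nat.lt_succ_self (Module.finrank ℚ F))
  set l := lowerWeight d (Module.finrank ℚ F).succ
  have hWc : ∀ (y : (Adele F)ˣ) (η : F), Continuous fun x =>
      whittakerCoeff dx ψ φ η (siegelTorus y * lower x) := fun y η =>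
    (continuous_whittakerCoeff Ψ hφ.continuous_self η).comp
      (continuous_const.mul (continuous_lower continuous_id))
  have key : ∀ m : ℕ, Module.finrank ℚ F < m → ∃ B : ℝ, 0 ≤ B ∧ ∀ (t : ℝ), ∀ k ∈ K,
      (∀ η : F, Integrable (fun x => whittakerCoeff dx ψ φ η
        (siegelTorus (posIdele t * k) * lower x)) dx) ∧
      (∀ η : F, ∫ x, ‖whittakerCoeff dx ψ φ η (siegelTorus (posIdele t * k) * lower x)‖ ∂dx ≤
        B * Real.exp (b * |t| - m * t) * principalWeight e m η * ∫ x, l x ∂dx) := by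
    intro m hm
    obtain ⟨B, hB, hle⟩ := hbound m (Module.finrank ℚ F).succ
    refine ⟨B, hB, fun t k hk => ?_⟩
    have hi : ∀ η : F, Integrable (fun x => whittakerCoeff dx ψ φ η
        (siegelTorus (posIdele t * k) * lower x)) dx := fun η =>
      Integrable.mono' (hl.const_mul (B * Real.exp (b * |t| - m * t) * principalWeight e m η))
        (hWc _ η).aestronglyMeasurable (Filter.Eventually.of_forall fun x => hle η t k hk x)
    refine ⟨hi, fun η => ?_⟩
    rw [← integral_const_mul]
    exact integral_mono (hi η).norm (hl.const_mul _) fun x => hle η t k hk x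
  have hw := fun m (hm : Module.finrank ℚ F < m) => summable_principalWeight he hm
  refine ⟨fun t k hk => ?_, b, fun m hm => ?_⟩
  · obtain ⟨B, hB, h⟩ := key _ (Nat.lt_succ_self _)
    obtain ⟨hi, hle⟩ := h t k hk
    have hsum : Summable fun η : F => ∫ x, ‖whittakerCoeff dx ψ φ η
        (siegelTorus (posIdele t * k) * lower x)‖ ∂dx :=
      Summable.of_nonneg_of_le (fun η => integral_nonneg fun _ => norm_nonneg _) hle
        (((hw _ (Nat.lt_succ_self _)).mul_left _).mul_right _)
    refine ⟨hi, hsum, ?_⟩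
    set y := posIdele t * k
    obtain ⟨B', hB', hle'⟩ := hbound (Module.finrank ℚ F).succ (Module.finrank ℚ F).succ
    have hsx : ∀ x, Summable fun η : F =>
        ‖whittakerCoeff dx ψ φ η (siegelTorus y * lower x)‖ := fun x =>
      Summable.of_nonneg_of_le (fun η => norm_nonneg _) (fun η => hle' η t k hk x)
        (((hw _ (Nat.lt_succ_self _)).mul_left _).mul_right _)
    have hexp := fun x => hφ.hasSum_whittakerCoeff Ψ hvol (hsx x)
    have h0 := hasSum_integral_of_summable_integral_norm hi hsum
    have hkc : Continuous fun x => klingenCoeff dx ψ φ (siegelTorus y * lower x) :=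
      (continuous_klingenCoeff Ψ hφ.continuous_self).comp
        (continuous_const.mul (continuous_lower continuous_id))
    have hik : Integrable (fun x => klingenCoeff dx ψ φ (siegelTorus y * lower x)) dx := by
      refine Integrable.mono' (hl.const_mul (∑' η : F, B' * Real.exp (b * |t| -
        (Module.finrank ℚ F).succ * t) * principalWeight e (Module.finrank ℚ F).succ η))
        hkc.aestronglyMeasurable (Filter.Eventually.of_forall fun x => ?_)
      rw [← (hexp x).tsum_eq, ← tsum_mul_right]
      refine (norm_tsum_le_tsum_norm (hsx x)).trans ?_
      exact (hsx x).tsum_le_tsum (fun η => hle' η t k hk x)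
        (((hw _ (Nat.lt_succ_self _)).mul_left _).mul_right _)
    -- Moving `lower x` past the torus replaces `x` by `yx`; the change of variables produces the
    -- factor `|y|⁻¹` of the statement.
    have hmv : ∀ x, klingenCoeff dx ψ φ (lower x * siegelTorus y) =
        klingenCoeff dx ψ φ (siegelTorus y * lower ((y : Adele F) * x)) := fun x => by
      rw [lower_mul_siegelTorus]
    have hik2 : Integrable (fun x => klingenCoeff dx ψ φ (lower x * siegelTorus y)) dx := by
      simp only [hmv]
      have h1 := (Homeomorph.smul y).measurableEmbedding.integrable_map_iff (μ := dx)
        (g := fun x => klingenCoeff dx ψ φ (siegelTorus y * lower x))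
      refine h1.1 ?_
      change Integrable _ (dx.map fun x => (y : Adele F) * x)
      rw [map_mul_idele]
      exact hik.smul_measure ENNReal.ofReal_ne_top
    have hik3 : Integrable (fun x => klingenCoeff dx ψ φ (lower (-x) * siegelTorus y)) dx :=
      hik2.comp_neg
    rw [hφ.setIntegral_centerCoeff Ψ hvol hik3,
      integral_neg_eq_self (fun x => klingenCoeff dx ψ φ (lower x * siegelTorus y)) dx]
    simp only [hmv]
    rw [integral_comp_mul_idele dx y (fun x => klingenCoeff dx ψ φ (siegelTorus y * lower x))]
    congr 1
    rw [h0.tsum_eq]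
    exact integral_congr_ae (Filter.Eventually.of_forall fun x => (hexp x).tsum_eq.symm)
  · obtain ⟨B, hB, h⟩ := key m hm
    refine ⟨B * (∑' η, principalWeight e m η) * ∫ x, l x ∂dx, mul_nonneg (mul_nonneg hB
      (tsum_nonneg fun _ => principalWeight_nonneg _ _ _))
      (integral_nonneg fun _ => lowerWeight_nonneg _ _ _), fun t k hk => ?_⟩
    obtain ⟨hi, hle⟩ := h t k hk
    have hs := ((hw m hm).mul_left (B * Real.exp (b * |t| - m * t))).mul_right (∫ x, l x ∂dx)
    refine ((Summable.of_nonneg_of_le (fun η => integral_nonneg fun _ => norm_nonneg _) hle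
      hs).tsum_le_tsum hle hs).trans_eq ?_
    rw [tsum_mul_right, tsum_mul_left]
    ring

end expansion

/-! ### Growth of the central character. -/

section scalarHeight

open GSp4 IsDedekindDomain NumberField.mixedEmbedding
open scoped Classical

variable {F : Type*} [Field F] [NumberField F]

theorem GSp4.scalar_mul {R : Type*} [CommRing R] (y z : Rˣ) :
    scalar (y * z) = scalar y * scalar z := by
  ext i j
  fin_cases i <;> fin_cases j <;>
    simp [scalar, GSp4.ofMatrix, Matrix.mul_apply, Fin.sum_univ_four]

theorem adelicHeight_scalar_posIdele_le (t : ℝ) :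
    adelicHeight (scalar (posIdele t : (Adele F)ˣ)) ≤
      Real.exp |t| ^ Module.finrank ℚ F := by
  have key : ∀ (s : ℝ), |s| = |t| → ∀ i j,
      finPart ((scalar (posIdele s : (Adele F)ˣ) : GL (Fin 4) (Adele F)) i j) ∈
        integralAdeles F ∧
      ‖archPart ((scalar (posIdele s : (Adele F)ˣ) : GL (Fin 4) (Adele F)) i j)‖ ≤
        Real.exp |t| := by
    intro s hs i j
    have h0 : finPart (0 : Adele F) ∈ integralAdeles F ∧ ‖archPart (0 : Adele F)‖ ≤
        Real.exp |t| := by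
      simp only [map_zero, norm_zero]; exact ⟨zero_mem _, (Real.exp_pos _).le⟩
    have h2 : finPart ((posIdele s : (Adele F)ˣ) : Adele F) ∈ integralAdeles F ∧
        ‖archPart ((posIdele s : (Adele F)ˣ) : Adele F)‖ ≤ Real.exp |t| := by
      rw [posIdele_val]
      simp only [finPart_adeleMk, archPart_adeleMk]
      refine ⟨one_mem _, ?_⟩
      rw [_root_.norm_smul, norm_one, mul_one, Real.norm_eq_abs, abs_of_pos (Real.exp_pos _), ← hs]
      exact Real.exp_le_exp.2 (le_abs_self _)
    fin_cases i <;> fin_cases j <;> first | exact h0 | exact h2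
  refine adelicHeight_le_of_forall (key t rfl) ?_
  have h3 : (scalar (posIdele t : (Adele F)ˣ))⁻¹ = scalar (posIdele (-t)) := by
    rw [inv_eq_iff_mul_eq_one, ← GSp4.scalar_mul, ← posIdele_add, add_neg_cancel, posIdele_zero]
    ext i j
    fin_cases i <;> fin_cases j <;> simp [scalar, GSp4.ofMatrix]
  rw [h3]
  exact key (-t) (abs_neg t)

/-- The central character of a nonzero cusp form has moderate growth. -/
theorem IsCuspForm.exists_centralCharacter_le {dxq : Measure (Adele F ⧸ principalAdeles F)}
    {φ : GSp4 (Adele F) → ℂ} (hφ : IsCuspForm dxq φ) {ω : (Adele F)ˣ → ℂ}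
    (hω : ∀ z g, φ (scalar z * g) = ω z * φ g) {g₀ : GSp4 (Adele F)} (hg₀ : φ g₀ ≠ 0)
    {K : Set (Adele F)ˣ} (hK : IsCompact K) :
    ∃ (C : ℝ) (c : ℕ), 0 ≤ C ∧ ∀ t, ∀ k ∈ K, ‖ω (posIdele t * k)‖ ≤ C * Real.exp (c * |t|) := by
  obtain ⟨N, hN⟩ := hφ.uniform_moderate_growth
  obtain ⟨C, hC⟩ := hN []
  obtain ⟨H, -, hH⟩ := exists_adelicHeight_le_of_isCompact (K := (fun k : (Adele F)ˣ => scalar k * g₀) '' K)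
    (hK.image ((continuous_scalar continuous_id).mul continuous_const))
  set n := Module.finrank ℚ F
  refine ⟨‖φ g₀‖⁻¹ * (|C| * (4 ^ n * |H|) ^ N), n * N, by positivity, fun t k hk => ?_⟩
  have h1 : ‖ω (posIdele t * k)‖ * ‖φ g₀‖ ≤ |C| * (4 ^ n * (Real.exp |t| ^ n * |H|)) ^ N := by
    rw [← norm_mul, ← hω, GSp4.scalar_mul, mul_assoc]
    refine (hC _).trans ?_
    have h2 := adelicHeight_mul_le (scalar (posIdele t : (Adele F)ˣ)) (scalar k * g₀)
    have h3 := hH _ ⟨k, hk, rfl⟩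
    have h4 := adelicHeight_scalar_posIdele_le (F := F) t
    have h0 := adelicHeight_nonneg (scalar (posIdele t : (Adele F)ˣ) * (scalar k * g₀))
    have h5 := adelicHeight_nonneg (scalar k * g₀)
    have h6 : adelicHeight (scalar (posIdele t : (Adele F)ˣ) * (scalar k * g₀)) ≤
        4 ^ n * (Real.exp |t| ^ n * |H|) := by
      refine h2.trans ?_
      gcongr
      exact h3.trans (le_abs_self _)
    gcongr
    exact le_abs_self C
  have h7 : 0 < ‖φ g₀‖ := norm_pos_iff.2 hg₀
  have h8 : Real.exp (((n * N : ℕ) : ℝ) * |t|) = (Real.exp |t| ^ n) ^ N := by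
    rw [← pow_mul, ← Real.exp_nat_mul]
  rw [h8, ← mul_le_mul_iff_left₀ h7]
  refine h1.trans (le_of_eq ?_)
  field_simp
  ring

end scalarHeight

/-! ### Periodicity, functional equation and decay of the Bessel coefficient. -/

section besselCoefficient

open GSp4

variable {F : Type*} [Field F] [NumberField F] {dx : Measure (Adele F)} [dx.IsAddHaarMeasure]
  {dxq : Measure (Adele F ⧸ principalAdeles F)} {ψ : AddChar (Adele F) Circle}
  {φ : GSp4 (Adele F) → ℂ}

local notation "κ" => algebraMap F (Adele F)

theorem centerCoeff_siegelTorus (hL : ∀ (γ : GSp4 F) (g : GSp4 (Adele F)),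
    φ (GSp4.map (algebraMap F (Adele F)) γ * g) = φ g) (η : Fˣ) (g : GSp4 (Adele F)) :
    centerCoeff dx ψ φ (siegelTorus (principalIdele η) * g) = centerCoeff dx ψ φ g := by
  have := boxAverage_congr (dx := dx) (ι := fun b => n b) (χ := fun b => (ψ (-b) : ℂ))
    (Φ := centerAverage dx φ) (g := g) (g' := siegelTorus (principalIdele η) * g) (k := 1)
    (fun x => by rw [← mul_assoc, n_mul_siegelTorus, mul_assoc, centerAverage_siegelTorus hL,
      one_mul])
  rwa [one_mul] at this

/-- The Bessel coefficient is invariant under `Fˣ`. -/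
theorem IsCuspForm.isIdelePeriodic_besselCoeff (hφ : IsCuspForm dxq φ) (Ψ : AdeleCharacter ψ)
    (hdx : IsAddQuotientMeasure (principalAdeles F) dx dxq) :
    IsIdelePeriodic fun y => besselCoeff dxq ψ φ (besselTorus y) := by
  intro η y
  have hL := (hφ.translate weyl⁻¹).left_invariant
  simp only [hφ.besselCoeff_eq Ψ hdx]
  have hp : IsPeriodic fun c => centerCoeff dx ψ (fun g => φ (g * weyl⁻¹))
      (GSp4.lower (-c) * siegelTorus y) := by
    intro c α
    simp only
    rw [neg_add, add_comm, ← lower_mul, ← map_neg, mul_assoc, centerCoeff_lower hL]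
  rw [← hp.setIntegral_mul isStrictFundDomain_adeleBox η.ne_zero]
  refine integral_congr_ae (Filter.Eventually.of_forall fun c => ?_)
  simp only
  rw [← siegelTorus_mul, ← mul_assoc, lower_mul_siegelTorus, mul_assoc, centerCoeff_siegelTorus hL,
    principalIdele_val, mul_neg]

theorem IsCuspForm.continuous_besselCoeff (hφ : IsCuspForm dxq φ) (Ψ : AdeleCharacter ψ)
    (hdx : IsAddQuotientMeasure (principalAdeles F) dx dxq) :
    Continuous fun y => besselCoeff dxq ψ φ (besselTorus y) := by
  simp only [hφ.besselCoeff_eq Ψ hdx]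
  exact continuous_setIntegral_adeleBox dx ((continuous_centerCoeff Ψ
    (hφ.translate weyl⁻¹).continuous_self).comp ((continuous_lower continuous_snd.neg).mul
    (continuous_siegelTorus continuous_fst)))

/-- The Bessel coefficient as an iterated integral over the box. -/
theorem IsCuspForm.besselCoeff_eq_setIntegral (hφ : IsCuspForm dxq φ) (Ψ : AdeleCharacter ψ)
    (hdx : IsAddQuotientMeasure (principalAdeles F) dx dxq) (g : GSp4 (Adele F)) :
    besselCoeff dxq ψ φ g = ∫ b in adeleBox F, ∫ c in adeleBox F, ∫ a in adeleBox F,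
      φ (u a b c * g) * (ψ (-b) : ℂ) ∂dx ∂dx ∂dx := by
  have hL := hφ.left_invariant
  have h3 : ∀ (a b c : Adele F) (α β γ : F), φ (u (a + κ α) (b + κ β) (c + κ γ) * g) =
      φ (u a b c * g) := fun a b c α β γ => by
    rw [add_comm a, add_comm b, add_comm c, ← u_mul, mul_assoc, left_u_of_left_invariant hL]
  refine hdx.intMod_three (f := fun a c b => φ (u a b c * g) * (ψ (-b) : ℂ))
    ((hφ.continuous_self.comp ((continuous_u continuous_fst (continuous_snd.comp continuous_snd)
      (continuous_fst.comp continuous_snd)).mul continuous_const)).mul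
      (Ψ.continuous_coe_neg.comp (continuous_snd.comp continuous_snd)))
    (fun a c b α => ?_) (fun a c b α => ?_) (fun a c b α => ?_)
  · have h := h3 a b c α 0 0
    simp only [map_zero, add_zero] at h
    rw [h]
  · have h := h3 a b c 0 0 α
    simp only [map_zero, add_zero] at h
    rw [h]
  · have h := h3 a b c 0 α 0
    simp only [map_zero, add_zero] at h
    rw [h, Ψ.neg_periodic]

/-- The functional equation of the Bessel coefficient under `y ↦ y⁻¹`. -/
theorem IsCuspForm.besselCoeff_inv (hφ : IsCuspForm dxq φ) (Ψ : AdeleCharacter ψ)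
    (hdx : IsAddQuotientMeasure (principalAdeles F) dx dxq) {ω : (Adele F)ˣ → ℂ}
    (hω : ∀ z g, φ (scalar z * g) = ω z * φ g) (y : (Adele F)ˣ) :
    besselCoeff dxq ψ φ (besselTorus y) =
      ω y * besselCoeff dxq ψ (fun g => φ (g * swap)) (besselTorus y⁻¹) := by
  rw [hφ.besselCoeff_eq_setIntegral Ψ hdx,
    (hφ.translate swap).besselCoeff_eq_setIntegral Ψ hdx, ← integral_const_mul]
  have h1 : ∀ a b c, φ (u a b c * besselTorus y) =
      ω y * φ (u c b a * besselTorus y⁻¹ * swap) := by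
    intro a b c
    have h2 := hφ.left_invariant swap (u a b c * besselTorus y)
    rw [map_swap, ← mul_assoc, swap_mul_u, mul_assoc, swap_mul_besselTorus, ← mul_assoc,
      ← scalar_comm, mul_assoc, hω] at h2
    rw [← h2, mul_assoc]
  refine integral_congr_ae (Filter.Eventually.of_forall fun b => ?_)
  simp only
  rw [setIntegral_adeleBox_swap dx (f := fun c a => φ (u a b c * besselTorus y) * (ψ (-b) : ℂ))
    ((hφ.continuous_self.comp ((continuous_u continuous_snd continuous_const
      continuous_fst).mul continuous_const)).mul continuous_const), ← integral_const_mul]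
  refine integral_congr_ae (Filter.Eventually.of_forall fun a => ?_)
  simp only
  rw [← integral_const_mul]
  refine integral_congr_ae (Filter.Eventually.of_forall fun c => ?_)
  simp only [h1, mul_assoc]

/-- For `t ≥ 0` the factor `exp (b|t| - mt)` decays as fast as desired, since `b` does not depend on
`m`, and the factor `|y|⁻¹` is at most `1`. -/
theorem IsCuspForm.exists_besselCoeff_le_of_nonneg (hφ : IsCuspForm dxq φ) (Ψ : AdeleCharacter ψ)
    (hdx : IsAddQuotientMeasure (principalAdeles F) dx dxq) (hvol : dx (adeleBox F) = 1)
    {K : Set (Adele F)ˣ} (hK : IsCompact K) (hK1 : ∀ k ∈ K, ideleNorm k = 1) (A : ℝ) :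
    ∃ B : ℝ, 0 ≤ B ∧ ∀ t, 0 ≤ t → ∀ k ∈ K,
      ‖besselCoeff dxq ψ φ (besselTorus (posIdele t * k))‖ ≤ B * Real.exp (-(A * t)) := by
  obtain ⟨h1, b, h2⟩ := (hφ.translate weyl⁻¹).exists_expansion Ψ hdx hvol hK
  obtain ⟨m, hm⟩ := exists_nat_ge (A + b)
  -- `m ≥ A + b` gives the decay; the lower bound `[F : ℚ] + 1` makes the sum of `‖η‖⁻ᵐ` over a
  -- fractional ideal converge.
  obtain ⟨B, hB, h3⟩ := h2 (max m (Module.finrank ℚ F + 1))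
    (lt_of_lt_of_le (Nat.lt_succ_self _) (le_max_right _ _))
  refine ⟨B, hB, fun t ht k hk => ?_⟩
  obtain ⟨-, h5, h6⟩ := h1 t k hk
  rw [hφ.besselCoeff_eq Ψ hdx, h6, norm_mul, norm_inv, Complex.norm_real, Real.norm_eq_abs,
    ideleNorm_mul, hK1 k hk, mul_one, ideleNorm_posIdele, abs_of_pos (Real.exp_pos _)]
  have h7 : 1 ≤ Real.exp (Module.finrank ℚ F * t) := Real.one_le_exp (by positivity)
  have h8 : ‖∑' η : F, ∫ x, whittakerCoeff dx ψ (fun g => φ (g * weyl⁻¹)) η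
      (siegelTorus (posIdele t * k) * GSp4.lower x) ∂dx‖ ≤ B * Real.exp (-(A * t)) := by
    refine (tsum_of_norm_bounded h5.hasSum fun η => norm_integral_le_integral_norm _).trans
      ((h3 t k hk).trans ?_)
    gcongr
    rw [abs_of_nonneg ht]
    have h9 : A + b ≤ ((max m (Module.finrank ℚ F + 1) : ℕ) : ℝ) :=
      hm.trans (by exact_mod_cast le_max_left _ _)
    nlinarith
  exact (mul_le_of_le_one_left (norm_nonneg _) (inv_le_one_of_one_le₀ h7)).trans h8

/-- The Bessel coefficient decreases rapidly in both directions of the idele norm. -/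
theorem IsCuspForm.exists_besselCoeff_le (hφ : IsCuspForm dxq φ) (Ψ : AdeleCharacter ψ)
    (hdx : IsAddQuotientMeasure (principalAdeles F) dx dxq) (hvol : dx (adeleBox F) = 1)
    {K : Set (Adele F)ˣ} (hK : IsCompact K) (hK1 : ∀ k ∈ K, ideleNorm k = 1) (A : ℝ) :
    ∃ B : ℝ, 0 ≤ B ∧ ∀ t, ∀ k ∈ K,
      ‖besselCoeff dxq ψ φ (besselTorus (posIdele t * k))‖ ≤ B * Real.exp (-(A * |t|)) := by
  obtain ⟨ω, hω⟩ := hφ.central_character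
  by_cases h0 : ∃ g₀, φ g₀ ≠ 0
  · obtain ⟨g₀, hg₀⟩ := h0
    obtain ⟨C, c, hC, hCc⟩ := hφ.exists_centralCharacter_le hω hg₀ hK
    obtain ⟨B₁, hB₁, h1⟩ := hφ.exists_besselCoeff_le_of_nonneg Ψ hdx hvol hK hK1 A
    -- For negative `t` the functional equation passes to `-t`. The surplus `c` in the rate of decay
    -- compensates the growth of the central character.
    obtain ⟨B₂, hB₂, h2⟩ := (hφ.translate swap).exists_besselCoeff_le_of_nonneg Ψ hdx hvol hK.inv
      (fun k hk => by
        have := hK1 _ (Set.mem_inv.1 hk)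
        rwa [ideleNorm_inv, inv_eq_one] at this) (A + c)
    refine ⟨B₁ + C * B₂, by positivity, fun t k hk => ?_⟩
    rcases le_total 0 t with ht | ht
    · refine (h1 t ht k hk).trans ?_
      rw [abs_of_nonneg ht]
      gcongr
      exact le_add_of_nonneg_right (by positivity)
    · have h3 := h2 (-t) (neg_nonneg.2 ht) k⁻¹ (by simpa using hk)
      rw [hφ.besselCoeff_inv Ψ hdx hω, norm_mul, mul_inv, ← posIdele_neg]
      refine (mul_le_mul (hCc t k hk) h3 (norm_nonneg _) (by positivity)).trans ?_
      rw [abs_of_nonpos ht]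
      have h4 : C * Real.exp (c * -t) * (B₂ * Real.exp (-((A + c) * -t))) =
          C * B₂ * Real.exp (-(A * -t)) := by
        rw [show -(A * -t) = c * -t + -((A + c) * -t) by ring, Real.exp_add]
        ring
      rw [h4]
      gcongr
      exact le_add_of_nonneg_left hB₁
  -- For `φ = 0` the function `ω` is arbitrary and admits no bound, but the Bessel coefficient
  -- vanishes.
  · push Not at h0
    refine ⟨0, le_rfl, fun t k hk => ?_⟩
    simp [besselCoeff, intMod, h0]

end besselCoefficient

/-! ### Integrals over `𝔸ˣ/Fˣ` of rapidly decreasing functions against `μ|·|^z`. -/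

section twistedIntegrals

variable {F : Type*} [Field F] [NumberField F] {dy : Measure (Adele F)ˣ} [dy.IsHaarMeasure]
  {dyq : Measure ((Adele F)ˣ ⧸ principalIdeles F)} {μ : (Adele F)ˣ →* ℂˣ} {K : Set (Adele F)ˣ}

theorem isIdelePeriodic_ideleNorm : IsIdelePeriodic (ideleNorm (F := F)) := fun η y => by
  rw [ideleNorm_mul, ideleNorm_principal, one_mul]

theorem isIdelePeriodic_of_principal (hμ : ∀ a ∈ principalIdeles F, μ a = 1) :
    IsIdelePeriodic μ := fun η y => by
  rw [map_mul, hμ _ ⟨η, rfl⟩, one_mul]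

theorem isIdelePeriodic_twist (hμ : ∀ a ∈ principalIdeles F, μ a = 1) (z : ℂ) :
    IsIdelePeriodic (twist μ z) := fun η y => by
  rw [twist, twist, isIdelePeriodic_of_principal hμ, isIdelePeriodic_ideleNorm]

theorem continuous_twist (hc : Continuous μ) (z : ℂ) : Continuous (twist μ z) :=
  (Units.continuous_val.comp hc).mul
    ((Complex.continuous_ofReal.comp continuous_ideleNorm).cpow continuous_const
      fun y => Complex.ofReal_mem_slitPlane.2 (ideleNorm_pos y))

theorem twist_add_one (z : ℂ) (y : (Adele F)ˣ) :
    twist μ (z + 1) y = twist μ z y * ideleNorm y := by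
  rw [twist, twist, Complex.cpow_add _ _ (Complex.ofReal_ne_zero.2 (ideleNorm_pos y).ne'),
    Complex.cpow_one, mul_assoc]

theorem norm_twist (z : ℂ) (y : (Adele F)ˣ) :
    ‖twist μ z y‖ = ‖(μ y : ℂ)‖ * ideleNorm y ^ z.re := by
  rw [twist, norm_mul, Complex.norm_cpow_eq_rpow_re_of_pos (ideleNorm_pos y)]

theorem ideleNorm_posIdele_mul {k : (Adele F)ˣ} (hk : ideleNorm k = 1) (t : ℝ) :
    ideleNorm (posIdele t * k) = Real.exp (Module.finrank ℚ F * t) := by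
  rw [ideleNorm_mul, hk, mul_one, ideleNorm_posIdele]

theorem ideleNorm_posIdele_mul_rpow {k : (Adele F)ˣ} (hk : ideleNorm k = 1) (t r : ℝ) :
    ideleNorm (posIdele t * k) ^ r = Real.exp (Module.finrank ℚ F * r * t) := by
  rw [ideleNorm_posIdele_mul hk, ← Real.exp_mul]
  ring_nf

/-- A quasi-character grows at most exponentially along the positive ideles. -/
theorem exists_norm_quasiCharacter_le (hc : Continuous μ) (hK : IsCompact K) :
    ∃ C c : ℝ, 0 ≤ C ∧ 0 ≤ c ∧ ∀ t, ∀ k ∈ K, ‖(μ (posIdele t * k) : ℂ)‖ ≤ C * Real.exp (c * |t|) := by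
  have hcn : Continuous fun y => ‖(μ y : ℂ)‖ := (Units.continuous_val.comp hc).norm
  obtain ⟨C, hC⟩ := (hK.image hcn).isBounded.bddAbove
  -- The logarithm of `|μ|` along the positive ideles is additive and continuous, hence linear.
  let f : ℝ →+ ℝ :=
    { toFun := fun t => Real.log ‖(μ (posIdele t) : ℂ)‖
      map_zero' := by simp [posIdele_zero]
      map_add' := fun s t => by
        rw [posIdele_add, map_mul, Units.val_mul, norm_mul, Real.log_mul] <;> simp }
  have hf : Continuous f := (hcn.comp continuous_posIdele).log fun t => by simp
  have hlin : ∀ t, f t = t * f 1 := fun t => by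
    have := (f.toRealLinearMap hf).map_smul t 1
    simpa using this
  refine ⟨|C|, |f 1|, abs_nonneg _, abs_nonneg _, fun t k hk => ?_⟩
  have h1 : ‖(μ (posIdele t) : ℂ)‖ = Real.exp (t * f 1) := by
    rw [← hlin]
    exact (Real.exp_log (norm_pos_iff.2 (Units.ne_zero _))).symm
  rw [map_mul, Units.val_mul, norm_mul, h1, mul_comm]
  refine mul_le_mul ((hC ⟨k, hk, rfl⟩).trans (le_abs_self _)) (Real.exp_le_exp.2 ?_)
    (Real.exp_pos _).le (abs_nonneg _)
  rw [← abs_mul, mul_comm]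
  exact le_abs_self _

theorem IsQuotientMeasure.integrable_out {E : Type*} [NormedAddCommGroup E]
    [MeasurableSpace E] [BorelSpace E] [SecondCountableTopology E]
    (hdy : IsQuotientMeasure (principalIdeles F) dy dyq) (hK : IsCompact K)
    (hcov : ∀ y : (Adele F)ˣ, ∃ (η : Fˣ) (t : ℝ) (k : (Adele F)ˣ), k ∈ K ∧
      y = principalIdele η * (posIdele t * k))
    {f : (Adele F)ˣ → E} (hf : Measurable f) (hp : IsIdelePeriodic f) {C : ℝ}
    (hdecay : ∀ t : ℝ, ∀ k ∈ K, ‖f (posIdele t * k)‖ ≤ C * Real.exp (-|t|)) :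
    Integrable (fun q : (Adele F)ˣ ⧸ principalIdeles F => f (Quotient.out q)) dyq := by
  refine ⟨(hp.measurable_out hf).aestronglyMeasurable, ?_⟩
  refine hdy.lintegral_out_lt_top hK hcov (f := fun y => ‖f y‖ₑ) hf.enorm
    (fun η y => by simp only [hp η y]) (C := C.toNNReal) fun t k hk => ?_
  have h := hdecay t k hk
  rw [← ofReal_norm, ← ENNReal.ofReal, ← ENNReal.ofReal_mul' (Real.exp_pos _).le]
  exact ENNReal.ofReal_le_ofReal h

variable {β : (Adele F)ˣ → ℂ}

theorem IsQuotientMeasure.integrable_out_mul_twist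
    (hdy : IsQuotientMeasure (principalIdeles F) dy dyq) (hK : IsCompact K)
    (hK1 : ∀ k ∈ K, ideleNorm k = 1)
    (hcov : ∀ y : (Adele F)ˣ, ∃ (η : Fˣ) (t : ℝ) (k : (Adele F)ˣ), k ∈ K ∧
      y = principalIdele η * (posIdele t * k))
    (hc : Continuous μ) (hμ : ∀ a ∈ principalIdeles F, μ a = 1)
    (hβ : Continuous β) (hp : IsIdelePeriodic β)
    (hdecay : ∀ A : ℝ, ∃ B : ℝ, 0 ≤ B ∧ ∀ t, ∀ k ∈ K,
      ‖β (posIdele t * k)‖ ≤ B * Real.exp (-(A * |t|))) (z : ℂ) :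
    Integrable (fun q : (Adele F)ˣ ⧸ principalIdeles F =>
      β (Quotient.out q) * twist μ z (Quotient.out q)) dyq := by
  obtain ⟨C, c, hC, hc0, hCc⟩ := exists_norm_quasiCharacter_le hc hK
  set n : ℝ := ((Module.finrank ℚ F : ℕ) : ℝ)
  -- `c` compensates `μ`, `n * |z.re|` compensates `|y|^z`, and `1` remains for integrability.
  obtain ⟨B, hB, h1⟩ := hdecay (c + n * |z.re| + 1)
  refine hdy.integrable_out hK hcov (f := fun y => β y * twist μ z y)
    (hβ.mul (continuous_twist hc z)).measurable
    (fun η y => by simp only [hp η y, isIdelePeriodic_twist hμ z η y]) (C := B * C)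
    fun t k hk => ?_
  rw [norm_mul, norm_twist, ideleNorm_posIdele_mul_rpow (hK1 k hk)]
  have h2 : n * z.re * t ≤ n * |z.re| * |t| := by
    rw [mul_assoc, mul_assoc, ← abs_mul]
    exact mul_le_mul_of_nonneg_left (le_abs_self _) (Nat.cast_nonneg _)
  calc ‖β (posIdele t * k)‖ * (‖(μ (posIdele t * k) : ℂ)‖ * Real.exp (n * z.re * t))
      ≤ (B * Real.exp (-((c + n * |z.re| + 1) * |t|))) *
          (C * Real.exp (c * |t|) * Real.exp (n * |z.re| * |t|)) := by
        gcongr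
        · exact h1 t k hk
        · exact hCc t k hk
    _ = B * C * Real.exp (-|t|) := by
        rw [show -|t| = -((c + n * |z.re| + 1) * |t|) + (c * |t| + n * |z.re| * |t|) by ring,
          Real.exp_add, Real.exp_add]
        ring

theorem rpow_le_rpow_add_rpow {x r r₀ : ℝ} (hx : 0 < x) (h : |r - r₀| ≤ 1) :
    x ^ r ≤ x ^ (r₀ + 1) + x ^ (r₀ - 1) := by
  obtain ⟨h1, h2⟩ := abs_le.1 h
  rcases le_total 1 x with hx1 | hx1
  · exact (Real.rpow_le_rpow_of_exponent_le hx1 (by linarith)).trans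
      (le_add_of_nonneg_right (Real.rpow_nonneg hx.le _))
  · exact (Real.rpow_le_rpow_of_exponent_ge hx hx1 (by linarith)).trans
      (le_add_of_nonneg_left (Real.rpow_nonneg hx.le _))

theorem hasDerivAt_twist (y : (Adele F)ˣ) (z : ℂ) :
    HasDerivAt (fun z => twist μ z y) (twist μ z y * Real.log (ideleNorm y)) z := by
  have h := ((hasDerivAt_id z).const_cpow (c := (ideleNorm y : ℂ))
    (Or.inl (Complex.ofReal_ne_zero.2 (ideleNorm_pos y).ne'))).const_mul ((μ y : ℂˣ) : ℂ)
  simp only [id, mul_one, ← Complex.ofReal_log (ideleNorm_pos y).le, ← mul_assoc] at h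
  exact h

theorem IsQuotientMeasure.differentiable_integral_mul_twist
    (hdy : IsQuotientMeasure (principalIdeles F) dy dyq) (hK : IsCompact K)
    (hK1 : ∀ k ∈ K, ideleNorm k = 1)
    (hcov : ∀ y : (Adele F)ˣ, ∃ (η : Fˣ) (t : ℝ) (k : (Adele F)ˣ), k ∈ K ∧
      y = principalIdele η * (posIdele t * k))
    (hc : Continuous μ) (hμ : ∀ a ∈ principalIdeles F, μ a = 1)
    (hβ : Continuous β) (hp : IsIdelePeriodic β)
    (hdecay : ∀ A : ℝ, ∃ B : ℝ, 0 ≤ B ∧ ∀ t, ∀ k ∈ K,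
      ‖β (posIdele t * k)‖ ≤ B * Real.exp (-(A * |t|))) :
    Differentiable ℂ fun z : ℂ => ∫ q : (Adele F)ˣ ⧸ principalIdeles F,
      β (Quotient.out q) * twist μ z (Quotient.out q) ∂dyq := by
  intro z₀
  set n : ℝ := ((Module.finrank ℚ F : ℕ) : ℝ) with hn
  have hlogc : Continuous fun y : (Adele F)ˣ => Real.log (ideleNorm y) :=
    continuous_ideleNorm.log fun y => (ideleNorm_pos y).ne'
  have hrpow : ∀ r : ℝ, Continuous fun y : (Adele F)ˣ => ideleNorm y ^ r := fun r =>
    continuous_ideleNorm.rpow_const fun y => Or.inl (ideleNorm_pos y).ne'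
  -- A bound for the derivative in `z` valid on the whole unit disc about `z₀`: there `|y|^(Re z)`
  -- is at most the sum of the powers with exponents `Re z₀ ± 1`.
  let G : (Adele F)ˣ → ℝ := fun y => ‖β y‖ * (‖(μ y : ℂ)‖ *
    (ideleNorm y ^ (z₀.re + 1) + ideleNorm y ^ (z₀.re - 1)) * |Real.log (ideleNorm y)|)
  have hGc : Continuous G := hβ.norm.mul ((((Units.continuous_val.comp hc).norm).mul
    ((hrpow _).add (hrpow _))).mul hlogc.abs)
  have hGp : IsIdelePeriodic G := fun η y => by
    simp only [G, hp η y, isIdelePeriodic_of_principal hμ η y, isIdelePeriodic_ideleNorm η y]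
  have hGi : Integrable (fun q : (Adele F)ˣ ⧸ principalIdeles F => G (Quotient.out q)) dyq := by
    obtain ⟨C, c, hC, hc0, hCc⟩ := exists_norm_quasiCharacter_le hc hK
    set a := n * (|z₀.re| + 1) with ha
    have hn0 : 0 ≤ n := Nat.cast_nonneg _
    -- `a` accounts for the powers of the norm. Of the `2`, one unit absorbs the logarithm, through
    -- `|t| ≤ exp |t|`, and one remains for integrability.
    obtain ⟨B, hB, h1⟩ := hdecay (c + a + 2)
    refine hdy.integrable_out hK hcov hGc.measurable hGp (C := B * C * 2 * n) fun t k hk => ?_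
    simp only [G]
    rw [ideleNorm_posIdele_mul_rpow (hK1 k hk), ideleNorm_posIdele_mul_rpow (hK1 k hk),
      ideleNorm_posIdele_mul (hK1 k hk), Real.log_exp, ← hn, Real.norm_of_nonneg (by positivity)]
    have h2 : ∀ e : ℝ, |e| ≤ 1 → n * (z₀.re + e) * t ≤ a * |t| := fun e he => by
      have h3 : (z₀.re + e) * t ≤ (|z₀.re| + 1) * |t| := by
        refine (le_abs_self _).trans ?_
        rw [abs_mul]
        gcongr
        exact (abs_add_le _ _).trans (by gcongr)
      rw [ha, mul_assoc, mul_assoc]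
      exact mul_le_mul_of_nonneg_left h3 hn0
    have h3 := h2 1 (by simp)
    have h4 := h2 (-1) (by simp)
    rw [← sub_eq_add_neg] at h4
    have h5 : |t| ≤ Real.exp |t| := by linarith [Real.add_one_le_exp |t|]
    calc ‖β (posIdele t * k)‖ * (‖(μ (posIdele t * k) : ℂ)‖ *
          (Real.exp (n * (z₀.re + 1) * t) + Real.exp (n * (z₀.re - 1) * t)) * |n * t|)
        ≤ (B * Real.exp (-((c + a + 2) * |t|))) *
          (C * Real.exp (c * |t|) * (Real.exp (a * |t|) + Real.exp (a * |t|)) *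
            (n * Real.exp |t|)) := by
          rw [abs_mul, abs_of_nonneg hn0]
          gcongr
          · exact h1 t k hk
          · exact hCc t k hk
      _ = B * C * 2 * n * Real.exp (-|t|) := by
          rw [show -|t| = -((c + a + 2) * |t|) + (c * |t| + (a * |t| + |t|)) by ring,
            Real.exp_add, Real.exp_add, Real.exp_add]
          ring
  refine (hasDerivAt_integral_of_dominated_loc_of_deriv_le (μ := dyq) (Metric.ball_mem_nhds z₀ one_pos)
    (F := fun (z : ℂ) (q : (Adele F)ˣ ⧸ principalIdeles F) =>
      β (Quotient.out q) * twist μ z (Quotient.out q))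
    (F' := fun (z : ℂ) (q : (Adele F)ˣ ⧸ principalIdeles F) => β (Quotient.out q) *
      (twist μ z (Quotient.out q) * Real.log (ideleNorm (Quotient.out q))))
    (bound := fun q => G (Quotient.out q))
    (Filter.Eventually.of_forall fun z => (hdy.integrable_out_mul_twist hK hK1 hcov hc hμ hβ hp hdecay
      z).aestronglyMeasurable)
    (hdy.integrable_out_mul_twist hK hK1 hcov hc hμ hβ hp hdecay z₀) ?_ ?_ hGi ?_).2.differentiableAt
  · refine (IsIdelePeriodic.measurable_out (f := fun y => β y * (twist μ z₀ y *
      (Real.log (ideleNorm y) : ℂ))) (fun η y => ?_) ?_).aestronglyMeasurable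
    · simp only [hp η y, isIdelePeriodic_twist hμ z₀ η y, isIdelePeriodic_ideleNorm η y]
    · exact (hβ.mul ((continuous_twist hc z₀).mul (Complex.continuous_ofReal.comp
        hlogc))).measurable
  · refine Filter.Eventually.of_forall fun q z hz => ?_
    have h1 : |z.re - z₀.re| ≤ 1 := by
      rw [← Complex.sub_re]
      exact (Complex.abs_re_le_norm _).trans (by rw [← dist_eq_norm]; exact (Metric.mem_ball.1 hz).le)
    rw [norm_mul, norm_mul, norm_twist, Complex.norm_real, Real.norm_eq_abs]
    simp only [G]
    gcongr
    exact rpow_le_rpow_add_rpow (ideleNorm_pos _) h1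
  · exact Filter.Eventually.of_forall fun q z _ => (hasDerivAt_twist _ z).const_mul _

end twistedIntegrals

/-! ### Absolute convergence and unfolding of the double integral. -/

section unfoldedIntegral

variable {F : Type*} [Field F] [NumberField F] {dx : Measure (Adele F)} [dx.IsAddHaarMeasure]
  {dy : Measure (Adele F)ˣ} [dy.IsHaarMeasure]
  {dyq : Measure ((Adele F)ˣ ⧸ principalIdeles F)} {μ : (Adele F)ˣ →* ℂˣ} {K : Set (Adele F)ˣ}

theorem isIdelePeriodic_tsum {E : Type*} [AddCommMonoid E] [TopologicalSpace E]
    (f : (Adele F)ˣ → E) : IsIdelePeriodic fun y => ∑' η : Fˣ, f (principalIdele η * y) := by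
  intro ξ y
  simp only
  rw [← (Equiv.mulRight ξ).tsum_eq fun η : Fˣ => f (principalIdele η * y)]
  exact tsum_congr fun η => by rw [Equiv.coe_mulRight, principalIdele_mul, mul_assoc]

variable {V : (Adele F)ˣ → Adele F → ℂ} {b : ℕ}

/-- Absolute convergence of `∫ V(y, x) χ(y) dx dy` from bounds for the sum over `Fˣ`. -/
theorem IsQuotientMeasure.exists_integrable_mul_twist
    (hdy : IsQuotientMeasure (principalIdeles F) dy dyq) (hK : IsCompact K)
    (hK1 : ∀ k ∈ K, ideleNorm k = 1)
    (hcov : ∀ y : (Adele F)ˣ, ∃ (η : Fˣ) (t : ℝ) (k : (Adele F)ˣ), k ∈ K ∧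
      y = principalIdele η * (posIdele t * k))
    (hc : Continuous μ) (hμ : ∀ a ∈ principalIdeles F, μ a = 1)
    (hV : Continuous (Function.uncurry V))
    (hI : ∀ t, ∀ k ∈ K, ∀ η : Fˣ, Integrable (V (principalIdele η * (posIdele t * k))) dx)
    (hS : ∀ t, ∀ k ∈ K, Summable fun η : Fˣ =>
      ∫ x, ‖V (principalIdele η * (posIdele t * k)) x‖ ∂dx)
    (hb : ∀ m : ℕ, Module.finrank ℚ F < m → ∃ B : ℝ, 0 ≤ B ∧ ∀ t, ∀ k ∈ K,
      ∑' η : Fˣ, ∫ x, ‖V (principalIdele η * (posIdele t * k)) x‖ ∂dx ≤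
        B * Real.exp (b * |t| - m * t)) :
    ∃ σ : ℝ, ∀ z : ℂ, σ < z.re →
      Integrable (fun p : (Adele F)ˣ × Adele F => V p.1 p.2 * twist μ z p.1) (dy.prod dx) := by
  have := countable_numberField (F := F)
  have : Countable Fˣ := Units.val_injective.countable
  obtain ⟨C, c, hC, hc0, hCc⟩ := exists_norm_quasiCharacter_le hc hK
  set n := Module.finrank ℚ F with hn
  have hn1 : (1 : ℝ) ≤ n := by exact_mod_cast (Module.finrank_pos : 0 < Module.finrank ℚ F)
  -- The abscissa comes from `t ≤ 0`, where `m = n + 1` is used: the growth `c + b + (n + 1)` and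
  -- one more unit for integrability must be outweighed by `n * Re z`.
  refine ⟨c + b + n + 2, fun z hz => ?_⟩
  have hfc : Continuous fun p : (Adele F)ˣ × Adele F => V p.1 p.2 * twist μ z p.1 :=
    hV.mul ((continuous_twist hc z).comp continuous_fst)
  refine ⟨hfc.measurable.aestronglyMeasurable, ?_⟩
  rw [HasFiniteIntegral, lintegral_prod _ hfc.measurable.enorm.aemeasurable]
  have hPm : Measurable fun y => ∫⁻ x, ‖V y x * twist μ z y‖ₑ ∂dx :=
    hfc.measurable.enorm.lintegral_prod_right'
  simp only
  rw [hdy.lintegral_eq hPm]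
  obtain ⟨B₁, hB₁, h1⟩ := hb (n + 1) (Nat.lt_succ_self _)
  -- For `t ≥ 0` the order `m` may depend on `z`, and it is taken large enough to outweigh all the
  -- growth.
  obtain ⟨m, hm⟩ := exists_nat_ge (n * z.re + c + b + 1)
  obtain ⟨B₂, hB₂, h2⟩ := hb (max m (n + 1)) (lt_of_lt_of_le (Nat.lt_succ_self _) (le_max_right _ _))
  refine hdy.lintegral_out_lt_top hK hcov
    (f := fun y => ∑' η : Fˣ, ∫⁻ x, ‖V (principalIdele η * y) x *
      twist μ z (principalIdele η * y)‖ₑ ∂dx)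
    (Measurable.tsum fun η => hPm.comp (continuous_const_mul _).measurable)
    (isIdelePeriodic_tsum fun y => ∫⁻ x, ‖V y x * twist μ z y‖ₑ ∂dx)
    (C := (C * (B₁ + B₂)).toNNReal) fun t k hk => ?_
  have h3 : ∀ η : Fˣ, ∫⁻ x, ‖V (principalIdele η * (posIdele t * k)) x *
      twist μ z (principalIdele η * (posIdele t * k))‖ₑ ∂dx = ‖twist μ z (posIdele t * k)‖ₑ *
      ENNReal.ofReal (∫ x, ‖V (principalIdele η * (posIdele t * k)) x‖ ∂dx) := fun η => by
    rw [ofReal_integral_norm_eq_lintegral_enorm (hI t k hk η), isIdelePeriodic_twist hμ,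
      ← lintegral_const_mul' _ _ enorm_ne_top]
    simp only [enorm_mul, mul_comm]
  simp only [h3]
  rw [ENNReal.tsum_mul_left, ← ENNReal.ofReal_tsum_of_nonneg
    (fun η => integral_nonneg fun x => norm_nonneg _) (hS t k hk), ← ofReal_norm,
    ← ENNReal.ofReal_mul (norm_nonneg _), ← ENNReal.ofReal,
    ← ENNReal.ofReal_mul' (Real.exp_pos _).le]
  refine ENNReal.ofReal_le_ofReal ?_
  have hS0 : 0 ≤ ∑' η : Fˣ, ∫ x, ‖V (principalIdele η * (posIdele t * k)) x‖ ∂dx :=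
    tsum_nonneg fun η => integral_nonneg fun x => norm_nonneg _
  rw [norm_twist, ideleNorm_posIdele_mul_rpow (hK1 k hk), ← hn]
  have key : ∀ (B : ℝ) (m : ℕ), 0 ≤ B → B ≤ B₁ + B₂ →
      ∑' η : Fˣ, ∫ x, ‖V (principalIdele η * (posIdele t * k)) x‖ ∂dx ≤
        B * Real.exp (b * |t| - m * t) →
      c * |t| + n * z.re * t + (b * |t| - m * t) ≤ -|t| →
      ‖(μ (posIdele t * k) : ℂ)‖ * Real.exp (n * z.re * t) *
        ∑' η : Fˣ, ∫ x, ‖V (principalIdele η * (posIdele t * k)) x‖ ∂dx ≤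
      C * (B₁ + B₂) * Real.exp (-|t|) := by
    intro B m hB hBle hle hexp
    calc _ ≤ C * Real.exp (c * |t|) * Real.exp (n * z.re * t) *
          (B * Real.exp (b * |t| - m * t)) := by
          gcongr
          exact hCc t k hk
      _ = C * B * Real.exp (c * |t| + n * z.re * t + (b * |t| - m * t)) := by
          rw [Real.exp_add, Real.exp_add]; ring
      _ ≤ _ := by gcongr
  rcases le_total 0 t with ht | ht
  · refine key B₂ _ hB₂ (le_add_of_nonneg_left hB₁) (h2 t k hk) ?_
    have h9 : n * z.re + c + b + 1 ≤ ((max m (n + 1) : ℕ) : ℝ) :=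
      hm.trans (by exact_mod_cast le_max_left _ _)
    rw [abs_of_nonneg ht]
    nlinarith
  · refine key B₁ _ hB₁ (le_add_of_nonneg_right hB₂) (h1 t k hk) ?_
    rw [abs_of_nonpos ht]
    have hz0 : 0 ≤ z.re := by
      have : (0 : ℝ) ≤ b := Nat.cast_nonneg _
      linarith
    have h9 : c + b + n + 2 ≤ n * z.re := hz.le.trans (le_mul_of_one_le_left hz0 hn1)
    push_cast
    nlinarith

/-- The unfolded integral. -/
theorem IsQuotientMeasure.integral_out_eq_integral_integral
    (hdy : IsQuotientMeasure (principalIdeles F) dy dyq)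
    (hcov : ∀ y : (Adele F)ˣ, ∃ (η : Fˣ) (t : ℝ) (k : (Adele F)ˣ), k ∈ K ∧
      y = principalIdele η * (posIdele t * k))
    (hc : Continuous μ) (hμ : ∀ a ∈ principalIdeles F, μ a = 1)
    (hV : Continuous (Function.uncurry V)) {β : (Adele F)ˣ → ℂ} (hβ : IsIdelePeriodic β)
    (hβV : ∀ t, ∀ k ∈ K, β (posIdele t * k) = (ideleNorm (posIdele t * k) : ℂ)⁻¹ *
      ∑' η : Fˣ, ∫ x, V (principalIdele η * (posIdele t * k)) x ∂dx) {z : ℂ}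
    (hi : Integrable (fun p : (Adele F)ˣ × Adele F => V p.1 p.2 * twist μ z p.1) (dy.prod dx)) :
    ∫ q : (Adele F)ˣ ⧸ principalIdeles F, β (Quotient.out q) * twist μ (z + 1) (Quotient.out q) ∂dyq =
      ∫ y, ∫ x, V y x * twist μ z y ∂dx ∂dy := by
  have hfc : Continuous fun p : (Adele F)ˣ × Adele F => V p.1 p.2 * twist μ z p.1 :=
    hV.mul ((continuous_twist hc z).comp continuous_fst)
  have hQm : Measurable fun y => ∫ x, V y x * twist μ z y ∂dx :=
    (hfc.measurable.stronglyMeasurable.integral_prod_right'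
      (f := fun p : (Adele F)ˣ × Adele F => V p.1 p.2 * twist μ z p.1)).measurable
  rw [hdy.integral_eq hQm hi.integral_prod_left]
  have h1 := isIdelePeriodic_tsum fun y : (Adele F)ˣ => ∫ x, V y x * twist μ z y ∂dx
  -- Both sides are `Fˣ`-invariant, so it suffices to compare them at the representatives `posIdele
  -- t * k`. There the extra power of `|y|` in `twist μ (z + 1)` cancels the `|y|⁻¹` of `hβV`.
  have h2 : ∀ y : (Adele F)ˣ, β y * twist μ (z + 1) y = ∑' η : Fˣ, ∫ x,
      V (principalIdele η * y) x * twist μ z (principalIdele η * y) ∂dx := by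
    intro y
    obtain ⟨ξ, t, k, hk, rfl⟩ := hcov y
    refine Eq.trans ?_ (h1 ξ (posIdele t * k)).symm
    rw [hβ, isIdelePeriodic_twist hμ, hβV t k hk, twist_add_one]
    simp only [isIdelePeriodic_twist hμ z _ (posIdele t * k), integral_mul_const]
    rw [tsum_mul_right]
    have h0 : (ideleNorm (posIdele t * k) : ℂ) ≠ 0 :=
      Complex.ofReal_ne_zero.2 (ideleNorm_pos _).ne'
    field_simp
  exact integral_congr_ae (Filter.Eventually.of_forall fun q => h2 _)

end unfoldedIntegral

/-! ### The Whittaker expansion of the Bessel coefficient, and the theorem. -/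

section novodvorsky

open GSp4

variable {F : Type*} [Field F] [NumberField F] {dx : Measure (Adele F)} [dx.IsAddHaarMeasure]
  {dxq : Measure (Adele F ⧸ principalAdeles F)} {ψ : AddChar (Adele F) Circle}
  {φ : GSp4 (Adele F) → ℂ}

theorem IsCuspForm.whittaker_novo_mul_weyl_inv (hφ : IsCuspForm dxq φ) (Ψ : AdeleCharacter ψ)
    (hdx : IsAddQuotientMeasure (principalAdeles F) dx dxq) (y : (Adele F)ˣ) (x : Adele F) :
    whittaker dxq ψ φ (novo y x * weyl⁻¹) =
      whittakerCoeff dx ψ (fun g => φ (g * weyl⁻¹)) 1 (siegelTorus y * GSp4.lower x) := by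
  rw [← (hφ.translate weyl⁻¹).whittaker_eq Ψ hdx, ← novo_eq]
  simp only [whittaker, mul_assoc]

theorem IsCuspForm.continuous_whittaker_novo (hφ : IsCuspForm dxq φ) (Ψ : AdeleCharacter ψ)
    (hdx : IsAddQuotientMeasure (principalAdeles F) dx dxq) :
    Continuous (Function.uncurry fun (y : (Adele F)ˣ) x =>
      whittaker dxq ψ φ (novo y x * weyl⁻¹)) := by
  simp only [hφ.whittaker_novo_mul_weyl_inv Ψ hdx]
  exact (continuous_whittakerCoeff Ψ (hφ.translate weyl⁻¹).continuous_self 1).comp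
    ((continuous_siegelTorus continuous_fst).mul (continuous_lower continuous_snd))

/-- The sum over `Fˣ` of the Whittaker integrals is the Bessel coefficient. -/
theorem IsCuspForm.exists_whittaker_expansion (hφ : IsCuspForm dxq φ) (Ψ : AdeleCharacter ψ)
    (hdx : IsAddQuotientMeasure (principalAdeles F) dx dxq) (hvol : dx (adeleBox F) = 1)
    {K : Set (Adele F)ˣ} (hK : IsCompact K) :
    (∀ (t : ℝ), ∀ k ∈ K,
      (∀ η : Fˣ, Integrable (fun x => whittaker dxq ψ φ
        (novo (principalIdele η * (posIdele t * k)) x * weyl⁻¹)) dx) ∧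
      (Summable fun η : Fˣ => ∫ x, ‖whittaker dxq ψ φ
        (novo (principalIdele η * (posIdele t * k)) x * weyl⁻¹)‖ ∂dx) ∧
      besselCoeff dxq ψ φ (besselTorus (posIdele t * k)) =
        (ideleNorm (posIdele t * k) : ℂ)⁻¹ * ∑' η : Fˣ, ∫ x, whittaker dxq ψ φ
          (novo (principalIdele η * (posIdele t * k)) x * weyl⁻¹) ∂dx) ∧
    ∃ b : ℕ, ∀ m : ℕ, Module.finrank ℚ F < m → ∃ B : ℝ, 0 ≤ B ∧ ∀ (t : ℝ), ∀ k ∈ K,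
      ∑' η : Fˣ, ∫ x, ‖whittaker dxq ψ φ
        (novo (principalIdele η * (posIdele t * k)) x * weyl⁻¹)‖ ∂dx ≤
          B * Real.exp (b * |t| - m * t) := by
  have hφ' := hφ.translate weyl⁻¹
  obtain ⟨h1, b, h2⟩ := hφ'.exists_expansion Ψ hdx hvol hK
  have h3 : ∀ (η : Fˣ) (y : (Adele F)ˣ) (x : Adele F),
      whittaker dxq ψ φ (novo (principalIdele η * y) x * weyl⁻¹) =
      whittakerCoeff dx ψ (fun g => φ (g * weyl⁻¹)) (η : F) (siegelTorus y * GSp4.lower x) :=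
    fun η y x => by
      rw [hφ.whittaker_novo_mul_weyl_inv Ψ hdx, ← siegelTorus_mul, mul_assoc,
        whittakerCoeff_siegelTorus Ψ hφ'.left_invariant]
  simp only [h3]
  refine ⟨fun t k hk => ?_, b, fun m hm => ?_⟩
  · obtain ⟨h4, h5, h6⟩ := h1 t k hk
    refine ⟨fun η => h4 η, h5.comp_injective Units.val_injective, ?_⟩
    rw [hφ.besselCoeff_eq Ψ hdx, h6, ← Units.val_injective.tsum_eq (f := fun η : F => ∫ x,
      whittakerCoeff dx ψ (fun g => φ (g * weyl⁻¹)) η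
        (siegelTorus (posIdele t * k) * GSp4.lower x) ∂dx)]
    -- The sum over `F` reduces to a sum over `Fˣ` because `W_0 = 0`.
    intro η hη
    have h7 : η ≠ 0 := by
      rintro rfl
      refine hη ?_
      simp only [hφ'.whittakerCoeff_zero Ψ hdx, integral_zero]
    exact ⟨Units.mk0 η h7, rfl⟩
  · obtain ⟨B, hB, h4⟩ := h2 m hm
    refine ⟨B, hB, fun t k hk => le_trans ?_ (h4 t k hk)⟩
    exact Summable.tsum_le_tsum_of_inj (fun η : Fˣ => (η : F)) Units.val_injective
      (fun η _ => integral_nonneg fun x => norm_nonneg _) (fun η => le_rfl)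
      ((h1 t k hk).2.1.comp_injective Units.val_injective) (h1 t k hk).2.1

end novodvorsky

end

theorem mainTheorem6 (F : Type*) [Field F] [NumberField F]
    (dx : Measure (Adele F)) [dx.IsAddHaarMeasure]
    (dxq : Measure (Adele F ⧸ principalAdeles F))
    (hdx : IsAddQuotientMeasure (principalAdeles F) dx dxq)
    (hvol : dxq Set.univ = 1)
    (dy : Measure (Adele F)ˣ) [dy.IsHaarMeasure]
    (dyq : Measure ((Adele F)ˣ ⧸ principalIdeles F))
    (hdy : IsQuotientMeasure (principalIdeles F) dy dyq)
    (ψ : AddChar (Adele F) Circle) (hψ_cont : Continuous ψ) (hψ_nontrivial : ψ ≠ 1)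
    (hψ_F : ∀ a : F, ψ (algebraMap F (Adele F) a) = 1)
    (μ : (Adele F)ˣ →* ℂˣ) (hμ_cont : Continuous μ)
    (hμ_F : ∀ a ∈ principalIdeles F, μ a = 1)
    (φ : GSp4 (Adele F) → ℂ) (hφ : IsCuspForm dxq φ) :
    -- the integral defining the Bessel functional converges absolutely for every `s`
    (∀ s : ℂ, Integrable (fun q : (Adele F)ˣ ⧸ principalIdeles F =>
      besselIntegrand dxq ψ (twist μ (s - 1 / 2)) 1 φ (Quotient.out q)) dyq) ∧
    -- and is an entire function of `s`
    Differentiable ℂ (fun s : ℂ => splitBessel dxq dyq ψ (twist μ (s - 1 / 2)) 1 φ) ∧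
    -- for `Re s` large it equals the absolutely convergent Novodvorsky integral
    ∃ σ₀ : ℝ, ∀ s : ℂ, σ₀ < s.re →
      Integrable (fun p : (Adele F)ˣ × Adele F =>
        whittaker dxq ψ φ (GSp4.novo p.1 p.2 * GSp4.weyl⁻¹) * twist μ (s - 3 / 2) p.1)
        (dy.prod dx) ∧
      splitBessel dxq dyq ψ (twist μ (s - 1 / 2)) 1 φ =
        ∫ y : (Adele F)ˣ, ∫ x : Adele F,
          whittaker dxq ψ φ (GSp4.novo y x * GSp4.weyl⁻¹) * twist μ (s - 3 / 2) y ∂dx ∂dy := by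
  obtain ⟨Ψ⟩ := exists_adeleCharacter ψ hψ_cont hψ_nontrivial hψ_F
  have hbox : dx (adeleBox F) = 1 := hdx.measure_eq_one hvol isStrictFundDomain_adeleBox
  obtain ⟨K, hK, hK1, hcov⟩ := exists_compact_idele_representatives F
  have hβc := hφ.continuous_besselCoeff Ψ hdx
  have hβp := hφ.isIdelePeriodic_besselCoeff Ψ hdx
  have hβd := hφ.exists_besselCoeff_le Ψ hdx hbox hK hK1
  simp only [splitBessel, besselIntegrand, mul_one]
  refine ⟨fun s => hdy.integrable_out_mul_twist hK hK1 hcov hμ_cont hμ_F hβc hβp hβd _,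
    (hdy.differentiable_integral_mul_twist hK hK1 hcov hμ_cont hμ_F hβc hβp hβd).comp
      (differentiable_id.sub_const _), ?_⟩
  obtain ⟨h1, b, h2⟩ := hφ.exists_whittaker_expansion Ψ hdx hbox hK
  have hV := hφ.continuous_whittaker_novo Ψ hdx
  obtain ⟨σ, hσ⟩ := hdy.exists_integrable_mul_twist hK hK1 hcov hμ_cont hμ_F hV
    (fun t k hk => (h1 t k hk).1) (fun t k hk => (h1 t k hk).2.1) h2
  -- The twist of the double integral has exponent `s - 3/2`, so the abscissa `σ` moves by `3/2`.
  refine ⟨σ + 3 / 2, fun s hs => ?_⟩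
  have h3 := hσ (s - 3 / 2) (by
    have h4 : (s - 3 / 2).re = s.re - 3 / 2 := by
      rw [Complex.sub_re]
      norm_num
    rw [h4]
    linarith)
  refine ⟨h3, ?_⟩
  have h5 : s - 1 / 2 = s - 3 / 2 + 1 := by ring
  rw [h5]
  exact hdy.integral_out_eq_integral_integral hcov hμ_cont hμ_F hV hβp
    (fun t k hk => (h1 t k hk).2.2) h3
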